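/- **Setting.** Let $X\in\mathbb R^p$ ($p\ge 1$) be covariates, $W\in\{0,1\}$ a treatment, $Y(0),Y(1)$ potential outcomes and $Y$ the observed outcome, with (consistency) $Y=Y(W)$, (unconfoundedness) $\{Y(1),Y(0)\}\perp W\mid X$, and (overlap) $c<\Pr(W=1\mid X)<1-c$ for some constant $c>0$. Assume $E[Y^2]<\infty$ and put $\mu(x,w)=E[Y\mid X=x,W=w]$, $\sigma^2(x,w)=\operatorname{Var}[Y\mid X=x,W=w]$, $\tau(X)=E[Y(1)-Y(0)\mid X]$. A policy is a (measurable) map $\pi:\mathbb R^p\to\{0,1\}$; its advantage is $A(\pi)=E[\{2\pi(X)-1\}\tau(X)]$. Let $(X_i,W_i,Y_i)$, $i=1,2,\dots$, be i.i.d. copies of $(X,W,Y)$ and fix an integer $M\ge 1$. For a sample of size $n$ let $\|v\|=(v^\top \hat\Sigma^{-1}v)^{1/2}$ with $\hat\Sigma=n^{-1}\sum_{i=1}^n(X_i-\bar X)(X_i-\bar X)^\top$ (Mahalanobis metric) and $$\mathcal J_M(i)=\Big\{j: W_j=1-W_i,\ \sum_{k:W_k=1-W_i} I\{\|X_k-X_i\|\le\|X_j-X_i\|\}\le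 M\Big\}.$$ Put $\hat Y_i(W_i)=Y_i$, $\hat Y_i(1-W_i)=M^{-1}\sum_{j\in\mathcal J_M(i)}Y_j$, $K_M(\pi,i)=\sum_{j:\,i\in\mathcal J_M(j)}\{2\pi(X_j)-1\}$, and $$\hat A_{match}(\pi)=\frac1n\sum_{i=1}^n\{2\pi(X_i)-1\}\{\hat Y_i(1)-\hat Y_i(0)\},$$ $$B_M(\pi)=\frac1n\sum_{i=1}^n(2W_i-1)\{2\pi(X_i)-1\}\frac1M\sum_{j\in\mathcal J_M(i)}\{\mu(X_i,1-W_i)-\mu(X_j,1-W_i)\},$$ $$E_M(\pi)=\frac1n\sum_{i=1}^n(2W_i-1)\Big[2\pi(X_i)-1+\frac{K_M(\pi,i)}M\Big]\{Y_i-\mu(X_i,W_i)\},$$ $V^E(\pi)=n\operatorname{Var}[E_M(\pi)\mid X_1,\dots,X_n,W_1,\dots,W_n]$ and $V^{\tau(X)}(\pi)=E[(\{2\pi(X)-1\}\tau(X)-A(\pi))^2]$. **Assumption 1.** $X$ has a Lebesgue density that vanishes outside a convex compact set $\mathcal X_0\subset\mathbb R^p$ and is bounded above and bounded away from zero on $\mathcal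 X_0$. **Assumption 2.** (i) For $w=0,1$, $\mu(\cdot,w)$ and $\sigma^2(\cdot,w)$ are Lipschitz on $\mathcal X_0$. (ii) $E[Y^4\mid X,W]$ is bounded. (iii) $V^E(\pi)$ is bounded away from zero with probability tending to one: there is $c>0$ with $\Pr\{V^E(\pi)<c\}\to0$ as $n\to\infty$ (in particular, this holds if $V^E(\pi)\ge c$ for all values of the covariates and treatments). **Theorem.** Let $\pi$ be a fixed policy. (i) Under Assumptions 1 and 2(i), $\hat A_{match}(\pi)-A(\pi)\to0$ in probability as $n\to\infty$. (ii) Under Assumptions 1 and 2, the latter with (iii) for this $\pi$, as $n\to\infty$, $$\{V^{\tau(X)}(\pi)+V^E(\pi)\}^{-1/2}\sqrt n\,\{\hat A_{match}(\pi)-B_M(\pi)-A(\pi)\}\to N(0,1)\quad\text{in distribution.}$$ -/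

import Mathlib

open MeasureTheory ProbabilityTheory Filter Topology

noncomputable section

namespace MatchingPolicy

/-- Covariate vectors in `ℝ^p`, with Lebesgue measure as `volume`. -/
abbrev Covariate (p : ℕ) := EuclideanSpace ℝ (Fin p)

/-- The sign `2 b - 1 ∈ {-1, 1}` of a binary value `b`; treatments and policy decisions are coded
as `true` (`= 1`, treated) and `false` (`= 0`, control), so that `1 - b` is `!b`. -/
def sgn (b : Bool) : ℝ := 2 * (if b then 1 else 0) - 1

/-! ### Matching on a finite sample `(x_i, w_i, y_i)`, `i : Fin n` -/

section Sample

variable {p n : ℕ}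

/-- The sample mean of the covariates. -/
def sampleMean (x : Fin n → Covariate p) : Covariate p :=
  (n : ℝ)⁻¹ • ∑ i, x i

/-- The sample covariance matrix `n⁻¹ ∑ i, (x_i - x̄) (x_i - x̄)ᵀ`. -/
def sampleCov (x : Fin n → Covariate p) : Matrix (Fin p) (Fin p) ℝ :=
  Matrix.of fun a b =>
    (n : ℝ)⁻¹ * ∑ i, (x i a - sampleMean x a) * (x i b - sampleMean x b)

/-- The Mahalanobis norm `(vᵀ S⁻¹ v)^{1/2}`, where `S` is the sample covariance matrix of `x`. -/
def mahaNorm (x : Fin n → Covariate p) (v : Covariate p) : ℝ :=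
  √(∑ a, ∑ b, v a * (sampleCov x)⁻¹ a b * v b)

open scoped Classical in
/-- The matched set of unit `i`: the units `j` of the opposite treatment arm such that at most `M`
units of that arm are at least as close to unit `i` as `j` is. -/
def matchSet (M : ℕ) (x : Fin n → Covariate p) (w : Fin n → Bool) (i : Fin n) : Finset (Fin n) :=
  Finset.univ.filter fun j => w j = !w i ∧
    (Finset.univ.filter fun k => w k = !w i ∧
      mahaNorm x (x k - x i) ≤ mahaNorm x (x j - x i)).card ≤ M

/-- The imputed potential outcome of unit `i` under treatment `a`. -/
def imputed (M : ℕ) (x : Fin n → Covariate p) (w : Fin n → Bool) (y : Fin n → ℝ)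
    (a : Bool) (i : Fin n) : ℝ :=
  if w i = a then y i else (M : ℝ)⁻¹ * ∑ j ∈ matchSet M x w i, y j

/-- The matching estimator of the advantage function at the policy `π`. -/
def matchEstimator (M : ℕ) (π : Covariate p → Bool)
    (x : Fin n → Covariate p) (w : Fin n → Bool) (y : Fin n → ℝ) : ℝ :=
  (n : ℝ)⁻¹ * ∑ i, sgn (π (x i)) * (imputed M x w y true i - imputed M x w y false i)

open scoped Classical in
/-- `K_M(π, i)`: the sum of `2 π(x_j) - 1` over all units `j` that unit `i` is a match of. -/
def matchWeight (M : ℕ) (π : Covariate p → Bool)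
    (x : Fin n → Covariate p) (w : Fin n → Bool) (i : Fin n) : ℝ :=
  ∑ j ∈ Finset.univ.filter (fun j => i ∈ matchSet M x w j), sgn (π (x j))

/-- The conditional matching bias `B_M(π)`, for the regression function `μ`. -/
def matchBias (M : ℕ) (π : Covariate p → Bool) (μ : Covariate p → Bool → ℝ)
    (x : Fin n → Covariate p) (w : Fin n → Bool) : ℝ :=
  (n : ℝ)⁻¹ * ∑ i, sgn (w i) * sgn (π (x i)) *
    ((M : ℝ)⁻¹ * ∑ j ∈ matchSet M x w i, (μ (x i) (!w i) - μ (x j) (!w i)))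

/-- The residual term `E_M(π)`, a weighted mean of the residuals `y_i - μ(x_i, w_i)`. -/
def matchResidual (M : ℕ) (π : Covariate p → Bool) (μ : Covariate p → Bool → ℝ)
    (x : Fin n → Covariate p) (w : Fin n → Bool) (y : Fin n → ℝ) : ℝ :=
  (n : ℝ)⁻¹ * ∑ i, sgn (w i) * (sgn (π (x i)) + matchWeight M π x w i / M) *
    (y i - μ (x i) (w i))

end Sample

/-! ### The population -/

/-- Conditional independence of `f` and `g` given the `σ`-algebra `m`, through conditional
probabilities; no assumption on the probability space is needed. -/
def CondIndependent {Ω β γ : Type*} (m : MeasurableSpace Ω) {mΩ : MeasurableSpace Ω}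
    [MeasurableSpace β] [MeasurableSpace γ] (f : Ω → β) (g : Ω → γ) (P : Measure Ω) : Prop :=
  ∀ (s : Set β) (t : Set γ), MeasurableSet s → MeasurableSet t →
    P⟦f ⁻¹' s ∩ g ⁻¹' t | m⟧ =ᵐ[P] P⟦f ⁻¹' s | m⟧ * P⟦g ⁻¹' t | m⟧

/-- On a standard Borel space this is Mathlib's conditional independence. -/
theorem condIndependent_iff_condIndepFun {Ω β γ : Type*} (m : MeasurableSpace Ω)
    {mΩ : MeasurableSpace Ω} [StandardBorelSpace Ω] [MeasurableSpace β] [MeasurableSpace γ]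
    (hm : m ≤ mΩ) (f : Ω → β) (g : Ω → γ)
    (hf : Measurable f) (hg : Measurable g) (P : Measure Ω) [IsProbabilityMeasure P] :
    CondIndependent m f g P ↔ CondIndepFun m hm f g P := by
  rw [condIndepFun_iff m hm f g hf hg P]
  constructor
  · rintro h _ _ ⟨s, hs, rfl⟩ ⟨t, ht, rfl⟩
    exact h s t hs ht
  · intro h s t hs ht
    exact h _ _ ⟨s, hs, rfl⟩ ⟨t, ht, rfl⟩

section Population

variable {Ω : Type*} [MeasurableSpace Ω]

/-- The `σ`-algebra on `Ω` generated by `f`. -/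
abbrev sigmaOf {β : Type*} [MeasurableSpace β] (f : Ω → β) : MeasurableSpace Ω :=
  MeasurableSpace.comap f inferInstance

variable {p : ℕ}

/-- The potential outcome framework for covariates `X`, treatment `W`, potential outcomes `Ypot a`
and observed outcome `Y`: consistency, unconfoundedness and overlap. -/
structure CausalModel (P : Measure Ω) (X : Ω → Covariate p) (W : Ω → Bool)
    (Ypot : Bool → Ω → ℝ) (Y : Ω → ℝ) : Prop where
  measurable_covariate : Measurable X
  measurable_treatment : Measurable W
  measurable_potential : ∀ a, Measurable (Ypot a)
  measurable_outcome : Measurable Y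
  consistency : ∀ᵐ ω ∂P, Y ω = Ypot (W ω) ω
  unconfounded : CondIndependent (sigmaOf X) (fun ω => (Ypot true ω, Ypot false ω)) W P
  overlap : ∃ c : ℝ, 0 < c ∧ ∀ᵐ ω ∂P,
    c < (P⟦W ⁻¹' {true} | sigmaOf X⟧) ω ∧ (P⟦W ⁻¹' {true} | sigmaOf X⟧) ω < 1 - c

/-- `Z 0, Z 1, …` are independent copies of `Z₀`. -/
structure IsIIDCopies {α : Type*} [MeasurableSpace α] (P : Measure Ω)
    (Z₀ : Ω → α) (Z : ℕ → Ω → α) : Prop where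
  measurable : ∀ i, Measurable (Z i)
  indep : iIndepFun Z P
  ident : ∀ i, IdentDistrib (Z i) Z₀ P P

/-- `μ` is a version of the regression function, `μ(x, w) = E[Y | X = x, W = w]`. -/
structure IsRegressionFunction (P : Measure Ω) (X : Ω → Covariate p) (W : Ω → Bool)
    (Y : Ω → ℝ) (μ : Covariate p → Bool → ℝ) : Prop where
  integrable : Integrable Y P
  measurable : ∀ w, Measurable fun x => μ x w
  ae_eq : (fun ω => μ (X ω) (W ω)) =ᵐ[P] P[Y | sigmaOf fun ω => (X ω, W ω)]

/-- `v` is a version of the conditional variance function, `v(x, w) = Var[Y | X = x, W = w]`. -/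
structure IsCondVarianceFunction (P : Measure Ω) (X : Ω → Covariate p) (W : Ω → Bool)
    (Y : Ω → ℝ) (v : Covariate p → Bool → ℝ) : Prop where
  memLp : MemLp Y 2 P
  measurable : ∀ w, Measurable fun x => v x w
  ae_eq : (fun ω => v (X ω) (W ω)) =ᵐ[P] Var[Y; P | sigmaOf fun ω => (X ω, W ω)]

/-- `X` has a Lebesgue density which vanishes off the convex compact set `S` and is bounded above
and bounded away from zero on `S`. -/
structure RegularSupport (P : Measure Ω) (X : Ω → Covariate p) (S : Set (Covariate p)) :
    Prop where
  convex : Convex ℝ S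
  compact : IsCompact S
  density : ∃ f : Covariate p → ℝ, Measurable f ∧
    P.map X = volume.withDensity (fun x => ENNReal.ofReal (f x)) ∧
    (∀ x, x ∉ S → f x = 0) ∧
    ∃ a b : ℝ, 0 < a ∧ ∀ x ∈ S, a ≤ f x ∧ f x ≤ b

/-- For `w = 0, 1`, the function `g(·, w)` is Lipschitz on `S`. -/
def LipschitzInCovariate (g : Covariate p → Bool → ℝ) (S : Set (Covariate p)) : Prop :=
  ∀ w, ∃ L : NNReal, LipschitzOnWith L (fun x => g x w) S

/-- `E[Y ^ 4 | X, W]` is bounded. -/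
def BoundedFourthMoment (P : Measure Ω) (X : Ω → Covariate p) (W : Ω → Bool) (Y : Ω → ℝ) : Prop :=
  Integrable (fun ω => Y ω ^ 4) P ∧
    ∃ C : ℝ, ∀ᵐ ω ∂P, (P[fun ω' => Y ω' ^ 4 | sigmaOf fun ω' => (X ω', W ω')]) ω ≤ C

/-- The conditional average treatment effect `τ(X) = E[Y(1) - Y(0) | X]`. -/
def cate (P : Measure Ω) (X : Ω → Covariate p) (Ypot : Bool → Ω → ℝ) : Ω → ℝ :=
  P[fun ω => Ypot true ω - Ypot false ω | sigmaOf X]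

/-- The advantage function `A(π) = E[(2 π(X) - 1) τ(X)]`. -/
def advantage (P : Measure Ω) (X : Ω → Covariate p) (Ypot : Bool → Ω → ℝ)
    (π : Covariate p → Bool) : ℝ :=
  ∫ ω, sgn (π (X ω)) * cate P X Ypot ω ∂P

/-- `V^{τ(X)}(π) = E[((2 π(X) - 1) τ(X) - A(π))²]`. -/
def cateVariance (P : Measure Ω) (X : Ω → Covariate p) (Ypot : Bool → Ω → ℝ)
    (π : Covariate p → Bool) : ℝ :=
  ∫ ω, (sgn (π (X ω)) * cate P X Ypot ω - advantage P X Ypot π) ^ 2 ∂P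

/-! ### The estimator and its components on the first `n` observations -/

/-- The matching estimator based on the first `n` observations. -/
def estimator (M : ℕ) (π : Covariate p → Bool) (Xs : ℕ → Ω → Covariate p) (Ws : ℕ → Ω → Bool)
    (Ys : ℕ → Ω → ℝ) (n : ℕ) (ω : Ω) : ℝ :=
  matchEstimator M π (fun i : Fin n => Xs i ω) (fun i : Fin n => Ws i ω) (fun i : Fin n => Ys i ω)

/-- The conditional matching bias `B_M(π)` of the first `n` observations. -/
def bias (M : ℕ) (π : Covariate p → Bool) (μ : Covariate p → Bool → ℝ)
    (Xs : ℕ → Ω → Covariate p) (Ws : ℕ → Ω → Bool) (n : ℕ) (ω : Ω) : ℝ :=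
  matchBias M π μ (fun i : Fin n => Xs i ω) (fun i : Fin n => Ws i ω)

/-- The residual term `E_M(π)` of the first `n` observations. -/
def residual (M : ℕ) (π : Covariate p → Bool) (μ : Covariate p → Bool → ℝ)
    (Xs : ℕ → Ω → Covariate p) (Ws : ℕ → Ω → Bool) (Ys : ℕ → Ω → ℝ) (n : ℕ) (ω : Ω) : ℝ :=
  matchResidual M π μ
    (fun i : Fin n => Xs i ω) (fun i : Fin n => Ws i ω) (fun i : Fin n => Ys i ω)

/-- `V^E(π) = n Var[E_M(π) | X_1, …, X_n, W_1, …, W_n]`, a random variable. -/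
def residualVariance (P : Measure Ω) (M : ℕ) (π : Covariate p → Bool)
    (μ : Covariate p → Bool → ℝ) (Xs : ℕ → Ω → Covariate p) (Ws : ℕ → Ω → Bool)
    (Ys : ℕ → Ω → ℝ) (n : ℕ) (ω : Ω) : ℝ :=
  n * (Var[residual M π μ Xs Ws Ys n; P |
    sigmaOf fun ω' => fun i : Fin n => (Xs i ω', Ws i ω')]) ω

/-- The random variables `V^E(π)` are bounded away from zero, with probability tending to one. -/
def ResidualVarianceNondegenerate (P : Measure Ω) (M : ℕ) (π : Covariate p → Bool)
    (μ : Covariate p → Bool → ℝ) (Xs : ℕ → Ω → Covariate p) (Ws : ℕ → Ω → Bool)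
    (Ys : ℕ → Ω → ℝ) : Prop :=
  ∃ c : ℝ, 0 < c ∧
    Tendsto (fun n => P {ω | residualVariance P M π μ Xs Ws Ys n ω < c}) atTop (𝓝 0)

end Population

end MatchingPolicy

end

/-! If no distances tie and each arm has enough units near every unit, all matched sets have exactly
`M` elements. Then `matchEstimator_eq` splits the estimator exactly into the sample mean of the
signed treatment effects, the residual term E_M and the bias B_M. Unconfoundedness and overlap
identify the mean effect with the advantage (`CausalModel.condExp_potential`). Consistency follows:
matches lie within a radius tending to zero, so the Lipschitz property removes the bias, and
Chebyshev bounds remove the fluctuations of the two means.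

For normality, the outcome is written as μ(X, W) plus a function of (X, W) and an independent
uniform variable (`exists_noiseModel`). Given the design, E_M is then a weighted sum of independent
centred terms, with conditional characteristic function close to that of a Gaussian of the same
conditional variance. If this variance is nearly deterministic, the conditional characteristic
function may be replaced by a constant, and what remains is the classical central limit theorem for
the effects (`NoiseModel.tendsto_charFun`). No limit of V^E is needed: it is enough that V^E minus a
deterministic sequence tends to zero in probability. Nondegeneracy keeps this sequence away from
zero, and Slutsky's theorem restores the random normalisation.

The core is thus the concentration of V^E, `RegularDesign.exists_matchVar_concentration`. For a
fixed metric it follows from the Efron–Stein inequality: resampling one unit alters only the matched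
sets of units near its old or its new position, and a good sample has few of these. The Mahalanobis
metric, however, depends on all units. It is replaced by the metric of the population covariance
matrix: the two quadratic forms are close in ratio, so the matched sets differ only at units with a
near tie between two distances, and near ties are counted through the volume of thin annuli.

Absence of ties (`RegularDesign.ae_no_ties`) is not immediate either, since moving one unit moves
the metric. But one unit enters the sample covariance matrix through a rank one term, so by the
Sherman–Morrison formula a tie is a nontrivial polynomial equation of degree at most two in that
unit's covariates, whose solutions form a null set. -/

noncomputable section

namespace MatchingPolicy

/-! ### Nearest neighbours in a finite set -/

section RankSet

variable {ι : Type*}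

/-- The elements `j` of `O` such that at most `M` elements of `O` have an `f`-value not exceeding
that of `j`. -/
def rankSet (M : ℕ) (O : Finset ι) (f : ι → ℝ) : Finset ι :=
  O.filter fun j => (O.filter fun k => f k ≤ f j).card ≤ M

lemma mem_rankSet {M : ℕ} {O : Finset ι} {f : ι → ℝ} {j : ι} :
    j ∈ rankSet M O f ↔ j ∈ O ∧ (O.filter fun k => f k ≤ f j).card ≤ M := by
  simp [rankSet]

/-- The member with the largest value counts every other member in its own rank, and that rank is at
most `M`. -/
lemma card_rankSet_le (M : ℕ) (O : Finset ι) (f : ι → ℝ) : (rankSet M O f).card ≤ M := by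
  rcases (rankSet M O f).eq_empty_or_nonempty with h | h
  · simp [h]
  · obtain ⟨j, hj, hmax⟩ := Finset.exists_max_image _ f h
    refine le_trans (Finset.card_le_card fun k hk => ?_) (mem_rankSet.1 hj).2
    exact Finset.mem_filter.2 ⟨(mem_rankSet.1 hk).1, hmax k hk⟩

/-- Only ties can make the set too small. If it had fewer than `M` elements, the least element
outside it would be preceded by members only, so its rank would be at most `M` and it would be a
member itself. -/
lemma card_rankSet_eq {M : ℕ} {O : Finset ι} {f : ι → ℝ} (hM : M ≤ O.card)
    (hf : Set.InjOn f O) : (rankSet M O f).card = M := by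
  classical
  refine le_antisymm (card_rankSet_le M O f) ?_
  by_contra! hlt
  have hsub : rankSet M O f ⊆ O := Finset.filter_subset _ _
  have hne : (O \ rankSet M O f).Nonempty := by
    rw [← Finset.card_pos, Finset.card_sdiff_of_subset hsub]
    omega
  obtain ⟨j, hj, hmin⟩ := Finset.exists_min_image _ f hne
  rw [Finset.mem_sdiff] at hj
  refine hj.2 (mem_rankSet.2 ⟨hj.1, ?_⟩)
  have : (O.filter fun k => f k ≤ f j) ⊆ insert j (rankSet M O f) := by
    intro k hk
    rw [Finset.mem_filter] at hk
    by_cases hkJ : k ∈ rankSet M O f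
    · exact Finset.mem_insert_of_mem hkJ
    · have := hmin k (Finset.mem_sdiff.2 ⟨hk.1, hkJ⟩)
      rw [hf hk.1 hj.1 (le_antisymm hk.2 this)]
      exact Finset.mem_insert_self _ _
  exact (Finset.card_le_card this).trans ((Finset.card_insert_le _ _).trans hlt)

/-- An element above the level `ρ` counts itself and the at least `M` elements below the level, so
its rank exceeds `M`. -/
lemma le_of_mem_rankSet {M : ℕ} {O : Finset ι} {f : ι → ℝ} {ρ : ℝ}
    (hM : M ≤ (O.filter fun k => f k ≤ ρ).card) {j : ι} (hj : j ∈ rankSet M O f) : f j ≤ ρ := by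
  classical
  by_contra! hlt
  rw [mem_rankSet] at hj
  have : insert j (O.filter fun k => f k ≤ ρ) ⊆ O.filter fun k => f k ≤ f j := by
    intro k hk
    rw [Finset.mem_insert, Finset.mem_filter] at hk
    rcases hk with rfl | hk
    · exact Finset.mem_filter.2 ⟨hj.1, le_rfl⟩
    · exact Finset.mem_filter.2 ⟨hk.1, hk.2.trans hlt.le⟩
  have h := Finset.card_le_card this
  rw [Finset.card_insert_of_notMem (by simp [hlt])] at h
  omega

/-- If the elements of two sets below the level `ρ` and their ranks agree, then so do the rank
sets. -/
lemma rankSet_congr {M : ℕ} {O O' : Finset ι} {f g : ι → ℝ}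
    {ρ : ℝ} (hf : ∀ j ∈ rankSet M O f, f j ≤ ρ) (hg : ∀ j ∈ rankSet M O' g, f j ≤ ρ)
    (hO : ∀ j, f j ≤ ρ → (j ∈ O ↔ j ∈ O'))
    (h : ∀ j ∈ O, j ∈ O' → f j ≤ ρ → ∀ k, (k ∈ O ∧ f k ≤ f j ↔ k ∈ O' ∧ g k ≤ g j)) :
    rankSet M O f = rankSet M O' g := by
  have key : ∀ j ∈ O, j ∈ O' → f j ≤ ρ →
      (O.filter fun k => f k ≤ f j) = O'.filter fun k => g k ≤ g j := by
    intro j hj hj' hjρ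
    ext k
    simpa using h j hj hj' hjρ k
  ext j
  constructor
  · intro hj
    have hρ := hf j hj
    rw [mem_rankSet] at hj ⊢
    have hj' := (hO j hρ).1 hj.1
    exact ⟨hj', by rw [← key j hj.1 hj' hρ]; exact hj.2⟩
  · intro hj
    have hρ := hg j hj
    rw [mem_rankSet] at hj ⊢
    have hj' := (hO j hρ).2 hj.1
    exact ⟨hj', by rw [key j hj' hj.1 hρ]; exact hj.2⟩

end RankSet

/-! ### Matching with respect to a general distance -/

section Weights

variable {n : ℕ}

/-- The units in the treatment arm opposite to that of unit `i`. -/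
def oppositeArm (w : Fin n → Bool) (i : Fin n) : Finset (Fin n) :=
  Finset.univ.filter fun j => w j = !w i

lemma mem_oppositeArm {w : Fin n → Bool} {i j : Fin n} : j ∈ oppositeArm w i ↔ w j = !w i := by
  simp [oppositeArm]

lemma matchSet_eq_rankSet {p : ℕ} (M : ℕ) (x : Fin n → Covariate p) (w : Fin n → Bool)
    (i : Fin n) :
    matchSet M x w i = rankSet M (oppositeArm w i) fun j => mahaNorm x (x j - x i) := by
  ext j
  simp only [matchSet, mem_rankSet, Finset.mem_filter, Finset.mem_univ, true_and,
    oppositeArm, Finset.filter_filter]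

/-- The sum of `s j` over all `j` such that `i` belongs to `J j`. -/
def weight (J : Fin n → Finset (Fin n)) (s : Fin n → ℝ) (i : Fin n) : ℝ :=
  ∑ j, if i ∈ J j then s j else 0

lemma matchWeight_eq_weight {p : ℕ} (M : ℕ) (π : Covariate p → Bool) (x : Fin n → Covariate p)
    (w : Fin n → Bool) (i : Fin n) :
    matchWeight M π x w i = weight (matchSet M x w) (fun j => sgn (π (x j))) i := by
  rw [matchWeight, weight, Finset.sum_filter]

/-- Exchange the sums: each `j` in `B` is seen by at most `M` indices through `J j` and by at most
`M` through `J' j`. The bound is in ℓ¹, hence linear in the number of altered sets. -/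
lemma sum_abs_weight_sub_le {M : ℕ} {J J' : Fin n → Finset (Fin n)} {s s' : Fin n → ℝ}
    (hJ : ∀ j, (J j).card ≤ M) (hJ' : ∀ j, (J' j).card ≤ M)
    (hs : ∀ j, |s j| ≤ 1) (hs' : ∀ j, |s' j| ≤ 1) (B : Finset (Fin n))
    (hB : ∀ j ∉ B, J j = J' j ∧ s j = s' j) :
    ∑ i, |weight J s i - weight J' s' i| ≤ 2 * M * B.card := by
  calc ∑ i, |weight J s i - weight J' s' i|
      ≤ ∑ i, ∑ j ∈ B, ((if i ∈ J j then (1 : ℝ) else 0) + if i ∈ J' j then (1 : ℝ) else 0) := by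
        refine Finset.sum_le_sum fun i _ => ?_
        rw [weight, weight, ← Finset.sum_sub_distrib]
        have : ∑ j, ((if i ∈ J j then s j else 0) - if i ∈ J' j then s' j else 0) =
            ∑ j ∈ B, ((if i ∈ J j then s j else 0) - if i ∈ J' j then s' j else 0) := by
          symm
          refine Finset.sum_subset (Finset.subset_univ B) fun j _ hj => ?_
          obtain ⟨h1, h2⟩ := hB j hj
          rw [h1, h2, sub_self]
        rw [this]
        refine (Finset.abs_sum_le_sum_abs _ _).trans (Finset.sum_le_sum fun j _ => ?_)
        refine (abs_sub _ _).trans (add_le_add ?_ ?_)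
        · split_ifs
          · exact hs j
          · simp
        · split_ifs
          · exact hs' j
          · simp
    _ = ∑ j ∈ B, (((J j).card : ℝ) + (J' j).card) := by
        rw [Finset.sum_comm]
        refine Finset.sum_congr rfl fun j _ => ?_
        rw [Finset.sum_add_distrib]
        simp
    _ ≤ ∑ _j ∈ B, (2 * M : ℝ) := by
        refine Finset.sum_le_sum fun j _ => ?_
        have h1 : ((J j).card : ℝ) ≤ M := by exact_mod_cast hJ j
        have h2 : ((J' j).card : ℝ) ≤ M := by exact_mod_cast hJ' j
        linarith
    _ = 2 * M * B.card := by rw [Finset.sum_const, nsmul_eq_mul]; ring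

lemma abs_weight_le {J : Fin n → Finset (Fin n)} {s : Fin n → ℝ} (hs : ∀ j, |s j| ≤ 1) (i : Fin n) :
    |weight J s i| ≤ (Finset.univ.filter fun j => i ∈ J j).card := by
  rw [weight, ← Finset.sum_filter]
  refine (Finset.abs_sum_le_sum_abs _ _).trans ?_
  refine (Finset.sum_le_sum fun j _ => hs j).trans ?_
  simp

/-- The variance form `n⁻¹ ∑ i, (s i + K i / M)² v i`, where `K` is the weight of `J` and `s`. -/
def varForm (M : ℕ) (J : Fin n → Finset (Fin n)) (s v : Fin n → ℝ) : ℝ :=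
  (n : ℝ)⁻¹ * ∑ i, (s i + weight J s i / M) ^ 2 * v i

/-- Terms with index in `B` are bounded trivially and contribute `2 C (1 + L)²` each. For the others
the difference of squares factors, and `sum_abs_weight_sub_le` bounds the sum of the weight
differences, contributing `4 C (1 + L)` per element of `B`. Together these give the constant `6`. -/
lemma abs_varForm_sub_le {M : ℕ} (hM : 1 ≤ M) {J J' : Fin n → Finset (Fin n)}
    {s s' v v' : Fin n → ℝ} {L C : ℝ} (hC : 0 ≤ C)
    (hJ : ∀ j, (J j).card ≤ M) (hJ' : ∀ j, (J' j).card ≤ M)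
    (hs : ∀ j, |s j| ≤ 1) (hs' : ∀ j, |s' j| ≤ 1)
    (hK : ∀ i, |weight J s i| ≤ L) (hK' : ∀ i, |weight J' s' i| ≤ L)
    (hv : ∀ i, |v i| ≤ C) (hv' : ∀ i, |v' i| ≤ C) (B : Finset (Fin n))
    (hB : ∀ j ∉ B, J j = J' j ∧ s j = s' j ∧ v j = v' j) :
    |varForm M J s v - varForm M J' s' v'| ≤ 6 * C * (1 + L) ^ 2 * B.card / n := by
  have hM' : (1 : ℝ) ≤ M := by exact_mod_cast hM
  rcases Nat.eq_zero_or_pos n with rfl | hn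
  · simp [varForm]
  have hL : 0 ≤ L := (abs_nonneg _).trans (hK ⟨0, hn⟩)
  have ha : ∀ (J : Fin n → Finset (Fin n)) (s : Fin n → ℝ), (∀ j, |s j| ≤ 1) →
      (∀ i, |weight J s i| ≤ L) → ∀ i, |s i + weight J s i / M| ≤ 1 + L := by
    intro J s hs hK i
    refine (abs_add_le _ _).trans (add_le_add (hs i) ?_)
    rw [abs_div, Nat.abs_cast]
    exact (div_le_self (abs_nonneg _) hM').trans (hK i)
  have h1 := ha J s hs hK
  have h2 := ha J' s' hs' hK'
  have hsum := sum_abs_weight_sub_le hJ hJ' hs hs' B fun j hj => ⟨(hB j hj).1, (hB j hj).2.1⟩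
  have hterm : ∀ i, |(s i + weight J s i / M) ^ 2 * v i - (s' i + weight J' s' i / M) ^ 2 * v' i| ≤
      C * (2 * (1 + L)) / M * |weight J s i - weight J' s' i| +
        if i ∈ B then 2 * C * (1 + L) ^ 2 else 0 := by
    intro i
    split_ifs with hi
    · have e1 : |(s i + weight J s i / M) ^ 2 * v i| ≤ (1 + L) ^ 2 * C := by
        rw [abs_mul, abs_pow]
        gcongr
        · exact h1 i
        · exact hv i
      have e2 : |(s' i + weight J' s' i / M) ^ 2 * v' i| ≤ (1 + L) ^ 2 * C := by
        rw [abs_mul, abs_pow]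
        gcongr
        · exact h2 i
        · exact hv' i
      have e3 : 0 ≤ C * (2 * (1 + L)) / M * |weight J s i - weight J' s' i| := by positivity
      have e4 := abs_sub ((s i + weight J s i / M) ^ 2 * v i)
        ((s' i + weight J' s' i / M) ^ 2 * v' i)
      linarith
    · obtain ⟨-, hsi, hvi⟩ := hB i hi
      have : (s i + weight J s i / M) ^ 2 * v i - (s' i + weight J' s' i / M) ^ 2 * v' i =
          ((s i + weight J s i / M) + (s' i + weight J' s' i / M)) *
            ((weight J s i - weight J' s' i) / M) * v i := by
        rw [← hvi, ← hsi]; ring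
      rw [this, abs_mul, abs_mul, abs_div, Nat.abs_cast, add_zero]
      have e1 := (abs_add_le (s i + weight J s i / M) (s' i + weight J' s' i / M)).trans
        (add_le_add (h1 i) (h2 i))
      calc _ ≤ (1 + L + (1 + L)) * (|weight J s i - weight J' s' i| / M) * C := by
            gcongr
            exact hv i
        _ = _ := by ring
  rw [varForm, varForm, ← mul_sub, ← Finset.sum_sub_distrib, abs_mul, abs_inv, Nat.abs_cast,
    inv_mul_eq_div]
  gcongr
  calc |∑ i, ((s i + weight J s i / M) ^ 2 * v i - (s' i + weight J' s' i / M) ^ 2 * v' i)|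
      ≤ ∑ i, (C * (2 * (1 + L)) / M * |weight J s i - weight J' s' i| +
        if i ∈ B then 2 * C * (1 + L) ^ 2 else 0) :=
        (Finset.abs_sum_le_sum_abs _ _).trans (Finset.sum_le_sum fun i _ => hterm i)
    _ = C * (2 * (1 + L)) / M * ∑ i, |weight J s i - weight J' s' i| +
        2 * C * (1 + L) ^ 2 * B.card := by
        rw [Finset.sum_add_distrib, ← Finset.mul_sum]
        simp [mul_comm]
    _ ≤ C * (2 * (1 + L)) / M * (2 * M * B.card) + 2 * C * (1 + L) ^ 2 * B.card := by gcongr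
    _ = (4 * C * (1 + L) + 2 * C * (1 + L) ^ 2) * B.card := by field_simp; ring
    _ ≤ 6 * C * (1 + L) ^ 2 * B.card := by
        gcongr
        nlinarith [mul_nonneg hC hL, mul_nonneg (mul_nonneg hC hL) hL]

end Weights

/-! ### Quadratic forms -/

section QuadraticForms

open Matrix

variable {p : ℕ}

/-- The quadratic form `vᵀ A v`. -/
def qform (A : Matrix (Fin p) (Fin p) ℝ) (v : Fin p → ℝ) : ℝ := v ⬝ᵥ A *ᵥ v

/-- A symmetric real matrix whose quadratic form is positive. -/
structure PositiveMatrix (A : Matrix (Fin p) (Fin p) ℝ) : Prop where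
  symm : Aᵀ = A
  pos : ∀ u, u ≠ 0 → 0 < qform A u

lemma PositiveMatrix.nonneg {A : Matrix (Fin p) (Fin p) ℝ} (hA : PositiveMatrix A)
    (u : Fin p → ℝ) : 0 ≤ qform A u := by
  rcases eq_or_ne u 0 with rfl | hu
  · simp [qform]
  · exact (hA.pos u hu).le

lemma PositiveMatrix.isUnit_det {A : Matrix (Fin p) (Fin p) ℝ} (hA : PositiveMatrix A) :
    IsUnit A.det := by
  rw [isUnit_iff_ne_zero]
  intro h
  obtain ⟨v, hv, hAv⟩ := Matrix.exists_mulVec_eq_zero_iff.2 h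
  have := hA.pos v hv
  simp [qform, hAv] at this

lemma dotProduct_mulVec_symm {A : Matrix (Fin p) (Fin p) ℝ} (hA : Aᵀ = A) (u v : Fin p → ℝ) :
    u ⬝ᵥ A *ᵥ v = v ⬝ᵥ A *ᵥ u := by
  rw [Matrix.dotProduct_mulVec, ← Matrix.mulVec_transpose, hA, dotProduct_comm]

lemma PositiveMatrix.inv {A : Matrix (Fin p) (Fin p) ℝ} (hA : PositiveMatrix A) :
    PositiveMatrix A⁻¹ where
  symm := by rw [Matrix.transpose_nonsing_inv, hA.symm]
  pos u hu := by
    have h1 : A *ᵥ (A⁻¹ *ᵥ u) = u := by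
      rw [Matrix.mulVec_mulVec, Matrix.mul_nonsing_inv _ hA.isUnit_det, Matrix.one_mulVec]
    have h2 := hA.pos (A⁻¹ *ᵥ u) (fun h => hu (by rw [← h1, h, Matrix.mulVec_zero]))
    rwa [qform, h1, dotProduct_comm] at h2

lemma qform_smul (A : Matrix (Fin p) (Fin p) ℝ) (c : ℝ) (v : Fin p → ℝ) :
    qform A (c • v) = c ^ 2 * qform A v := by
  simp only [qform, Matrix.mulVec_smul, smul_dotProduct, dotProduct_smul, smul_eq_mul]
  ring

lemma qform_add {A : Matrix (Fin p) (Fin p) ℝ} (hA : Aᵀ = A) (u v : Fin p → ℝ) :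
    qform A (u + v) = qform A u + 2 * (u ⬝ᵥ A *ᵥ v) + qform A v := by
  simp only [qform, Matrix.mulVec_add, add_dotProduct, dotProduct_add]
  rw [dotProduct_mulVec_symm hA v u]
  ring

/-- Inversion is antitone for quadratic forms. -/
lemma qform_inv_le {A B : Matrix (Fin p) (Fin p) ℝ} (hA : PositiveMatrix A)
    (hB : PositiveMatrix B) {c : ℝ} (hc : 0 < c) (h : ∀ u, qform A u ≤ c * qform B u)
    (v : Fin p → ℝ) : qform B⁻¹ v ≤ c * qform A⁻¹ v := by
  have hAv : A *ᵥ (A⁻¹ *ᵥ v) = v := by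
    rw [Matrix.mulVec_mulVec, Matrix.mul_nonsing_inv _ hA.isUnit_det, Matrix.one_mulVec]
  have hBv : B *ᵥ (B⁻¹ *ᵥ v) = v := by
    rw [Matrix.mulVec_mulVec, Matrix.mul_nonsing_inv _ hB.isUnit_det, Matrix.one_mulVec]
  -- Expanding the form of `A` at `A⁻¹ v - c⁻¹ B⁻¹ v` completes the square; the cross term is `-2
  -- c⁻¹ qform B⁻¹ v`.
  have h1 := hA.nonneg ((-c⁻¹) • (B⁻¹ *ᵥ v) + A⁻¹ *ᵥ v)
  have e1 : qform A (A⁻¹ *ᵥ v) = qform A⁻¹ v := by rw [qform, hAv, dotProduct_comm, qform]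
  have e2 : qform B (B⁻¹ *ᵥ v) = qform B⁻¹ v := by rw [qform, hBv, dotProduct_comm, qform]
  have e3 : (B⁻¹ *ᵥ v) ⬝ᵥ v = qform B⁻¹ v := by rw [dotProduct_comm, qform]
  rw [qform_add hA.symm, qform_smul, hAv, smul_dotProduct, e1, e3, smul_eq_mul] at h1
  have h2 := h (B⁻¹ *ᵥ v)
  rw [e2] at h2
  have h3 : (-c⁻¹) ^ 2 * qform A (B⁻¹ *ᵥ v) ≤ c⁻¹ * qform B⁻¹ v := by
    calc (-c⁻¹) ^ 2 * qform A (B⁻¹ *ᵥ v) ≤ (-c⁻¹) ^ 2 * (c * qform B⁻¹ v) := by gcongr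
      _ = c⁻¹ * qform B⁻¹ v := by field_simp
  have h4 : c⁻¹ * qform B⁻¹ v ≤ qform A⁻¹ v := by linarith
  calc qform B⁻¹ v = c * (c⁻¹ * qform B⁻¹ v) := by field_simp
    _ ≤ _ := by gcongr

lemma PositiveMatrix.add_vecMulVec {A : Matrix (Fin p) (Fin p) ℝ} (hA : PositiveMatrix A)
    {α : ℝ} (hα : 0 ≤ α) (u : Fin p → ℝ) : PositiveMatrix (A + α • vecMulVec u u) where
  symm := by rw [Matrix.transpose_add, hA.symm, Matrix.transpose_smul, Matrix.transpose_vecMulVec]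
  pos v hv := by
    have := hA.pos v hv
    have h2 : qform (A + α • vecMulVec u u) v = qform A v + α * (u ⬝ᵥ v) ^ 2 := by
      simp only [qform, Matrix.add_mulVec, dotProduct_add, Matrix.smul_mulVec, dotProduct_smul,
        Matrix.vecMulVec_mulVec, smul_eq_mul,
        dotProduct_comm v u, op_smul_eq_smul]
      ring
    rw [h2]
    positivity

/-- The Sherman–Morrison formula, for quadratic forms. -/
lemma qform_inv_add_vecMulVec {A : Matrix (Fin p) (Fin p) ℝ} (hA : PositiveMatrix A)
    {α : ℝ} (hα : 0 ≤ α) (u v : Fin p → ℝ) :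
    (1 + α * qform A⁻¹ u) * qform (A + α • vecMulVec u u)⁻¹ v =
      (1 + α * qform A⁻¹ u) * qform A⁻¹ v - α * (v ⬝ᵥ A⁻¹ *ᵥ u) ^ 2 := by
  set c := qform A⁻¹ u with hc
  have hc0 : 0 ≤ c := hA.inv.nonneg u
  have hpos : 0 < 1 + α * c := by positivity
  have hAu : A *ᵥ (A⁻¹ *ᵥ u) = u := by
    rw [Matrix.mulVec_mulVec, Matrix.mul_nonsing_inv _ hA.isUnit_det, Matrix.one_mulVec]
  have huA : u ᵥ* A⁻¹ = A⁻¹ *ᵥ u := by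
    rw [← Matrix.mulVec_transpose, hA.inv.symm]
  -- The inverse is written down explicitly and verified as a right inverse; the denominator is
  -- positive because `A⁻¹` is.
  have hinv : (A + α • vecMulVec u u)⁻¹ =
      A⁻¹ - (α / (1 + α * c)) • vecMulVec (A⁻¹ *ᵥ u) (A⁻¹ *ᵥ u) := by
    refine Matrix.inv_eq_right_inv ?_
    rw [Matrix.mul_sub, Matrix.add_mul, Matrix.add_mul, Matrix.mul_nonsing_inv _ hA.isUnit_det,
      Matrix.mul_smul, Matrix.mul_vecMulVec, hAu, Matrix.smul_mul, Matrix.vecMulVec_mul, huA,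
      Matrix.mul_smul, Matrix.smul_mul, Matrix.vecMulVec_mul_vecMulVec]
    have : u ⬝ᵥ A⁻¹ *ᵥ u = c := rfl
    rw [this]
    ext i j
    simp only [Matrix.sub_apply, Matrix.add_apply, Matrix.smul_apply, Matrix.vecMulVec_apply,
      smul_eq_mul, Pi.smul_apply]
    field_simp
    ring
  rw [hinv]
  simp only [qform, Matrix.sub_mulVec, dotProduct_sub, Matrix.smul_mulVec, dotProduct_smul,
    Matrix.vecMulVec_mulVec, smul_eq_mul, op_smul_eq_smul]
  rw [dotProduct_comm (A⁻¹ *ᵥ u) v]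
  field_simp

/-- Fubini in the direction `w`: each line parallel to `w` meets the zero set in the roots of a
nonzero polynomial of degree at most two, a finite set. -/
lemma volume_zeros_eq_zero_of_quadratic_on_lines {f : (Fin p → ℝ) → ℝ} (hf : Continuous f)
    (w : Fin p → ℝ) (h : ∀ y, ∃ a b c : ℝ, (a ≠ 0 ∨ b ≠ 0 ∨ c ≠ 0) ∧
      ∀ t : ℝ, f (y + t • w) = a * t ^ 2 + b * t + c) :
    volume {y | f y = 0} = 0 := by
  have hs : MeasurableSet {y | f y ≠ 0} := (isOpen_ne_fun hf continuous_const).measurableSet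
  have := ae_mem_of_ae_add_linearMap_mem (LinearMap.toSpanSingleton ℝ (Fin p → ℝ) w)
    (volume : Measure ℝ) (volume : Measure (Fin p → ℝ)) hs (fun y => ?_)
  · rw [ae_iff] at this
    simpa using this
  · obtain ⟨a, b, c, hne, habc⟩ := h y
    rw [ae_iff]
    refine Set.Finite.measure_zero ?_ _
    let P : Polynomial ℝ := Polynomial.C a * Polynomial.X ^ 2 + Polynomial.C b * Polynomial.X +
      Polynomial.C c
    have hP : P ≠ 0 := by
      intro h0
      have h2 : P.coeff 2 = 0 := by rw [h0]; simp
      have h1 : P.coeff 1 = 0 := by rw [h0]; simp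
      have h3 : P.coeff 0 = 0 := by rw [h0]; simp
      simp [P, Polynomial.coeff_X, Polynomial.coeff_C] at h1 h2 h3
      tauto
    refine (Polynomial.finite_setOfPred_isRoot hP).subset fun t ht => ?_
    have ht' : f (y + t • w) = 0 := by simpa using ht
    simpa [P, Polynomial.IsRoot, habc] using ht'

/-- For a rank one perturbation of a positive matrix, ties between the distances of `z` and `y` to
`x` occur only for a null set of `z`. -/
lemma volume_tie_eq_zero {A : Matrix (Fin p) (Fin p) ℝ} (hA : PositiveMatrix A)
    {α : ℝ} (hα : 0 ≤ α) (m x y : Fin p → ℝ) (hxy : x ≠ y) :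
    volume {z : Fin p → ℝ | qform (A + α • vecMulVec (z - m) (z - m))⁻¹ (z - x) =
      qform (A + α • vecMulVec (z - m) (z - m))⁻¹ (y - x)} = 0 := by
  set e := m - x with he
  set d := y - x with hd
  have hd0 : d ≠ 0 := sub_ne_zero.2 hxy.symm
  set D := qform A⁻¹ d with hD
  set E := qform A⁻¹ e with hE
  have hDpos : 0 < D := hA.inv.pos d hd0
  -- This is the difference of the two squared distances multiplied by `1 + α qform A⁻¹ (z - m)`.
  -- With Sherman–Morrison and `z - x = e + (z - m)`, the quartic and cubic terms in `z - m` cancel,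
  -- so `f` is quadratic.
  let f : (Fin p → ℝ) → ℝ := fun z => qform A⁻¹ (z - m) * (1 + α * (E - D)) +
    2 * (e ⬝ᵥ A⁻¹ *ᵥ (z - m)) + (E - D) - α * (e ⬝ᵥ A⁻¹ *ᵥ (z - m)) ^ 2 +
      α * (d ⬝ᵥ A⁻¹ *ᵥ (z - m)) ^ 2
  have hf : Continuous f := by
    unfold f qform
    fun_prop
  have hsub : {z : Fin p → ℝ | qform (A + α • vecMulVec (z - m) (z - m))⁻¹ (z - x) =
      qform (A + α • vecMulVec (z - m) (z - m))⁻¹ (y - x)} ⊆ {z | f z = 0} := by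
    intro z hz
    rw [Set.mem_ofPred_eq] at hz ⊢
    have h1 := qform_inv_add_vecMulVec hA hα (z - m) (z - x)
    have h2 := qform_inv_add_vecMulVec hA hα (z - m) d
    rw [hz, h2] at h1
    have e1 : z - x = e + (z - m) := by rw [he]; abel
    rw [e1, qform_add hA.inv.symm, add_dotProduct] at h1
    simp only [f]
    rw [← hD, ← hE] at h1
    have e2 : (z - m) ⬝ᵥ A⁻¹ *ᵥ (z - m) = qform A⁻¹ (z - m) := rfl
    rw [e2] at h1
    linarith
  refine measure_mono_null hsub ?_
  -- the expansion of `f` along a line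
  have hline : ∀ (w z : Fin p → ℝ) (t : ℝ), f (z + t • w) =
      (qform A⁻¹ w * (1 + α * (E - D)) - α * (e ⬝ᵥ A⁻¹ *ᵥ w) ^ 2 + α * (d ⬝ᵥ A⁻¹ *ᵥ w) ^ 2) * t ^ 2
      + (2 * (w ⬝ᵥ A⁻¹ *ᵥ (z - m)) * (1 + α * (E - D)) + 2 * (e ⬝ᵥ A⁻¹ *ᵥ w)
        - 2 * α * (e ⬝ᵥ A⁻¹ *ᵥ (z - m)) * (e ⬝ᵥ A⁻¹ *ᵥ w)
        + 2 * α * (d ⬝ᵥ A⁻¹ *ᵥ (z - m)) * (d ⬝ᵥ A⁻¹ *ᵥ w)) * t + f z := by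
    intro w z t
    have e1 : z + t • w - m = t • w + (z - m) := by abel
    simp only [f]
    rw [e1, qform_add hA.inv.symm, qform_smul]
    simp only [Matrix.mulVec_add, Matrix.mulVec_smul, dotProduct_add, dotProduct_smul,
      smul_dotProduct, smul_eq_mul]
    ring
  -- If some direction has a nonzero leading coefficient, lines in that direction settle the claim.
  by_cases hw : ∃ w : Fin p → ℝ, qform A⁻¹ w * (1 + α * (E - D)) - α * (e ⬝ᵥ A⁻¹ *ᵥ w) ^ 2 +
      α * (d ⬝ᵥ A⁻¹ *ᵥ w) ^ 2 ≠ 0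
  · obtain ⟨w, hw⟩ := hw
    exact volume_zeros_eq_zero_of_quadratic_on_lines hf w
      fun z => ⟨_, _, _, Or.inl hw, hline w z⟩
  · push Not at hw
    -- Otherwise the quadratic part vanishes identically and `f` is affine.
    have hf2 : ∀ z, f z = 2 * (e ⬝ᵥ A⁻¹ *ᵥ (z - m)) + (E - D) := by
      intro z
      have := hw (z - m)
      simp only [f]
      linarith
    -- For `e = 0` the affine function is the nonzero constant `-D`; this is where `x ≠ y` is
    -- needed. For `e ≠ 0` its slope along `e` is `2 E > 0`.
    by_cases he0 : e = 0
    · have hE0 : E = 0 := by rw [hE, he0]; simp [qform]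
      have : {z | f z = 0} = ∅ := by
        ext z
        rw [Set.mem_ofPred_eq, hf2, he0, hE0]
        simp [hDpos.ne']
      rw [this, measure_empty]
    · refine volume_zeros_eq_zero_of_quadratic_on_lines hf e fun z =>
        ⟨0, 2 * E, f z, Or.inr (Or.inl ?_), fun t => ?_⟩
      · have := hA.inv.pos e he0
        rw [hE]
        positivity
      · rw [hf2, hf2, add_sub_right_comm, Matrix.mulVec_add, dotProduct_add, Matrix.mulVec_smul,
          dotProduct_smul, smul_eq_mul, hE, qform]
        ring

end QuadraticForms

/-! ### Product measures: resampling one coordinate -/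

section Resampling

variable {α : Type*} [MeasurableSpace α] (Q : Measure α) [IsProbabilityMeasure Q]

/-- The law of an i.i.d. sample of size `n`. -/
abbrev sampleLaw (n : ℕ) : Measure (Fin n → α) := Measure.pi fun _ => Q

variable {n : ℕ}

lemma measurable_update_prod (k : Fin n) :
    Measurable fun q : (Fin n → α) × α => Function.update q.1 k q.2 := by
  refine measurable_pi_lambda _ fun j => ?_
  by_cases hj : j = k
  · subst hj
    simpa using measurable_snd
  · simp only [Function.update_of_ne hj]
    fun_prop

/-- Overwriting one coordinate with an independent draw preserves the product law. All conditioning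
on the remaining coordinates goes through this identity. -/
lemma map_update_sampleLaw (k : Fin n) :
    ((sampleLaw Q n).prod Q).map (fun q => Function.update q.1 k q.2) = sampleLaw Q n := by
  symm
  refine Measure.pi_eq fun s hs => ?_
  rw [Measure.map_apply (measurable_update_prod k) (MeasurableSet.univ_pi hs)]
  have : (fun q : (Fin n → α) × α => Function.update q.1 k q.2) ⁻¹' Set.univ.pi s =
      (Set.univ.pi (Function.update s k Set.univ)) ×ˢ s k := by
    ext q
    simp only [Set.mem_preimage, Set.mem_univ_pi, Set.mem_prod]
    constructor
    · intro h
      refine ⟨fun j => ?_, by simpa using h k⟩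
      by_cases hj : j = k
      · subst hj; simp
      · simpa [hj] using h j
    · rintro ⟨h1, h2⟩ j
      by_cases hj : j = k
      · subst hj; simpa using h2
      · simpa [hj] using h1 j
  rw [this, Measure.prod_prod, Measure.pi_pi, ← Finset.mul_prod_erase _ _ (Finset.mem_univ k),
    ← Finset.mul_prod_erase _ (fun i => Q (s i)) (Finset.mem_univ k)]
  simp only [Function.update_self, measure_univ, one_mul]
  rw [mul_comm]
  congr 1
  refine Finset.prod_congr rfl fun j hj => ?_
  rw [Function.update_of_ne (Finset.ne_of_mem_erase hj)]

lemma sampleLaw_apply_eq_lintegral_update (k : Fin n) {s : Set (Fin n → α)}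
    (hs : MeasurableSet s) :
    sampleLaw Q n s = ∫⁻ z, Q {a | Function.update z k a ∈ s} ∂sampleLaw Q n := by
  conv_lhs => rw [← map_update_sampleLaw Q k, Measure.map_apply (measurable_update_prod k) hs,
    Measure.prod_apply (measurable_update_prod k hs)]
  rfl

/-- A conditional bound: given the other units, `s` has probability at most `q` on `t` and zero off
`t`. It is applied once per unit involved in an event, so that the successive factors multiply. -/
lemma sampleLaw_le_mul_of_update (k : Fin n) {s t : Set (Fin n → α)} (hs : MeasurableSet s)
    (ht : MeasurableSet t) {q : ENNReal}
    (h1 : ∀ᵐ z ∂sampleLaw Q n, z ∈ t → Q {a | Function.update z k a ∈ s} ≤ q)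
    (h2 : ∀ᵐ z ∂sampleLaw Q n, z ∉ t → Q {a | Function.update z k a ∈ s} = 0) :
    sampleLaw Q n s ≤ q * sampleLaw Q n t := by
  rw [sampleLaw_apply_eq_lintegral_update Q k hs, ← lintegral_indicator_const ht]
  refine lintegral_mono_ae ?_
  filter_upwards [h1, h2] with z h1 h2
  by_cases hz : z ∈ t
  · rw [Set.indicator_of_mem hz]; exact h1 hz
  · rw [h2 hz]; exact zero_le

lemma integral_sampleLaw_eq_update (k : Fin n) {f : (Fin n → α) → ℝ}
    (hf : Measurable f) {C : ℝ} (hC : ∀ z, |f z| ≤ C) :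
    ∫ z, f z ∂sampleLaw Q n = ∫ a, ∫ z, f (Function.update z k a) ∂sampleLaw Q n ∂Q := by
  conv_lhs => rw [← map_update_sampleLaw Q k,
    integral_map (measurable_update_prod k).aemeasurable hf.aestronglyMeasurable]
  rw [integral_prod_symm]
  exact Integrable.of_bound (hf.comp (measurable_update_prod k)).aestronglyMeasurable C
    (ae_of_all _ fun q => hC _)

lemma map_eval_sampleLaw (i : Fin n) : (sampleLaw Q n).map (fun z => z i) = Q :=
  (measurePreserving_eval (fun _ : Fin n => Q) i).map_eq

lemma ae_sampleLaw_of_ae {P : α → Prop} (h : ∀ᵐ a ∂Q, P a) :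
    ∀ᵐ z ∂sampleLaw Q n, ∀ i, P (z i) := by
  rw [ae_all_iff]
  intro i
  rw [← map_eval_sampleLaw Q i] at h
  exact ae_of_ae_map (measurable_pi_apply i).aemeasurable h

/-! ### The Efron–Stein inequality -/

lemma sq_integral_le_integral_sq {β : Type*} [MeasurableSpace β] (ν : Measure β)
    [IsProbabilityMeasure ν] {g : β → ℝ} (hg : AEStronglyMeasurable g ν) {C : ℝ}
    (hC : ∀ b, |g b| ≤ C) : (∫ b, g b ∂ν) ^ 2 ≤ ∫ b, g b ^ 2 ∂ν := by
  have h := variance_nonneg g ν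
  have hg2 : MemLp g 2 ν := MemLp.of_bound hg C (ae_of_all _ hC)
  rw [variance_eq_sub hg2] at h
  simpa using h

lemma abs_sub_sq_le {a b C : ℝ} (ha : |a| ≤ C) (hb : |b| ≤ C) : |(a - b) ^ 2| ≤ (2 * C) ^ 2 := by
  rw [abs_pow]
  gcongr
  exact (abs_sub _ _).trans (by linarith)

/-- The inductive step of Efron–Stein. The variance is the mean conditional variance given `x` plus
the variance of the conditional mean `h`, and the latter is bounded by the effect of resampling `x`.
-/
lemma integral_sub_sq_le_prod {β : Type*} [MeasurableSpace β] (ν : Measure β)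
    [IsProbabilityMeasure ν] {F : α → β → ℝ} (hF : Measurable (Function.uncurry F)) {C : ℝ}
    (hC : ∀ x y, |F x y| ≤ C) :
    ∫ x, ∫ y, (F x y - ∫ x', ∫ y', F x' y' ∂ν ∂Q) ^ 2 ∂ν ∂Q ≤
      ∫ x, ∫ y, ∫ x', (F x y - F x' y) ^ 2 ∂Q ∂ν ∂Q +
        ∫ x, ∫ y, (F x y - ∫ y', F x y' ∂ν) ^ 2 ∂ν ∂Q := by
  set h : α → ℝ := fun x => ∫ y, F x y ∂ν with hh
  set m : ℝ := ∫ x', ∫ y', F x' y' ∂ν ∂Q with hm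
  have hFx : ∀ x, Measurable (F x) := fun x => hF.comp measurable_prodMk_left
  have hFi : ∀ x, Integrable (F x) ν := fun x =>
    Integrable.of_bound (hFx x).aestronglyMeasurable C (ae_of_all _ (hC x))
  have hmeas : StronglyMeasurable h := hF.stronglyMeasurable.integral_prod_right
  have hhC : ∀ x, |h x| ≤ C := fun x => by
    have := norm_integral_le_of_norm_le_const (μ := ν) (f := F x) (ae_of_all _ (hC x))
    simpa using this
  have hmC : |m| ≤ C := by
    have := norm_integral_le_of_norm_le_const (μ := Q) (f := h) (ae_of_all _ hhC)
    simpa using this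
  have e1 : ∀ x, ∫ y, (F x y - m) ^ 2 ∂ν = ∫ y, (F x y - h x) ^ 2 ∂ν + (h x - m) ^ 2 := by
    intro x
    have : ∀ y, (F x y - m) ^ 2 = (F x y - h x) ^ 2 +
        (2 * (h x - m) * (F x y - h x) + (h x - m) ^ 2) := fun y => by ring
    simp_rw [this]
    have i1 : Integrable (fun y => (F x y - h x) ^ 2) ν :=
      Integrable.of_bound ((hFx x).sub_const _ |>.pow_const 2).aestronglyMeasurable
        ((2 * C) ^ 2) (ae_of_all _ fun y => abs_sub_sq_le (hC x y) (hhC x))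
    have i2 : Integrable (fun y => 2 * (h x - m) * (F x y - h x)) ν :=
      ((hFi x).sub (integrable_const _)).const_mul _
    have i3 : Integrable (fun y => 2 * (h x - m) * (F x y - h x) + (h x - m) ^ 2) ν :=
      i2.add (integrable_const _)
    rw [integral_add i1 i3, integral_add i2 (integrable_const _), integral_const_mul,
      integral_sub (hFi x) (integrable_const _)]
    simp [hh]
  -- `h x - m` is the average of `F x y - F x' y` over `y` and `x'`, so Jensen's inequality in each
  -- variable applies.
  have e2 : ∀ x, (h x - m) ^ 2 ≤ ∫ y, ∫ x', (F x y - F x' y) ^ 2 ∂Q ∂ν := by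
    intro x
    have j1 : h x - m = ∫ y, ∫ x', (F x y - F x' y) ∂Q ∂ν := by
      have hsw : m = ∫ y, ∫ x', F x' y ∂Q ∂ν := by
        rw [hm]
        exact integral_integral_swap
          (Integrable.of_bound hF.aestronglyMeasurable C (ae_of_all _ fun q => hC q.1 q.2))
      have hFy : ∀ y, Integrable (fun x' => F x' y) Q := fun y =>
        Integrable.of_bound (hF.comp measurable_prodMk_right).aestronglyMeasurable C
          (ae_of_all _ fun x' => hC x' y)
      have : ∀ y, ∫ x', (F x y - F x' y) ∂Q = F x y - ∫ x', F x' y ∂Q := fun y => by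
        rw [integral_sub (integrable_const _) (hFy y)]; simp
      simp_rw [this]
      rw [integral_sub (hFi x), ← hsw]
      have hm2 : StronglyMeasurable fun y => ∫ x', F x' y ∂Q :=
        hF.stronglyMeasurable.integral_prod_left
      refine Integrable.of_bound hm2.aestronglyMeasurable C (ae_of_all _ fun y => ?_)
      have := norm_integral_le_of_norm_le_const (μ := Q) (f := fun x' => F x' y)
        (ae_of_all _ fun x' => hC x' y)
      simpa using this
    have hG : Measurable fun q : β × α => F x q.1 - F q.2 q.1 :=
      ((hFx x).comp measurable_fst).sub (hF.comp measurable_swap)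
    have hGC : ∀ y x', |F x y - F x' y| ≤ 2 * C := fun y x' =>
      (abs_sub _ _).trans (by linarith [hC x y, hC x' y])
    rw [j1]
    refine (sq_integral_le_integral_sq ν
        hG.stronglyMeasurable.integral_prod_right.aestronglyMeasurable
      (C := 2 * C) fun y => ?_).trans ?_
    · have := norm_integral_le_of_norm_le_const (μ := Q) (f := fun x' => F x y - F x' y)
        (ae_of_all _ (hGC y))
      simpa using this
    · refine integral_mono_of_nonneg (ae_of_all _ fun y => sq_nonneg _) ?_ (ae_of_all _ fun y => ?_)
      · refine Integrable.of_bound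
          (hG.pow_const 2).stronglyMeasurable.integral_prod_right.aestronglyMeasurable
          ((2 * C) ^ 2) (ae_of_all _ fun y => ?_)
        have := norm_integral_le_of_norm_le_const (μ := Q) (f := fun x' => (F x y - F x' y) ^ 2)
          (ae_of_all _ fun x' => abs_sub_sq_le (hC x y) (hC x' y))
        simpa using this
      · exact sq_integral_le_integral_sq Q
          (hG.comp measurable_prodMk_left).aestronglyMeasurable (hGC y)
  simp_rw [e1]
  have hm3 : Measurable fun q : α × β => (F q.1 q.2 - h q.1) ^ 2 :=
    (hF.sub (hmeas.measurable.comp measurable_fst)).pow_const 2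
  have i1 : Integrable (fun x => ∫ y, (F x y - h x) ^ 2 ∂ν) Q := by
    refine Integrable.of_bound hm3.stronglyMeasurable.integral_prod_right.aestronglyMeasurable
      ((2 * C) ^ 2) (ae_of_all _ fun x => ?_)
    have := norm_integral_le_of_norm_le_const (μ := ν) (f := fun y => (F x y - h x) ^ 2)
      (ae_of_all _ fun y => abs_sub_sq_le (hC x y) (hhC x))
    simpa using this
  have i2 : Integrable (fun x => (h x - m) ^ 2) Q :=
    Integrable.of_bound (hmeas.measurable.sub_const _ |>.pow_const 2).aestronglyMeasurable
      ((2 * C) ^ 2) (ae_of_all _ fun x => abs_sub_sq_le (hhC x) hmC)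
  rw [integral_add i1 i2, add_comm]
  refine add_le_add ?_ le_rfl
  refine integral_mono_of_nonneg (ae_of_all _ fun x => sq_nonneg _) ?_ (ae_of_all _ e2)
  have hm4 : Measurable fun q : (α × β) × α => (F q.1.1 q.1.2 - F q.2 q.1.2) ^ 2 := by
    refine Measurable.pow_const (Measurable.sub (hF.comp measurable_fst) ?_) 2
    exact hF.comp (measurable_snd.prodMk (measurable_snd.comp measurable_fst))
  have hb : ∀ x y, |∫ x', (F x y - F x' y) ^ 2 ∂Q| ≤ (2 * C) ^ 2 := fun x y => by
    have := norm_integral_le_of_norm_le_const (μ := Q) (f := fun x' => (F x y - F x' y) ^ 2)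
      (ae_of_all _ fun x' => abs_sub_sq_le (hC x y) (hC x' y))
    simpa using this
  refine Integrable.of_bound
    hm4.stronglyMeasurable.integral_prod_right.integral_prod_right.aestronglyMeasurable
    ((2 * C) ^ 2) (ae_of_all _ fun x => ?_)
  have := norm_integral_le_of_norm_le_const (μ := ν)
    (f := fun y => ∫ x', (F x y - F x' y) ^ 2 ∂Q) (ae_of_all _ (hb x))
  simpa using this

lemma integral_sampleLaw_succ {f : (Fin (n + 1) → α) → ℝ}
    (hf : Measurable f) {C : ℝ} (hC : ∀ z, |f z| ≤ C) :
    ∫ z, f z ∂sampleLaw Q (n + 1) = ∫ x, ∫ y, f (Fin.cons x y) ∂sampleLaw Q n ∂Q := by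
  have h := (measurePreserving_piFinSuccAbove (fun _ : Fin (n + 1) => Q) 0).symm
  have h2 := h.integral_comp' (g := f)
  rw [← h2, integral_prod]
  · simp [MeasurableEquiv.piFinSuccAbove, Fin.insertNthEquiv, Fin.insertNth_zero']
  · exact Integrable.of_bound (hf.comp h.measurable).aestronglyMeasurable C
      (ae_of_all _ fun q => hC _)

lemma measurable_fin_cons :
    Measurable fun q : α × (Fin n → α) => (Fin.cons q.1 q.2 : Fin (n + 1) → α) := by
  refine measurable_pi_lambda _ fun j => ?_
  refine Fin.cases ?_ (fun i => ?_) j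
  · simpa using measurable_fst
  · simp only [Fin.cons_succ]
    fun_prop

/-- The **Efron–Stein inequality**, up to a constant factor. -/
theorem integral_sub_sq_le_sum_update {f : (Fin n → α) → ℝ}
    (hf : Measurable f) {C : ℝ} (hC : ∀ z, |f z| ≤ C) :
    ∫ z, (f z - ∫ z', f z' ∂sampleLaw Q n) ^ 2 ∂sampleLaw Q n ≤
      ∑ k, ∫ z, ∫ a, (f z - f (Function.update z k a)) ^ 2 ∂Q ∂sampleLaw Q n := by
  induction n with
  | zero =>
    have : ∀ z : Fin 0 → α, f z = f Fin.elim0 := fun z => by congr; exact Subsingleton.elim _ _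
    simp only [this]
    simp
  | succ n ih =>
    have hcons := measurable_fin_cons (α := α) (n := n)
    have hfm := hf.comp hcons
    have hint : |∫ z', f z' ∂sampleLaw Q (n + 1)| ≤ C := by
      have := norm_integral_le_of_norm_le_const (μ := sampleLaw Q (n + 1)) (f := f) (ae_of_all _ hC)
      simpa using this
    have hm1 : ∀ k : Fin (n + 1), Measurable fun z => ∫ a, (f z - f (Function.update z k a)) ^ 2
        ∂Q := by
      intro k
      have : Measurable fun q : (Fin (n + 1) → α) × α =>
          (f q.1 - f (Function.update q.1 k q.2)) ^ 2 :=
        ((hf.comp measurable_fst).sub (hf.comp (measurable_update_prod k))).pow_const 2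
      exact this.stronglyMeasurable.integral_prod_right.measurable
    have hb1 : ∀ (k : Fin (n + 1)) z, |∫ a, (f z - f (Function.update z k a)) ^ 2 ∂Q| ≤
        (2 * C) ^ 2 := by
      intro k z
      have := norm_integral_le_of_norm_le_const (μ := Q)
        (f := fun a => (f z - f (Function.update z k a)) ^ 2)
        (ae_of_all _ fun a => abs_sub_sq_le (hC _) (hC _))
      simpa using this
    rw [integral_sampleLaw_succ Q (f := fun z => (f z - ∫ z', f z' ∂sampleLaw Q (n + 1)) ^ 2)
      ((hf.sub_const _).pow_const 2) (C := (2 * C) ^ 2) fun z => abs_sub_sq_le (hC _) hint]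
    simp_rw [integral_sampleLaw_succ Q (hm1 _) (hb1 _)]
    rw [integral_sampleLaw_succ Q hf hC, Fin.sum_univ_succ]
    -- The first summand is the term for resampling coordinate `0`; the second is a variance with
    -- the first coordinate frozen, to which the induction hypothesis applies.
    refine (integral_sub_sq_le_prod Q (sampleLaw Q n) (F := fun x y => f (Fin.cons x y)) hfm
      fun x y => hC _).trans ?_
    simp only [Fin.update_cons_zero]
    gcongr
    rw [← integral_finsetSum]
    · refine integral_mono_of_nonneg (ae_of_all _ fun x => integral_nonneg fun y => sq_nonneg _)
        (integrable_finsetSum _ fun k _ => ?_) (ae_of_all _ fun x => ?_)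
      · exact integrable_aux hcons hm1 hb1 k
      · simpa [Fin.cons_update] using ih (f := fun y => f (Fin.cons x y))
          (hfm.comp measurable_prodMk_left) fun y => hC _
    · exact fun k _ => integrable_aux hcons hm1 hb1 k
where
  integrable_aux {n : ℕ} {f : (Fin (n + 1) → α) → ℝ} {C : ℝ}
      (hcons : Measurable fun q : α × (Fin n → α) => (Fin.cons q.1 q.2 : Fin (n + 1) → α))
      (hm1 : ∀ k : Fin (n + 1), Measurable fun z => ∫ a, (f z - f (Function.update z k a)) ^ 2 ∂Q)
      (hb1 : ∀ (k : Fin (n + 1)) z, |∫ a, (f z - f (Function.update z k a)) ^ 2 ∂Q| ≤ (2 * C) ^ 2)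
      (k : Fin n) :
      Integrable (fun x => ∫ y, ∫ a, (f (Fin.cons x y) -
        f (Function.update (Fin.cons x y) k.succ a)) ^ 2 ∂Q ∂sampleLaw Q n) Q := by
    have hsm : StronglyMeasurable fun q : α × (Fin n → α) =>
        ∫ a, (f (Fin.cons q.1 q.2) - f (Function.update (Fin.cons q.1 q.2) k.succ a)) ^ 2 ∂Q :=
      ((hm1 k.succ).comp hcons).stronglyMeasurable
    refine Integrable.of_bound hsm.integral_prod_right'.aestronglyMeasurable ((2 * C) ^ 2)
      (ae_of_all _ fun x => ?_)
    have := norm_integral_le_of_norm_le_const (μ := sampleLaw Q n)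
      (f := fun y => ∫ a, (f (Fin.cons x y) - f (Function.update (Fin.cons x y) k.succ a)) ^ 2 ∂Q)
      (ae_of_all _ fun y => hb1 _ _)
    simpa using this

end Resampling

/-! ### Tail bounds for counts and averages -/

section Tails

variable {α : Type*} [MeasurableSpace α] (Q : Measure α) [IsProbabilityMeasure Q] {n : ℕ}

open scoped Classical in
/-- The number of indices `j ≠ i` such that `(z i, z j)` belongs to `A`. -/
def relCount (A : Set (α × α)) (i : Fin n) (z : Fin n → α) : ℝ :=
  ∑ j, if j ≠ i ∧ (z i, z j) ∈ A then 1 else 0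

lemma measurable_relCount {A : Set (α × α)} (hA : MeasurableSet A) (i : Fin n) :
    Measurable (relCount A i) := by
  classical
  refine Finset.measurable_sum _ fun j _ => ?_
  refine Measurable.ite ?_ measurable_const measurable_const
  have : Measurable fun z : Fin n → α => (z i, z j) := by fun_prop
  exact (MeasurableSet.const (j ≠ i)).inter (this hA)

omit [MeasurableSpace α] in
lemma abs_relCount_le (A : Set (α × α)) (i : Fin n) (z : Fin n → α) : |relCount A i z| ≤ n := by
  classical
  rw [relCount]
  refine (Finset.abs_sum_le_sum_abs _ _).trans ?_
  refine (Finset.sum_le_sum (g := fun _ => (1 : ℝ)) fun j _ => ?_).trans (by simp)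
  split_ifs <;> simp

lemma integrable_exp_mul_relCount {A : Set (α × α)} (hA : MeasurableSet A) (i : Fin n) (c : ℝ) :
    Integrable (fun z => Real.exp (c * relCount A i z)) (sampleLaw Q n) := by
  refine Integrable.of_bound
    (Real.measurable_exp.comp ((measurable_relCount hA i).const_mul c)).aestronglyMeasurable
    (Real.exp (|c| * n)) (ae_of_all _ fun z => ?_)
  rw [Real.norm_eq_abs, Real.abs_exp, Real.exp_le_exp]
  refine (le_abs_self _).trans ?_
  rw [abs_mul]
  gcongr
  exact abs_relCount_le A i z

/-- Given `z i = a`, the other `n - 1` indicators are independent with success probability `Q.real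
{b | (a, b) ∈ A}`, while index `i` itself contributes the factor `1`. -/
lemma integral_exp_mul_relCount {A : Set (α × α)} (hA : MeasurableSet A) (i : Fin n) (c : ℝ) :
    ∫ z, Real.exp (c * relCount A i z) ∂sampleLaw Q n =
      ∫ a, (1 + (Real.exp c - 1) * Q.real {b | (a, b) ∈ A}) ^ (n - 1) ∂Q := by
  classical
  rw [integral_sampleLaw_eq_update Q i (f := fun z => Real.exp (c * relCount A i z))
    (Real.measurable_exp.comp ((measurable_relCount hA i).const_mul c)) (C := Real.exp (|c| * n))]
  · congr 1
    ext a
    have hAa : MeasurableSet {b | (a, b) ∈ A} := measurable_prodMk_left hA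
    have h1 : ∀ z : Fin n → α, Real.exp (c * relCount A i (Function.update z i a)) =
        ∏ j, (if j = i then (1 : ℝ) else Real.exp (c * if (a, z j) ∈ A then 1 else 0)) := by
      intro z
      rw [relCount, Finset.mul_sum, Real.exp_sum]
      refine Finset.prod_congr rfl fun j _ => ?_
      by_cases hj : j = i
      · simp [hj]
      · simp [hj]
    have h2 := integral_fintype_prod_eq_prod (𝕜 := ℝ) (μ := fun _ : Fin n => Q)
      (fun (j : Fin n) (b : α) =>
        if j = i then (1 : ℝ) else Real.exp (c * if (a, b) ∈ A then 1 else 0))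
    simp only [h1]
    rw [h2]
    have h3 : ∫ b, Real.exp (c * if (a, b) ∈ A then 1 else 0) ∂Q =
        1 + (Real.exp c - 1) * Q.real {b | (a, b) ∈ A} := by
      have : ∀ b, Real.exp (c * if (a, b) ∈ A then 1 else 0) =
          1 + (Real.exp c - 1) * ({b | (a, b) ∈ A}.indicator (fun _ => (1 : ℝ)) b) := by
        intro b
        by_cases hb : (a, b) ∈ A <;> simp [hb]
      simp_rw [this]
      rw [integral_add (integrable_const _)
        (((integrable_const (1 : ℝ)).indicator hAa).const_mul _), integral_const_mul,
        integral_indicator_const _ hAa]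
      simp
    rw [← Finset.mul_prod_erase _ _ (Finset.mem_univ i)]
    simp only [if_true, integral_const, probReal_univ, smul_eq_mul, one_mul]
    rw [Finset.prod_congr rfl (g := fun _ => 1 + (Real.exp c - 1) * Q.real {b | (a, b) ∈ A})]
    · rw [Finset.prod_const, Finset.card_erase_of_mem (Finset.mem_univ i), Finset.card_univ,
        Fintype.card_fin]
    · intro j hj
      simp only [Finset.ne_of_mem_erase hj, if_false]
      exact h3
  · intro z
    rw [Real.abs_exp, Real.exp_le_exp]
    refine (le_abs_self _).trans ?_
    rw [abs_mul]
    gcongr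
    exact abs_relCount_le A i z

/-- Chernoff bound with exponent `1`, using `e - 1 ≤ 2` and `1 + 2 q ≤ exp (2 q)`. -/
lemma sampleLaw_le_relCount_le {A : Set (α × α)} (hA : MeasurableSet A) (i : Fin n) {q : ℝ}
    (hq0 : 0 ≤ q) (hq : ∀ᵐ a ∂Q, Q.real {b | (a, b) ∈ A} ≤ q) (s : ℝ) :
    (sampleLaw Q n).real {z | s ≤ relCount A i z} ≤ Real.exp (2 * n * q - s) := by
  have h := measure_ge_le_exp_mul_mgf (μ := sampleLaw Q n) (X := relCount A i) (t := 1) s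
    zero_le_one (integrable_exp_mul_relCount Q hA i 1)
  refine h.trans ?_
  rw [mgf, integral_exp_mul_relCount Q hA i 1]
  have h2 : ∫ a, (1 + (Real.exp 1 - 1) * Q.real {b | (a, b) ∈ A}) ^ (n - 1) ∂Q ≤
      ∫ _a, Real.exp (2 * n * q) ∂Q := by
    refine integral_mono_of_nonneg (ae_of_all _ fun a => ?_) (integrable_const _) ?_
    · have := Real.one_le_exp (zero_le_one' ℝ)
      have h0 : 0 ≤ (Real.exp 1 - 1) * Q.real {b | (a, b) ∈ A} :=
        mul_nonneg (by linarith) measureReal_nonneg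
      exact pow_nonneg (by linarith) _
    · filter_upwards [hq] with a ha
      have h3 : 1 + (Real.exp 1 - 1) * Q.real {b | (a, b) ∈ A} ≤ Real.exp (2 * q) := by
        have e1 := Real.add_one_le_exp (2 * q)
        have e2 := Real.exp_one_lt_d9
        have e3 : (Real.exp 1 - 1) * Q.real {b | (a, b) ∈ A} ≤ 2 * q := by
          gcongr
          linarith
        linarith
      have h4 : 0 ≤ 1 + (Real.exp 1 - 1) * Q.real {b | (a, b) ∈ A} := by
        have := Real.one_le_exp (zero_le_one' ℝ)
        have h0 : 0 ≤ (Real.exp 1 - 1) * Q.real {b | (a, b) ∈ A} :=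
          mul_nonneg (by linarith) measureReal_nonneg
        linarith
      calc _ ≤ Real.exp (2 * q) ^ (n - 1) := by gcongr
        _ = Real.exp ((n - 1 : ℕ) * (2 * q)) := by rw [← Real.exp_nat_mul]
        _ ≤ Real.exp (2 * n * q) := by
          rw [Real.exp_le_exp]
          have : ((n - 1 : ℕ) : ℝ) ≤ n := by exact_mod_cast Nat.sub_le n 1
          nlinarith
  rw [integral_const, probReal_univ, one_smul] at h2
  calc _ ≤ Real.exp (-1 * s) * Real.exp (2 * n * q) := by gcongr
    _ = _ := by rw [← Real.exp_add]; ring_nf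

/-- Chernoff bound with exponent `-1`: since `e⁻¹ ≤ 1/2`, each factor is at most `1 - q/2 ≤ exp
(-q/2)`. -/
lemma sampleLaw_relCount_le_le {A : Set (α × α)} (hA : MeasurableSet A) (i : Fin n) {q : ℝ}
    (hq : ∀ᵐ a ∂Q, q ≤ Q.real {b | (a, b) ∈ A}) (s : ℝ) :
    (sampleLaw Q n).real {z | relCount A i z ≤ s} ≤ Real.exp (s - (n - 1) * q / 2) := by
  have h := measure_le_le_exp_mul_mgf (μ := sampleLaw Q n) (X := relCount A i) (t := -1) s
    (by norm_num) (integrable_exp_mul_relCount Q hA i (-1))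
  refine h.trans ?_
  rw [mgf, integral_exp_mul_relCount Q hA i (-1)]
  have e0 : Real.exp (-1) ≤ 1 / 2 := by
    rw [Real.exp_neg, inv_le_comm₀ (Real.exp_pos _) (by norm_num)]
    have := Real.add_one_le_exp (1 : ℝ)
    linarith
  have e1 := Real.exp_pos (-1)
  have h4 : ∀ a, 0 ≤ 1 + (Real.exp (-1) - 1) * Q.real {b | (a, b) ∈ A} := fun a => by
    have : Q.real {b | (a, b) ∈ A} ≤ 1 := measureReal_le_one
    have := measureReal_nonneg (μ := Q) (s := {b | (a, b) ∈ A})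
    nlinarith
  have h2 : ∫ a, (1 + (Real.exp (-1) - 1) * Q.real {b | (a, b) ∈ A}) ^ (n - 1) ∂Q ≤
      ∫ _a, Real.exp (-((n - 1) * q / 2)) ∂Q := by
    refine integral_mono_of_nonneg (ae_of_all _ fun a => pow_nonneg (h4 a) _)
      (integrable_const _) ?_
    filter_upwards [hq] with a ha
    have h3 : 1 + (Real.exp (-1) - 1) * Q.real {b | (a, b) ∈ A} ≤ Real.exp (-(q / 2)) := by
      have e2 := Real.add_one_le_exp (-(q / 2))
      have := measureReal_nonneg (μ := Q) (s := {b | (a, b) ∈ A})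
      nlinarith
    calc _ ≤ Real.exp (-(q / 2)) ^ (n - 1) := by
          gcongr
          exact h4 a
      _ = Real.exp ((n - 1 : ℕ) * (-(q / 2))) := by rw [← Real.exp_nat_mul]
      _ = Real.exp (-((n - 1) * q / 2)) := by
        have hn : 1 ≤ n := Nat.one_le_of_lt i.2
        rw [Nat.cast_sub hn]
        congr 1
        push_cast
        ring
  rw [integral_const, probReal_univ, one_smul] at h2
  calc _ ≤ Real.exp (- -1 * s) * Real.exp (-((n - 1) * q / 2)) := by gcongr
    _ = _ := by rw [← Real.exp_add]; ring_nf

/-- **Chebyshev's inequality**, from a bound on the second moment about `m`. -/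
lemma measureReal_le_abs_sub_le {β : Type*} [MeasurableSpace β] {ν : Measure β}
    [IsFiniteMeasure ν] {f : β → ℝ} {m : ℝ}
    (hf : Integrable (fun b => (f b - m) ^ 2) ν) {V t : ℝ} (ht : 0 < t)
    (hV : ∫ b, (f b - m) ^ 2 ∂ν ≤ V) : ν.real {b | t ≤ |f b - m|} ≤ V / t ^ 2 := by
  have h := mul_meas_ge_le_integral_of_nonneg (ae_of_all ν fun b => sq_nonneg (f b - m)) hf (t ^ 2)
  rw [le_div_iff₀ (by positivity), mul_comm]
  refine le_trans ?_ (h.trans hV)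
  refine mul_le_mul_of_nonneg_left (measureReal_mono fun b hb => ?_) (sq_nonneg t)
  rw [Set.mem_ofPred_eq] at hb ⊢
  rw [← sq_abs (f b - m)]
  gcongr

/-- The average of `h` over the sample `z`. -/
def average (h : α → ℝ) (z : Fin n → α) : ℝ := (n : ℝ)⁻¹ * ∑ i, h (z i)

lemma measurable_average {h : α → ℝ} (hh : Measurable h) :
    Measurable (average h : (Fin n → α) → ℝ) := by
  unfold average
  fun_prop

omit [MeasurableSpace α] in
lemma abs_average_le {h : α → ℝ} {C : ℝ} (hC : ∀ a, |h a| ≤ C) (hC0 : 0 ≤ C) (z : Fin n → α) :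
    |average h z| ≤ C := by
  rcases Nat.eq_zero_or_pos n with rfl | hn
  · simpa [average] using hC0
  rw [average, abs_mul, abs_inv, Nat.abs_cast, inv_mul_le_iff₀ (by positivity)]
  refine (Finset.abs_sum_le_sum_abs _ _).trans ?_
  refine (Finset.sum_le_sum fun i _ => hC (z i)).trans ?_
  simp

lemma integral_average (hn : 0 < n) {h : α → ℝ} (hh : Measurable h) {C : ℝ}
    (hC : ∀ a, |h a| ≤ C) : ∫ z, average h z ∂sampleLaw Q n = ∫ a, h a ∂Q := by
  simp only [average]
  rw [integral_const_mul, integral_finsetSum]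
  · have : ∀ i : Fin n, ∫ z, h (z i) ∂sampleLaw Q n = ∫ a, h a ∂Q := fun i => by
      conv_rhs => rw [← map_eval_sampleLaw Q i, integral_map (measurable_pi_apply i).aemeasurable
        hh.aestronglyMeasurable]
    simp only [this, Finset.sum_const, Finset.card_univ, Fintype.card_fin, nsmul_eq_mul]
    field_simp
  · intro i _
    exact Integrable.of_bound (hh.comp (measurable_pi_apply i)).aestronglyMeasurable C
      (ae_of_all _ fun z => hC _)

/-- By Efron–Stein: resampling one unit moves the average by at most `2 C / n`, and there are `n`
units. -/
lemma integral_average_sub_sq_le {h : α → ℝ} (hh : Measurable h) {C : ℝ}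
    (hC : ∀ a, |h a| ≤ C) (hn : 0 < n) :
    ∫ z, (average h z - ∫ a, h a ∂Q) ^ 2 ∂sampleLaw Q n ≤ 4 * C ^ 2 / n := by
  have hC0 : 0 ≤ C := by
    obtain ⟨a⟩ : Nonempty α := nonempty_of_isProbabilityMeasure Q
    exact (abs_nonneg _).trans (hC a)
  rw [← integral_average Q hn hh hC]
  refine (integral_sub_sq_le_sum_update Q (measurable_average hh) (abs_average_le hC hC0)).trans ?_
  have hn' : (0 : ℝ) < n := by exact_mod_cast hn
  have hterm : ∀ (k : Fin n) z a, (average h z - average h (Function.update z k a)) ^ 2 ≤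
      4 * C ^ 2 / n ^ 2 := by
    intro k z a
    have : average h z - average h (Function.update z k a) = (n : ℝ)⁻¹ * (h (z k) - h a) := by
      rw [average, average, ← mul_sub, ← Finset.sum_sub_distrib,
        Finset.sum_eq_single k (fun j _ hj => by simp [hj]) (by simp)]
      simp
    rw [this, mul_pow, inv_pow, inv_mul_eq_div]
    gcongr
    have := abs_sub_sq_le (hC (z k)) (hC a)
    rw [abs_of_nonneg (sq_nonneg _)] at this
    linarith
  have hint : ∀ k : Fin n, ∫ z, ∫ a, (average h z - average h (Function.update z k a)) ^ 2 ∂Q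
      ∂sampleLaw Q n ≤ 4 * C ^ 2 / n ^ 2 := by
    intro k
    have h1 : ∀ z : Fin n → α, ∫ a, (average h z - average h (Function.update z k a)) ^ 2 ∂Q ≤
        4 * C ^ 2 / n ^ 2 := fun z => by
      have := integral_mono_of_nonneg (μ := Q) (ae_of_all _ fun a => sq_nonneg _)
        (integrable_const (4 * C ^ 2 / n ^ 2)) (ae_of_all _ (hterm k z))
      simpa using this
    have := integral_mono_of_nonneg (μ := sampleLaw Q n)
      (ae_of_all _ fun z => integral_nonneg fun a => sq_nonneg _)
      (integrable_const (4 * C ^ 2 / n ^ 2)) (ae_of_all _ h1)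
    simpa using this
  refine (Finset.sum_le_sum fun k _ => hint k).trans ?_
  rw [Finset.sum_const, Finset.card_univ, Fintype.card_fin, nsmul_eq_mul]
  apply le_of_eq
  field_simp

lemma sampleLaw_le_abs_average_sub_le {h : α → ℝ} (hh : Measurable h) {C : ℝ}
    (hC : ∀ a, |h a| ≤ C) (hn : 0 < n) {t : ℝ} (ht : 0 < t) :
    (sampleLaw Q n).real {z | t ≤ |average h z - ∫ a, h a ∂Q|} ≤ 4 * C ^ 2 / n / t ^ 2 := by
  have hC0 : 0 ≤ C := by
    obtain ⟨a⟩ : Nonempty α := nonempty_of_isProbabilityMeasure Q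
    exact (abs_nonneg _).trans (hC a)
  have hm : |∫ a, h a ∂Q| ≤ C := by
    have := norm_integral_le_of_norm_le_const (μ := Q) (f := h) (ae_of_all _ hC)
    simpa using this
  refine measureReal_le_abs_sub_le ?_ ht (integral_average_sub_sq_le Q hh hC hn)
  exact Integrable.of_bound ((measurable_average hh).sub_const _ |>.pow_const
      2).aestronglyMeasurable
    ((2 * C) ^ 2) (ae_of_all _ fun z => abs_sub_sq_le (abs_average_le hC hC0 z) hm)

end Tails

/-! ### Norms given by positive matrices -/

section FormNorm

open Matrix

open scoped Pointwise

variable {p : ℕ}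

/-- The norm `(vᵀ A⁻¹ v)^{1/2}`. -/
def formNorm (A : Matrix (Fin p) (Fin p) ℝ) (v : Covariate p) : ℝ := √(qform A⁻¹ v.ofLp)

lemma mahaNorm_eq_formNorm {n : ℕ} (x : Fin n → Covariate p) (v : Covariate p) :
    mahaNorm x v = formNorm (sampleCov x) v := by
  simp only [mahaNorm, formNorm, qform, dotProduct, mulVec, Finset.mul_sum, mul_assoc]

lemma continuous_qform (A : Matrix (Fin p) (Fin p) ℝ) : Continuous (qform A) := by
  unfold qform
  fun_prop

lemma continuous_formNorm (A : Matrix (Fin p) (Fin p) ℝ) : Continuous (formNorm A) := by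
  unfold formNorm
  exact Real.continuous_sqrt.comp ((continuous_qform _).comp (PiLp.continuous_ofLp 2 _))

lemma formNorm_nonneg (A : Matrix (Fin p) (Fin p) ℝ) (v : Covariate p) : 0 ≤ formNorm A v :=
  Real.sqrt_nonneg _

lemma formNorm_smul (A : Matrix (Fin p) (Fin p) ℝ) {c : ℝ} (hc : 0 ≤ c) (v : Covariate p) :
    formNorm A (c • v) = c * formNorm A v := by
  rw [formNorm, WithLp.ofLp_smul, qform_smul, Real.sqrt_mul (sq_nonneg c), Real.sqrt_sq hc,
    formNorm]

lemma PositiveMatrix.formNorm_sq {A : Matrix (Fin p) (Fin p) ℝ} (hA : PositiveMatrix A)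
    (v : Covariate p) : formNorm A v ^ 2 = qform A⁻¹ v.ofLp :=
  Real.sq_sqrt (hA.inv.nonneg _)

/-- Extreme values on the compact unit sphere, extended by homogeneity; `1 ≤ p` makes the sphere
nonempty. -/
lemma exists_qform_bounds (hp : 1 ≤ p) {A : Matrix (Fin p) (Fin p) ℝ} (hA : PositiveMatrix A) :
    ∃ c C : ℝ, 0 < c ∧ 0 < C ∧ ∀ v : Covariate p,
      c * ‖v‖ ^ 2 ≤ qform A v.ofLp ∧ qform A v.ofLp ≤ C * ‖v‖ ^ 2 := by
  have : Nonempty (Fin p) := ⟨⟨0, hp⟩⟩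
  have hne : (Metric.sphere (0 : Covariate p) 1).Nonempty :=
    NormedSpace.sphere_nonempty.2 zero_le_one
  have hc : Continuous fun v : Covariate p => qform A v.ofLp :=
    (continuous_qform _).comp (PiLp.continuous_ofLp 2 _)
  obtain ⟨v₀, hv₀, hmin⟩ := (isCompact_sphere (0 : Covariate p) 1).exists_isMinOn hne
    hc.continuousOn
  obtain ⟨v₁, hv₁, hmax⟩ := (isCompact_sphere (0 : Covariate p) 1).exists_isMaxOn hne
    hc.continuousOn
  have hpos : ∀ v ∈ Metric.sphere (0 : Covariate p) 1, 0 < qform A v.ofLp := fun v hv => by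
    refine hA.pos _ fun h => ?_
    have : v = 0 := by ext i; simpa using congrFun h i
    simp [this] at hv
  refine ⟨_, _, hpos v₀ hv₀, hpos v₁ hv₁, fun v => ?_⟩
  rcases eq_or_ne v 0 with rfl | hv
  · simp [qform]
  have hv' : 0 < ‖v‖ := norm_pos_iff.2 hv
  have hmem : ‖v‖⁻¹ • v ∈ Metric.sphere (0 : Covariate p) 1 := by
    simp [norm_smul, hv'.ne']
  have h1 := hmin hmem
  have h2 := hmax hmem
  simp only [Set.mem_ofPred_eq, WithLp.ofLp_smul, qform_smul, inv_pow, inv_mul_eq_div] at h1 h2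
  exact ⟨(le_div_iff₀ (by positivity)).1 h1, (div_le_iff₀ (by positivity)).1 h2⟩

lemma exists_formNorm_bounds (hp : 1 ≤ p) {A : Matrix (Fin p) (Fin p) ℝ}
    (hA : PositiveMatrix A) : ∃ c C : ℝ, 0 < c ∧ 0 < C ∧ ∀ v : Covariate p,
      c * ‖v‖ ≤ formNorm A v ∧ formNorm A v ≤ C * ‖v‖ := by
  obtain ⟨c, C, hc, hC, h⟩ := exists_qform_bounds hp hA.inv
  refine ⟨√c, √C, by positivity, by positivity, fun v => ⟨?_, ?_⟩⟩
  · refine Real.le_sqrt_of_sq_le ?_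
    rw [mul_pow, Real.sq_sqrt hc.le]
    exact (h v).1
  · refine (Real.sqrt_le_left (by positivity)).2 ?_
    rw [mul_pow, Real.sq_sqrt hC.le]
    exact (h v).2

/-- The quadratic forms of `A` and `B` are close, up to a factor. -/
def FormClose (δ : ℝ) (A B : Matrix (Fin p) (Fin p) ℝ) : Prop :=
  ∀ u, |qform B u - qform A u| ≤ δ * qform A u

section Close

variable {A B : Matrix (Fin p) (Fin p) ℝ} {δ : ℝ}

lemma FormClose.positiveMatrix (h : FormClose δ A B) (hA : PositiveMatrix A) (hB : Bᵀ = B)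
    (hδ : δ ≤ 1 / 2) : PositiveMatrix B where
  symm := hB
  pos u hu := by
    have h1 := hA.pos u hu
    have h2 := (abs_le.1 (h u)).1
    nlinarith

lemma FormClose.qform_inv_le (h : FormClose δ A B) (hA : PositiveMatrix A) (hB : Bᵀ = B)
    (hδ : δ ≤ 1 / 2) (v : Fin p → ℝ) : qform B⁻¹ v ≤ (1 - δ)⁻¹ * qform A⁻¹ v := by
  refine MatchingPolicy.qform_inv_le hA (h.positiveMatrix hA hB hδ)
    (inv_pos.2 (by linarith)) (fun u => ?_) v
  rw [inv_mul_eq_div, le_div_iff₀ (by linarith)]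
  have h2 := (abs_le.1 (h u)).1
  linarith

lemma FormClose.le_qform_inv (h : FormClose δ A B) (hA : PositiveMatrix A) (hB : Bᵀ = B)
    (hδ0 : 0 ≤ δ) (hδ : δ ≤ 1 / 2) (v : Fin p → ℝ) : qform A⁻¹ v ≤ (1 + δ) * qform B⁻¹ v := by
  refine MatchingPolicy.qform_inv_le (h.positiveMatrix hA hB hδ) hA (by linarith)
    (fun u => ?_) v
  have h2 := (abs_le.1 (h u)).2
  linarith

/-- The squared distances are compared up to the factor `(1 + δ) / (1 - δ)`, which is at most `(1 +
2 δ)²` for `δ ≤ 1/2`. Hence two distances can be ordered differently by the two norms only if their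
ratio is within `1 + 2 δ` of one. -/
lemma FormClose.formNorm_le_mul (h : FormClose δ A B) (hA : PositiveMatrix A) (hB : Bᵀ = B)
    (hδ0 : 0 ≤ δ) (hδ : δ ≤ 1 / 2) {v w : Covariate p} (hvw : formNorm B v ≤ formNorm B w) :
    formNorm A v ≤ (1 + 2 * δ) * formNorm A w := by
  have hBp := h.positiveMatrix hA hB hδ
  have h0 : qform B⁻¹ v.ofLp ≤ qform B⁻¹ w.ofLp := by
    rw [← hBp.formNorm_sq, ← hBp.formNorm_sq]
    exact pow_le_pow_left₀ (formNorm_nonneg _ _) hvw 2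
  have h1 := h.le_qform_inv hA hB hδ0 hδ v.ofLp
  have h2 := h.qform_inv_le hA hB hδ w.ofLp
  have h3 : 0 ≤ qform A⁻¹ w.ofLp := hA.inv.nonneg _
  refine (Real.sqrt_le_left (mul_nonneg (by linarith) (formNorm_nonneg _ _))).2 ?_
  rw [mul_pow, hA.formNorm_sq]
  calc qform A⁻¹ v.ofLp ≤ (1 + δ) * ((1 - δ)⁻¹ * qform A⁻¹ w.ofLp) :=
        h1.trans (by gcongr; exact h0.trans h2)
    _ = ((1 + δ) * (1 - δ)⁻¹) * qform A⁻¹ w.ofLp := by ring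
    _ ≤ _ := by
      gcongr
      rw [← div_eq_mul_inv, div_le_iff₀ (by linarith)]
      nlinarith [mul_nonneg hδ0 (sub_nonneg.2 hδ), mul_nonneg (mul_nonneg hδ0 hδ0) (sub_nonneg.2
          hδ)]

lemma FormClose.formNorm_le_two_mul (h : FormClose δ A B) (hA : PositiveMatrix A) (hB : Bᵀ = B)
    (hδ : δ ≤ 1 / 2) (v : Covariate p) : formNorm B v ≤ 2 * formNorm A v := by
  refine (Real.sqrt_le_left (mul_nonneg zero_le_two (formNorm_nonneg _ _))).2 ?_
  rw [mul_pow, hA.formNorm_sq]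
  refine (h.qform_inv_le hA hB hδ _).trans ?_
  have := hA.inv.nonneg v.ofLp
  gcongr
  rw [inv_le_comm₀ (by linarith) (by norm_num)]
  linarith

lemma FormClose.le_two_mul_formNorm (h : FormClose δ A B) (hA : PositiveMatrix A) (hB : Bᵀ = B)
    (hδ0 : 0 ≤ δ) (hδ : δ ≤ 1 / 2) (v : Covariate p) : formNorm A v ≤ 2 * formNorm B v := by
  refine (Real.sqrt_le_left (mul_nonneg zero_le_two (formNorm_nonneg _ _))).2 ?_
  have hBp := h.positiveMatrix hA hB hδ
  rw [mul_pow, hBp.formNorm_sq]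
  refine (h.le_qform_inv hA hB hδ0 hδ _).trans ?_
  have := hBp.inv.nonneg v.ofLp
  gcongr
  linarith

end Close

/-! ### Volumes of balls and annuli -/

lemma setOf_formNorm_le_eq_smul (hp : 1 ≤ p) {A : Matrix (Fin p) (Fin p) ℝ}
    (hA : PositiveMatrix A) {t : ℝ} (ht : 0 ≤ t) :
    {v : Covariate p | formNorm A v ≤ t} = t • {v : Covariate p | formNorm A v ≤ 1} := by
  rcases ht.eq_or_lt with rfl | ht
  · obtain ⟨c, C, hc, -, h⟩ := exists_formNorm_bounds hp hA
    have h0 : formNorm A 0 = 0 := le_antisymm (by simpa using (h 0).2) (formNorm_nonneg _ _)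
    rw [Set.zero_smul_set ⟨0, by simp [h0]⟩]
    ext v
    simp only [Set.mem_ofPred_eq, Set.mem_zero]
    constructor
    · intro hv
      have := (h v).1.trans hv
      by_contra hne
      have := mul_pos hc (norm_pos_iff.2 hne)
      linarith
    · rintro rfl; exact h0.le
  · ext v
    rw [Set.mem_smul_set_iff_inv_smul_mem₀ ht.ne', Set.mem_ofPred_eq, Set.mem_ofPred_eq,
      formNorm_smul _ (by positivity), inv_mul_le_iff₀ ht, mul_one]

/-- The volume of the unit ball of `formNorm A`. -/
def formBallVolume (A : Matrix (Fin p) (Fin p) ℝ) : ℝ :=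
  volume.real {v : Covariate p | formNorm A v ≤ 1}

lemma volume_setOf_formNorm_le (hp : 1 ≤ p) {A : Matrix (Fin p) (Fin p) ℝ}
    (hA : PositiveMatrix A) {t : ℝ} (ht : 0 ≤ t) :
    volume {v : Covariate p | formNorm A v ≤ t} = ENNReal.ofReal (t ^ p * formBallVolume A) := by
  obtain ⟨c, C, hc, -, h⟩ := exists_formNorm_bounds hp hA
  have hfin : volume {v : Covariate p | formNorm A v ≤ 1} ≠ ⊤ := by
    have hsub : {v : Covariate p | formNorm A v ≤ 1} ⊆ Metric.closedBall 0 c⁻¹ := by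
      intro v hv
      rw [mem_closedBall_zero_iff, ← mul_one c⁻¹, le_inv_mul_iff₀ hc]
      exact (h v).1.trans hv
    exact ((measure_mono hsub).trans_lt measure_closedBall_lt_top).ne
  rw [setOf_formNorm_le_eq_smul hp hA ht, Measure.addHaar_smul, finrank_euclideanSpace,
    Fintype.card_fin, abs_of_nonneg (by positivity), ENNReal.ofReal_mul (by positivity),
    formBallVolume, ofReal_measureReal hfin]

lemma one_add_pow_le {ε : ℝ} (h0 : 0 ≤ ε) (h1 : ε ≤ 1) (k : ℕ) :
    (1 + ε) ^ k ≤ 1 + 3 ^ k * ε := by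
  induction k with
  | zero => simp [h0]
  | succ k ih =>
    have h3 : (1 : ℝ) ≤ 3 ^ k := one_le_pow₀ (by norm_num)
    calc (1 + ε) ^ (k + 1) = (1 + ε) ^ k * (1 + ε) := pow_succ _ _
      _ ≤ (1 + 3 ^ k * ε) * (1 + ε) := by gcongr
      _ = 1 + (1 + 3 ^ k + 3 ^ k * ε) * ε := by ring
      _ ≤ 1 + (3 ^ k + 3 ^ k + 3 ^ k * 1) * ε := by gcongr
      _ = _ := by ring

/-- A difference of two balls, by homogeneity of the volume. The growth of the outer ball is
linearised by `one_add_pow_le`, giving `3 ^ p`, and the shrinking of the inner one by Bernoulli's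
inequality, giving `2 p`. For `t = 0` the annulus is null because `p` is positive. -/
lemma volume_annulus_le (hp : 1 ≤ p) {A : Matrix (Fin p) (Fin p) ℝ}
    (hA : PositiveMatrix A) {t ε : ℝ} (ht : 0 ≤ t) (hε0 : 0 < ε) (hε : ε ≤ 1 / 2) :
    volume {v : Covariate p | (1 - ε) * t ≤ formNorm A v ∧ formNorm A v ≤ (1 + ε) * t} ≤
      ENNReal.ofReal ((3 ^ p + 2 * p) * ε * t ^ p * formBallVolume A) := by
  have hV : 0 ≤ formBallVolume A := measureReal_nonneg
  rcases ht.eq_or_lt with rfl | ht'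
  · refine (measure_mono (t := {v | formNorm A v ≤ 0}) fun v hv => by simpa using hv.2).trans ?_
    rw [volume_setOf_formNorm_le hp hA le_rfl]
    simp [show p ≠ 0 by omega]
  -- The inner radius is reduced to `(1 - 2 ε) t` since the closed inner ball of radius `(1 - ε) t`
  -- would meet the annulus.
  have hsub : {v : Covariate p | (1 - ε) * t ≤ formNorm A v ∧ formNorm A v ≤ (1 + ε) * t} ⊆
      {v | formNorm A v ≤ (1 + ε) * t} \ {v | formNorm A v ≤ (1 - 2 * ε) * t} := by
    intro v hv
    refine ⟨hv.2, fun h => ?_⟩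
    have h' : formNorm A v ≤ (1 - 2 * ε) * t := h
    nlinarith [hv.1, mul_pos hε0 ht']
  have h2ε : 0 ≤ 1 - 2 * ε := by linarith
  refine (measure_mono hsub).trans ?_
  have hss : {v : Covariate p | formNorm A v ≤ (1 - 2 * ε) * t} ⊆
      {v | formNorm A v ≤ (1 + ε) * t} := fun v hv => by
    have h' : formNorm A v ≤ (1 - 2 * ε) * t := hv
    exact h'.trans (by nlinarith [mul_pos hε0 ht'])
  rw [measure_sdiff hss
    (measurableSet_le (continuous_formNorm A).measurable measurable_const).nullMeasurableSet,
    volume_setOf_formNorm_le hp hA (by positivity), volume_setOf_formNorm_le hp hA (by positivity),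
    ← ENNReal.ofReal_sub _ (by positivity)]
  · refine ENNReal.ofReal_le_ofReal ?_
    have b1 := one_add_pow_le hε0.le (by linarith) p
    have b2 := one_add_mul_le_pow (a := -(2 * ε)) (by linarith) p
    rw [mul_pow, mul_pow, ← sub_mul, ← sub_mul]
    gcongr
    rw [← sub_eq_add_neg] at b2
    linarith
  · rw [volume_setOf_formNorm_le hp hA (by positivity)]; exact ENNReal.ofReal_ne_top

end FormNorm

/-! ### The sample covariance matrix -/

section SampleCov

open Matrix

variable {p n : ℕ}

lemma sampleMean_apply (x : Fin n → Covariate p) (a : Fin p) :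
    sampleMean x a = (n : ℝ)⁻¹ * ∑ i, x i a := by
  simp [sampleMean]

lemma sampleCov_apply (hn : 0 < n) (x : Fin n → Covariate p) (a b : Fin p) :
    sampleCov x a b = (n : ℝ)⁻¹ * ∑ i, x i a * x i b -
      ((n : ℝ)⁻¹ * ∑ i, x i a) * ((n : ℝ)⁻¹ * ∑ i, x i b) := by
  have hn' : (n : ℝ) ≠ 0 := by exact_mod_cast hn.ne'
  simp only [sampleCov, Matrix.of_apply]
  have h : ∀ i, (x i a - sampleMean x a) * (x i b - sampleMean x b) =
      x i a * x i b - sampleMean x b * x i a - sampleMean x a * x i b +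
        sampleMean x a * sampleMean x b := fun i => by ring
  simp only [h, Finset.sum_add_distrib, Finset.sum_sub_distrib, ← Finset.mul_sum,
    Finset.sum_const, Finset.card_univ, Fintype.card_fin, nsmul_eq_mul]
  rw [sampleMean_apply, sampleMean_apply]
  field_simp
  ring

lemma transpose_sampleCov (x : Fin n → Covariate p) : (sampleCov x)ᵀ = sampleCov x := by
  ext a b
  simp only [sampleCov, Matrix.transpose_apply, Matrix.of_apply, mul_comm]

/-- The mean of the covariates of the units other than `k`. -/
def restMean (k : Fin n) (x : Fin n → Covariate p) (a : Fin p) : ℝ :=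
  ((n : ℝ) - 1)⁻¹ * ∑ i ∈ Finset.univ.erase k, x i a

/-- The part of the sample covariance matrix not depending on unit `k`. -/
def restCov (k : Fin n) (x : Fin n → Covariate p) : Matrix (Fin p) (Fin p) ℝ :=
  Matrix.of fun a b => (n : ℝ)⁻¹ * ∑ i ∈ Finset.univ.erase k, x i a * x i b -
    ((n : ℝ)⁻¹ * ((n : ℝ) - 1)⁻¹) *
      ((∑ i ∈ Finset.univ.erase k, x i a) * ∑ i ∈ Finset.univ.erase k, x i b)

lemma restMean_update (k : Fin n) (x : Fin n → Covariate p) (y : Covariate p) :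
    restMean k (Function.update x k y) = restMean k x := by
  ext a
  simp only [restMean]
  congr 1
  exact Finset.sum_congr rfl fun i hi => by rw [Function.update_of_ne (Finset.ne_of_mem_erase hi)]

lemma restCov_update (k : Fin n) (x : Fin n → Covariate p) (y : Covariate p) :
    restCov k (Function.update x k y) = restCov k x := by
  have h : ∀ f : Covariate p → ℝ, ∑ i ∈ Finset.univ.erase k, f (Function.update x k y i) =
      ∑ i ∈ Finset.univ.erase k, f (x i) := fun f =>
    Finset.sum_congr rfl fun i hi => by rw [Function.update_of_ne (Finset.ne_of_mem_erase hi)]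
  ext a b
  simp only [restCov, Matrix.of_apply]
  rw [h fun v => v a * v b, h fun v => v a, h fun v => v b]

lemma transpose_restCov (k : Fin n) (x : Fin n → Covariate p) :
    (restCov k x)ᵀ = restCov k x := by
  ext a b
  simp only [restCov, Matrix.transpose_apply, Matrix.of_apply, mul_comm]

/-- Unit `k` enters only through a rank one term, centred at the mean of the other units. With
`restCov_update` and `restMean_update`, this makes Sherman–Morrison available in the covariates of a
single unit. -/
lemma sampleCov_eq_restCov_add (hn : 2 ≤ n) (k : Fin n) (x : Fin n → Covariate p) :
    sampleCov x = restCov k x + (((n : ℝ) - 1) / n ^ 2) •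
      vecMulVec ((x k).ofLp - restMean k x) ((x k).ofLp - restMean k x) := by
  have hn2 : (2 : ℝ) ≤ n := by exact_mod_cast hn
  have hn' : (n : ℝ) ≠ 0 := by positivity
  have hn1 : (n : ℝ) - 1 ≠ 0 := by linarith
  ext a b
  rw [sampleCov_apply (by omega)]
  simp only [restCov, restMean, Matrix.add_apply, Matrix.of_apply, Matrix.smul_apply,
    Matrix.vecMulVec_apply, Pi.sub_apply, smul_eq_mul]
  rw [← Finset.add_sum_erase _ _ (Finset.mem_univ k),
    ← Finset.add_sum_erase _ (fun i => x i a) (Finset.mem_univ k),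
    ← Finset.add_sum_erase _ (fun i => x i b) (Finset.mem_univ k)]
  field_simp
  ring

lemma measurable_coord {β : Type*} [MeasurableSpace β] {f : β → Covariate p}
    (hf : Measurable f) (a : Fin p) : Measurable fun b => f b a :=
  ((PiLp.continuous_apply 2 _ a).measurable).comp hf

lemma measurable_sampleCov_apply {β : Type*} [MeasurableSpace β]
    {x : β → Fin n → Covariate p} (hx : ∀ i, Measurable fun c => x c i) (a b : Fin p) :
    Measurable fun c => sampleCov (x c) a b := by
  have h : ∀ a i, Measurable fun c => x c i a := fun a i => measurable_coord (hx i) a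
  simp only [sampleCov, Matrix.of_apply, sampleMean_apply]
  fun_prop

/-- The inverse is the inverted determinant times the adjugate; both are polynomial in the entries,
and inversion in `ℝ` is measurable also at zero. -/
lemma measurable_matrix_inv_apply {β : Type*} [MeasurableSpace β]
    {A : β → Matrix (Fin p) (Fin p) ℝ} (hA : ∀ a b, Measurable fun c => A c a b) (a b : Fin p) :
    Measurable fun c => (A c)⁻¹ a b := by
  have hA' : Measurable fun c => (fun a b => A c a b : Fin p → Fin p → ℝ) :=
    measurable_pi_lambda _ fun a => measurable_pi_lambda _ fun b => hA a b
  have h1 : Continuous fun B : Fin p → Fin p → ℝ => (Matrix.of B).det :=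
    Continuous.matrix_det continuous_id
  have h2 : Continuous fun B : Fin p → Fin p → ℝ => (Matrix.of B).adjugate a b :=
    (Continuous.matrix_adjugate continuous_id).matrix_elem a b
  have h3 : ∀ c, (A c)⁻¹ a b = (A c).det⁻¹ * (A c).adjugate a b := fun c => by
    rw [Matrix.inv_def, Matrix.smul_apply, smul_eq_mul, Ring.inverse_eq_inv']
  simp only [h3]
  exact ((h1.measurable.comp hA').inv).mul (h2.measurable.comp hA')

lemma measurable_qform_comp {β : Type*} [MeasurableSpace β]
    {A : β → Matrix (Fin p) (Fin p) ℝ} (hA : ∀ a b, Measurable fun c => A c a b)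
    {v : β → Fin p → ℝ} (hv : ∀ a, Measurable fun c => v c a) :
    Measurable fun c => qform (A c) (v c) := by
  simp only [qform, dotProduct, mulVec]
  exact Finset.measurable_sum _ fun a _ => (hv a).mul
    (Finset.measurable_sum _ fun b _ => (hA a b).mul (hv b))

lemma measurable_formNorm_comp {β : Type*} [MeasurableSpace β]
    {A : β → Matrix (Fin p) (Fin p) ℝ} (hA : ∀ a b, Measurable fun c => A c a b)
    {v : β → Covariate p} (hv : Measurable v) : Measurable fun c => formNorm (A c) (v c) :=
  (measurable_qform_comp (fun a b => measurable_matrix_inv_apply hA a b)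
    fun a => measurable_coord hv a).sqrt

lemma abs_qform_sub_le {A B : Matrix (Fin p) (Fin p) ℝ} {t : ℝ}
    (h : ∀ a b, |B a b - A a b| ≤ t) (u : Fin p → ℝ) :
    |qform B u - qform A u| ≤ t * p * (u ⬝ᵥ u) := by
  rcases Nat.eq_zero_or_pos p with rfl | hp
  · simp [qform]
  have ht : 0 ≤ t := (abs_nonneg _).trans (h ⟨0, hp⟩ ⟨0, hp⟩)
  have e : qform B u - qform A u = ∑ a, ∑ b, u a * u b * (B a b - A a b) := by
    simp only [qform, dotProduct, mulVec, Finset.mul_sum, ← Finset.sum_sub_distrib]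
    exact Finset.sum_congr rfl fun a _ => Finset.sum_congr rfl fun b _ => by ring
  calc |qform B u - qform A u| ≤ ∑ a, ∑ b, |u a| * |u b| * t := by
        rw [e]
        refine (Finset.abs_sum_le_sum_abs _ _).trans (Finset.sum_le_sum fun a _ => ?_)
        refine (Finset.abs_sum_le_sum_abs _ _).trans (Finset.sum_le_sum fun b _ => ?_)
        rw [abs_mul, abs_mul]
        gcongr
        exact h a b
    _ = t * (∑ a, |u a|) ^ 2 := by
        rw [sq, Finset.sum_mul_sum, Finset.mul_sum]
        refine Finset.sum_congr rfl fun a _ => ?_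
        rw [Finset.mul_sum]
        exact Finset.sum_congr rfl fun b _ => by ring
    _ ≤ t * (p * ∑ a, |u a| ^ 2) := by
        gcongr
        simpa using sq_sum_le_card_mul_sum_sq (s := Finset.univ) (f := fun a => |u a|)
    _ = t * p * (u ⬝ᵥ u) := by simp only [sq_abs, dotProduct, ← sq, mul_assoc]

end SampleCov

/-- Null sets of `ℝ^p` with the product and with the Euclidean structure agree. -/
lemma volume_setOf_ofLp_eq_zero {p : ℕ} {s : Set (Fin p → ℝ)} (hs : volume s = 0) :
    volume {v : Covariate p | v.ofLp ∈ s} = 0 :=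
  (PiLp.volume_preserving_ofLp (Fin p)).quasiMeasurePreserving.preimage_null hs

/-! ### Regular designs -/

section Design

open Matrix

variable {p : ℕ}

/-- A law of covariates and treatment whose covariates have a bounded density, are supported in a
compact set `S`, and charge the small balls about the points of `S` in either treatment arm. -/
structure RegularDesign (Q : Measure (Covariate p × Bool)) (S : Set (Covariate p)) : Prop where
  compact : IsCompact S
  ae_mem : ∀ᵐ z ∂Q, z.1 ∈ S
  exists_upper : ∃ b : ℝ, 0 < b ∧ ∀ B : Set (Covariate p),
    Q (Prod.fst ⁻¹' B) ≤ ENNReal.ofReal b * volume B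
  exists_lower : ∃ κ : ℝ, 0 < κ ∧ ∀ x ∈ S, ∀ (w : Bool) (r : ℝ), 0 ≤ r → r ≤ 1 →
    κ * r ^ p ≤ Q.real {z | dist z.1 x ≤ r ∧ z.2 = w}

variable {Q : Measure (Covariate p × Bool)} {S : Set (Covariate p)}

lemma RegularDesign.null (hQ : RegularDesign Q S) {B : Set (Covariate p)} (hB : volume B = 0) :
    Q (Prod.fst ⁻¹' B) = 0 := by
  obtain ⟨b, -, h⟩ := hQ.exists_upper
  simpa [hB] using h B

lemma RegularDesign.exists_norm_le (hQ : RegularDesign Q S) :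
    ∃ D : ℝ, 0 < D ∧ ∀ x ∈ S, ‖x‖ ≤ D := by
  obtain ⟨D, hD0, hD⟩ := hQ.compact.isBounded.subset_ball_lt 0 0
  exact ⟨D, hD0, fun x hx => (mem_ball_zero_iff.1 (hD hx)).le⟩

/-- A coordinate of the covariate vector, set to zero outside of `S`. -/
def coordOn (S : Set (Covariate p)) (a : Fin p) (z : Covariate p × Bool) : ℝ :=
  S.indicator (fun x => x a) z.1

lemma coordOn_of_mem {a : Fin p} {z : Covariate p × Bool} (hz : z.1 ∈ S) :
    coordOn S a z = z.1 a := Set.indicator_of_mem hz _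

lemma measurable_coordOn (hS : MeasurableSet S) (a : Fin p) : Measurable (coordOn S a) :=
  ((measurable_coord measurable_id a).indicator hS).comp measurable_fst

lemma abs_coord_le (v : Covariate p) (a : Fin p) : |v a| ≤ ‖v‖ := by
  simpa using PiLp.norm_apply_le v a

lemma abs_coordOn_le {D : ℝ} (hD0 : 0 < D) (hD : ∀ x ∈ S, ‖x‖ ≤ D) (a : Fin p)
    (z : Covariate p × Bool) : |coordOn S a z| ≤ D := by
  by_cases hz : z.1 ∈ S
  · rw [coordOn_of_mem hz]
    exact (abs_coord_le _ _).trans (hD _ hz)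
  · rw [coordOn, Set.indicator_of_notMem hz]
    simpa using hD0.le

variable [IsProbabilityMeasure Q]

variable (Q S) in
/-- The covariance matrix of the covariates. -/
def popCov : Matrix (Fin p) (Fin p) ℝ :=
  Matrix.of fun a b => ∫ z, coordOn S a z * coordOn S b z ∂Q -
    (∫ z, coordOn S a z ∂Q) * ∫ z, coordOn S b z ∂Q

/-- The form at `u` is the variance of the linear functional `uᵀ X`. If it vanished, the covariates
would lie almost surely on a hyperplane, which is null for a law with a density. -/
lemma RegularDesign.positiveMatrix_popCov (hQ : RegularDesign Q S) :
    PositiveMatrix (popCov Q S) where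
  symm := by
    ext a b
    simp only [popCov, Matrix.transpose_apply, Matrix.of_apply, mul_comm]
  pos u hu := by
    obtain ⟨D, hD0, hD⟩ := hQ.exists_norm_le
    have hm := fun a => measurable_coordOn (a := a) hQ.compact.measurableSet
    have hi : ∀ a, MemLp (coordOn S a) 2 Q := fun a =>
      MemLp.of_bound (hm a).aestronglyMeasurable D (ae_of_all _ (abs_coordOn_le hD0 hD a))
    set Y : Covariate p × Bool → ℝ := fun z => ∑ a, u a * coordOn S a z with hY
    have hYm : MemLp Y 2 Q := memLp_finsetSum _ fun a _ => (hi a).const_mul _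
    have e : qform (popCov Q S) u = Var[Y; Q] := by
      rw [variance_eq_sub hYm]
      have e1 : ∫ z, Y z ∂Q = ∑ a, u a * ∫ z, coordOn S a z ∂Q := by
        rw [integral_finsetSum _ fun a _ => ((hi a).integrable one_le_two).const_mul _]
        simp only [integral_const_mul]
      have e2 : ∫ z, (Y ^ 2) z ∂Q =
          ∑ a, ∑ b, u a * u b * ∫ z, coordOn S a z * coordOn S b z ∂Q := by
        have : ∀ z, (Y ^ 2) z = ∑ a, ∑ b, u a * u b * (coordOn S a z * coordOn S b z) := by
          intro z
          rw [Pi.pow_apply, sq, hY, Finset.sum_mul_sum]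
          exact Finset.sum_congr rfl fun a _ => Finset.sum_congr rfl fun b _ => by ring
        have hii : ∀ a b, Integrable
            (fun z => u a * u b * (coordOn S a z * coordOn S b z)) Q := fun a b =>
          ((hi a).integrable_mul (hi b)).const_mul _
        simp only [this]
        rw [integral_finsetSum _ fun a _ => integrable_finsetSum _ fun b _ => hii a b]
        refine Finset.sum_congr rfl fun a _ => ?_
        rw [integral_finsetSum _ fun b _ => hii a b]
        simp only [integral_const_mul]
      rw [e2, e1, sq, Finset.sum_mul_sum, ← Finset.sum_sub_distrib]
      simp only [qform, dotProduct, mulVec, Finset.mul_sum, ← Finset.sum_sub_distrib, popCov,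
        Matrix.of_apply]
      exact Finset.sum_congr rfl fun a _ => Finset.sum_congr rfl fun b _ => by ring
    rw [e]
    refine lt_of_le_of_ne (variance_nonneg _ _) fun h0 => ?_
    have hae := ae_eq_integral_of_variance_eq_zero hYm h0.symm
    set c := ∫ z, Y z ∂Q
    have hnull : volume {v : Fin p → ℝ | u ⬝ᵥ v - c = 0} = 0 := by
      refine volume_zeros_eq_zero_of_quadratic_on_lines (by unfold dotProduct; fun_prop) u
        fun y => ⟨0, u ⬝ᵥ u, u ⬝ᵥ y - c, Or.inr (Or.inl ?_), fun t => ?_⟩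
      · simpa [dotProduct_self_eq_zero] using hu
      · rw [dotProduct_add, dotProduct_smul, smul_eq_mul]; ring
    have hz := hQ.null (volume_setOf_ofLp_eq_zero hnull)
    have h1 : ∀ᵐ z ∂Q, z ∈ Prod.fst ⁻¹' {v : Covariate p | v.ofLp ∈ {v | u ⬝ᵥ v - c = 0}} := by
      filter_upwards [hae, hQ.ae_mem] with z hz hzS
      have : Y z = u ⬝ᵥ z.1.ofLp := by
        simp only [hY, coordOn_of_mem hzS, dotProduct]
      simp [← this, hz]
    have h2 : ∀ᵐ z ∂Q, z ∉ Prod.fst ⁻¹' {v : Covariate p | v.ofLp ∈ {v | u ⬝ᵥ v - c = 0}} :=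
      measure_eq_zero_iff_ae_notMem.1 hz
    obtain ⟨z, hz1, hz2⟩ := (h1.and h2).exists
    exact hz2 hz1

lemma ofLp_dotProduct_self (v : Covariate p) : v.ofLp ⬝ᵥ v.ofLp = ‖v‖ ^ 2 := by
  rw [EuclideanSpace.norm_sq_eq]
  simp [dotProduct, sq]

/-- The sample covariance matrix is close to the population covariance matrix. -/
lemma RegularDesign.exists_formClose (hp : 1 ≤ p) (hQ : RegularDesign Q S) :
    ∃ K : ℝ, 0 < K ∧ ∀ (n : ℕ) (t : ℝ), 0 < n → 0 < t →
      (sampleLaw Q n).real {z | ¬ FormClose (K * t) (popCov Q S) (sampleCov fun i => (z i).1)} ≤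
        K / (n * t ^ 2) := by
  obtain ⟨D, hD0, hD⟩ := hQ.exists_norm_le
  obtain ⟨c, C, hc, -, hcb⟩ := exists_qform_bounds hp hQ.positiveMatrix_popCov
  have hm := fun a => measurable_coordOn (a := a) hQ.compact.measurableSet
  have hb := fun a => abs_coordOn_le hD0 hD a
  -- One constant for both roles. The first summand turns an entrywise error `t` into a relative
  -- error of the forms; the second adds the Chebyshev constants of the `p²` mean products and the
  -- `p` means; the `1` ensures positivity.
  set K := (1 + 2 * D) * p / c + (p ^ 2 * (4 * (D ^ 2) ^ 2) + p * (4 * D ^ 2)) + 1 with hK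
  refine ⟨K, by positivity, fun n t hn ht => ?_⟩
  have hsub : {z : Fin n → Covariate p × Bool |
        ¬ FormClose (K * t) (popCov Q S) (sampleCov fun i => (z i).1)} ⊆
      ((⋃ a : Fin p, ⋃ b : Fin p, {z | t ≤ |average (fun z => coordOn S a z * coordOn S b z) z -
        ∫ z, coordOn S a z * coordOn S b z ∂Q|}) ∪
      ⋃ a : Fin p, {z | t ≤ |average (coordOn S a) z - ∫ z, coordOn S a z ∂Q|}) ∪
      {z | ¬ ∀ i, (z i).1 ∈ S} := by
    intro z hz
    by_contra hcon
    simp only [Set.mem_union, Set.mem_iUnion, Set.mem_ofPred_eq, not_or, not_exists, not_le,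
      not_not] at hcon hz
    obtain ⟨⟨h1, h2⟩, h3⟩ := hcon
    refine hz fun u => ?_
    have hentry : ∀ a b, |sampleCov (fun i => (z i).1) a b - popCov Q S a b| ≤ t * (1 + 2 * D) := by
      intro a b
      have e1 : sampleCov (fun i => (z i).1) a b =
          average (fun z => coordOn S a z * coordOn S b z) z -
            average (coordOn S a) z * average (coordOn S b) z := by
        rw [sampleCov_apply hn]
        simp only [average, coordOn_of_mem (h3 _)]
      rw [e1, popCov, Matrix.of_apply]
      set A := average (coordOn S a) z
      set B := average (coordOn S b) z
      set A' := ∫ z, coordOn S a z ∂Q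
      set B' := ∫ z, coordOn S b z ∂Q with hB'
      have hA : |A| ≤ D := abs_average_le (hb a) hD0.le z
      have hB'D : |B'| ≤ D := by
        have := norm_integral_le_of_norm_le_const (μ := Q) (f := coordOn S b)
          (ae_of_all _ (hb b))
        simpa using this
      have e2 : average (fun z => coordOn S a z * coordOn S b z) z - A * B -
          (∫ z, coordOn S a z * coordOn S b z ∂Q - A' * B') =
          (average (fun z => coordOn S a z * coordOn S b z) z -
            ∫ z, coordOn S a z * coordOn S b z ∂Q) - A * (B - B') - (A - A') * B' := by ring
      rw [e2]
      calc _ ≤ |average (fun z => coordOn S a z * coordOn S b z) z -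
            ∫ z, coordOn S a z * coordOn S b z ∂Q| + |A * (B - B')| + |(A - A') * B'| :=
            (abs_sub _ _).trans (by gcongr; exact abs_sub _ _)
        _ ≤ t + D * t + t * D := by
            rw [abs_mul, abs_mul]
            gcongr
            · exact (h1 a b).le
            · exact (h2 b).le
            · exact (h2 a).le
        _ = t * (1 + 2 * D) := by ring
    refine (abs_qform_sub_le hentry u).trans ?_
    have h4 := (hcb (WithLp.toLp 2 u)).1
    rw [← ofLp_dotProduct_self] at h4
    have h4' : u ⬝ᵥ u ≤ c⁻¹ * qform (popCov Q S) u := by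
      rw [← div_eq_inv_mul, le_div_iff₀ hc]
      simpa [mul_comm] using h4
    calc t * (1 + 2 * D) * p * (u ⬝ᵥ u) ≤ t * (1 + 2 * D) * p * (c⁻¹ * qform (popCov Q S) u) := by
          gcongr
      _ = ((1 + 2 * D) * p / c) * t * qform (popCov Q S) u := by ring
      _ ≤ K * t * qform (popCov Q S) u := by
          have := hQ.positiveMatrix_popCov.nonneg u
          gcongr
          rw [hK, add_assoc]
          exact le_add_of_nonneg_right (by positivity)
  have hz3 : (sampleLaw Q n).real {z | ¬ ∀ i, (z i).1 ∈ S} = 0 := by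
    rw [measureReal_eq_zero_iff]
    exact ae_iff.1 (ae_sampleLaw_of_ae Q hQ.ae_mem)
  refine (measureReal_mono hsub).trans ?_
  have hn' : (0 : ℝ) < n := by exact_mod_cast hn
  calc _ ≤ (∑ _a : Fin p, ∑ _b : Fin p, 4 * (D ^ 2) ^ 2 / n / t ^ 2) +
        (∑ _a : Fin p, 4 * D ^ 2 / n / t ^ 2) + 0 := by
        rw [← hz3]
        refine (measureReal_union_le _ _).trans (add_le_add ?_ le_rfl)
        refine (measureReal_union_le _ _).trans (add_le_add ?_ ?_)
        · refine (measureReal_iUnion_fintype_le _).trans (Finset.sum_le_sum fun a _ => ?_)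
          refine (measureReal_iUnion_fintype_le _).trans (Finset.sum_le_sum fun b _ => ?_)
          refine sampleLaw_le_abs_average_sub_le Q ((hm a).mul (hm b)) (fun z => ?_) hn ht
          rw [Pi.mul_apply, abs_mul, sq]
          gcongr
          · exact hb a z
          · exact hb b z
        · refine (measureReal_iUnion_fintype_le _).trans (Finset.sum_le_sum fun a _ => ?_)
          exact sampleLaw_le_abs_average_sub_le Q (hm a) (hb a) hn ht
    _ = (p ^ 2 * (4 * (D ^ 2) ^ 2) + p * (4 * D ^ 2)) / (n * t ^ 2) := by
        simp only [Finset.sum_const, Finset.card_univ, Fintype.card_fin, nsmul_eq_mul]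
        field_simp
        ring
    _ ≤ K / (n * t ^ 2) := by
        gcongr
        rw [hK]
        have : 0 ≤ (1 + 2 * D) * p / c := by positivity
        linarith

/-! ### Ties -/

/-- The condition ranges over uncountably many `u`, but it defines a closed set of matrices. -/
lemma measurableSet_setOf_forall_le_qform {β : Type*} [MeasurableSpace β]
    {A : β → Matrix (Fin p) (Fin p) ℝ} (hA : ∀ a b, Measurable fun c => A c a b) (c : ℝ) :
    MeasurableSet {y | ∀ u, c * (u ⬝ᵥ u) ≤ qform (A y) u} := by
  have hA' : Measurable fun y => (fun a b => A y a b : Fin p → Fin p → ℝ) :=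
    measurable_pi_lambda _ fun a => measurable_pi_lambda _ fun b => hA a b
  have hcl : IsClosed {B : Fin p → Fin p → ℝ | ∀ u, c * (u ⬝ᵥ u) ≤ qform (Matrix.of B) u} := by
    simp only [Set.ofPred_forall]
    refine isClosed_iInter fun u => isClosed_le continuous_const ?_
    simp only [qform, dotProduct, mulVec, Matrix.of_apply]
    fun_prop
  exact hA' hcl.measurableSet

lemma sampleLaw_eq_zero_of_update {α : Type*} [MeasurableSpace α] (Q : Measure α)
    [IsProbabilityMeasure Q] {n : ℕ} (k : Fin n) {s : Set (Fin n → α)} (hs : MeasurableSet s)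
    (h : ∀ z, Q {a | Function.update z k a ∈ s} = 0) : sampleLaw Q n s = 0 := by
  rw [sampleLaw_apply_eq_lintegral_update Q k hs]
  simp [h]

lemma measurable_eval_fst {n : ℕ} (i : Fin n) :
    Measurable fun z : Fin n → Covariate p × Bool => (z i).1 :=
  measurable_fst.comp (measurable_pi_apply i)

lemma RegularDesign.ae_ne (hp : 1 ≤ p) (hQ : RegularDesign Q S) {n : ℕ} :
    ∀ᵐ z ∂sampleLaw Q n, ∀ i j, i ≠ j → (z i).1 ≠ (z j).1 := by
  simp only [ae_all_iff]
  intro i j hij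
  have hs : MeasurableSet {z : Fin n → Covariate p × Bool | (z i).1 = (z j).1} :=
    measurableSet_eq_fun (measurable_eval_fst i) (measurable_eval_fst j)
  have : Nontrivial (Covariate p) := by
    have : Nonempty (Fin p) := ⟨⟨0, hp⟩⟩
    infer_instance
  have h := sampleLaw_eq_zero_of_update Q i hs fun z => by
    have e : {a | Function.update z i a ∈ {z : Fin n → Covariate p × Bool | (z i).1 = (z j).1}} =
        Prod.fst ⁻¹' {(z j).1} := by
      ext a
      simp [Function.update_of_ne hij.symm]
    rw [e]
    exact hQ.null (measure_singleton _)
  rw [ae_iff]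
  simpa using h

/-- The rank one term of unit `k` has a coefficient of at most `1 / n` and a vector whose
coordinates are bounded by `2 D`. For `8 p D² ≤ c n` removing it costs at most half of the lower
bound. -/
lemma le_qform_restCov {n : ℕ} (hn : 2 ≤ n) {x : Fin n → Covariate p} {D c : ℝ} (hc : 0 < c)
    (hD : ∀ i, ‖x i‖ ≤ D) (hcov : ∀ u, c * (u ⬝ᵥ u) ≤ qform (sampleCov x) u)
    (hcn : 8 * (p * D ^ 2) ≤ c * n) (k : Fin n) (u : Fin p → ℝ) :
    c / 2 * (u ⬝ᵥ u) ≤ qform (restCov k x) u := by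
  have hn2 : (2 : ℝ) ≤ n := by exact_mod_cast hn
  have hD0 : 0 ≤ D := (norm_nonneg _).trans (hD k)
  set y := (x k).ofLp - restMean k x with hy
  have h1 := hcov u
  have h2 : qform (sampleCov x) u = qform (restCov k x) u +
      (((n : ℝ) - 1) / n ^ 2) * (u ⬝ᵥ y) ^ 2 := by
    rw [sampleCov_eq_restCov_add hn k x]
    simp only [qform, Matrix.add_mulVec, dotProduct_add, Matrix.smul_mulVec, dotProduct_smul,
      Matrix.vecMulVec_mulVec, smul_eq_mul, op_smul_eq_smul]
    rw [← hy, dotProduct_comm y u]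
    ring
  have hya : ∀ a, |y a| ≤ 2 * D := by
    intro a
    have h3 : |restMean k x a| ≤ D := by
      have hn1 : (0 : ℝ) < (n : ℝ) - 1 := by linarith
      rw [restMean, abs_mul, abs_inv, abs_of_pos hn1, inv_mul_le_iff₀ hn1]
      refine (Finset.abs_sum_le_sum_abs _ _).trans ?_
      refine (Finset.sum_le_sum fun i _ => (abs_coord_le _ _).trans (hD i)).trans ?_
      rw [Finset.sum_const, Finset.card_erase_of_mem (Finset.mem_univ k), Finset.card_univ,
        Fintype.card_fin, nsmul_eq_mul, Nat.cast_sub (by omega)]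
      simp
    have h4 : |x k a| ≤ D := (abs_coord_le _ _).trans (hD k)
    rw [hy, Pi.sub_apply]
    exact (abs_sub _ _).trans (by linarith)
  have h5 : (u ⬝ᵥ y) ^ 2 ≤ (u ⬝ᵥ u) * (p * (2 * D) ^ 2) := by
    have hcs := Finset.sum_mul_sq_le_sq_mul_sq Finset.univ u y
    have e1 : ∑ a, y a ^ 2 ≤ p * (2 * D) ^ 2 := by
      calc ∑ a, y a ^ 2 ≤ ∑ _a : Fin p, (2 * D) ^ 2 := Finset.sum_le_sum fun a _ => by
            rw [← sq_abs]
            gcongr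
            exact hya a
        _ = _ := by simp
    simp only [dotProduct, ← sq]
    exact hcs.trans (by gcongr)
  have huu : 0 ≤ u ⬝ᵥ u := by
    simp only [dotProduct]
    exact Finset.sum_nonneg fun a _ => mul_self_nonneg _
  have h6 : (((n : ℝ) - 1) / n ^ 2) ≤ 1 / n := by
    rw [div_le_div_iff₀ (by positivity) (by positivity)]
    nlinarith
  have h7 : (((n : ℝ) - 1) / n ^ 2) * (u ⬝ᵥ y) ^ 2 ≤ c / 2 * (u ⬝ᵥ u) := by
    calc _ ≤ 1 / (n : ℝ) * ((u ⬝ᵥ u) * (p * (2 * D) ^ 2)) := by gcongr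
      _ = (8 * (p * D ^ 2)) * ((u ⬝ᵥ u) / (2 * n)) := by ring
      _ ≤ (c * n) * ((u ⬝ᵥ u) / (2 * n)) := by gcongr
      _ = c / 2 * (u ⬝ᵥ u) := by field_simp
  linarith

/-- Almost surely, there are no ties among the Mahalanobis distances, provided that the sample
covariance matrix is close to the population covariance matrix. -/
lemma RegularDesign.ae_no_ties (hp : 1 ≤ p) (hQ : RegularDesign Q S) :
    ∀ᶠ n : ℕ in atTop, ∀ᵐ z ∂sampleLaw Q n,
      FormClose (1 / 2) (popCov Q S) (sampleCov fun i => (z i).1) → ∀ i j k, i ≠ j → i ≠ k → j ≠ k →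
        formNorm (sampleCov fun i => (z i).1) ((z j).1 - (z i).1) ≠
          formNorm (sampleCov fun i => (z i).1) ((z k).1 - (z i).1) := by
  obtain ⟨D, hD0, hD⟩ := hQ.exists_norm_le
  obtain ⟨c, C, hc, -, hcb⟩ := exists_qform_bounds hp hQ.positiveMatrix_popCov
  have hlim : Tendsto (fun n : ℕ => c / 2 * (n : ℝ)) atTop atTop :=
    tendsto_natCast_atTop_atTop.const_mul_atTop (by positivity)
  filter_upwards [eventually_ge_atTop 2, hlim.eventually_ge_atTop (8 * (p * D ^ 2))] with n hn hcn
  -- The positivity condition is imposed on `restCov k`, which does not involve unit `k`, so it is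
  -- fixed while unit `k` is resampled. When it fails, or when units `i` and `j` coincide, the
  -- section is empty; otherwise `volume_tie_eq_zero` applies.
  have hnull : ∀ i j k : Fin n, i ≠ j → i ≠ k → j ≠ k → sampleLaw Q n
      {z | (∀ u, c / 2 / 2 * (u ⬝ᵥ u) ≤ qform (restCov k fun i => (z i).1) u) ∧
        (z i).1 ≠ (z j).1 ∧ formNorm (sampleCov fun i => (z i).1) ((z k).1 - (z i).1) =
          formNorm (sampleCov fun i => (z i).1) ((z j).1 - (z i).1)} = 0 := by
    intro i j k hij hik hjk
    refine sampleLaw_eq_zero_of_update Q k ?_ fun z => ?_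
    · refine MeasurableSet.inter ?_ (MeasurableSet.inter ?_ ?_)
      · refine measurableSet_setOf_forall_le_qform (fun a b => ?_) _
        have h : ∀ a (i : Fin n), Measurable fun z : Fin n → Covariate p × Bool => (z i).1 a :=
          fun a i => measurable_coord (measurable_eval_fst i) a
        simp only [restCov, Matrix.of_apply]
        fun_prop
      · exact (measurableSet_eq_fun (measurable_eval_fst i) (measurable_eval_fst j)).compl
      · have hcov : ∀ a b, Measurable fun z : Fin n → Covariate p × Bool =>
            sampleCov (fun i => (z i).1) a b := fun a b =>
          measurable_sampleCov_apply (fun i => measurable_eval_fst i) a b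
        exact measurableSet_eq_fun
          (measurable_formNorm_comp hcov ((measurable_eval_fst k).sub (measurable_eval_fst i)))
          (measurable_formNorm_comp hcov ((measurable_eval_fst j).sub (measurable_eval_fst i)))
    · by_cases hpos : ∀ u, c / 2 / 2 * (u ⬝ᵥ u) ≤ qform (restCov k fun i => (z i).1) u
      swap
      · refine measure_mono_null (t := ∅) (fun a ha => ?_) measure_empty
        refine hpos ?_
        have h := ha.1
        have e : (fun i => (Function.update z k a i).1) =
            Function.update (fun i => (z i).1) k a.1 := by
          ext i : 1
          by_cases hi : i = k
          · subst hi; simp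
          · simp [hi]
        rwa [e, restCov_update] at h
      by_cases hne : (z i).1 = (z j).1
      · refine measure_mono_null (t := ∅) (fun a ha => ?_) measure_empty
        have h := ha.2.1
        simp only [Function.update_of_ne hik, Function.update_of_ne hjk] at h
        exact h hne
      have hA : PositiveMatrix (restCov k fun i => (z i).1) :=
        ⟨transpose_restCov _ _, fun u hu => lt_of_lt_of_le (by
          have : 0 < u ⬝ᵥ u := lt_of_le_of_ne
            (by simp only [dotProduct]; exact Finset.sum_nonneg fun a _ => mul_self_nonneg _)
            fun h => hu (dotProduct_self_eq_zero.1 h.symm)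
          positivity) (hpos u)⟩
      have hn2 : (2 : ℝ) ≤ n := by exact_mod_cast hn
      have hα : 0 ≤ ((n : ℝ) - 1) / n ^ 2 := div_nonneg (by linarith) (by positivity)
      have hne' : (z i).1.ofLp ≠ (z j).1.ofLp := fun h => hne (by ext a; exact congrFun h a)
      refine measure_mono_null (fun a ha => ?_)
        (hQ.null (volume_setOf_ofLp_eq_zero (volume_tie_eq_zero hA hα
          (restMean k fun i => (z i).1) _ _ hne')))
      have h := ha.2.2
      have e : (fun i => (Function.update z k a i).1) =
          Function.update (fun i => (z i).1) k a.1 := by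
        ext i : 1
        by_cases hi : i = k
        · subst hi; simp
        · simp [hi]
      simp only [Function.update_of_ne hik, Function.update_of_ne hjk, Function.update_self] at h
      rw [e, sampleCov_eq_restCov_add hn k, restCov_update, restMean_update,
        Function.update_self] at h
      have hA' := hA.add_vecMulVec hα (a.1.ofLp - restMean k fun i => (z i).1)
      have h' := congrArg (fun t => t ^ 2) h
      simp only [hA'.formNorm_sq, WithLp.ofLp_sub] at h'
      exact h'
  have hnull' : ∀ᵐ z ∂sampleLaw Q n, ∀ i j k : Fin n, i ≠ j → i ≠ k → j ≠ k →
      ¬ ((∀ u, c / 2 / 2 * (u ⬝ᵥ u) ≤ qform (restCov k fun i => (z i).1) u) ∧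
        (z i).1 ≠ (z j).1 ∧ formNorm (sampleCov fun i => (z i).1) ((z k).1 - (z i).1) =
          formNorm (sampleCov fun i => (z i).1) ((z j).1 - (z i).1)) := by
    simp only [ae_all_iff]
    intro i j k hij hik hjk
    exact measure_eq_zero_iff_ae_notMem.1 (hnull i j k hij hik hjk)
  filter_upwards [hnull', hQ.ae_ne hp, ae_sampleLaw_of_ae Q hQ.ae_mem] with z h1 h2 h3 hclose
    i j k hij hik hjk heq
  -- Closeness within `1/2` leaves the lower bound `c / 2` for the sample covariance matrix, and the
  -- removal of unit `k` leaves `c / 2 / 2`.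
  refine h1 i j k hij hik hjk ⟨fun u => ?_, h2 i j hij, heq.symm⟩
  refine le_qform_restCov hn (by positivity) (fun i => hD _ (h3 i)) (fun u => ?_) hcn k u
  have h4 := (abs_le.1 (hclose u)).1
  have h5 := (hcb (WithLp.toLp 2 u)).1
  rw [← ofLp_dotProduct_self] at h5
  simp only at h5
  linarith

end Design

/-! ### Matching with respect to a norm -/

section Matching

open Matrix

variable {p n : ℕ}

/-- The units matched to unit `i`, for distances measured by `d`. -/
def nbrSet (M : ℕ) (d : Covariate p → ℝ) (z : Fin n → Covariate p × Bool) (i : Fin n) :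
    Finset (Fin n) :=
  rankSet M (oppositeArm (fun j => (z j).2) i) fun j => d ((z j).1 - (z i).1)

/-- The variance form of the matching weights, for distances measured by `d`. -/
def matchVar (M : ℕ) (d : Covariate p → ℝ) (s v : Covariate p × Bool → ℝ)
    (z : Fin n → Covariate p × Bool) : ℝ :=
  varForm M (nbrSet M d z) (fun i => s (z i)) fun i => v (z i)

lemma card_nbrSet_le (M : ℕ) (d : Covariate p → ℝ) (z : Fin n → Covariate p × Bool) (i : Fin n) :
    (nbrSet M d z i).card ≤ M := card_rankSet_le _ _ _

lemma ne_of_mem_nbrSet {M : ℕ} {d : Covariate p → ℝ} {z : Fin n → Covariate p × Bool}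
    {i j : Fin n} (h : j ∈ nbrSet M d z i) : j ≠ i := by
  rintro rfl
  have := (mem_rankSet.1 h).1
  rw [mem_oppositeArm] at this
  exact absurd this (by simp)

section Measurability

variable {β : Type*} [MeasurableSpace β] {D : β → Covariate p → ℝ}
  {z : β → Fin n → Covariate p × Bool}

lemma measurableSet_mem_nbrSet (M : ℕ) (hz : ∀ i, Measurable fun c => z c i)
    (hD : ∀ i j, Measurable fun c => D c ((z c j).1 - (z c i).1)) (i j : Fin n) :
    MeasurableSet {c | j ∈ nbrSet M (D c) (z c) i} := by
  classical
  have harm : ∀ k, MeasurableSet {c | (z c k).2 = !(z c i).2} := fun k =>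
    measurableSet_eq_fun (measurable_snd.comp (hz k))
      ((measurable_of_finite Bool.not).comp (measurable_snd.comp (hz i)))
  have hle : ∀ k, MeasurableSet {c | D c ((z c k).1 - (z c i).1) ≤ D c ((z c j).1 - (z c i).1)} :=
    fun k => measurableSet_le (hD i k) (hD i j)
  have e : {c | j ∈ nbrSet M (D c) (z c) i} = {c | (z c j).2 = !(z c i).2} ∩
      {c | (∑ k, if (z c k).2 = !(z c i).2 ∧
        D c ((z c k).1 - (z c i).1) ≤ D c ((z c j).1 - (z c i).1) then 1 else 0) ≤ M} := by
    ext c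
    simp only [nbrSet, mem_rankSet, Finset.mem_filter, Finset.mem_univ, true_and,
      Set.mem_ofPred_eq, Set.mem_inter_iff, oppositeArm, Finset.filter_filter, Finset.card_filter]
  rw [e]
  refine (harm j).inter (measurableSet_le (Finset.measurable_sum _ fun k _ => ?_)
    measurable_const)
  exact Measurable.ite ((harm k).inter (hle k)) measurable_const measurable_const

lemma measurable_weight_nbrSet (M : ℕ) (hz : ∀ i, Measurable fun c => z c i)
    (hD : ∀ i j, Measurable fun c => D c ((z c j).1 - (z c i).1))
    {s : Covariate p × Bool → ℝ} (hs : Measurable s) (i : Fin n) :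
    Measurable fun c => weight (nbrSet M (D c) (z c)) (fun j => s (z c j)) i := by
  unfold weight
  exact Finset.measurable_sum _ fun j _ =>
    Measurable.ite (measurableSet_mem_nbrSet M hz hD j i) (hs.comp (hz j)) measurable_const

lemma measurable_matchVar (M : ℕ) (hz : ∀ i, Measurable fun c => z c i)
    (hD : ∀ i j, Measurable fun c => D c ((z c j).1 - (z c i).1))
    {s v : Covariate p × Bool → ℝ} (hs : Measurable s) (hv : Measurable v) :
    Measurable fun c => matchVar M (D c) s v (z c) := by
  have hw := measurable_weight_nbrSet M hz hD hs
  unfold matchVar varForm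
  refine Measurable.const_mul (Finset.measurable_sum _ fun i _ => ?_) _
  exact (((hs.comp (hz i)).add ((hw i).div_const _)).pow_const 2).mul (hv.comp (hz i))

end Measurability

/-- Pairs of observations at a distance of at most `r`, the second one having treatment `w`. -/
def armRel (p : ℕ) (r : ℝ) (w : Bool) : Set ((Covariate p × Bool) × (Covariate p × Bool)) :=
  {q | dist q.2.1 q.1.1 ≤ r ∧ q.2.2 = w}

/-- Pairs of observations at a distance of at most `r`. -/
def ballRel (p : ℕ) (r : ℝ) : Set ((Covariate p × Bool) × (Covariate p × Bool)) :=
  {q | dist q.2.1 q.1.1 ≤ r}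

lemma measurableSet_ballRel (r : ℝ) : MeasurableSet (ballRel p r) := by
  refine measurableSet_le ?_ measurable_const
  exact (measurable_fst.comp measurable_snd).dist (measurable_fst.comp measurable_fst)

lemma measurableSet_armRel (r : ℝ) (w : Bool) : MeasurableSet (armRel p r w) :=
  (measurableSet_ballRel r).inter
    ((measurable_snd.comp measurable_snd) (measurableSet_singleton w))

/-- A sample with at least `M` units of either arm within distance `r` of every unit, and at most
`L` units within distance `r'`. -/
structure GoodSample (M : ℕ) (r r' L : ℝ) (z : Fin n → Covariate p × Bool) : Prop where
  arm : ∀ i w, (M : ℝ) ≤ relCount (armRel p r w) i z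
  ball : ∀ i, relCount (ballRel p r') i z ≤ L

lemma measurableSet_goodSample (M : ℕ) (r r' L : ℝ) :
    MeasurableSet {z : Fin n → Covariate p × Bool | GoodSample M r r' L z} := by
  have e : {z : Fin n → Covariate p × Bool | GoodSample M r r' L z} =
      (⋂ i, ⋂ w, {z | (M : ℝ) ≤ relCount (armRel p r w) i z}) ∩
        ⋂ i, {z | relCount (ballRel p r') i z ≤ L} := by
    ext z
    simp only [Set.mem_ofPred_eq, Set.mem_inter_iff, Set.mem_iInter]
    exact ⟨fun h => ⟨h.arm, h.ball⟩, fun h => ⟨h.1, h.2⟩⟩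
  rw [e]
  refine MeasurableSet.inter ?_ ?_
  · exact MeasurableSet.iInter fun i => MeasurableSet.iInter fun w =>
      measurableSet_le measurable_const (measurable_relCount (measurableSet_armRel r w) i)
  · exact MeasurableSet.iInter fun i =>
      measurableSet_le (measurable_relCount (measurableSet_ballRel r') i) measurable_const

/-! ### Stability of the matched sets of a good sample -/

section Deterministic

variable {M : ℕ} {r r' L c₁ c₂ : ℝ} {d : Covariate p → ℝ} {z : Fin n → Covariate p × Bool}

lemma card_filter_le_relCount {A : Set ((Covariate p × Bool) × (Covariate p × Bool))} {i : Fin n}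
    {B : Finset (Fin n)} (hB : ∀ j ∈ B, j ≠ i ∧ (z i, z j) ∈ A) : (B.card : ℝ) ≤
        relCount A i z := by
  classical
  rw [relCount, Finset.sum_boole]
  exact_mod_cast Finset.card_le_card fun j hj => Finset.mem_filter.2 ⟨Finset.mem_univ j, hB j hj⟩

lemma GoodSample.nonneg (h : GoodSample M r r' L z) (i : Fin n) : 0 ≤ L :=
  le_trans (by simpa using card_filter_le_relCount (z := z) (i := i) (B := ∅) (by simp)) (h.ball i)

lemma GoodSample.le_card_filter (h : GoodSample M r r' L z) (hc₂ : 0 ≤ c₂)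
    (hd : ∀ v, d v ≤ c₂ * ‖v‖) (i : Fin n) :
    M ≤ ((oppositeArm (fun j => (z j).2) i).filter
      fun j => d ((z j).1 - (z i).1) ≤ c₂ * r).card := by
  classical
  have h1 := h.arm i (!(z i).2)
  rw [relCount, Finset.sum_boole] at h1
  have h2 : M ≤ (Finset.univ.filter fun j => j ≠ i ∧ (z i, z j) ∈ armRel p r (!(z i).2)).card := by
    exact_mod_cast h1
  refine h2.trans (Finset.card_le_card fun j hj => ?_)
  obtain ⟨-, -, hj1, hj2⟩ := Finset.mem_filter.1 hj
  refine Finset.mem_filter.2 ⟨mem_oppositeArm.2 hj2, (hd _).trans ?_⟩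
  rw [← dist_eq_norm]
  gcongr

lemma GoodSample.le_of_mem_nbrSet (h : GoodSample M r r' L z) (hc₂ : 0 ≤ c₂)
    (hd : ∀ v, d v ≤ c₂ * ‖v‖) {i j : Fin n} (hj : j ∈ nbrSet M d z i) :
    d ((z j).1 - (z i).1) ≤ c₂ * r :=
  le_of_mem_rankSet (f := fun j => d ((z j).1 - (z i).1)) (h.le_card_filter hc₂ hd i) hj

/-- `M` units of the opposite arm lie within Euclidean distance `r`, so matches have `d`-distance at
most `c₂ r`. The link `c₂ r ≤ c₁ r'` between the two radii returns to the Euclidean distance. -/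
lemma GoodSample.dist_le_of_mem_nbrSet (h : GoodSample M r r' L z) (hc₁ : 0 < c₁) (hc₂ : 0 ≤ c₂)
    (hd : ∀ v, c₁ * ‖v‖ ≤ d v ∧ d v ≤ c₂ * ‖v‖) (hr : c₂ * r ≤ c₁ * r') {i j : Fin n}
    (hj : j ∈ nbrSet M d z i) : dist (z j).1 (z i).1 ≤ r' := by
  have h1 := h.le_of_mem_nbrSet hc₂ (fun v => (hd v).2) hj
  have h2 := (hd ((z j).1 - (z i).1)).1
  rw [dist_eq_norm]
  exact le_of_mul_le_mul_left (h2.trans (h1.trans hr)) hc₁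

lemma GoodSample.card_nbrSet (h : GoodSample M r r' L z)
    (hinj : ∀ i j k, i ≠ j → i ≠ k → j ≠ k → d ((z j).1 - (z i).1) ≠ d ((z k).1 - (z i).1))
    (i : Fin n) : (nbrSet M d z i).card = M := by
  classical
  refine card_rankSet_eq ?_ fun j hj k hk hjk => ?_
  · have h1 := h.arm i (!(z i).2)
    rw [relCount, Finset.sum_boole] at h1
    have h2 : M ≤ (Finset.univ.filter
        fun j => j ≠ i ∧ (z i, z j) ∈ armRel p r (!(z i).2)).card := by exact_mod_cast h1
    refine h2.trans (Finset.card_le_card fun j hj => ?_)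
    obtain ⟨-, -, -, hj2⟩ := Finset.mem_filter.1 hj
    exact mem_oppositeArm.2 hj2
  · by_contra hne
    have hne' : ∀ j ∈ (oppositeArm (fun j => (z j).2) i : Set (Fin n)), i ≠ j := by
      rintro j hj rfl
      rw [Finset.mem_coe, mem_oppositeArm] at hj
      exact absurd hj (by simp)
    exact hinj i j k (hne' j hj) (hne' k hk) hne hjk

/-- Any unit that `i` is matched to lies within `r'` of `i`, and there are at most `L` of these. -/
lemma GoodSample.abs_weight_le (h : GoodSample M r r' L z) (hc₁ : 0 < c₁) (hc₂ : 0 ≤ c₂)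
    (hd : ∀ v, c₁ * ‖v‖ ≤ d v ∧ d v ≤ c₂ * ‖v‖) (hr : c₂ * r ≤ c₁ * r')
    {s : Fin n → ℝ} (hs : ∀ j, |s j| ≤ 1) (i : Fin n) : |weight (nbrSet M d z) s i| ≤ L := by
  refine (MatchingPolicy.abs_weight_le hs i).trans (le_trans ?_ (h.ball i))
  refine card_filter_le_relCount fun j hj => ?_
  have hj' := (Finset.mem_filter.1 hj).2
  refine ⟨(ne_of_mem_nbrSet hj').symm, ?_⟩
  have := h.dist_le_of_mem_nbrSet hc₁ hc₂ hd hr hj'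
  rw [dist_comm] at this
  exact this

/-- Resampling one unit of a good sample changes few matched sets. -/
lemma GoodSample.abs_matchVar_update_sub_le (hM : 1 ≤ M) (h : GoodSample M r r' L z) {k : Fin n}
    {a : Covariate p × Bool} (h' : GoodSample M r r' L (Function.update z k a))
    (hc₁ : 0 < c₁) (hc₂ : 0 ≤ c₂)
    (hd : ∀ v, c₁ * ‖v‖ ≤ d v ∧ d v ≤ c₂ * ‖v‖) (hr : c₂ * r ≤ c₁ * r')
    {s v : Covariate p × Bool → ℝ} {C : ℝ} (hC : 0 ≤ C) (hs : ∀ y, |s y| ≤ 1)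
    (hv : ∀ y, |v y| ≤ C) :
    |matchVar M d s v z - matchVar M d s v (Function.update z k a)| ≤
      6 * C * (1 + L) ^ 2 * (1 + 2 * L) / n := by
  classical
  set z' := Function.update z k a with hz'
  have hL := h.nonneg k
  have hz'k : z' k = a := by simp [hz']
  have hz'j : ∀ j, j ≠ k → z' j = z j := fun j hj => by simp [hz', hj]
  -- Only unit `k` and the units close to its old or to its new position can have their matched sets
  -- altered, at most `1 + 2 L` in all. The new position is controlled because the resampled sample
  -- is good as well.
  set B₁ := Finset.univ.filter fun i => i ≠ k ∧ dist (z i).1 (z k).1 ≤ r' with hB₁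
  set B₂ := Finset.univ.filter fun i => i ≠ k ∧ dist (z i).1 a.1 ≤ r' with hB₂
  have hB₁c : (B₁.card : ℝ) ≤ L :=
    (card_filter_le_relCount fun j hj => (Finset.mem_filter.1 hj).2).trans (h.ball k)
  have hB₂c : (B₂.card : ℝ) ≤ L := by
    refine (card_filter_le_relCount fun j hj => ?_).trans (h'.ball k)
    have hj' := (Finset.mem_filter.1 hj).2
    rw [hz'k, hz'j j hj'.1]
    exact hj'
  have hcard : ((insert k (B₁ ∪ B₂)).card : ℝ) ≤ 1 + 2 * L := by
    have h1 : (insert k (B₁ ∪ B₂)).card ≤ (B₁.card + B₂.card) + 1 :=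
      (Finset.card_insert_le _ _).trans (Nat.add_le_add_right (Finset.card_union_le _ _) 1)
    have h2 : ((insert k (B₁ ∪ B₂)).card : ℝ) ≤ (B₁.card + B₂.card) + 1 := by exact_mod_cast h1
    linarith
  refine (abs_varForm_sub_le hM hC (card_nbrSet_le M d z) (card_nbrSet_le M d z')
    (fun j => hs _) (fun j => hs _) (h.abs_weight_le hc₁ hc₂ hd hr fun j => hs _)
    (h'.abs_weight_le hc₁ hc₂ hd hr fun j => hs _) (fun j => hv _) (fun j => hv _)
    (insert k (B₁ ∪ B₂)) fun i hi => ?_).trans (by gcongr)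
  simp only [Finset.mem_insert, Finset.mem_union, not_or, hB₁, hB₂, Finset.mem_filter,
    Finset.mem_univ, true_and, not_and, not_le] at hi
  obtain ⟨hik, hi1, hi2⟩ := hi
  have hi1 := hi1 hik
  have hi2 := hi2 hik
  refine ⟨?_, by rw [hz'j i hik], by rw [hz'j i hik]⟩
  -- Seen from a unit far from both positions, unit `k` lies beyond the level `c₁ r'`, before and
  -- after, while all matches lie below that level. Hence unit `k` is neither a match nor counted in
  -- the rank of a match.
  have far : ∀ y : Covariate p, r' < dist (z i).1 y → c₁ * r' < d (y - (z i).1) := by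
    intro y hy
    refine lt_of_lt_of_le ?_ (hd _).1
    rw [← dist_eq_norm, dist_comm]
    gcongr
  have far1 := far _ hi1
  have far2 := far _ hi2
  have hle : ∀ j ∈ nbrSet M d z i, d ((z j).1 - (z i).1) ≤ c₁ * r' := fun j hj =>
    (h.le_of_mem_nbrSet hc₂ (fun v => (hd v).2) hj).trans hr
  have hle' : ∀ j ∈ nbrSet M d z' i, d ((z' j).1 - (z' i).1) ≤ c₁ * r' := fun j hj =>
    (h'.le_of_mem_nbrSet hc₂ (fun v => (hd v).2) hj).trans hr
  rw [hz'j i hik] at hle'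
  rw [nbrSet, nbrSet]
  refine rankSet_congr (ρ := c₁ * r') hle (fun j hj => ?_) (fun j hj => ?_)
    fun j hj hj' hjρ l => ?_
  · have := hle' j hj
    by_cases hjk : j = k
    · subst hjk
      rw [hz'k] at this
      linarith
    · rwa [hz'j j hjk] at this
  · have hjk : j ≠ k := by
      rintro rfl
      linarith
    rw [mem_oppositeArm, mem_oppositeArm, hz'j j hjk, hz'j i hik]
  · have hjk : j ≠ k := by
      rintro rfl
      linarith
    simp only [mem_oppositeArm]
    rw [hz'j j hjk, hz'j i hik]
    by_cases hlk : l = k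
    · subst hlk
      rw [hz'k]
      constructor
      · rintro ⟨-, h3⟩
        linarith
      · rintro ⟨-, h3⟩
        linarith
    · rw [hz'j l hlk]

/-- The units `i` for which the distances of two other units, the first one being close, agree up
to a factor near one. -/
def nearTies (A : Matrix (Fin p) (Fin p) ℝ) (r' ε : ℝ) (z : Fin n → Covariate p × Bool)
    (i j k : Fin n) : Prop :=
  (i ≠ j ∧ i ≠ k ∧ j ≠ k) ∧ dist (z j).1 (z i).1 ≤ r' ∧
    (1 - ε) * formNorm A ((z j).1 - (z i).1) ≤ formNorm A ((z k).1 - (z i).1) ∧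
      formNorm A ((z k).1 - (z i).1) ≤ (1 + ε) * formNorm A ((z j).1 - (z i).1)

open scoped Classical in
/-- The number of near ties. -/
def nearTieCount (A : Matrix (Fin p) (Fin p) ℝ) (r' ε : ℝ) (z : Fin n → Covariate p × Bool) : ℝ :=
  ∑ i, ∑ j, ∑ k, if nearTies A r' ε z i j k then 1 else 0

lemma FormClose.formNorm_bounds {A B : Matrix (Fin p) (Fin p) ℝ} {δ : ℝ} (h : FormClose δ A B)
    (hA : PositiveMatrix A) (hB : Bᵀ = B) (hδ0 : 0 ≤ δ) (hδ : δ ≤ 1 / 2)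
    (hd : ∀ v, c₁ * ‖v‖ ≤ formNorm A v ∧ formNorm A v ≤ c₂ * ‖v‖) (v : Covariate p) :
    c₁ / 2 * ‖v‖ ≤ formNorm B v ∧ formNorm B v ≤ 2 * c₂ * ‖v‖ := by
  have h1 := h.formNorm_le_two_mul hA hB hδ v
  have h2 := h.le_two_mul_formNorm hA hB hδ0 hδ v
  have h3 := hd v
  constructor <;> linarith

/-- The matched sets of a good sample with respect to two close norms agree up to near ties. -/
lemma GoodSample.abs_matchVar_sub_le (hM : 1 ≤ M) (h : GoodSample M r r' L z)
    {A B : Matrix (Fin p) (Fin p) ℝ} {δ : ℝ} (hAB : FormClose δ A B)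
    (hA : PositiveMatrix A) (hB : Bᵀ = B) (hδ0 : 0 ≤ δ) (hδ : δ ≤ 1 / 2)
    (hd : ∀ v, c₁ * ‖v‖ ≤ formNorm A v ∧ formNorm A v ≤ c₂ * ‖v‖)
    (hc₁ : 0 < c₁) (hc₂ : 0 ≤ c₂) (hr0 : 0 ≤ r) (hr : 4 * c₂ * r ≤ c₁ * r')
    {s v : Covariate p × Bool → ℝ} {C : ℝ} (hC : 0 ≤ C) (hs : ∀ y, |s y| ≤ 1)
    (hv : ∀ y, |v y| ≤ C) :
    |matchVar M (formNorm B) s v z - matchVar M (formNorm A) s v z| ≤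
      6 * C * (1 + L) ^ 2 * nearTieCount A r' (2 * δ) z / n := by
  classical
  rcases Nat.eq_zero_or_pos n with rfl | hn
  · simp [matchVar, varForm]
  have hL := h.nonneg ⟨0, hn⟩
  have hdB := hAB.formNorm_bounds hA hB hδ0 hδ hd
  have hr1 : c₂ * r ≤ c₁ * r' := by nlinarith [mul_nonneg hc₂ hr0]
  -- The norm of `B` satisfies the bounds of the norm of `A` only with `c₁ / 2` and `2 c₂`, which is
  -- why the hypothesis on the radii carries a factor of four.
  have hr2 : 2 * c₂ * r ≤ c₁ / 2 * r' := by linarith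
  -- The parameter `2 δ` is the loss in `FormClose.formNorm_le_mul`. Outside of `NT` the two norms
  -- order any two opposite units in the same way as soon as one of the two is close.
  set NT := Finset.univ.filter fun i => ∃ j k, nearTies A r' (2 * δ) z i j k with hNT
  have hcard : (NT.card : ℝ) ≤ nearTieCount A r' (2 * δ) z := by
    rw [nearTieCount, Finset.card_eq_sum_ones, hNT, Finset.sum_filter, Nat.cast_sum]
    refine Finset.sum_le_sum fun i _ => ?_
    split_ifs with hi
    · obtain ⟨j, k, hjk⟩ := hi
      have h1 : ∀ j, 0 ≤ ∑ k, if nearTies A r' (2 * δ) z i j k then (1 : ℝ) else 0 := fun j =>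
        Finset.sum_nonneg fun k _ => by split_ifs <;> norm_num
      refine le_trans ?_ (Finset.single_le_sum (fun j _ => h1 j) (Finset.mem_univ j))
      refine le_trans ?_ (Finset.single_le_sum (f := fun k =>
        if nearTies A r' (2 * δ) z i j k then (1 : ℝ) else 0)
        (fun k _ => by split_ifs <;> norm_num) (Finset.mem_univ k))
      simp [hjk]
    · rw [Nat.cast_zero]
      exact Finset.sum_nonneg fun j _ => Finset.sum_nonneg fun k _ => by split_ifs <;> norm_num
  refine (abs_varForm_sub_le hM hC (card_nbrSet_le M (formNorm B) z)
    (card_nbrSet_le M (formNorm A) z) (fun j => hs _) (fun j => hs _)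
    (h.abs_weight_le (by positivity) (by positivity) hdB hr2 fun j => hs _)
    (h.abs_weight_le hc₁ hc₂ hd hr1 fun j => hs _) (fun j => hv _) (fun j => hv _)
    NT fun i hi => ⟨?_, rfl, rfl⟩).trans (by gcongr)
  have hi' : ∀ j k, ¬ nearTies A r' (2 * δ) z i j k := by simpa [hNT] using hi
  symm
  refine rankSet_congr (ρ := c₁ * r') (fun j hj => ?_) (fun j hj => ?_) (fun j _ => Iff.rfl)
    fun j hj _ hjρ k => and_congr_right fun hk => ?_
  · exact (h.le_of_mem_nbrSet hc₂ (fun v => (hd v).2) hj).trans hr1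
  · have h1 := h.le_of_mem_nbrSet (by positivity) (fun v => (hdB v).2) hj
    have h2 := hAB.le_two_mul_formNorm hA hB hδ0 hδ ((z j).1 - (z i).1)
    linarith
  · rcases eq_or_ne j k with rfl | hjk
    · simp
    have hij : ∀ j ∈ oppositeArm (fun j => (z j).2) i, i ≠ j := by
      rintro j hj rfl
      rw [mem_oppositeArm] at hj
      exact absurd hj (by simp)
    have hdist : dist (z j).1 (z i).1 ≤ r' := by
      rw [dist_eq_norm]
      exact le_of_mul_le_mul_left ((hd _).1.trans hjρ) hc₁
    have hno := hi' j k
    simp only [nearTies, not_and, not_le] at hno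
    have hno := hno ⟨hij j hj, hij k hk, hjk⟩ hdist
    have hf0 := formNorm_nonneg A ((z k).1 - (z i).1)
    have hf0' := formNorm_nonneg A ((z j).1 - (z i).1)
    -- A reversed order would give the two `A`-distances a ratio within the near tie range, which
    -- `hno` excludes.
    constructor
    · intro h1
      by_contra! h2
      have h3 := hAB.formNorm_le_mul hA hB hδ0 hδ h2.le
      have h4 := hno (by nlinarith)
      nlinarith
    · intro h1
      by_contra! h2
      have h3 := hAB.formNorm_le_mul hA hB hδ0 hδ h1
      have h4 := hno (by nlinarith)
      linarith

/-- Used with `L = n`, where it bounds the form on every sample by a polynomial in `n`, whether the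
sample is good or not. -/
lemma abs_matchVar_le (hM : 1 ≤ M) {s v : Covariate p × Bool → ℝ} {C : ℝ}
    (hs : ∀ y, |s y| ≤ 1) (hv : ∀ y, |v y| ≤ C) (hC : 0 ≤ C) {L : ℝ} (hL : 0 ≤ L)
    (hK : ∀ i, |weight (nbrSet M d z) (fun i => s (z i)) i| ≤ L) :
    |matchVar M d s v z| ≤ C * (1 + L) ^ 2 := by
  have hM' : (1 : ℝ) ≤ M := by exact_mod_cast hM
  rcases Nat.eq_zero_or_pos n with rfl | hn
  · simp only [matchVar, varForm, CharP.cast_eq_zero, _root_.inv_zero, zero_mul, abs_zero]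
    positivity
  rw [matchVar, varForm, abs_mul, abs_inv, Nat.abs_cast, inv_mul_le_iff₀ (by positivity)]
  calc _ ≤ ∑ _i : Fin n, (1 + L) ^ 2 * C := by
        refine (Finset.abs_sum_le_sum_abs _ _).trans (Finset.sum_le_sum fun i _ => ?_)
        rw [abs_mul, abs_pow]
        gcongr
        · refine (abs_add_le _ _).trans (add_le_add (hs _) ?_)
          rw [abs_div, Nat.abs_cast]
          exact (div_le_self (abs_nonneg _) hM').trans (hK i)
        · exact hv _
    _ = _ := by
        rw [Finset.sum_const, Finset.card_univ, Fintype.card_fin, nsmul_eq_mul]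
        ring

lemma abs_weight_nbrSet_le_card {s : Fin n → ℝ} (hs : ∀ y, |s y| ≤ 1) (i : Fin n) :
    |weight (nbrSet M d z) s i| ≤ n := by
  refine (MatchingPolicy.abs_weight_le hs i).trans ?_
  exact_mod_cast (Finset.card_le_univ _).trans_eq (Fintype.card_fin n)

end Deterministic

end Matching

/-! ### Probabilities of bad samples and of near ties, and the variance of the variance form -/

section Bounds

open Matrix

variable {p : ℕ} {Q : Measure (Covariate p × Bool)} {S : Set (Covariate p)}

lemma RegularDesign.real_le (hQ : RegularDesign Q S) : ∃ b : ℝ, 0 < b ∧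
    ∀ (B : Set (Covariate p)) (m : ℝ), 0 ≤ m → volume B ≤ ENNReal.ofReal m →
      Q (Prod.fst ⁻¹' B) ≤ ENNReal.ofReal (b * m) := by
  obtain ⟨b, hb, h⟩ := hQ.exists_upper
  refine ⟨b, hb, fun B m hm hB => (h B).trans ?_⟩
  rw [ENNReal.ofReal_mul hb.le]
  gcongr

lemma RegularDesign.exists_ball_le [IsProbabilityMeasure Q] (hQ : RegularDesign Q S) :
    ∃ K : ℝ, 0 < K ∧ ∀ (x : Covariate p) (r : ℝ), 0 ≤ r →
      Q {z | dist z.1 x ≤ r} ≤ ENNReal.ofReal (K * r ^ p) := by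
  obtain ⟨b, hb, h⟩ := hQ.real_le
  refine ⟨b * volume.real (Metric.ball (0 : Covariate p) 1), ?_, fun x r hr => ?_⟩
  · have : 0 < volume.real (Metric.ball (0 : Covariate p) 1) :=
      ENNReal.toReal_pos (Metric.measure_ball_pos _ _ one_pos).ne' measure_ball_lt_top.ne
    positivity
  · refine (h (Metric.closedBall x r) (r ^ p * volume.real (Metric.ball (0 : Covariate p) 1))
      (by positivity) ?_).trans_eq (by ring_nf)
    rw [Measure.addHaar_closedBall _ _ hr, finrank_euclideanSpace, Fintype.card_fin,
      ENNReal.ofReal_mul (by positivity), ofReal_measureReal measure_ball_lt_top.ne]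

variable [IsProbabilityMeasure Q]

/-- Samples are good with high probability. -/
lemma RegularDesign.exists_goodSample_bound (hQ : RegularDesign Q S) :
    ∃ κ K : ℝ, 0 < κ ∧ 0 < K ∧ ∀ (M n : ℕ) (r r' L : ℝ), 0 ≤ r → r ≤ 1 → 0 ≤ r' →
      (sampleLaw Q n).real {z | ¬ GoodSample M r r' L z} ≤
        2 * n * Real.exp (M - (n - 1) * (κ * r ^ p) / 2) +
          n * Real.exp (2 * n * (K * r' ^ p) - L) := by
  obtain ⟨κ, hκ, hlow⟩ := hQ.exists_lower
  obtain ⟨K, hK, hup⟩ := hQ.exists_ball_le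
  refine ⟨κ, K, hκ, hK, fun M n r r' L hr0 hr1 hr' => ?_⟩
  have hsub : {z : Fin n → Covariate p × Bool | ¬ GoodSample M r r' L z} ⊆
      (⋃ i, ⋃ w, {z | relCount (armRel p r w) i z ≤ M}) ∪
        ⋃ i, {z | L ≤ relCount (ballRel p r') i z} := by
    intro z hz
    by_contra hcon
    simp only [Set.mem_union, Set.mem_iUnion, Set.mem_ofPred_eq, not_or, not_exists, not_le] at hcon
    exact hz ⟨fun i w => (hcon.1 i w).le, fun i => (hcon.2 i).le⟩
  refine (measureReal_mono hsub).trans ((measureReal_union_le _ _).trans (add_le_add ?_ ?_))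
  · calc _ ≤ ∑ _i : Fin n, ∑ _w : Bool, Real.exp (M - (n - 1) * (κ * r ^ p) / 2) := by
          refine (measureReal_iUnion_fintype_le _).trans (Finset.sum_le_sum fun i _ => ?_)
          refine (measureReal_iUnion_fintype_le _).trans (Finset.sum_le_sum fun w _ => ?_)
          refine sampleLaw_relCount_le_le Q (measurableSet_armRel r w) i ?_ _
          filter_upwards [hQ.ae_mem] with a ha
          exact hlow a.1 ha w r hr0 hr1
      _ = _ := by
          simp only [Finset.sum_const, Finset.card_univ, Fintype.card_fin, Fintype.card_bool,
            nsmul_eq_mul]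
          push_cast
          ring
  · calc _ ≤ ∑ _i : Fin n, Real.exp (2 * n * (K * r' ^ p) - L) := by
          refine (measureReal_iUnion_fintype_le _).trans (Finset.sum_le_sum fun i _ => ?_)
          refine sampleLaw_le_relCount_le Q (measurableSet_ballRel r') i (by positivity)
            (ae_of_all _ fun a => ?_) _
          exact ENNReal.toReal_le_of_le_ofReal (by positivity) (hup a.1 r' hr')
      _ = _ := by
          simp only [Finset.sum_const, Finset.card_univ, Fintype.card_fin, nsmul_eq_mul]

/-- Markov's inequality for the number of events that occur; no independence is involved. -/
lemma sum_measureReal_bound {β ι : Type*} [Fintype ι] [MeasurableSpace β] (ν : Measure β)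
    [IsFiniteMeasure ν] {E : ι → Set β} (hE : ∀ i, MeasurableSet (E i)) {q T : ℝ} (hT : 0 < T)
    (hq : ∀ i, ν.real (E i) ≤ q) :
    ν.real {b | T ≤ ∑ i, (E i).indicator (fun _ => (1 : ℝ)) b} ≤ Fintype.card ι * q / T := by
  have hint : ∀ i, Integrable ((E i).indicator fun _ => (1 : ℝ)) ν := fun i =>
    (integrable_const (1 : ℝ)).indicator (hE i)
  have h := mul_meas_ge_le_integral_of_nonneg (μ := ν)
    (f := fun b => ∑ i, (E i).indicator (fun _ => (1 : ℝ)) b)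
    (ae_of_all _ fun b => Finset.sum_nonneg fun i _ => Set.indicator_nonneg (by simp) b)
    (integrable_finsetSum _ fun i _ => hint i) T
  rw [le_div_iff₀ hT, mul_comm]
  refine h.trans ?_
  rw [integral_finsetSum _ fun i _ => hint i]
  calc _ ≤ ∑ _i : ι, q := Finset.sum_le_sum fun i _ => by
        rw [integral_indicator_const _ (hE i)]
        simpa using hq i
    _ = _ := by simp

/-- There are few near ties. -/
lemma RegularDesign.exists_nearTieCount_bound (hp : 1 ≤ p) (hQ : RegularDesign Q S)
    {A : Matrix (Fin p) (Fin p) ℝ} (hA : PositiveMatrix A) :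
    ∃ K : ℝ, 0 < K ∧ ∀ (n : ℕ) (r' ε T : ℝ), 0 ≤ r' → 0 < ε → ε ≤ 1 / 2 → 0 < T →
      (sampleLaw Q n).real {z | T ≤ nearTieCount A r' ε z} ≤
        K * n ^ 3 * ε * r' ^ p * r' ^ p / T := by
  classical
  obtain ⟨b, hb, hup⟩ := hQ.real_le
  obtain ⟨K, hK, hball⟩ := hQ.exists_ball_le
  obtain ⟨c₁, c₂, hc₁, hc₂, hd⟩ := exists_formNorm_bounds hp hA
  have hV : 0 ≤ formBallVolume A := measureReal_nonneg
  set K' := b * ((3 ^ p + 2 * p) * c₂ ^ p * formBallVolume A) with hK'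
  have hK'0 : 0 ≤ K' := by positivity
  refine ⟨K' * K + 1, by positivity, fun n r' ε T hr' hε0 hε hT => ?_⟩
  let E : Fin n × Fin n × Fin n → Set (Fin n → Covariate p × Bool) :=
    fun t => {z | nearTies A r' ε z t.1 t.2.1 t.2.2}
  have hfm : ∀ i j : Fin n, Measurable fun z : Fin n → Covariate p × Bool =>
      formNorm A ((z j).1 - (z i).1) := fun i j =>
    (continuous_formNorm A).measurable.comp ((measurable_eval_fst j).sub (measurable_eval_fst i))
  have hdm : ∀ i j : Fin n, MeasurableSet {z : Fin n → Covariate p × Bool |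
      dist (z j).1 (z i).1 ≤ r'} := fun i j =>
    measurableSet_le ((measurable_eval_fst j).dist (measurable_eval_fst i)) measurable_const
  have hEm : ∀ t, MeasurableSet (E t) := fun t => by
    refine (MeasurableSet.const _).inter ((hdm t.1 t.2.1).inter (MeasurableSet.inter ?_ ?_))
    · exact measurableSet_le ((hfm _ _).const_mul _) (hfm _ _)
    · exact measurableSet_le (hfm _ _) ((hfm _ _).const_mul _)
  have hEq : ∀ t, (sampleLaw Q n).real (E t) ≤ K' * ε * r' ^ p * (K * r' ^ p) := by
    rintro ⟨i, j, k⟩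
    refine ENNReal.toReal_le_of_le_ofReal (by positivity) ?_
    rw [ENNReal.ofReal_mul (by positivity)]
    by_cases hne : i ≠ j ∧ i ≠ k ∧ j ≠ k
    swap
    · have : E (i, j, k) = ∅ := by
        ext z
        simp only [E, Set.mem_ofPred_eq, Set.mem_empty_iff_false, iff_false]
        exact fun h => hne h.1
      rw [this, measure_empty]
      exact zero_le
    obtain ⟨hij, hik, hjk⟩ := hne
    -- Resample unit `k`: given units `i` and `j`, it has to fall into an annulus about unit `i` of
    -- relative width `ε` and radius at most `c₂ r'`. This gives the factor `ε r' ^ p`.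
    have h1 : sampleLaw Q n (E (i, j, k)) ≤ ENNReal.ofReal (K' * ε * r' ^ p) *
        sampleLaw Q n {z | dist (z j).1 (z i).1 ≤ r'} := by
      refine sampleLaw_le_mul_of_update Q k (hEm _) (hdm i j) (ae_of_all _ fun z hz => ?_)
        (ae_of_all _ fun z hz => ?_)
      · set t := formNorm A ((z j).1 - (z i).1) with ht
        have ht0 : 0 ≤ t := formNorm_nonneg _ _
        have ht1 : t ≤ c₂ * r' := by
          refine (hd _).2.trans ?_
          rw [← dist_eq_norm]
          have hz' : dist (z j).1 (z i).1 ≤ r' := hz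
          gcongr
        refine (measure_mono (t := Prod.fst ⁻¹' ((fun x => x - (z i).1) ⁻¹' {v | (1 - ε) * t ≤
          formNorm A v ∧ formNorm A v ≤ (1 + ε) * t})) fun a ha => ?_).trans
          ((hup _ ((3 ^ p + 2 * p) * ε * t ^ p * formBallVolume A) (by positivity) ?_).trans ?_)
        · have h := ha.2.2
          simp only [Function.update_of_ne hik, Function.update_of_ne hjk,
            Function.update_self] at h
          exact h
        · simp only [sub_eq_add_neg (_ : Covariate p)]
          rw [measure_preimage_add_right]
          exact volume_annulus_le hp hA ht0 hε0 hε
        · refine ENNReal.ofReal_le_ofReal ?_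
          calc b * ((3 ^ p + 2 * p) * ε * t ^ p * formBallVolume A)
              ≤ b * ((3 ^ p + 2 * p) * ε * (c₂ * r') ^ p * formBallVolume A) := by gcongr
            _ = _ := by rw [hK', mul_pow]; ring
      · refine measure_mono_null (t := ∅) (fun a ha => hz ?_) measure_empty
        have h := ha.2.1
        simp only [Function.update_of_ne hik, Function.update_of_ne hjk] at h
        exact h
    refine h1.trans ?_
    gcongr
    -- Resample unit `j`: it has to fall into the ball of radius `r'` about unit `i`, which gives
    -- the second factor `r' ^ p`.
    have h2 := sampleLaw_le_mul_of_update Q j (hdm i j) MeasurableSet.univ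
      (q := ENNReal.ofReal (K * r' ^ p)) (ae_of_all _ fun z _ => ?_)
      (ae_of_all _ fun z hz => absurd (Set.mem_univ z) hz)
    · simpa using h2
    · refine le_trans (measure_mono fun a ha => ?_) (hball (z i).1 r' hr')
      have h : dist (Function.update z j a j).1 (Function.update z j a i).1 ≤ r' := ha
      simp only [Function.update_of_ne hij, Function.update_self] at h
      exact h
  have h := sum_measureReal_bound (sampleLaw Q n) hEm hT hEq
  have e : ∀ z, nearTieCount A r' ε z = ∑ t, (E t).indicator (fun _ => (1 : ℝ)) z := by
    intro z
    rw [nearTieCount, Fintype.sum_prod_type]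
    refine Finset.sum_congr rfl fun i _ => ?_
    rw [Fintype.sum_prod_type]
    refine Finset.sum_congr rfl fun j _ => Finset.sum_congr rfl fun k _ => ?_
    rw [Set.indicator_apply]
    rfl
  simp only [← e] at h
  refine h.trans ?_
  simp only [Fintype.card_prod, Fintype.card_fin]
  push_cast
  gcongr ?_ / _
  calc (n : ℝ) * (n * n) * (K' * ε * r' ^ p * (K * r' ^ p))
      = (K' * K) * n ^ 3 * ε * r' ^ p * r' ^ p := by ring
    _ ≤ _ := by gcongr; linarith

/-- The variance form has a small variance. -/
lemma integral_matchVar_sub_sq_le {M n : ℕ} (hM : 1 ≤ M) (hn : 0 < n) {r r' L c₁ c₂ : ℝ}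
    {d : Covariate p → ℝ} (hdc : Continuous d)
    (hc₁ : 0 < c₁) (hc₂ : 0 ≤ c₂)
    (hd : ∀ v, c₁ * ‖v‖ ≤ d v ∧ d v ≤ c₂ * ‖v‖) (hr : c₂ * r ≤ c₁ * r')
    {s v : Covariate p × Bool → ℝ} {C : ℝ} (hC : 0 ≤ C) (hs : ∀ y, |s y| ≤ 1)
    (hv : ∀ y, |v y| ≤ C) (hsm : Measurable s) (hvm : Measurable v) :
    ∫ z, (matchVar M d s v z - ∫ z', matchVar M d s v z' ∂sampleLaw Q n) ^ 2 ∂sampleLaw Q n ≤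
      (6 * C * (1 + L) ^ 2 * (1 + 2 * L)) ^ 2 / n +
        8 * C ^ 2 * (n * (1 + n) ^ 4) * (sampleLaw Q n).real {z | ¬ GoodSample M r r' L z} := by
  have hVm : Measurable fun z : Fin n → Covariate p × Bool => matchVar M d s v z :=
    measurable_matchVar M (D := fun _ => d) (fun i => measurable_pi_apply i)
      (fun i j => hdc.measurable.comp ((measurable_eval_fst j).sub (measurable_eval_fst i))) hsm hvm
  have hVb : ∀ z : Fin n → Covariate p × Bool, |matchVar M d s v z| ≤ C * (1 + n) ^ 2 := fun z =>
    abs_matchVar_le hM hs hv hC (Nat.cast_nonneg n)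
      (abs_weight_nbrSet_le_card (s := fun i => s (z i)) fun _ => hs _)
  refine (integral_sub_sq_le_sum_update Q hVm hVb).trans ?_
  -- The squared change under resampling when both samples are good; summed over the `n` units it is
  -- of order `1 / n`, up to powers of `L`.
  set b := (6 * C * (1 + L) ^ 2 * (1 + 2 * L) / n) ^ 2 with hb
  have hn' : (0 : ℝ) < n := by exact_mod_cast hn
  have hb0 : 0 ≤ b := sq_nonneg _
  set G := {z : Fin n → Covariate p × Bool | ¬ GoodSample M r r' L z} with hG
  have hGm : MeasurableSet G := (measurableSet_goodSample M r r' L).compl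
  have hterm : ∀ k, ∫ z, ∫ a, (matchVar M d s v z - matchVar M d s v (Function.update z k a)) ^ 2 ∂Q
      ∂sampleLaw Q n ≤ b + 2 * ((2 * (C * (1 + n) ^ 2)) ^ 2 * (sampleLaw Q n).real G) := by
    intro k
    set B := (2 * (C * (1 + (n : ℝ)) ^ 2)) ^ 2 with hB
    have hB0 : 0 ≤ B := sq_nonneg _
    have hum := measurable_update_prod (α := Covariate p × Bool) k
    have hm : Measurable fun q : (Fin n → Covariate p × Bool) × (Covariate p × Bool) =>
        (matchVar M d s v q.1 - matchVar M d s v (Function.update q.1 k q.2)) ^ 2 :=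
      ((hVm.comp measurable_fst).sub (hVm.comp hum)).pow_const 2
    have hint := Integrable.of_bound (μ := (sampleLaw Q n).prod Q) hm.aestronglyMeasurable B
      (ae_of_all _ fun q => abs_sub_sq_le (hVb _) (hVb _))
    rw [← integral_prod _ hint]
    have hGi : Integrable (G.indicator fun _ => B) (sampleLaw Q n) :=
      (integrable_const B).indicator hGm
    have hi1 : Integrable (fun q : (Fin n → Covariate p × Bool) × (Covariate p × Bool) =>
        G.indicator (fun _ => B) q.1) ((sampleLaw Q n).prod Q) := hGi.comp_fst Q
    have hi2 : Integrable (fun q : (Fin n → Covariate p × Bool) × (Covariate p × Bool) =>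
        G.indicator (fun _ => B) (Function.update q.1 k q.2)) ((sampleLaw Q n).prod Q) := by
      rw [← map_update_sampleLaw Q k] at hGi
      exact hGi.comp_measurable hum
    have e1 : ∫ q, G.indicator (fun _ => B) q.1 ∂((sampleLaw Q n).prod Q) =
        (sampleLaw Q n).real G * B := by
      rw [integral_fun_fst (fun z => G.indicator (fun _ => B) z), integral_indicator_const _ hGm]
      simp
    have e2 : ∫ q, G.indicator (fun _ => B) (Function.update q.1 k q.2) ∂((sampleLaw Q n).prod Q) =
        (sampleLaw Q n).real G * B := by
      have hmap := integral_map (μ := (sampleLaw Q n).prod Q) hum.aemeasurable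
        (f := G.indicator fun _ => B)
        (measurable_const.indicator hGm).aestronglyMeasurable
      rw [← hmap, map_update_sampleLaw, integral_indicator_const _ hGm, smul_eq_mul]
    -- If the original or the resampled sample is bad, the crude bound `B` is charged to that event.
    -- The resampled sample has the same law, so the two charges are equal, which explains the
    -- factor `2` above.
    have hle : ∀ q : (Fin n → Covariate p × Bool) × (Covariate p × Bool),
        (matchVar M d s v q.1 - matchVar M d s v (Function.update q.1 k q.2)) ^ 2 ≤
          b + (G.indicator (fun _ => B) q.1 +
            G.indicator (fun _ => B) (Function.update q.1 k q.2)) := by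
      intro q
      have hnn : ∀ z, 0 ≤ G.indicator (fun _ => B) z := fun z =>
        Set.indicator_nonneg (fun _ _ => hB0) z
      have hbig := abs_sub_sq_le (hVb q.1) (hVb (Function.update q.1 k q.2))
      rw [abs_of_nonneg (sq_nonneg _)] at hbig
      by_cases h1 : q.1 ∈ G
      · rw [Set.indicator_of_mem h1]
        have := hnn (Function.update q.1 k q.2)
        linarith
      by_cases h2 : Function.update q.1 k q.2 ∈ G
      · rw [Set.indicator_of_mem h2]
        have := hnn q.1
        linarith
      have h1' : GoodSample M r r' L q.1 := not_not.1 h1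
      have h2' : GoodSample M r r' L (Function.update q.1 k q.2) := not_not.1 h2
      have h3 := h1'.abs_matchVar_update_sub_le hM h2' hc₁ hc₂ hd hr hC hs hv
      have h4 := hnn q.1
      have h5 := hnn (Function.update q.1 k q.2)
      have h6 : (matchVar M d s v q.1 - matchVar M d s v (Function.update q.1 k q.2)) ^ 2 ≤ b := by
        rw [← sq_abs, hb]
        gcongr
      linarith
    have hi12 : Integrable (fun q : (Fin n → Covariate p × Bool) × (Covariate p × Bool) =>
        G.indicator (fun _ => B) q.1 + G.indicator (fun _ => B) (Function.update q.1 k q.2))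
        ((sampleLaw Q n).prod Q) := hi1.add hi2
    calc _ ≤ ∫ q, (b + (G.indicator (fun _ => B) q.1 +
            G.indicator (fun _ => B) (Function.update q.1 k q.2))) ∂((sampleLaw Q n).prod Q) :=
          integral_mono hint ((integrable_const b).add hi12) hle
      _ = b + ((sampleLaw Q n).real G * B + (sampleLaw Q n).real G * B) := by
          rw [integral_add (integrable_const b) hi12, integral_add hi1 hi2, e1, e2]
          simp
      _ = _ := by ring
  refine (Finset.sum_le_sum fun k _ => hterm k).trans ?_
  rw [Finset.sum_const, Finset.card_univ, Fintype.card_fin, nsmul_eq_mul, hb]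
  apply le_of_eq
  field_simp
  ring

end Bounds

/-! ### Choice of rates, the matching event, and concentration of the variance form -/

section Asymptotics

open Matrix

/-- The rate `n^{1/64}`. -/
def rate (n : ℕ) : ℝ := (n : ℝ) ^ (1 / 64 : ℝ)

/-- With `u = rate n` one has `n = u^64`, so comparing rates is arithmetic of exponents: `n r^p = u`
for the radius, weights of at most `u²`, a covariance error of order `u⁻¹⁶`, and at most `u^51` near
ties. -/
lemma rate_pow (n : ℕ) : rate n ^ 64 = n := by
  rw [rate, ← Real.rpow_natCast, ← Real.rpow_mul (Nat.cast_nonneg n)]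
  norm_num

lemma rate_nonneg (n : ℕ) : 0 ≤ rate n := by unfold rate; positivity

lemma tendsto_rate : Tendsto rate atTop atTop :=
  (tendsto_rpow_atTop (by norm_num)).comp tendsto_natCast_atTop_atTop

lemma one_le_rate {n : ℕ} (hn : 1 ≤ n) : 1 ≤ rate n :=
  Real.one_le_rpow (by exact_mod_cast hn) (by norm_num)

/-- The radius `r` with `n r ^ p = n^{1/64}`. -/
def radius (p n : ℕ) : ℝ := (rate n ^ 63)⁻¹ ^ (1 / p : ℝ)

lemma radius_nonneg (p n : ℕ) : 0 ≤ radius p n := by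
  have := rate_nonneg n
  unfold radius
  positivity

lemma radius_pow {p : ℕ} (hp : 1 ≤ p) (n : ℕ) : radius p n ^ p = (rate n ^ 63)⁻¹ := by
  have h0 : 0 ≤ (rate n ^ 63)⁻¹ := by have := rate_nonneg n; positivity
  rw [radius, ← Real.rpow_natCast, ← Real.rpow_mul h0, one_div,
    inv_mul_cancel₀ (by exact_mod_cast (by omega : p ≠ 0)), Real.rpow_one]

lemma radius_le_one (p : ℕ) {n : ℕ} (hn : 1 ≤ n) : radius p n ≤ 1 := by
  have h1 : 1 ≤ rate n ^ 63 := one_le_pow₀ (one_le_rate hn)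
  exact Real.rpow_le_one (by positivity) (inv_le_one_of_one_le₀ h1) (by positivity)

lemma tendsto_radius {p : ℕ} (hp : 1 ≤ p) : Tendsto (radius p) atTop (𝓝 0) := by
  have h1 : Tendsto (fun n => (rate n ^ 63)⁻¹) atTop (𝓝 0) :=
    ((tendsto_pow_atTop (by norm_num)).comp tendsto_rate).inv_tendsto_atTop
  have hp' : (0 : ℝ) < 1 / p := by
    have : (0 : ℝ) < p := by exact_mod_cast hp
    positivity
  have h2 := h1.rpow_const (Or.inr hp'.le) (p := (1 / p : ℝ))
  rwa [Real.zero_rpow hp'.ne'] at h2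

lemma tendsto_rate_pow_mul_exp (C a : ℝ) (ha : 0 < a) (k : ℕ) :
    Tendsto (fun n => rate n ^ k * Real.exp (C - a * rate n)) atTop (𝓝 0) := by
  have h := (Real.tendsto_pow_mul_exp_neg_atTop_nhds_zero k).comp
    (tendsto_rate.const_mul_atTop ha)
  have h2 := h.const_mul (Real.exp C / a ^ k)
  rw [mul_zero] at h2
  refine h2.congr fun n => ?_
  simp only [Function.comp_apply]
  rw [sub_eq_add_neg, Real.exp_add, mul_pow]
  field_simp

variable {p : ℕ} {Q : Measure (Covariate p × Bool)} {S : Set (Covariate p)}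
  [IsProbabilityMeasure Q]

/-- Samples are good with high probability, at every polynomial rate. -/
lemma RegularDesign.tendsto_goodSample (hp : 1 ≤ p) (hQ : RegularDesign Q S) (M k : ℕ) {a : ℝ}
    (ha : 0 ≤ a) :
    Tendsto (fun n : ℕ => rate n ^ k * (sampleLaw Q n).real
      {z | ¬ GoodSample M (radius p n) (a * radius p n) (rate n ^ 2) z}) atTop (𝓝 0) := by
  obtain ⟨κ, K, hκ, hK, h⟩ := hQ.exists_goodSample_bound
  have hlim : Tendsto (fun n => 2 * (rate n ^ (k + 64) * Real.exp ((M + κ / 2) - κ / 2 * rate n)) +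
      rate n ^ (k + 64) * Real.exp (0 - 1 * rate n)) atTop (𝓝 0) := by
    have := ((tendsto_rate_pow_mul_exp (M + κ / 2) (κ / 2) (by positivity) (k + 64)).const_mul
      2).add (tendsto_rate_pow_mul_exp 0 1 one_pos (k + 64))
    simpa using this
  refine squeeze_zero' (Eventually.of_forall fun n => ?_) ?_ hlim
  · have := rate_nonneg n
    positivity
  -- The expected number of units in a ball of radius `a r` is of order `u`, so for large `u` the
  -- level `u²` leaves an exponent of at most `-u` in the upper tail bound. The lower tail has
  -- exponent about `-κ u / 2`. Both beat every power of `u`.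
  filter_upwards [eventually_ge_atTop 1, tendsto_rate.eventually_ge_atTop (2 * (K * a ^ p) + 1)]
    with n hn hn2
  have hu1 := one_le_rate hn
  have hu0 : 0 < rate n := by linarith
  have hb := h M n (radius p n) (a * radius p n) (rate n ^ 2) (radius_nonneg p n)
    (radius_le_one p hn) (mul_nonneg ha (radius_nonneg p n))
  rw [mul_pow, radius_pow hp, ← rate_pow n] at hb
  have h2 : (rate n ^ 63)⁻¹ ≤ 1 := inv_le_one_of_one_le₀ (one_le_pow₀ hu1)
  have hE1 : M - (rate n ^ 64 - 1) * (κ * (rate n ^ 63)⁻¹) / 2 ≤ M + κ / 2 - κ / 2 * rate n := by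
    have e : (rate n ^ 64 - 1) * (κ * (rate n ^ 63)⁻¹) / 2 =
        κ / 2 * rate n - κ / 2 * (rate n ^ 63)⁻¹ := by
      field_simp
    rw [e]
    nlinarith
  have hE2 : 2 * rate n ^ 64 * (K * (a ^ p * (rate n ^ 63)⁻¹)) - rate n ^ 2 ≤ 0 - 1 * rate n := by
    have e : 2 * rate n ^ 64 * (K * (a ^ p * (rate n ^ 63)⁻¹)) = 2 * (K * a ^ p) * rate n := by
      field_simp
    rw [e]
    nlinarith
  calc _ ≤ rate n ^ k * _ := mul_le_mul_of_nonneg_left hb (by positivity)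
    _ ≤ rate n ^ k * (2 * rate n ^ 64 * Real.exp ((M + κ / 2) - κ / 2 * rate n) +
        rate n ^ 64 * Real.exp (0 - 1 * rate n)) :=
      mul_le_mul_of_nonneg_left (add_le_add
        (mul_le_mul_of_nonneg_left (Real.exp_le_exp.2 hE1) (by positivity))
        (mul_le_mul_of_nonneg_left (Real.exp_le_exp.2 hE2) (by positivity))) (by positivity)
    _ = _ := by ring

/-- The error `t = u⁻¹⁶` is much larger than `n^(-1/2) = u⁻³²`, so Chebyshev leaves `K / (n t²) = K
u⁻³²`. -/
lemma RegularDesign.exists_tendsto_formClose (hp : 1 ≤ p) (hQ : RegularDesign Q S) :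
    ∃ K : ℝ, 0 < K ∧ Tendsto (fun n : ℕ => (sampleLaw Q n).real
      {z | ¬ FormClose (K * (rate n ^ 16)⁻¹) (popCov Q S) (sampleCov fun i => (z i).1)})
        atTop (𝓝 0) := by
  obtain ⟨K, hK, h⟩ := hQ.exists_formClose hp
  refine ⟨K, hK, ?_⟩
  have hlim : Tendsto (fun n => K * (rate n ^ 32)⁻¹) atTop (𝓝 0) := by
    have := (((tendsto_pow_atTop (by norm_num : (32 : ℕ) ≠ 0)).comp
      tendsto_rate).inv_tendsto_atTop).const_mul K
    simpa using this
  refine squeeze_zero' (Eventually.of_forall fun n => measureReal_nonneg) ?_ hlim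
  filter_upwards [eventually_ge_atTop 1] with n hn
  have hu1 := one_le_rate hn
  have hu0 : 0 < rate n := by linarith
  refine (h n (rate n ^ 16)⁻¹ (by omega) (by positivity)).trans (le_of_eq ?_)
  rw [← rate_pow n]
  field_simp

lemma tendsto_const_mul_inv_rate_pow (C : ℝ) {k : ℕ} (hk : k ≠ 0) :
    Tendsto (fun n => C * (rate n ^ k)⁻¹) atTop (𝓝 0) := by
  have := (((tendsto_pow_atTop hk).comp tendsto_rate).inv_tendsto_atTop).const_mul C
  simpa using this

/-- With probability tending to one, all matched sets have `M` elements, all matches are close, and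
no weight is large. -/
lemma RegularDesign.exists_tendsto_matching (hp : 1 ≤ p) (hQ : RegularDesign Q S) (M : ℕ) :
    ∃ ρ : ℕ → ℝ, Tendsto ρ atTop (𝓝 0) ∧ Tendsto (fun n : ℕ => (sampleLaw Q n).real
      {z | ¬ ((∀ i, (nbrSet M (formNorm (sampleCov fun i => (z i).1)) z i).card = M) ∧
        (∀ i, ∀ j ∈ nbrSet M (formNorm (sampleCov fun i => (z i).1)) z i,
          dist (z j).1 (z i).1 ≤ ρ n) ∧
        ∀ s : Fin n → ℝ, (∀ j, |s j| ≤ 1) → ∀ i,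
          |weight (nbrSet M (formNorm (sampleCov fun i => (z i).1)) z) s i| ≤ rate n ^ 2)})
      atTop (𝓝 0) := by
  have hA := hQ.positiveMatrix_popCov
  obtain ⟨c₁, c₂, hc₁, hc₂, hd⟩ := exists_formNorm_bounds hp hA
  obtain ⟨K, hK, hclose⟩ := hQ.exists_tendsto_formClose hp
  -- This choice makes `2 c₂ r = (c₁ / 2) (a r)`, the relation between the radii needed for the
  -- Mahalanobis norm.
  set a := 4 * c₂ / c₁ with ha
  have ha0 : 0 ≤ a := by positivity
  have hgood := hQ.tendsto_goodSample hp M 0 ha0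
  simp only [pow_zero, one_mul] at hgood
  refine ⟨fun n => a * radius p n, by simpa using (tendsto_radius hp).const_mul a, ?_⟩
  have hsum := hclose.add hgood
  rw [add_zero] at hsum
  refine squeeze_zero' (Eventually.of_forall fun n => measureReal_nonneg) ?_ hsum
  filter_upwards [hQ.ae_no_ties hp, eventually_ge_atTop 1,
    (tendsto_const_mul_inv_rate_pow K (k := 16) (by norm_num)).eventually_le_const
      (show (0 : ℝ) < 1 / 2 by norm_num)] with n hties hn hδ
  have hu0 := rate_nonneg n
  refine le_trans ?_ (measureReal_union_le _ _)
  refine ENNReal.toReal_mono (measure_ne_top _ _) (measure_mono_ae ?_)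
  filter_upwards [hties] with z hz hbad
  by_contra hcon
  have hcon1 : FormClose (K * (rate n ^ 16)⁻¹) (popCov Q S) (sampleCov fun i => (z i).1) := by
    by_contra h; exact hcon (Or.inl h)
  have hcon2 : GoodSample M (radius p n) (a * radius p n) (rate n ^ 2) z := by
    by_contra h; exact hcon (Or.inr h)
  have hdB := hcon1.formNorm_bounds hA (transpose_sampleCov _) (by positivity) hδ hd
  have hr : 2 * c₂ * radius p n ≤ c₁ / 2 * (a * radius p n) := by
    apply le_of_eq
    rw [ha]
    field_simp
    ring
  refine hbad ⟨hcon2.card_nbrSet (hz fun u => (hcon1 u).trans ?_), fun i j hj => ?_,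
    fun s hs i => ?_⟩
  · have := hA.nonneg u
    gcongr
  · exact hcon2.dist_le_of_mem_nbrSet (by positivity) (by positivity) hdB hr hj
  · exact hcon2.abs_weight_le (by positivity) (by positivity) hdB hr hs i

/-- The variance form of the matching weights is asymptotically deterministic. -/
theorem RegularDesign.exists_matchVar_concentration (hp : 1 ≤ p) (hQ : RegularDesign Q S) {M : ℕ}
    (hM : 1 ≤ M) {s v : Covariate p × Bool → ℝ} {C : ℝ} (hs : ∀ y, |s y| ≤ 1)
    (hv : ∀ y, |v y| ≤ C) (hsm : Measurable s) (hvm : Measurable v) :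
    ∃ c : ℕ → ℝ, ∀ ε : ℝ, 0 < ε → Tendsto (fun n : ℕ => (sampleLaw Q n).real
      {z | ε ≤ |matchVar M (formNorm (sampleCov fun i => (z i).1)) s v z - c n|}) atTop (𝓝 0) := by
  have hC : 0 ≤ C := (abs_nonneg _).trans (hv (0, true))
  set A := popCov Q S with hAdef
  have hA : PositiveMatrix A := hQ.positiveMatrix_popCov
  obtain ⟨c₁, c₂, hc₁, hc₂, hd⟩ := exists_formNorm_bounds hp hA
  obtain ⟨K, hK, hclose⟩ := hQ.exists_tendsto_formClose hp
  obtain ⟨K', hK', hnt⟩ := hQ.exists_nearTieCount_bound hp hA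
  set a := 4 * c₂ / c₁ with ha
  have ha0 : 0 ≤ a := by positivity
  have hgood := hQ.tendsto_goodSample hp M 0 ha0
  -- The power `384` dominates the crude factor `n (1 + n)^4`, of order `u^320`, attached to bad
  -- samples in `integral_matchVar_sub_sq_le`.
  have hgood' := hQ.tendsto_goodSample hp M 384 ha0
  simp only [pow_zero, one_mul] at hgood
  -- The centre is the expectation of the variance form for the fixed population metric; whether it
  -- converges is irrelevant.
  refine ⟨fun n => ∫ z, matchVar M (formNorm A) s v z ∂sampleLaw Q n, fun ε hε => ?_⟩
  have hr1 : ∀ n, c₂ * radius p n ≤ c₁ * (a * radius p n) := fun n => by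
    have : c₁ * (a * radius p n) = 4 * c₂ * radius p n := by rw [ha]; field_simp
    rw [this]
    nlinarith [mul_nonneg hc₂.le (radius_nonneg p n)]
  have hr2 : ∀ n, 4 * c₂ * radius p n ≤ c₁ * (a * radius p n) := fun n => by
    apply le_of_eq
    rw [ha]; field_simp
  -- the bound for the probability of many near ties
  have hnear : Tendsto (fun n : ℕ => (sampleLaw Q n).real
      {z | rate n ^ 51 ≤ nearTieCount A (a * radius p n) (2 * (K * (rate n ^ 16)⁻¹)) z})
      atTop (𝓝 0) := by
    refine squeeze_zero' (Eventually.of_forall fun n => measureReal_nonneg) ?_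
      (tendsto_const_mul_inv_rate_pow (2 * K * K' * (a ^ p) ^ 2) (k := 1) (by norm_num))
    filter_upwards [eventually_ge_atTop 1,
      (tendsto_const_mul_inv_rate_pow K (k := 16) (by norm_num)).eventually_le_const
      (show (0 : ℝ) < 1 / 4 by norm_num)] with n hn hδ
    have hu0 : 0 < rate n := by linarith [one_le_rate hn]
    -- With `n³ = u^192`, `ε = 2 K u⁻¹⁶`, two ball factors `a^p u⁻⁶³` and the threshold `u^51`, the
    -- exponent is `192 - 16 - 126 - 51 = -1`.
    refine (hnt n _ _ _ (mul_nonneg ha0 (radius_nonneg p n)) (by positivity) (by linarith)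
      (by positivity)).trans (le_of_eq ?_)
    rw [mul_pow, radius_pow hp, ← rate_pow n]
    field_simp
  -- the bound for the variance
  have hvar : Tendsto (fun n : ℕ => (sampleLaw Q n).real {z | ε / 2 ≤
      |matchVar M (formNorm A) s v z -
      ∫ z, matchVar M (formNorm A) s v z ∂sampleLaw Q n|}) atTop (𝓝 0) := by
    have hlim : Tendsto (fun n : ℕ => ((6 * C * 4 * 3) ^ 2 * (rate n ^ 52)⁻¹ +
        8 * C ^ 2 * 16 * (rate n ^ 384 * (sampleLaw Q n).real
          {z | ¬ GoodSample M (radius p n) (a * radius p n) (rate n ^ 2) z})) / (ε / 2) ^ 2)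
        atTop (𝓝 0) := by
      have := ((tendsto_const_mul_inv_rate_pow ((6 * C * 4 * 3) ^ 2) (k := 52) (by norm_num)).add
        (hgood'.const_mul (8 * C ^ 2 * 16))).div_const ((ε / 2) ^ 2)
      simpa using this
    refine squeeze_zero' (Eventually.of_forall fun n => measureReal_nonneg) ?_ hlim
    filter_upwards [eventually_ge_atTop 1] with n hn
    have hu1 := one_le_rate hn
    have hu0 : 0 < rate n := by linarith
    have hVm : Measurable fun z : Fin n → Covariate p × Bool => matchVar M (formNorm A) s v z :=
      measurable_matchVar M (D := fun _ => formNorm A) (fun i => measurable_pi_apply i)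
        (fun i j => (continuous_formNorm A).measurable.comp
          ((measurable_eval_fst j).sub (measurable_eval_fst i))) hsm hvm
    have hVb : ∀ z : Fin n → Covariate p × Bool,
        |matchVar M (formNorm A) s v z| ≤ C * (1 + n) ^ 2 := fun z =>
      abs_matchVar_le hM hs hv hC (Nat.cast_nonneg n)
        (abs_weight_nbrSet_le_card (s := fun i => s (z i)) fun _ => hs _)
    have hmb : |∫ z, matchVar M (formNorm A) s v z ∂sampleLaw Q n| ≤ C * (1 + n) ^ 2 := by
      have := norm_integral_le_of_norm_le_const (μ := sampleLaw Q n)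
        (f := fun z => matchVar M (formNorm A) s v z) (ae_of_all _ hVb)
      simpa using this
    refine measureReal_le_abs_sub_le (Integrable.of_bound
      ((hVm.sub_const _).pow_const 2).aestronglyMeasurable ((2 * (C * (1 + n) ^ 2)) ^ 2)
      (ae_of_all _ fun z => abs_sub_sq_le (hVb z) hmb)) (by positivity)
      ((integral_matchVar_sub_sq_le hM hn (continuous_formNorm A) hc₁ hc₂.le hd
        (hr1 n) hC hs hv hsm hvm (L := rate n ^ 2)).trans ?_)
    gcongr ?_ + ?_
    · rw [← rate_pow n]
      have h2 : 1 ≤ rate n ^ 2 := one_le_pow₀ hu1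
      calc (6 * C * (1 + rate n ^ 2) ^ 2 * (1 + 2 * rate n ^ 2)) ^ 2 / rate n ^ 64
          ≤ (6 * C * (2 * rate n ^ 2) ^ 2 * (3 * rate n ^ 2)) ^ 2 / rate n ^ 64 := by
            gcongr <;> linarith
        _ = _ := by field_simp; norm_num
    · have h1 : (1 : ℝ) ≤ rate n ^ 64 := one_le_pow₀ hu1
      have hE : (n : ℝ) * (1 + n) ^ 4 ≤ 16 * rate n ^ 384 := by
        rw [← rate_pow n]
        calc rate n ^ 64 * (1 + rate n ^ 64) ^ 4 ≤ rate n ^ 64 * (2 * rate n ^ 64) ^ 4 := by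
              gcongr; linarith
          _ = 16 * rate n ^ 320 := by ring
          _ ≤ 16 * rate n ^ 384 := by
              have := pow_le_pow_right₀ hu1 (show 320 ≤ 384 by norm_num)
              linarith
      rw [← mul_assoc (8 * C ^ 2 * 16), mul_assoc (8 * C ^ 2) 16]
      exact mul_le_mul_of_nonneg_right (mul_le_mul_of_nonneg_left hE (by positivity))
        measureReal_nonneg
  have hsum := ((hclose.add hgood).add hnear).add hvar
  simp only [add_zero] at hsum
  refine squeeze_zero' (Eventually.of_forall fun n => measureReal_nonneg) ?_ hsum
  filter_upwards [eventually_ge_atTop 1,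
    (tendsto_const_mul_inv_rate_pow K (k := 16) (by norm_num)).eventually_le_const
      (show (0 : ℝ) < 1 / 2 by norm_num),
    (tendsto_const_mul_inv_rate_pow (24 * C) (k := 9) (by norm_num)).eventually_lt_const
      (show (0 : ℝ) < ε / 2 by positivity)] with n hn hδ hsmall
  have hu1 := one_le_rate hn
  have hu0 : 0 < rate n := by linarith
  refine le_trans (measureReal_mono ?_) ((measureReal_union_le _ _).trans (add_le_add
    ((measureReal_union_le _ _).trans (add_le_add (measureReal_union_le _ _) le_rfl)) le_rfl))
  intro z hz
  by_contra hcon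
  simp only [Set.mem_union, Set.mem_ofPred_eq, not_or, not_not, not_le] at hcon hz
  obtain ⟨⟨⟨h1, h2⟩, h3⟩, h4⟩ := hcon
  have h5 := h2.abs_matchVar_sub_le hM h1 hA (transpose_sampleCov _) (by positivity) hδ hd hc₁
    hc₂.le (radius_nonneg p n) (hr2 n) hC hs hv
  -- The change of metric costs `u^4` for the weights times `u^51` near ties, divided by `n = u^64`,
  -- which is of order `u⁻⁹`.
  have h6 : 6 * C * (1 + rate n ^ 2) ^ 2 *
      nearTieCount A (a * radius p n) (2 * (K * (rate n ^ 16)⁻¹)) z / n ≤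
        24 * C * (rate n ^ 9)⁻¹ := by
    have h2 : 1 ≤ rate n ^ 2 := one_le_pow₀ hu1
    rw [← rate_pow n]
    have h3' : 6 * C * (1 + rate n ^ 2) ^ 2 ≤ 6 * C * (2 * rate n ^ 2) ^ 2 := by
      gcongr
      linarith
    calc _ ≤ 6 * C * (2 * rate n ^ 2) ^ 2 * rate n ^ 51 / rate n ^ 64 :=
          div_le_div_of_nonneg_right ((mul_le_mul_of_nonneg_left h3.le (by positivity)).trans
            (mul_le_mul_of_nonneg_right h3' (by positivity))) (by positivity)
      _ = _ := by field_simp; ring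
  have h7 := abs_sub_le (matchVar M (formNorm (sampleCov fun i => (z i).1)) s v z)
    (matchVar M (formNorm A) s v z) (∫ z, matchVar M (formNorm A) s v z ∂sampleLaw Q n)
  linarith

end Asymptotics

/-! ### Propensities -/

section Propensity

variable {Ω : Type*} [MeasurableSpace Ω] {P : Measure Ω} [IsProbabilityMeasure P] {p : ℕ}
  {X : Ω → Covariate p} {W : Ω → Bool} {Ypot : Bool → Ω → ℝ} {Y : Ω → ℝ}

/-- The propensity `P(W = w | X)`. -/
def propensity (P : Measure Ω) (X : Ω → Covariate p) (W : Ω → Bool) (w : Bool) : Ω → ℝ :=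
  P⟦W ⁻¹' {w} | sigmaOf X⟧

omit [IsProbabilityMeasure P] in
lemma stronglyMeasurable_propensity (w : Bool) :
    StronglyMeasurable[sigmaOf X] (propensity P X W w) := stronglyMeasurable_condExp

lemma CausalModel.exists_propensity_bounds (h : CausalModel P X W Ypot Y) :
    ∃ c : ℝ, 0 < c ∧ ∀ w, ∀ᵐ ω ∂P, c ≤ propensity P X W w ω ∧ propensity P X W w ω ≤ 1 := by
  obtain ⟨c, hc, ho⟩ := h.overlap
  have hm : sigmaOf X ≤ ‹MeasurableSpace Ω› := h.measurable_covariate.comap_le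
  have hW : ∀ w, MeasurableSet (W ⁻¹' {w}) := fun w =>
    h.measurable_treatment (measurableSet_singleton w)
  have hf : propensity P X W false =ᵐ[P] fun ω => 1 - propensity P X W true ω := by
    have h1 : (W ⁻¹' {false}).indicator (fun _ => (1 : ℝ)) =
        (fun _ => (1 : ℝ)) - (W ⁻¹' {true}).indicator fun _ => (1 : ℝ) := by
      ext ω
      cases hω : W ω <;> simp [Set.indicator, hω]
    have h2 := condExp_sub (μ := P) (m := sigmaOf X) (integrable_const (1 : ℝ))
      ((integrable_const (1 : ℝ)).indicator (hW true))
    rw [condExp_const hm] at h2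
    unfold propensity
    rw [h1]
    filter_upwards [h2] with ω hω
    simpa using hω
  refine ⟨c, hc, fun w => ?_⟩
  cases w
  · filter_upwards [hf, ho] with ω h1 h2
    have h3 : c < propensity P X W true ω ∧ propensity P X W true ω < 1 - c := h2
    rw [h1]
    constructor <;> linarith [h3.1, h3.2]
  · filter_upwards [ho] with ω h2
    have h3 : c < propensity P X W true ω ∧ propensity P X W true ω < 1 - c := h2
    constructor <;> linarith [h3.1, h3.2]

omit [IsProbabilityMeasure P] in
lemma integrable_propensity (w : Bool) : Integrable (propensity P X W w) P := integrable_condExp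

/-- Unconfoundedness factors the conditional probability of `{Ypot w ∈ A, W = w}` given `X`. As the
propensity is a function of `X`, it can then be moved back inside the conditional expectation and
integrated against the indicator of `A`. -/
lemma CausalModel.measureReal_inter_eq (h : CausalModel P X W Ypot Y) (w : Bool)
    {B : Set (Covariate p)} {A : Set ℝ} (hB : MeasurableSet B) (hA : MeasurableSet A) :
    P.real ((X ⁻¹' B ∩ Ypot w ⁻¹' A) ∩ W ⁻¹' {w}) =
      ∫ ω in X ⁻¹' B ∩ Ypot w ⁻¹' A, propensity P X W w ω ∂P := by
  have hm : sigmaOf X ≤ ‹MeasurableSpace Ω› := h.measurable_covariate.comap_le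
  have hW : MeasurableSet (W ⁻¹' {w}) := h.measurable_treatment (measurableSet_singleton w)
  have hYA : MeasurableSet (Ypot w ⁻¹' A) := h.measurable_potential w hA
  have hXB' : MeasurableSet[sigmaOf X] (X ⁻¹' B) := ⟨B, hB, rfl⟩
  have hXB : MeasurableSet (X ⁻¹' B) := h.measurable_covariate hB
  obtain ⟨c, hc, hbd⟩ := h.exists_propensity_bounds
  -- Unconfoundedness concerns the pair of potential outcomes; a single one is reached through the
  -- preimage of `A` under a projection.
  have h1 : P⟦Ypot w ⁻¹' A ∩ W ⁻¹' {w} | sigmaOf X⟧ =ᵐ[P]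
      P⟦Ypot w ⁻¹' A | sigmaOf X⟧ * propensity P X W w := by
    have := h.unconfounded ((fun y : ℝ × ℝ => if w then y.1 else y.2) ⁻¹' A) {w}
      (by cases w <;> simpa using (by first | exact measurable_fst hA | exact measurable_snd hA))
      (measurableSet_singleton w)
    have e : (fun ω => (Ypot true ω, Ypot false ω)) ⁻¹'
        ((fun y : ℝ × ℝ => if w then y.1 else y.2) ⁻¹' A) = Ypot w ⁻¹' A := by
      ext ω; cases w <;> simp
    rw [e] at this
    exact this
  have h2 : P[(Ypot w ⁻¹' A).indicator (fun _ => (1 : ℝ)) * propensity P X W w | sigmaOf X] =ᵐ[P]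
      P⟦Ypot w ⁻¹' A | sigmaOf X⟧ * propensity P X W w := by
    have := condExp_stronglyMeasurable_mul_of_bound hm
      (stronglyMeasurable_propensity (P := P) (X := X) (W := W) w)
      (((integrable_const (1 : ℝ)).indicator hYA) : Integrable _ P) 1
      ((hbd w).mono fun ω hω => by
        rw [Real.norm_eq_abs, abs_of_nonneg (by linarith [hω.1])]; exact hω.2)
    rw [mul_comm] at this
    filter_upwards [this] with ω hω
    rw [hω]
    exact mul_comm _ _
  have hint : Integrable ((Ypot w ⁻¹' A).indicator (fun _ => (1 : ℝ)) * propensity P X W w) P := by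
    have : (Ypot w ⁻¹' A).indicator (fun _ => (1 : ℝ)) * propensity P X W w =
        (Ypot w ⁻¹' A).indicator (propensity P X W w) := by
      ext ω; simp [Set.indicator]
    rw [this]
    exact (integrable_propensity w).indicator hYA
  calc P.real ((X ⁻¹' B ∩ Ypot w ⁻¹' A) ∩ W ⁻¹' {w})
      = ∫ ω in X ⁻¹' B, (Ypot w ⁻¹' A ∩ W ⁻¹' {w}).indicator (fun _ => (1 : ℝ)) ω ∂P := by
        rw [setIntegral_indicator (hYA.inter hW), setIntegral_const, smul_eq_mul, mul_one,
          Set.inter_assoc]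
    _ = ∫ ω in X ⁻¹' B, (P⟦Ypot w ⁻¹' A ∩ W ⁻¹' {w} | sigmaOf X⟧) ω ∂P :=
        (setIntegral_condExp hm ((integrable_const (1 : ℝ)).indicator (hYA.inter hW)) hXB').symm
    _ = ∫ ω in X ⁻¹' B,
          (P[(Ypot w ⁻¹' A).indicator (fun _ => (1 : ℝ)) * propensity P X W w | sigmaOf X]) ω ∂P :=
        setIntegral_congr_ae hXB ((h1.trans h2.symm).mono fun ω hω _ => hω)
    _ = ∫ ω in X ⁻¹' B,
          ((Ypot w ⁻¹' A).indicator (fun _ => (1 : ℝ)) * propensity P X W w) ω ∂P :=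
        setIntegral_condExp hm hint hXB'
    _ = ∫ ω in X ⁻¹' B, (Ypot w ⁻¹' A).indicator (propensity P X W w) ω ∂P := by
        congr 1; ext ω; simp [Set.indicator]
    _ = _ := setIntegral_indicator hYA

/-- Both finite measures agree on rectangles by `measureReal_inter_eq`. This removes the selection
by treatment from integrals of functions of `(X, Ypot w)`. -/
lemma CausalModel.map_restrict_treatment (h : CausalModel P X W Ypot Y) (w : Bool) :
    (P.restrict (W ⁻¹' {w})).map (fun ω => (X ω, Ypot w ω)) =
      (P.withDensity fun ω => ENNReal.ofReal (propensity P X W w ω)).map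
        fun ω => (X ω, Ypot w ω) := by
  have hfin : IsFiniteMeasure (P.withDensity fun ω => ENNReal.ofReal (propensity P X W w ω)) :=
    isFiniteMeasure_withDensity_ofReal (integrable_propensity w).2
  have hXY : Measurable fun ω => (X ω, Ypot w ω) :=
    h.measurable_covariate.prodMk (h.measurable_potential w)
  obtain ⟨c, hc, hbd⟩ := h.exists_propensity_bounds
  refine Measure.ext_prod fun {B} {A} hB hA => ?_
  have hS : MeasurableSet (X ⁻¹' B ∩ Ypot w ⁻¹' A) :=
    (h.measurable_covariate hB).inter (h.measurable_potential w hA)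
  rw [Measure.map_apply hXY (hB.prod hA), Measure.map_apply hXY (hB.prod hA)]
  change P.restrict (W ⁻¹' {w}) (X ⁻¹' B ∩ Ypot w ⁻¹' A) =
    P.withDensity _ (X ⁻¹' B ∩ Ypot w ⁻¹' A)
  rw [Measure.restrict_apply hS, withDensity_apply _ hS,
    ← ofReal_integral_eq_lintegral_ofReal (integrable_propensity w).integrableOn
      (ae_restrict_of_ae ((hbd w).mono fun ω hω => by simpa using hc.le.trans hω.1)),
    ← h.measureReal_inter_eq w hB hA, ofReal_measureReal]

omit [IsProbabilityMeasure P] in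
lemma measurable_toNNReal_propensity (hX : Measurable X) (w : Bool) :
    Measurable fun ω => (propensity P X W w ω).toNNReal :=
  (((stronglyMeasurable_propensity (P := P) (W := W) w).mono hX.comap_le).measurable).real_toNNReal

/-- Integrals over a treatment arm are integrals weighted by the propensity. -/
lemma CausalModel.setIntegral_treatment (h : CausalModel P X W Ypot Y) (w : Bool)
    {f : Covariate p × ℝ → ℝ} (hf : Measurable f) :
    ∫ ω in W ⁻¹' {w}, f (X ω, Ypot w ω) ∂P =
      ∫ ω, propensity P X W w ω * f (X ω, Ypot w ω) ∂P := by
  have hXY : Measurable fun ω => (X ω, Ypot w ω) :=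
    h.measurable_covariate.prodMk (h.measurable_potential w)
  obtain ⟨c, hc, hbd⟩ := h.exists_propensity_bounds
  rw [← integral_map (μ := P.restrict (W ⁻¹' {w})) hXY.aemeasurable hf.aestronglyMeasurable,
    h.map_restrict_treatment, integral_map hXY.aemeasurable hf.aestronglyMeasurable]
  refine (integral_withDensity_eq_integral_smul
    (measurable_toNNReal_propensity h.measurable_covariate w) _).trans (integral_congr_ae ?_)
  filter_upwards [hbd w] with ω hω
  rw [NNReal.smul_def, Real.coe_toNNReal _ (hc.le.trans hω.1), smul_eq_mul]

lemma CausalModel.integrableOn_treatment_iff (h : CausalModel P X W Ypot Y) (w : Bool)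
    {f : Covariate p × ℝ → ℝ} (hf : Measurable f) :
    IntegrableOn (fun ω => f (X ω, Ypot w ω)) (W ⁻¹' {w}) P ↔
      Integrable (fun ω => propensity P X W w ω * f (X ω, Ypot w ω)) P := by
  have hXY : Measurable fun ω => (X ω, Ypot w ω) :=
    h.measurable_covariate.prodMk (h.measurable_potential w)
  obtain ⟨c, hc, hbd⟩ := h.exists_propensity_bounds
  have h1 := integrable_map_measure (μ := P.restrict (W ⁻¹' {w})) (f := fun ω => (X ω, Ypot w ω))
    (g := f) hf.aestronglyMeasurable hXY.aemeasurable
  rw [IntegrableOn]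
  change Integrable (f ∘ fun ω => (X ω, Ypot w ω)) _ ↔ _
  rw [← h1, h.map_restrict_treatment, integrable_map_measure hf.aestronglyMeasurable
    hXY.aemeasurable]
  refine (integrable_withDensity_iff_integrable_smul
    (measurable_toNNReal_propensity h.measurable_covariate w)).trans (integrable_congr ?_)
  filter_upwards [hbd w] with ω hω
  rw [NNReal.smul_def, Real.coe_toNNReal _ (hc.le.trans hω.1), smul_eq_mul]
  rfl

/-- On `{W = w}` the potential outcome is the observed one, hence integrable. So its product with
the propensity is integrable, and overlap bounds the propensity below. -/
lemma CausalModel.integrable_potential (h : CausalModel P X W Ypot Y) (hY : Integrable Y P)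
    (w : Bool) : Integrable (Ypot w) P := by
  obtain ⟨c, hc, hbd⟩ := h.exists_propensity_bounds
  have hW : MeasurableSet (W ⁻¹' {w}) := h.measurable_treatment (measurableSet_singleton w)
  have h1 : IntegrableOn (fun ω => (fun q : Covariate p × ℝ => q.2) (X ω, Ypot w ω))
      (W ⁻¹' {w}) P := by
    refine (integrableOn_congr_fun_ae ?_).1 (hY.integrableOn (s := W ⁻¹' {w}))
    filter_upwards [ae_restrict_of_ae h.consistency, ae_restrict_mem hW] with ω h2 h3
    have h4 : W ω = w := h3
    simp only [h2, h4]
  have h2 := (h.integrableOn_treatment_iff w measurable_snd).1 h1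
  refine (h2.const_mul c⁻¹).mono (h.measurable_potential w).aestronglyMeasurable ?_
  filter_upwards [hbd w] with ω hω
  rw [← mul_assoc, norm_mul]
  refine le_mul_of_one_le_left (norm_nonneg _) ?_
  rw [Real.norm_eq_abs, abs_of_nonneg (mul_nonneg (inv_nonneg.2 hc.le) (hc.le.trans hω.1)),
    inv_mul_eq_div, one_le_div hc]
  exact hω.1

/-- The regression function identifies the conditional mean of the potential outcomes. -/
lemma CausalModel.condExp_potential (h : CausalModel P X W Ypot Y)
    {μ : Covariate p → Bool → ℝ} (hμ : IsRegressionFunction P X W Y μ) (w : Bool)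
    (hμi : Integrable (fun ω => μ (X ω) w) P) :
    P[Ypot w | sigmaOf X] =ᵐ[P] fun ω => μ (X ω) w := by
  obtain ⟨c, hc, hbd⟩ := h.exists_propensity_bounds
  have hm : sigmaOf X ≤ ‹MeasurableSpace Ω› := h.measurable_covariate.comap_le
  have hm2 : (sigmaOf fun ω => (X ω, W ω)) ≤ ‹MeasurableSpace Ω› :=
    (h.measurable_covariate.prodMk h.measurable_treatment).comap_le
  have hW : MeasurableSet (W ⁻¹' {w}) := h.measurable_treatment (measurableSet_singleton w)
  have hYi := h.integrable_potential hμ.integrable w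
  have hμX : StronglyMeasurable[sigmaOf X] fun ω => μ (X ω) w :=
    ((hμ.measurable w).comp (comap_measurable X)).stronglyMeasurable
  set g : Ω → ℝ := fun ω => Ypot w ω - μ (X ω) w with hg
  have hgi : Integrable g P := hYi.sub hμi
  have hpg : Integrable (propensity P X W w * g) P := by
    refine hgi.bdd_mul (c := 1) (integrable_propensity w).aestronglyMeasurable ?_
    filter_upwards [hbd w] with ω hω
    rw [Real.norm_eq_abs, abs_of_nonneg (hc.le.trans hω.1)]
    exact hω.2
  -- It is enough that the propensity times `E[Ypot w - μ(X, w) | X]` vanishes, since overlap allows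
  -- division. The integral over `{X ∈ B}` of the weighted difference equals that of `Y - μ(X, W)`
  -- over `{X ∈ B, W = w}`, which is zero by the definition of the regression function.
  have h0 : (fun _ => (0 : ℝ)) =ᵐ[P] P[propensity P X W w * g | sigmaOf X] := by
    refine ae_eq_condExp_of_forall_setIntegral_eq hm hpg
      (fun _ _ _ => (integrable_zero _ _ _).integrableOn) ?_
      stronglyMeasurable_const.aestronglyMeasurable
    rintro _ ⟨B, hB, rfl⟩ -
    have hXB : MeasurableSet (X ⁻¹' B) := h.measurable_covariate hB
    have h1 := h.setIntegral_treatment w (f := fun q => B.indicator 1 q.1 * (q.2 - μ q.1 w))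
      (((measurable_one.indicator hB).comp measurable_fst).mul
        (measurable_snd.sub ((hμ.measurable w).comp measurable_fst)))
    have hXW : MeasurableSet[sigmaOf fun ω => (X ω, W ω)] (X ⁻¹' B ∩ W ⁻¹' {w}) :=
      ⟨B ×ˢ {w}, hB.prod (measurableSet_singleton w), rfl⟩
    have h2 : ∫ ω in X ⁻¹' B ∩ W ⁻¹' {w}, Y ω ∂P =
        ∫ ω in X ⁻¹' B ∩ W ⁻¹' {w}, μ (X ω) (W ω) ∂P := by
      rw [← setIntegral_condExp hm2 hμ.integrable hXW]
      exact setIntegral_congr_ae (hXB.inter hW) (hμ.ae_eq.mono fun ω hω _ => hω.symm)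
    have h3 : ∫ ω in X ⁻¹' B ∩ W ⁻¹' {w}, (Y ω - μ (X ω) (W ω)) ∂P = 0 := by
      rw [integral_sub hμ.integrable.integrableOn, h2, sub_self]
      exact ((integrable_congr hμ.ae_eq).2 integrable_condExp).integrableOn
    have h4 : ∫ ω in W ⁻¹' {w}, (B.indicator 1 (X ω) * (Ypot w ω - μ (X ω) w)) ∂P = 0 := by
      rw [← h3, Set.inter_comm, ← setIntegral_indicator hXB]
      refine setIntegral_congr_ae hW ?_
      filter_upwards [h.consistency] with ω hω hw
      have hw' : W ω = w := hw
      by_cases hB : X ω ∈ B <;> simp [Set.indicator, hB, hω, hw']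
    rw [h4] at h1
    rw [integral_zero, h1, ← integral_indicator hXB]
    congr 1
    ext ω
    by_cases hB : X ω ∈ B <;> simp [Set.indicator, hB, hg]
  have h1 : P[propensity P X W w * g | sigmaOf X] =ᵐ[P] propensity P X W w * P[g | sigmaOf X] :=
    condExp_mul_of_stronglyMeasurable_left (stronglyMeasurable_propensity w) hpg hgi
  have h2 : P[g | sigmaOf X] =ᵐ[P] P[Ypot w | sigmaOf X] - fun ω => μ (X ω) w := by
    have := condExp_sub (m := sigmaOf X) hYi hμi
    rwa [condExp_of_stronglyMeasurable hm hμX hμi] at this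
  filter_upwards [h0, h1, h2, hbd w] with ω a1 a2 a3 a4
  have a5 : propensity P X W w ω * (P[g | sigmaOf X]) ω = 0 := by
    have := a1.trans a2
    simpa using this.symm
  have a6 : (P[g | sigmaOf X]) ω = 0 :=
    (mul_eq_zero.1 a5).resolve_left (hc.trans_le a4.1).ne'
  rw [a6] at a3
  simp only [Pi.sub_apply] at a3
  linarith

end Propensity

/-! ### The design induced by the population -/

section PopulationDesign

variable {Ω : Type*} [MeasurableSpace Ω] {P : Measure Ω} [IsProbabilityMeasure P] {p : ℕ}
  {X : Ω → Covariate p} {W : Ω → Bool} {Ypot : Bool → Ω → ℝ} {Y : Ω → ℝ}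
  {S : Set (Covariate p)}

/-- A convex set contains small homothetic copies of itself about each of its points. -/
lemma exists_volume_inter_closedBall_ge (hc : Convex ℝ S) (hS : IsCompact S) :
    ∃ a : ℝ, 0 < a ∧ ∀ x ∈ S, ∀ r : ℝ, 0 ≤ r → r ≤ 1 →
      ENNReal.ofReal ((a * r) ^ p) * volume S ≤ volume (S ∩ Metric.closedBall x r) := by
  obtain ⟨D, hD0, hD⟩ := hS.isBounded.subset_ball_lt 1 0
  have hD0' : 0 < D := by linarith
  refine ⟨(2 * D)⁻¹, by positivity, fun x hx r hr0 hr1 => ?_⟩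
  -- Points of `S` are at most `2 D` apart, so the homothety of this ratio about `x` maps `S` into
  -- the ball of radius `r`, and into `S` by convexity. Taking `D > 1` ensures `t ≤ 1`.
  set t := (2 * D)⁻¹ * r with ht
  have ht0 : 0 ≤ t := by positivity
  have ht1 : t ≤ 1 := by
    rw [ht, inv_mul_eq_div, div_le_one (by positivity)]
    linarith
  have hsub : (AffineMap.homothety x t) '' S ⊆ S ∩ Metric.closedBall x r := by
    rintro _ ⟨y, hy, rfl⟩
    have e : AffineMap.homothety x t y = (1 - t) • x + t • y := by
      simp only [AffineMap.homothety_apply, vsub_eq_sub, vadd_eq_add, smul_sub, sub_smul, one_smul]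
      abel
    refine ⟨?_, ?_⟩
    · rw [e]
      exact hc hx hy (by linarith) ht0 (by ring)
    · rw [Metric.mem_closedBall, dist_homothety_center, Real.norm_of_nonneg ht0]
      have h1 : dist x y ≤ 2 * D := by
        have hx' := mem_ball_zero_iff.1 (hD hx)
        have hy' := mem_ball_zero_iff.1 (hD hy)
        rw [dist_eq_norm]
        linarith [norm_sub_le x y]
      calc t * dist x y ≤ t * (2 * D) := by gcongr
        _ = r := by rw [ht]; field_simp
  refine le_trans (le_of_eq ?_) (measure_mono hsub)
  rw [Measure.addHaar_image_homothety, abs_of_nonneg (by positivity)]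
  simp

omit [IsProbabilityMeasure P] in
lemma RegularSupport.exists_upper (hS : RegularSupport P X S) :
    ∃ b : ℝ, 0 < b ∧ ∀ B : Set (Covariate p), P.map X B ≤ ENNReal.ofReal b * volume B := by
  obtain ⟨f, hf, hmap, hoff, a, b, ha, hab⟩ := hS.density
  refine ⟨max b 1, by positivity, fun B => ?_⟩
  have h : P.map X ≤ ENNReal.ofReal (max b 1) • volume := by
    rw [hmap, ← withDensity_const]
    refine withDensity_mono (ae_of_all _ fun x => ENNReal.ofReal_le_ofReal ?_)
    by_cases hx : x ∈ S
    · exact (hab x hx).2.trans (le_max_left _ _)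
    · rw [hoff x hx]; positivity
  simpa using h B

omit [IsProbabilityMeasure P] in
lemma RegularSupport.exists_lower (hS : RegularSupport P X S) :
    ∃ a : ℝ, 0 < a ∧ ∀ B : Set (Covariate p), MeasurableSet B → B ⊆ S →
      ENNReal.ofReal a * volume B ≤ P.map X B := by
  obtain ⟨f, hf, hmap, hoff, a, b, ha, hab⟩ := hS.density
  refine ⟨a, ha, fun B hB hBS => ?_⟩
  rw [hmap, withDensity_apply _ hB, ← setLIntegral_const]
  exact setLIntegral_mono' hB fun x hx => ENNReal.ofReal_le_ofReal (hab x (hBS hx)).1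

omit [IsProbabilityMeasure P] in
lemma RegularSupport.ae_mem (hS : RegularSupport P X S) (hX : Measurable X) :
    ∀ᵐ ω ∂P, X ω ∈ S := by
  obtain ⟨f, hf, hmap, hoff, a, b, ha, hab⟩ := hS.density
  have h : P.map X Sᶜ = 0 := by
    rw [hmap, withDensity_apply _ hS.compact.measurableSet.compl]
    refine (setLIntegral_congr_fun hS.compact.measurableSet.compl fun x hx => ?_).trans
      lintegral_zero
    simp [hoff x hx]
  rwa [Measure.map_apply hX hS.compact.measurableSet.compl] at h

lemma CausalModel.le_measureReal_inter (h : CausalModel P X W Ypot Y) :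
    ∃ c : ℝ, 0 < c ∧ ∀ (w : Bool) (B : Set (Covariate p)), MeasurableSet B →
      c * P.real (X ⁻¹' B) ≤ P.real (X ⁻¹' B ∩ W ⁻¹' {w}) := by
  obtain ⟨c, hc, hbd⟩ := h.exists_propensity_bounds
  refine ⟨c, hc, fun w B hB => ?_⟩
  have h1 := h.measureReal_inter_eq w hB MeasurableSet.univ
  simp only [Set.preimage_univ, Set.inter_univ] at h1
  rw [h1]
  calc c * P.real (X ⁻¹' B) = ∫ ω in X ⁻¹' B, c ∂P := by
        rw [setIntegral_const, smul_eq_mul, mul_comm]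
    _ ≤ _ := setIntegral_mono_ae (integrable_const c).integrableOn
        (integrable_propensity w).integrableOn ((hbd w).mono fun ω hω => hω.1)

/-- The law of covariates and treatment is a regular design. -/
theorem CausalModel.regularDesign (h : CausalModel P X W Ypot Y) (hS : RegularSupport P X S) :
    RegularDesign (P.map fun ω => (X ω, W ω)) S where
  compact := hS.compact
  ae_mem := by
    have hXW := h.measurable_covariate.prodMk h.measurable_treatment
    rw [ae_map_iff hXW.aemeasurable (measurable_fst hS.compact.measurableSet)]
    exact hS.ae_mem h.measurable_covariate
  exists_upper := by
    obtain ⟨b, hb, hB⟩ := hS.exists_upper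
    refine ⟨b, hb, fun B => ?_⟩
    have hXW := h.measurable_covariate.prodMk h.measurable_treatment
    have e : P.map X = (P.map fun ω => (X ω, W ω)).map Prod.fst := by
      rw [Measure.map_map measurable_fst hXW]
      rfl
    refine le_trans ?_ (hB B)
    rw [e]
    exact Measure.le_map_apply measurable_fst.aemeasurable _
  exists_lower := by
    obtain ⟨a, ha, hball⟩ := exists_volume_inter_closedBall_ge hS.convex hS.compact
    obtain ⟨l, hl, hlow⟩ := hS.exists_lower
    obtain ⟨c, hc, hcw⟩ := h.le_measureReal_inter
    have hXW := h.measurable_covariate.prodMk h.measurable_treatment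
    -- A null set `S` would contradict that `X` lies in `S` almost surely.
    have hSv : 0 < (volume S).toReal := by
      refine ENNReal.toReal_pos ?_ hS.compact.measure_lt_top.ne
      intro h0
      obtain ⟨b, hb, hB⟩ := hS.exists_upper
      have h1 : P.map X S = 0 := by simpa [h0] using hB S
      rw [Measure.map_apply h.measurable_covariate hS.compact.measurableSet] at h1
      have h2 := hS.ae_mem h.measurable_covariate
      have h3 : ∀ᵐ ω ∂P, False := by
        filter_upwards [h2, measure_eq_zero_iff_ae_notMem.1 h1] with ω h4 h5
        exact h5 h4
      rw [ae_iff] at h3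
      simp at h3
    refine ⟨c * l * a ^ p * (volume S).toReal, by positivity, fun x hx w r hr0 hr1 => ?_⟩
    have hBm : MeasurableSet (S ∩ Metric.closedBall x r) :=
      hS.compact.measurableSet.inter Metric.isClosed_closedBall.measurableSet
    have h1 : l * ((a * r) ^ p * (volume S).toReal) ≤ P.real (X ⁻¹' (S ∩ Metric.closedBall x r))
        := by
      have h2 := (mul_le_mul_right (hball x hx r hr0 hr1) (ENNReal.ofReal l)).trans
        (hlow _ hBm Set.inter_subset_left)
      rw [Measure.map_apply h.measurable_covariate hBm] at h2
      have h3 := ENNReal.toReal_mono (measure_ne_top _ _) h2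
      rwa [ENNReal.toReal_mul, ENNReal.toReal_mul, ENNReal.toReal_ofReal hl.le,
        ENNReal.toReal_ofReal (by positivity)] at h3
    calc c * l * a ^ p * (volume S).toReal * r ^ p
        = c * (l * ((a * r) ^ p * (volume S).toReal)) := by ring
      _ ≤ c * P.real (X ⁻¹' (S ∩ Metric.closedBall x r)) := by gcongr
      _ ≤ P.real (X ⁻¹' (S ∩ Metric.closedBall x r) ∩ W ⁻¹' {w}) := hcw w _ hBm
      _ ≤ P.real ((fun ω => (X ω, W ω)) ⁻¹' {z | dist z.1 x ≤ r ∧ z.2 = w}) :=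
          measureReal_mono fun ω hω => ⟨hω.1.2, hω.2⟩
      _ ≤ _ := ENNReal.toReal_mono (measure_ne_top _ _)
          (Measure.le_map_apply hXW.aemeasurable _)

end PopulationDesign

/-! ### Representation of the outcomes -/

section Representation

open Function

variable {Ω : Type*} [MeasurableSpace Ω] {P : Measure Ω} [IsProbabilityMeasure P]

section CondExp

variable {β γ : Type*} [MeasurableSpace β] [MeasurableSpace γ] {ν : Measure β}
  [IsProbabilityMeasure ν] {η : Measure γ} [IsProbabilityMeasure η] {Z : Ω → β} {f : Ω → ℝ}
  {G : β → γ → ℝ}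

lemma measurable_prodMk_uncurry (hG : Measurable (uncurry G)) :
    Measurable fun c : β × γ => (c.1, G c.1 c.2) := measurable_fst.prodMk hG

omit [IsProbabilityMeasure P] [IsProbabilityMeasure ν] in
lemma map_eq_of_map_prodMk_eq (hZ : Measurable Z) (hf : Measurable f) (hG : Measurable (uncurry G))
    (hlaw : P.map (fun ω => (Z ω, f ω)) = (ν.prod η).map fun c => (c.1, G c.1 c.2)) :
    P.map Z = ν := by
  have h1 : P.map Z = (P.map fun ω => (Z ω, f ω)).map Prod.fst := by
    rw [Measure.map_map measurable_fst (hZ.prodMk hf)]; rfl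
  rw [h1, hlaw, Measure.map_map measurable_fst (measurable_prodMk_uncurry hG)]
  change Measure.map Prod.fst _ = _
  rw [Measure.map_fst_prod, measure_univ, one_smul]

omit [IsProbabilityMeasure P] [IsProbabilityMeasure ν] [IsProbabilityMeasure η] in
lemma integrable_of_map_prodMk_eq (hZ : Measurable Z) (hf : Measurable f)
    (hG : Measurable (uncurry G))
    (hlaw : P.map (fun ω => (Z ω, f ω)) = (ν.prod η).map fun c => (c.1, G c.1 c.2)) :
    Integrable (uncurry G) (ν.prod η) ↔ Integrable f P := by
  have h1 := integrable_map_measure (μ := P) (f := fun ω => (Z ω, f ω))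
    (g := fun q : β × ℝ => q.2) measurable_snd.aestronglyMeasurable (hZ.prodMk hf).aemeasurable
  rw [hlaw, integrable_map_measure measurable_snd.aestronglyMeasurable
    (measurable_prodMk_uncurry hG).aemeasurable] at h1
  exact h1

/-- Conditional expectations through a representation of the joint law. -/
lemma integral_ae_eq_condExp_of_map_prodMk_eq (hZ : Measurable Z) (hf : Measurable f)
    (hfi : Integrable f P) (hG : Measurable (uncurry G))
    (hlaw : P.map (fun ω => (Z ω, f ω)) = (ν.prod η).map fun c => (c.1, G c.1 c.2)) :
    (fun ω => ∫ u, G (Z ω) u ∂η) =ᵐ[P] P[f | sigmaOf Z] := by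
  have hmap := map_eq_of_map_prodMk_eq hZ hf hG hlaw
  have hGi := (integrable_of_map_prodMk_eq hZ hf hG hlaw).2 hfi
  have hIm : StronglyMeasurable fun z => ∫ u, G z u ∂η := hG.stronglyMeasurable.integral_prod_right
  have hIi : Integrable (fun z => ∫ u, G z u ∂η) (P.map Z) := by
    rw [hmap]; exact hGi.integral_prod_left
  refine ae_eq_condExp_of_forall_setIntegral_eq hZ.comap_le hfi
    (fun s _ _ => (hIi.comp_measurable hZ).integrableOn) ?_
    (hIm.comp_measurable (comap_measurable Z)).aestronglyMeasurable
  rintro _ ⟨B, hB, rfl⟩ -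
  calc ∫ ω in Z ⁻¹' B, ∫ u, G (Z ω) u ∂η ∂P
      = ∫ z in B, ∫ u, G z u ∂η ∂ν := by
        rw [← hmap, setIntegral_map hB hIm.aestronglyMeasurable hZ.aemeasurable]
    _ = ∫ c in B ×ˢ Set.univ, uncurry G c ∂ν.prod η := by
        rw [setIntegral_prod _ hGi.integrableOn]; simp
    _ = ∫ q in B ×ˢ Set.univ, q.2 ∂(ν.prod η).map fun c => (c.1, G c.1 c.2) := by
        rw [setIntegral_map (hB.prod MeasurableSet.univ) measurable_snd.aestronglyMeasurable
          (measurable_prodMk_uncurry hG).aemeasurable]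
        congr 2
    _ = ∫ ω in Z ⁻¹' B, f ω ∂P := by
        rw [← hlaw, setIntegral_map (hB.prod MeasurableSet.univ)
          measurable_snd.aestronglyMeasurable (hZ.prodMk hf).aemeasurable]
        congr 2
        ext c; simp

end CondExp

variable {p : ℕ}

/-- Centred noise `R z u`, for `u` uniform on the unit interval, with bounded variance function
`v`. -/
structure NoiseModel (R : Covariate p × Bool → unitInterval → ℝ) (v : Covariate p × Bool → ℝ)
    (C : ℝ) : Prop where
  measurable : Measurable (uncurry R)
  memLp : ∀ z, MemLp (R z) 2 volume
  integral_eq_zero : ∀ z, ∫ u, R z u = 0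
  integral_sq : ∀ z, ∫ u, R z u ^ 2 = v z
  variance_le : ∀ z, v z ≤ C

variable {R : Covariate p × Bool → unitInterval → ℝ} {v : Covariate p × Bool → ℝ} {C : ℝ}

lemma NoiseModel.variance_nonneg (h : NoiseModel R v C) (z : Covariate p × Bool) : 0 ≤ v z := by
  rw [← h.integral_sq]
  exact integral_nonneg fun u => sq_nonneg _

lemma NoiseModel.measurable_variance (h : NoiseModel R v C) : Measurable v := by
  have : v = fun z => ∫ u, R z u ^ 2 := funext fun z => (h.integral_sq z).symm
  rw [this]
  exact ((h.measurable.pow_const 2).stronglyMeasurable.integral_prod_right).measurable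

lemma LipschitzInCovariate.exists_abs_le {g : Covariate p → Bool → ℝ} {S : Set (Covariate p)}
    (hg : LipschitzInCovariate g S) (hS : IsCompact S) :
    ∃ B : ℝ, 0 ≤ B ∧ ∀ x ∈ S, ∀ w, |g x w| ≤ B := by
  choose L hL using hg
  choose B hB using fun w => hS.exists_bound_of_continuousOn (hL w).continuousOn
  refine ⟨max 0 (max (B true) (B false)), le_max_left _ _, fun x hx w => ?_⟩
  have := hB w x hx
  rw [Real.norm_eq_abs] at this
  cases w <;> simp [this]

lemma measurable_of_forall_treatment {g : Covariate p → Bool → ℝ}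
    (hg : ∀ w, Measurable fun x => g x w) : Measurable fun z : Covariate p × Bool => g z.1 z.2 :=
  measurable_from_prod_countable_left hg

variable {X : Ω → Covariate p} {W : Ω → Bool} {Y : Ω → ℝ} {S : Set (Covariate p)}
  {μ ς : Covariate p → Bool → ℝ}

/-- The outcome is the regression function plus noise which is a function of covariates, treatment
and an independent uniform random variable. -/
theorem exists_noiseModel (hX : Measurable X) (hW : Measurable W) (hY : Measurable Y)
    (hXS : ∀ᵐ ω ∂P, X ω ∈ S) (hS : IsCompact S)
    (hμ : IsRegressionFunction P X W Y μ) (hς : IsCondVarianceFunction P X W Y ς)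
    (hμL : LipschitzInCovariate μ S) (hςL : LipschitzInCovariate ς S) :
    ∃ (R : Covariate p × Bool → unitInterval → ℝ) (v : Covariate p × Bool → ℝ) (C : ℝ),
        NoiseModel R v C ∧
      (BoundedFourthMoment P X W Y →
        ∃ C₃, ∀ z, Integrable (fun u => |R z u| ^ 3) ∧ ∫ u, |R z u| ^ 3 ≤ C₃) ∧
      P.map (fun ω => ((X ω, W ω), Y ω)) =
        ((P.map fun ω => (X ω, W ω)).prod volume).map
          fun c => (c.1, μ c.1.1 c.1.2 + R c.1 c.2) := by
  set Z : Ω → Covariate p × Bool := fun ω => (X ω, W ω) with hZdef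
  have hZ : Measurable Z := hX.prodMk hW
  set Q := P.map Z with hQ
  have hQp : IsProbabilityMeasure Q := Measure.isProbabilityMeasure_map hZ.aemeasurable
  have hμm := measurable_of_forall_treatment hμ.measurable
  have hςm := measurable_of_forall_treatment hς.measurable
  -- Every Markov kernel into `ℝ` is the image of the uniform law under a jointly measurable map:
  -- this `F` samples the conditional law of `Y` given `(X, W)`.
  obtain ⟨F, hF, hFκ⟩ := Kernel.exists_measurable_map_eq_unitInterval (condDistrib Y Z P)
  have hlaw : P.map (fun ω => (Z ω, Y ω)) = (Q.prod volume).map fun c => (c.1, F c.1 c.2) := by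
    rw [← compProd_map_condDistrib hY.aemeasurable]
    have hg : Measurable fun c : (Covariate p × Bool) × unitInterval => (c.1, F c.1 c.2) :=
      measurable_fst.prodMk hF
    ext s hs
    rw [Measure.compProd_apply hs, Measure.map_apply hg hs, Measure.prod_apply (hg hs)]
    refine lintegral_congr fun z => ?_
    have hFz : Measurable (F z) := hF.comp measurable_prodMk_left
    rw [← hFκ, Measure.map_apply hFz (measurable_prodMk_left hs)]
    rfl
  have hpow : ∀ k : ℕ, P.map (fun ω => (Z ω, Y ω ^ k)) =
      (Q.prod volume).map fun c => (c.1, F c.1 c.2 ^ k) := fun k => by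
    have hg : Measurable fun q : (Covariate p × Bool) × ℝ => (q.1, q.2 ^ k) :=
      measurable_fst.prodMk (measurable_snd.pow_const k)
    have := congrArg (Measure.map fun q : (Covariate p × Bool) × ℝ => (q.1, q.2 ^ k)) hlaw
    rwa [Measure.map_map hg (hZ.prodMk hY), Measure.map_map hg (measurable_prodMk_uncurry hF)]
      at this
  have hmom : ∀ k : ℕ, Integrable (fun ω => Y ω ^ k) P →
      (∀ᵐ z ∂Q, Integrable (fun u => F z u ^ k)) ∧
        (fun ω => ∫ u, F (Z ω) u ^ k) =ᵐ[P] P[fun ω => Y ω ^ k | sigmaOf Z] := fun k hk =>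
    ⟨((integrable_of_map_prodMk_eq (G := fun z u => F z u ^ k) hZ (hY.pow_const k) (hF.pow_const
        k) (hpow k)).2
      hk).prod_right_ae, integral_ae_eq_condExp_of_map_prodMk_eq
        (G := fun z u => F z u ^ k) hZ (hY.pow_const k) hk (hF.pow_const k) (hpow k)⟩
  have hmeas : ∀ k : ℕ, Measurable fun z => ∫ u, F z u ^ k := fun k =>
    ((hF.pow_const k).stronglyMeasurable.integral_prod_right).measurable
  have h1 := hmom 1 (by simpa using hμ.integrable)
  have h2 := hmom 2 hς.memLp.integrable_sq
  simp only [pow_one] at h1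
  have hmean : ∀ᵐ z ∂Q, ∫ u, F z u = μ z.1 z.2 := by
    rw [hQ, ae_map_iff hZ.aemeasurable (measurableSet_eq_fun (by simpa using hmeas 1) hμm)]
    filter_upwards [h1.2, hμ.ae_eq] with ω a b
    exact a.trans b.symm
  have hvar : ∀ᵐ z ∂Q, ∫ u, F z u ^ 2 = ς z.1 z.2 + μ z.1 z.2 ^ 2 := by
    rw [hQ, ae_map_iff hZ.aemeasurable (measurableSet_eq_fun (hmeas 2)
      (show Measurable fun z : Covariate p × Bool => ς z.1 z.2 + μ z.1 z.2 ^ 2 from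
        hςm.add (hμm.pow_const 2)))]
    filter_upwards [h2.2, hμ.ae_eq, hς.ae_eq,
      condVar_ae_eq_condExp_sq_sub_sq_condExp hZ.comap_le hς.memLp] with ω a b c d
    have e : (P[Y ^ 2 | sigmaOf Z]) ω = ∫ u, F (Z ω) u ^ 2 := a.symm
    rw [d] at c
    simp only [Pi.sub_apply, Pi.pow_apply] at c
    rw [e, ← b] at c
    change _ = ς (X ω) (W ω) + μ (X ω) (W ω) ^ 2
    linarith
  -- The constant is obtained outside of the implication, so that it is available for one
  -- description of the exceptional set with or without fourth moments.
  have hfour : ∃ C₄ : ℝ, BoundedFourthMoment P X W Y →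
      ∀ᵐ z ∂Q, Integrable (fun u => F z u ^ 4) ∧ ∫ u, F z u ^ 4 ≤ C₄ := by
    by_cases hb : BoundedFourthMoment P X W Y
    · obtain ⟨hi, C₄, hC⟩ := hb
      refine ⟨C₄, fun _ => (hmom 4 hi).1.and ?_⟩
      rw [hQ, ae_map_iff hZ.aemeasurable (measurableSet_le (hmeas 4) measurable_const)]
      filter_upwards [(hmom 4 hi).2, hC] with ω a b
      exact a.trans_le b
    · exact ⟨0, fun h => absurd h hb⟩
  obtain ⟨C₄, hC₄⟩ := hfour
  obtain ⟨Bμ, hBμ0, hBμ⟩ := hμL.exists_abs_le hS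
  obtain ⟨Bς, hBς0, hBς⟩ := hςL.exists_abs_le hS
  have hQS : ∀ᵐ z ∂Q, z.1 ∈ S := by
    rw [hQ, ae_map_iff hZ.aemeasurable (measurable_fst hS.measurableSet)]
    exact hXS
  -- a measurable set of full measure on which all of this holds
  have hall : ∀ᵐ z ∂Q, z.1 ∈ S ∧ Integrable (F z) ∧ Integrable (fun u => F z u ^ 2) ∧
      ∫ u, F z u = μ z.1 z.2 ∧ ∫ u, F z u ^ 2 = ς z.1 z.2 + μ z.1 z.2 ^ 2 ∧
      (BoundedFourthMoment P X W Y → Integrable (fun u => F z u ^ 4) ∧ ∫ u, F z u ^ 4 ≤ C₄) := by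
    have h4 : ∀ᵐ z ∂Q, (BoundedFourthMoment P X W Y →
        Integrable (fun u => F z u ^ 4) ∧ ∫ u, F z u ^ 4 ≤ C₄) := by
      by_cases hb : BoundedFourthMoment P X W Y
      · filter_upwards [hC₄ hb] with z hz _ using hz
      · exact ae_of_all _ fun z h => absurd h hb
    filter_upwards [hQS, h1.1, h2.1, hmean, hvar, h4] with z a b c d e f
    exact ⟨a, b, c, d, e, f⟩
  -- The moment identities hold only almost everywhere. Setting the noise to zero on a measurable
  -- null set `T` makes them hold at every point, without changing the joint law.
  obtain ⟨T, hT, hTm, hT0⟩ := exists_measurable_superset_of_null (ae_iff.1 hall)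
  have hgood : ∀ z, z ∉ T → _ := fun z hz => not_not.1 fun hn => hz (hT hn)
  classical
  set R : Covariate p × Bool → unitInterval → ℝ := fun z u => if z ∈ T then 0 else F z u - μ z.1
      z.2 with hR
  have hRm : Measurable (uncurry R) := by
    refine Measurable.ite (measurable_fst hTm) measurable_const ?_
    exact hF.sub (hμm.comp measurable_fst)
  have hin : ∀ z ∈ T, R z = 0 := fun z hz => by ext u; simp [hR, hz]
  have hout : ∀ z, z ∉ T → R z = fun u => F z u - μ z.1 z.2 := fun z hz => by ext u; simp [hR, hz]
  -- The variance function is the second moment of `R` itself, which agrees with `ς` off `T` and is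
  -- zero on `T`. The summand `|C₄| * 8` keeps the third moment bound nonnegative on `T`, where
  -- nothing is known about the sign of `C₄`.
  refine ⟨R, fun z => ∫ u, R z u ^ 2, Bς, ⟨hRm, fun z => ?_, fun z => ?_, fun z => rfl,
    fun z => ?_⟩, fun hb => ⟨1 + 8 * C₄ + 8 * Bμ ^ 4 + |C₄| * 8, fun z => ?_⟩, ?_⟩
  · by_cases hz : z ∈ T
    · rw [hin z hz]; exact MemLp.zero
    · obtain ⟨a, b, c, d, e, f⟩ := hgood z hz
      rw [hout z hz]
      refine MemLp.sub ?_ (memLp_const _)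
      exact (memLp_two_iff_integrable_sq b.aestronglyMeasurable).2 c
  · by_cases hz : z ∈ T
    · simp [hin z hz]
    · obtain ⟨a, b, c, d, e, f⟩ := hgood z hz
      rw [hout z hz, integral_sub b (integrable_const _), d]
      simp
  · by_cases hz : z ∈ T
    · simpa [hin z hz] using hBς0
    · obtain ⟨a, b, c, d, e, f⟩ := hgood z hz
      have h3 : ∫ u, R z u ^ 2 = ς z.1 z.2 := by
        have : ∀ u, R z u ^ 2 = F z u ^ 2 - 2 * μ z.1 z.2 * F z u + μ z.1 z.2 ^ 2 := fun u => by
          rw [hout z hz]; ring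
        simp_rw [this]
        have i1 : Integrable (fun u => F z u ^ 2 - 2 * μ z.1 z.2 * F z u) := c.sub (b.const_mul _)
        rw [integral_add i1 (integrable_const _),
          integral_sub c (b.const_mul _), integral_const_mul, d, e]
        simp
        ring
      rw [h3]
      exact (le_abs_self _).trans (hBς _ a _)
  · have hC0 : 0 ≤ 8 * C₄ + |C₄| * 8 := by linarith [neg_abs_le C₄]
    by_cases hz : z ∈ T
    · rw [hin z hz]
      have h0 : (fun u : unitInterval => |(0 : unitInterval → ℝ) u| ^ 3) = fun _ => 0 := by
        ext u; simp
      rw [h0, integral_zero]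
      refine ⟨integrable_zero _ _ _, ?_⟩
      have : 0 ≤ 8 * Bμ ^ 4 := by positivity
      linarith
    · obtain ⟨a, b, c, d, e, f⟩ := hgood z hz
      obtain ⟨f1, f2⟩ := f hb
      -- From `|R|³ ≤ 1 + R⁴` and `(a - b)⁴ ≤ 8 a⁴ + 8 b⁴`.
      have hle : ∀ u, |R z u| ^ 3 ≤ 1 + 8 * F z u ^ 4 + 8 * Bμ ^ 4 := fun u => by
        have hm4 : μ z.1 z.2 ^ 4 ≤ Bμ ^ 4 := by
          rw [← Even.pow_abs (by decide : Even 4)]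
          exact pow_le_pow_left₀ (abs_nonneg _) (hBμ _ a _) 4
        have hR4 : R z u ^ 4 ≤ 8 * F z u ^ 4 + 8 * μ z.1 z.2 ^ 4 := by
          rw [hout z hz]
          nlinarith [sq_nonneg (F z u ^ 2 - μ z.1 z.2 ^ 2), sq_nonneg (F z u + μ z.1 z.2),
            sq_nonneg ((F z u + μ z.1 z.2) ^ 2), sq_nonneg ((F z u) * (μ z.1 z.2)),
            sq_nonneg ((F z u + μ z.1 z.2) * (F z u - μ z.1 z.2))]
        have h34 : |R z u| ^ 3 ≤ 1 + R z u ^ 4 := by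
          rw [← Even.pow_abs (by decide : Even 4)]
          have := abs_nonneg (R z u)
          rcases le_total (|R z u|) 1 with h | h
          · nlinarith [pow_le_one₀ this h (n := 3), pow_nonneg this 4]
          · nlinarith [pow_le_pow_right₀ h (show 3 ≤ 4 by norm_num)]
        linarith
      have hi1 : Integrable (fun u => 1 + 8 * F z u ^ 4) :=
        (integrable_const _).add (f1.const_mul 8)
      have hi : Integrable (fun u => 1 + 8 * F z u ^ 4 + 8 * Bμ ^ 4) :=
        hi1.add (integrable_const _)
      have hi3 : Integrable (fun u => |R z u| ^ 3) :=
        hi.mono' ((hRm.comp measurable_prodMk_left).abs.pow_const 3).aestronglyMeasurable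
          (ae_of_all _ fun u => by
            rw [Real.norm_of_nonneg (by positivity)]; exact hle u)
      refine ⟨hi3, (integral_mono hi3 hi hle).trans ?_⟩
      rw [integral_add hi1 (integrable_const _),
        integral_add (integrable_const _) (f1.const_mul 8), integral_const_mul]
      simp only [integral_const, probReal_univ, smul_eq_mul, one_mul]
      have := abs_nonneg C₄
      linarith
  · rw [hlaw]
    refine Measure.map_congr ?_
    have : ∀ᵐ c ∂Q.prod (volume : Measure unitInterval), c.1 ∉ T :=
      Measure.quasiMeasurePreserving_fst.ae (measure_eq_zero_iff_ae_notMem.1 hT0)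
    filter_upwards [this] with c hc
    simp [hout _ hc]

end Representation

/-! ### The law of the sample -/

section SampleLaw

open Function

variable {p n : ℕ}

/-- The law of a sample of covariates and treatments, and of independent uniform variables. -/
def noiseLaw (Q : Measure (Covariate p × Bool)) (n : ℕ) :
    Measure ((Fin n → Covariate p × Bool) × (Fin n → unitInterval)) :=
  (sampleLaw Q n).prod (Measure.pi fun _ => volume)

/-- A weighted sum of noise terms. -/
def noiseSum (R : Covariate p × Bool → unitInterval → ℝ) (a : Fin n → ℝ)
    (z : Fin n → Covariate p × Bool) (u : Fin n → unitInterval) : ℝ :=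
  ∑ i, a i * R (z i) (u i)

variable {R : Covariate p × Bool → unitInterval → ℝ} {v : Covariate p × Bool → ℝ} {C : ℝ}

lemma NoiseModel.memLp_term (h : NoiseModel R v C) (a : Fin n → ℝ)
    (z : Fin n → Covariate p × Bool) (i : Fin n) :
    MemLp (fun u : Fin n → unitInterval => a i * R (z i) (u i)) 2 (Measure.pi fun _ => volume) :=
  ((h.memLp (z i)).comp_measurePreserving
    (measurePreserving_eval (fun _ : Fin n => (volume : Measure unitInterval)) i)).const_mul (a i)

lemma NoiseModel.memLp_noiseSum (h : NoiseModel R v C) (a : Fin n → ℝ)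
    (z : Fin n → Covariate p × Bool) :
    MemLp (noiseSum R a z) 2 (Measure.pi fun _ => volume) :=
  memLp_finsetSum _ fun i _ => h.memLp_term a z i

lemma NoiseModel.integral_term (h : NoiseModel R v C) (a : Fin n → ℝ)
    (z : Fin n → Covariate p × Bool) (i : Fin n) :
    ∫ u : Fin n → unitInterval, a i * R (z i) (u i) ∂(Measure.pi fun _ => volume) = 0 := by
  have hmp := measurePreserving_eval (fun _ : Fin n => (volume : Measure unitInterval)) i
  have h1 := integral_map (μ := Measure.pi fun _ : Fin n => (volume : Measure unitInterval))
    (φ := eval i) hmp.measurable.aemeasurable (f := R (z i))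
    (by rw [hmp.map_eq]; exact (h.memLp (z i)).aestronglyMeasurable)
  rw [hmp.map_eq, h.integral_eq_zero] at h1
  rw [integral_const_mul]
  exact mul_eq_zero_of_right _ h1.symm

lemma NoiseModel.integral_noiseSum (h : NoiseModel R v C) (a : Fin n → ℝ)
    (z : Fin n → Covariate p × Bool) :
    ∫ u, noiseSum R a z u ∂(Measure.pi fun _ => volume) = 0 := by
  unfold noiseSum
  rw [integral_finsetSum _ fun i _ => (h.memLp_term a z i).integrable (by norm_num)]
  exact Finset.sum_eq_zero fun i _ => h.integral_term a z i

lemma NoiseModel.integral_noiseSum_sq (h : NoiseModel R v C) (a : Fin n → ℝ)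
    (z : Fin n → Covariate p × Bool) :
    ∫ u, noiseSum R a z u ^ 2 ∂(Measure.pi fun _ => volume) = ∑ i, a i ^ 2 * v (z i) := by
  have h1 := variance_of_integral_eq_zero (h.memLp_noiseSum a z).aestronglyMeasurable.aemeasurable
    (h.integral_noiseSum a z)
  have h2 := variance_sum_pi (μ := fun _ : Fin n => (volume : Measure unitInterval))
    (X := fun i u => a i * R (z i) u) fun i => (h.memLp (z i)).const_mul (a i)
  have e : (∑ i, fun ω : Fin n → unitInterval => a i * R (z i) (ω i)) = noiseSum R a z := by
    ext u; simp [noiseSum]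
  rw [e, h1] at h2
  rw [h2]
  refine Finset.sum_congr rfl fun i _ => ?_
  rw [variance_const_mul, variance_of_integral_eq_zero
    (h.memLp (z i)).aestronglyMeasurable.aemeasurable (h.integral_eq_zero _), h.integral_sq]

lemma NoiseModel.measurable_noiseSum (h : NoiseModel R v C) {a : (Fin n → Covariate p × Bool) →
    Fin n → ℝ} (ha : ∀ i, Measurable fun z => a z i) :
    Measurable (uncurry fun z u => noiseSum R (a z) z u) := by
  unfold noiseSum uncurry
  refine Finset.measurable_sum _ fun i _ => ((ha i).comp measurable_fst).mul ?_
  have hi : Measurable fun c : (Fin n → Covariate p × Bool) × (Fin n → unitInterval) =>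
      (c.1 i, c.2 i) :=
    ((measurable_pi_apply i).comp measurable_fst).prodMk ((measurable_pi_apply i).comp
        measurable_snd)
  exact h.measurable.comp hi

variable {Ω : Type*} [MeasurableSpace Ω] {P : Measure Ω} [IsProbabilityMeasure P]

lemma IsIIDCopies.map_eq_pi {α : Type*} [MeasurableSpace α] {Z₀ : Ω → α} {Z : ℕ → Ω → α}
    (h : IsIIDCopies P Z₀ Z) (n : ℕ) :
    P.map (fun ω (i : Fin n) => Z i ω) = Measure.pi fun _ => P.map Z₀ := by
  have h1 := (iIndepFun_iff_map_fun_eq_pi_map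
    (fun i : Fin n => (h.measurable (i : ℕ)).aemeasurable)).1
    (h.indep.precomp (g := fun i : Fin n => (i : ℕ)) Fin.val_injective)
  rw [h1]
  congr 1
  ext1 i
  exact (h.ident i).map_eq

variable {X : Ω → Covariate p} {W : Ω → Bool} {Y : Ω → ℝ}
  {Xs : ℕ → Ω → Covariate p} {Ws : ℕ → Ω → Bool} {Ys : ℕ → Ω → ℝ}

/-- The first `n` covariates and treatments. -/
def designSample (Xs : ℕ → Ω → Covariate p) (Ws : ℕ → Ω → Bool) (n : ℕ) (ω : Ω)
    (i : Fin n) : Covariate p × Bool := (Xs i ω, Ws i ω)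

omit [IsProbabilityMeasure P] in
lemma IsIIDCopies.measurable_designSample
    (h : IsIIDCopies P (fun ω => (X ω, W ω, Y ω)) fun i ω => (Xs i ω, Ws i ω, Ys i ω)) (n : ℕ) :
    Measurable (designSample Xs Ws n) :=
  measurable_pi_lambda _ fun i => (measurable_fst.comp (h.measurable i)).prodMk
    (measurable_fst.comp (measurable_snd.comp (h.measurable i)))

omit [IsProbabilityMeasure P] in
lemma IsIIDCopies.measurable_outcome
    (h : IsIIDCopies P (fun ω => (X ω, W ω, Y ω)) fun i ω => (Xs i ω, Ws i ω, Ys i ω)) (i : ℕ) :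
    Measurable (Ys i) :=
  measurable_snd.comp (measurable_snd.comp (h.measurable i))

/-- The law of the sample, in terms of the design and independent noise. -/
lemma IsIIDCopies.map_sample_eq
    (h : IsIIDCopies P (fun ω => (X ω, W ω, Y ω)) fun i ω => (Xs i ω, Ws i ω, Ys i ω))
    (hX : Measurable X) (hW : Measurable W) (hY : Measurable Y)
    {f : Covariate p × Bool → unitInterval → ℝ} (hf : Measurable (uncurry f))
    (hlaw : P.map (fun ω => ((X ω, W ω), Y ω)) =
      ((P.map fun ω => (X ω, W ω)).prod volume).map fun c => (c.1, f c.1 c.2)) (n : ℕ) :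
    P.map (fun ω => (designSample Xs Ws n ω, fun i : Fin n => Ys i ω)) =
      (noiseLaw (P.map fun ω => (X ω, W ω)) n).map
        fun c => (c.1, fun i => f (c.1 i) (c.2 i)) := by
  set Q := P.map fun ω => (X ω, W ω) with hQ
  have hQp : IsProbabilityMeasure Q := Measure.isProbabilityMeasure_map (hX.prodMk hW).aemeasurable
  have hg : Measurable fun c : (Covariate p × Bool) × unitInterval => (c.1, f c.1 c.2) :=
    measurable_prodMk_uncurry hf
  have hlaw0 : P.map (fun ω => (X ω, W ω, Y ω)) =
      ((Q.prod volume).map fun c => (c.1, f c.1 c.2)).map MeasurableEquiv.prodAssoc := by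
    rw [← hlaw, Measure.map_map MeasurableEquiv.prodAssoc.measurable ((hX.prodMk hW).prodMk hY)]
    rfl
  have h1 := h.map_eq_pi n
  rw [hlaw0, Measure.map_map MeasurableEquiv.prodAssoc.measurable hg] at h1
  have hpr : IsProbabilityMeasure ((Q.prod volume).map
      (MeasurableEquiv.prodAssoc ∘ fun c : (Covariate p × Bool) × unitInterval =>
        (c.1, f c.1 c.2))) :=
    Measure.isProbabilityMeasure_map (MeasurableEquiv.prodAssoc.measurable.comp hg).aemeasurable
  rw [← Measure.pi_map_pi fun _ => (MeasurableEquiv.prodAssoc.measurable.comp hg).aemeasurable]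
      at h1
  have h2 := (measurePreserving_arrowProdEquivProdArrow (Covariate p × Bool) unitInterval (Fin n)
    (fun _ => Q) (fun _ => volume)).symm
  have hT : Measurable fun (q : Fin n → Covariate p × Bool × ℝ) =>
      ((fun i => ((q i).1, (q i).2.1)), fun i => (q i).2.2) := by
    refine Measurable.prodMk (measurable_pi_lambda _ fun i => ?_) (measurable_pi_lambda _ fun i
        => ?_)
    · exact (measurable_fst.comp (measurable_pi_apply i)).prodMk
        (measurable_fst.comp (measurable_snd.comp (measurable_pi_apply i)))
    · exact measurable_snd.comp (measurable_snd.comp (measurable_pi_apply i))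
  have h3 := congrArg (Measure.map fun (q : Fin n → Covariate p × Bool × ℝ) =>
      ((fun i => ((q i).1, (q i).2.1)), fun i => (q i).2.2)) h1
  have hTg : Measurable fun (x : Fin n → (Covariate p × Bool) × unitInterval) i =>
      (MeasurableEquiv.prodAssoc ∘ fun c : (Covariate p × Bool) × unitInterval =>
        (c.1, f c.1 c.2)) (x i) :=
    measurable_pi_lambda _ fun i =>
      (MeasurableEquiv.prodAssoc.measurable.comp hg).comp (measurable_pi_apply i)
  rw [Measure.map_map hT (measurable_pi_lambda _ fun i => h.measurable i), ← h2.map_eq,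
    Measure.map_map hTg (MeasurableEquiv.measurable _),
    Measure.map_map hT (hTg.comp (MeasurableEquiv.measurable _))] at h3
  exact h3

end SampleLaw

/-! ### The decomposition of the matching estimator -/

section Decomposition

open Function

lemma sgn_mul_self (b : Bool) : sgn b * sgn b = 1 := by cases b <;> norm_num [sgn]

lemma abs_sgn (b : Bool) : |sgn b| = 1 := by cases b <;> norm_num [sgn]

lemma sgn_not (b : Bool) : sgn (!b) = -sgn b := by cases b <;> norm_num [sgn]

variable {p n M : ℕ}

lemma matchSet_eq_nbrSet (M : ℕ) (z : Fin n → Covariate p × Bool) :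
    matchSet M (fun i => (z i).1) (fun i => (z i).2) =
      nbrSet M (formNorm (sampleCov fun i => (z i).1)) z := by
  ext1 i
  rw [matchSet_eq_rankSet, nbrSet]
  simp only [mahaNorm_eq_formNorm]

/-- Exchange of the sums over units and over their matches. A match has the opposite treatment,
hence the opposite sign. -/
lemma sum_sgn_mul_matchWeight (M : ℕ) (π : Covariate p → Bool) (x : Fin n → Covariate p)
    (w : Fin n → Bool) (e : Fin n → ℝ) :
    ∑ i, sgn (w i) * (matchWeight M π x w i / M) * e i =
      -∑ i, sgn (w i) * sgn (π (x i)) * ((M : ℝ)⁻¹ * ∑ j ∈ matchSet M x w i, e j) := by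
  classical
  have h1 : ∀ i, sgn (w i) * (matchWeight M π x w i / M) * e i =
      ∑ j, if i ∈ matchSet M x w j then -(sgn (w j) * sgn (π (x j)) * ((M : ℝ)⁻¹ * e i)) else 0
          := by
    intro i
    rw [matchWeight_eq_weight, weight, div_eq_mul_inv, Finset.sum_mul, Finset.mul_sum,
      Finset.sum_mul]
    refine Finset.sum_congr rfl fun j _ => ?_
    split_ifs with hij
    · rw [matchSet_eq_rankSet, mem_rankSet, mem_oppositeArm] at hij
      rw [hij.1, sgn_not]
      ring
    · ring
  rw [Finset.sum_congr rfl fun i _ => h1 i, Finset.sum_comm, ← Finset.sum_neg_distrib]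
  refine Finset.sum_congr rfl fun j _ => ?_
  rw [← Finset.sum_filter, Finset.filter_mem_eq_inter, Finset.univ_inter, Finset.mul_sum,
    Finset.mul_sum, Finset.sum_neg_distrib]

/-- If all matched sets have `M` elements, the matching estimator is the sample mean of the
treatment effects, plus the residual, plus the bias. -/
lemma matchEstimator_eq (hM : 1 ≤ M) (π : Covariate p → Bool) (μ : Covariate p → Bool → ℝ)
    {x : Fin n → Covariate p} {w : Fin n → Bool} (y : Fin n → ℝ)
    (hcard : ∀ i, (matchSet M x w i).card = M) :
    matchEstimator M π x w y =
      (n : ℝ)⁻¹ * ∑ i, sgn (π (x i)) * (μ (x i) true - μ (x i) false) +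
        matchResidual M π μ x w y + matchBias M π μ x w := by
  have hM0 : (M : ℝ) ≠ 0 := by positivity
  rw [matchEstimator, matchResidual, matchBias, ← mul_add, ← mul_add]
  congr 1
  have hres : ∑ i, sgn (w i) * (sgn (π (x i)) + matchWeight M π x w i / M) * (y i - μ (x i) (w i)) =
      ∑ i, (sgn (w i) * sgn (π (x i)) * (y i - μ (x i) (w i)) - sgn (w i) * sgn (π (x i)) *
        ((M : ℝ)⁻¹ * ∑ j ∈ matchSet M x w i, (y j - μ (x j) (w j)))) := by
    rw [Finset.sum_sub_distrib, sub_eq_add_neg, ← sum_sgn_mul_matchWeight,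
      ← Finset.sum_add_distrib]
    refine Finset.sum_congr rfl fun i _ => ?_
    ring
  rw [hres, ← Finset.sum_add_distrib, ← Finset.sum_add_distrib]
  refine Finset.sum_congr rfl fun i _ => ?_
  have h1 : ∑ j ∈ matchSet M x w i, (y j - μ (x j) (w j)) =
      ∑ j ∈ matchSet M x w i, y j - ∑ j ∈ matchSet M x w i, μ (x j) (!w i) := by
    rw [← Finset.sum_sub_distrib]
    refine Finset.sum_congr rfl fun j hj => ?_
    rw [matchSet_eq_rankSet, mem_rankSet, mem_oppositeArm] at hj
    rw [hj.1]
  -- Only here does the number of matches matter: with exactly `M` of them, the mean of the constant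
  -- `μ (x i) (!w i)` over the matched set is that constant.
  have h2 : ∑ j ∈ matchSet M x w i, (μ (x i) (!w i) - μ (x j) (!w i)) =
      M * μ (x i) (!w i) - ∑ j ∈ matchSet M x w i, μ (x j) (!w i) := by
    rw [Finset.sum_sub_distrib, Finset.sum_const, hcard, nsmul_eq_mul]
  have h3 : imputed M x w y true i - imputed M x w y false i =
      sgn (w i) * (y i - (M : ℝ)⁻¹ * ∑ j ∈ matchSet M x w i, y j) := by
    unfold imputed
    cases w i <;> norm_num [sgn]
  have h4 : μ (x i) true - μ (x i) false = sgn (w i) * (μ (x i) (w i) - μ (x i) (!w i)) := by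
    cases w i <;> norm_num [sgn]
  rw [h1, h2, h3, h4]
  field_simp
  ring

/-- The coefficients of the residuals in the residual term. -/
def residualCoef (M : ℕ) (π : Covariate p → Bool) (z : Fin n → Covariate p × Bool) (i : Fin n) :
    ℝ :=
  sgn (z i).2 * (sgn (π (z i).1) +
    matchWeight M π (fun i => (z i).1) (fun i => (z i).2) i / M)

lemma residualCoef_eq (M : ℕ) (π : Covariate p → Bool) (z : Fin n → Covariate p × Bool)
    (i : Fin n) :
    residualCoef M π z i = sgn (z i).2 * (sgn (π (z i).1) +
      weight (nbrSet M (formNorm (sampleCov fun i => (z i).1)) z)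
        (fun j => (fun q : Covariate p × Bool => sgn (π q.1)) (z j)) i / M) := by
  rw [residualCoef, matchWeight_eq_weight, matchSet_eq_nbrSet]

lemma sum_residualCoef_sq (M : ℕ) (π : Covariate p → Bool) (v : Covariate p × Bool → ℝ)
    (z : Fin n → Covariate p × Bool) :
    (n : ℝ)⁻¹ * ∑ i, residualCoef M π z i ^ 2 * v (z i) =
      matchVar M (formNorm (sampleCov fun i => (z i).1)) (fun q => sgn (π q.1)) v z := by
  simp only [residualCoef_eq, matchVar, varForm, mul_pow, sq (sgn _), sgn_mul_self, one_mul]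

lemma abs_residualCoef_le (hM : 1 ≤ M) (π : Covariate p → Bool) {z : Fin n → Covariate p × Bool}
    {i : Fin n} {L : ℝ}
    (h : |weight (nbrSet M (formNorm (sampleCov fun i => (z i).1)) z)
        (fun j => (fun q : Covariate p × Bool => sgn (π q.1)) (z j)) i| ≤ L) :
    |residualCoef M π z i| ≤ 1 + L := by
  have hM' : (1 : ℝ) ≤ M := by exact_mod_cast hM
  rw [residualCoef_eq, abs_mul, abs_sgn, one_mul]
  refine (abs_add_le _ _).trans ?_
  rw [abs_sgn, abs_div, Nat.abs_cast]
  have := (div_le_self (abs_nonneg _) hM').trans h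
  linarith

lemma abs_residualCoef_le_card (hM : 1 ≤ M) (π : Covariate p → Bool)
    (z : Fin n → Covariate p × Bool) (i : Fin n) : |residualCoef M π z i| ≤ 1 + n :=
  abs_residualCoef_le hM π (abs_weight_nbrSet_le_card (fun _ => (abs_sgn _).le) i)

lemma measurable_sgn_comp {α : Type*} [MeasurableSpace α] {f : α → Bool} (hf : Measurable f) :
    Measurable fun q => sgn (f q) := (measurable_of_finite sgn).comp hf

lemma measurable_formNorm_sampleCov (i j : Fin n) :
    Measurable fun z : Fin n → Covariate p × Bool =>
      formNorm (sampleCov fun i => (z i).1) ((z j).1 - (z i).1) :=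
  measurable_formNorm_comp (measurable_sampleCov_apply fun k => measurable_eval_fst k)
    ((measurable_eval_fst j).sub (measurable_eval_fst i))

lemma measurable_residualCoef (M : ℕ) {π : Covariate p → Bool} (hπ : Measurable π) (i : Fin n) :
    Measurable fun z : Fin n → Covariate p × Bool => residualCoef M π z i := by
  simp only [residualCoef_eq]
  have hs : Measurable fun q : Covariate p × Bool => sgn (π q.1) :=
    measurable_sgn_comp (hπ.comp measurable_fst)
  refine (measurable_sgn_comp (measurable_snd.comp (measurable_pi_apply i))).mul
    ((hs.comp (measurable_pi_apply i)).add (Measurable.div_const ?_ _))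
  exact measurable_weight_nbrSet M
    (D := fun z : Fin n → Covariate p × Bool => formNorm (sampleCov fun i => (z i).1))
    (fun i => measurable_pi_apply i) (fun i j => measurable_formNorm_sampleCov i j) hs i

lemma measurable_matchEstimator (M : ℕ) {π : Covariate p → Bool} (hπ : Measurable π) :
    Measurable fun c : (Fin n → Covariate p × Bool) × (Fin n → ℝ) =>
      matchEstimator M π (fun i => (c.1 i).1) (fun i => (c.1 i).2) c.2 := by
  classical
  unfold matchEstimator imputed
  simp only [matchSet_eq_nbrSet]
  have hy : ∀ i, Measurable fun c : (Fin n → Covariate p × Bool) × (Fin n → ℝ) => c.2 i :=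
    fun i => (measurable_pi_apply i).comp measurable_snd
  have hz : ∀ i, Measurable fun c : (Fin n → Covariate p × Bool) × (Fin n → ℝ) => c.1 i :=
    fun i => (measurable_pi_apply i).comp measurable_fst
  have himp : ∀ i, Measurable fun c : (Fin n → Covariate p × Bool) × (Fin n → ℝ) =>
      (M : ℝ)⁻¹ * ∑ j ∈ nbrSet M (formNorm (sampleCov fun i => (c.1 i).1)) c.1 i, c.2 j := by
    intro i
    refine Measurable.const_mul ?_ _
    have e : ∀ c : (Fin n → Covariate p × Bool) × (Fin n → ℝ),
        ∑ j ∈ nbrSet M (formNorm (sampleCov fun i => (c.1 i).1)) c.1 i, c.2 j =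
        ∑ j, if j ∈ nbrSet M (formNorm (sampleCov fun i => (c.1 i).1)) c.1 i then c.2 j else 0 := by
      intro c
      rw [← Finset.sum_filter, Finset.filter_mem_eq_inter, Finset.univ_inter]
    simp only [e]
    refine Finset.measurable_sum _ fun j _ => Measurable.ite ?_ (hy j) measurable_const
    exact measurable_fst (measurableSet_mem_nbrSet M
      (D := fun z : Fin n → Covariate p × Bool => formNorm (sampleCov fun i => (z i).1))
      (fun i => measurable_pi_apply i) (fun i j => measurable_formNorm_sampleCov i j) i j)
  refine Measurable.const_mul (Finset.measurable_sum _ fun i _ => ?_) _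
  have hw : ∀ a, MeasurableSet {c : (Fin n → Covariate p × Bool) × (Fin n → ℝ) | (c.1 i).2 = a} :=
    fun a => measurableSet_eq_fun (measurable_snd.comp (hz i)) measurable_const
  exact (measurable_sgn_comp (hπ.comp (measurable_fst.comp (hz i)))).mul
    ((Measurable.ite (hw _) (hy i) (himp i)).sub (Measurable.ite (hw _) (hy i) (himp i)))

variable {Ω : Type*} [MeasurableSpace Ω] {P : Measure Ω} [IsProbabilityMeasure P]

omit [IsProbabilityMeasure P] in
lemma map_prodMk_comp_eq {β δ γ : Type*} [MeasurableSpace β] [MeasurableSpace δ]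
    [MeasurableSpace γ] {ν : Measure β} {η : Measure γ} {Z : Ω → β} {Y : Ω → δ}
    {F : β × γ → δ} (hZ : Measurable Z) (hY : Measurable Y) (hF : Measurable F)
    (hlaw : P.map (fun ω => (Z ω, Y ω)) = (ν.prod η).map fun c => (c.1, F c))
    {ψ : β × δ → ℝ} (hψ : Measurable ψ) :
    P.map (fun ω => (Z ω, ψ (Z ω, Y ω))) = (ν.prod η).map fun c => (c.1, ψ (c.1, F c)) := by
  have h1 := congrArg (Measure.map fun q : β × δ => (q.1, ψ q)) hlaw
  rwa [Measure.map_map (measurable_fst.prodMk hψ) (hZ.prodMk hY),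
    Measure.map_map (measurable_fst.prodMk hψ) (measurable_fst.prodMk hF)] at h1

variable {Q : Measure (Covariate p × Bool)} [IsProbabilityMeasure Q]
  {R : Covariate p × Bool → unitInterval → ℝ} {v : Covariate p × Bool → ℝ} {C : ℝ}
  {Xs : ℕ → Ω → Covariate p} {Ws : ℕ → Ω → Bool} {Ys : ℕ → Ω → ℝ} {μ : Covariate p → Bool → ℝ}
  {π : Covariate p → Bool}

omit [IsProbabilityMeasure P] [IsProbabilityMeasure Q] in
/-- The joint law of the design and a weighted sum of residuals. -/
lemma map_weightedResidual_eq (hR : NoiseModel R v C)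
    (hμ : Measurable fun z : Covariate p × Bool => μ z.1 z.2)
    (hZ : Measurable (designSample Xs Ws n)) (hY : ∀ i, Measurable (Ys i))
    (hlaw : P.map (fun ω => (designSample Xs Ws n ω, fun i : Fin n => Ys i ω)) =
      (noiseLaw Q n).map
        fun c => (c.1, fun i => μ (c.1 i).1 (c.1 i).2 + R (c.1 i) (c.2 i)))
    {a : (Fin n → Covariate p × Bool) → Fin n → ℝ} (ha : ∀ i, Measurable fun z => a z i) :
    P.map (fun ω => (designSample Xs Ws n ω,
        ∑ i : Fin n, a (designSample Xs Ws n ω) i * (Ys i ω - μ (Xs i ω) (Ws i ω)))) =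
      (noiseLaw Q n).map fun c => (c.1, noiseSum R (a c.1) c.1 c.2) := by
  have hF : Measurable fun c : (Fin n → Covariate p × Bool) × (Fin n → unitInterval) =>
      fun i => μ (c.1 i).1 (c.1 i).2 + R (c.1 i) (c.2 i) := by
    refine measurable_pi_lambda _ fun i => ?_
    have h1 : Measurable fun c : (Fin n → Covariate p × Bool) × (Fin n → unitInterval) => c.1 i :=
      (measurable_pi_apply i).comp measurable_fst
    have h2 : Measurable fun c : (Fin n → Covariate p × Bool) × (Fin n → unitInterval) => c.2 i :=
      (measurable_pi_apply i).comp measurable_snd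
    exact (hμ.comp h1).add (hR.measurable.comp (h1.prodMk h2))
  have hψ : Measurable fun q : (Fin n → Covariate p × Bool) × (Fin n → ℝ) =>
      ∑ i, a q.1 i * (q.2 i - μ (q.1 i).1 (q.1 i).2) := by
    refine Finset.measurable_sum _ fun i _ => ?_
    have h1 : Measurable fun c : (Fin n → Covariate p × Bool) × (Fin n → ℝ) => c.1 i :=
      (measurable_pi_apply i).comp measurable_fst
    have h2 : Measurable fun c : (Fin n → Covariate p × Bool) × (Fin n → ℝ) => c.2 i :=
      (measurable_pi_apply i).comp measurable_snd
    exact ((ha i).comp measurable_fst).mul (h2.sub (hμ.comp h1))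
  have := map_prodMk_comp_eq hZ (measurable_pi_lambda _ fun i : Fin n => hY i) hF hlaw hψ
  simp only [add_sub_cancel_left] at this
  exact this

omit [IsProbabilityMeasure P] in
lemma measurable_weightedResidual
    (hμ : Measurable fun z : Covariate p × Bool => μ z.1 z.2)
    (hZ : Measurable (designSample Xs Ws n)) (hY : ∀ i, Measurable (Ys i))
    {a : (Fin n → Covariate p × Bool) → Fin n → ℝ} (ha : ∀ i, Measurable fun z => a z i) :
    Measurable fun ω => ∑ i : Fin n, a (designSample Xs Ws n ω) i *
      (Ys i ω - μ (Xs i ω) (Ws i ω)) := by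
  refine Finset.measurable_sum _ fun i _ => ((ha i).comp hZ).mul ((hY i).sub ?_)
  exact hμ.comp ((measurable_pi_apply i).comp hZ)

lemma NoiseModel.integrable_noiseSum_sq (hR : NoiseModel R v C)
    {a : (Fin n → Covariate p × Bool) → Fin n → ℝ} (ha : ∀ i, Measurable fun z => a z i) {A : ℝ}
    (haA : ∀ z i, |a z i| ≤ A) (r : ℝ) :
    Integrable (uncurry fun (z : Fin n → Covariate p × Bool) u =>
      (r * noiseSum R (a z) z u) ^ 2) (noiseLaw Q n) := by
  have hm := ((hR.measurable_noiseSum ha).const_mul r).pow_const 2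
  have hm' : AEStronglyMeasurable (uncurry fun (z : Fin n → Covariate p × Bool) u =>
      (r * noiseSum R (a z) z u) ^ 2)
      ((sampleLaw Q n).prod (Measure.pi fun _ => volume)) := hm.aestronglyMeasurable
  have hCb : ∀ z : Fin n → Covariate p × Bool,
      |∑ i, a z i ^ 2 * v (z i)| ≤ ∑ _i : Fin n, A ^ 2 * C := by
    intro z
    refine (Finset.abs_sum_le_sum_abs _ _).trans (Finset.sum_le_sum fun i _ => ?_)
    rw [abs_mul, abs_of_nonneg (hR.variance_nonneg _), abs_pow]
    exact mul_le_mul (pow_le_pow_left₀ (abs_nonneg _) (haA z i) 2)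
      (hR.variance_le _) (hR.variance_nonneg _) (sq_nonneg _)
  refine (integrable_prod_iff hm').2 ⟨ae_of_all _ fun z => ?_, ?_⟩
  · exact ((hR.memLp_noiseSum (a z) z).const_mul _).integrable_sq
  · have e : ∀ z : Fin n → Covariate p × Bool, ∫ u, ‖(uncurry fun z u =>
        (r * noiseSum R (a z) z u) ^ 2) (z, u)‖ ∂(Measure.pi fun _ => volume) =
        r ^ 2 * ∑ i, a z i ^ 2 * v (z i) := by
      intro z
      rw [← hR.integral_noiseSum_sq, ← integral_const_mul]
      refine integral_congr_ae (ae_of_all _ fun u => ?_)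
      simp only [uncurry_apply_pair]
      rw [Real.norm_of_nonneg (sq_nonneg _), mul_pow]
    simp only [e]
    refine (Integrable.of_bound ?_ _ (ae_of_all _ hCb)).const_mul _
    exact (Finset.measurable_sum _ fun i _ => ((ha i).pow_const 2).mul
      (hR.measurable_variance.comp (measurable_pi_apply i))).aestronglyMeasurable

lemma NoiseModel.integral_noiseLaw_sq_le (hR : NoiseModel R v C)
    {a : (Fin n → Covariate p × Bool) → Fin n → ℝ} (ha : ∀ i, Measurable fun z => a z i) {A : ℝ}
    (haA : ∀ z i, |a z i| ≤ A) (r : ℝ) :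
    ∫ q, (r * noiseSum R (a q.1) q.1 q.2) ^ 2 ∂noiseLaw Q n ≤ r ^ 2 * (n * (A ^ 2 * C)) := by
  have hi := hR.integrable_noiseSum_sq (Q := Q) ha haA r
  have h1 := integral_prod _ hi
  change ∫ q, (r * noiseSum R (a q.1) q.1 q.2) ^ 2 ∂noiseLaw Q n = _ at h1
  have e : ∀ z : Fin n → Covariate p × Bool, ∫ u, (uncurry fun z u =>
      (r * noiseSum R (a z) z u) ^ 2) (z, u) ∂(Measure.pi fun _ => volume) =
      r ^ 2 * ∑ i, a z i ^ 2 * v (z i) := by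
    intro z
    rw [← hR.integral_noiseSum_sq, ← integral_const_mul]
    refine integral_congr_ae (ae_of_all _ fun u => ?_)
    simp only [uncurry_apply_pair]
    rw [mul_pow]
  rw [h1]
  refine (integral_mono hi.integral_prod_left (integrable_const (r ^ 2 * (n * (A ^ 2 * C))))
    fun z => ?_).trans_eq (by simp)
  rw [e]
  refine mul_le_mul_of_nonneg_left ?_ (sq_nonneg r)
  refine (Finset.sum_le_sum fun i _ => ?_).trans_eq (b := ∑ _i : Fin n, A ^ 2 * C) (by simp)
  refine mul_le_mul ?_ (hR.variance_le _) (hR.variance_nonneg _) (sq_nonneg _)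
  rw [← sq_abs]
  exact pow_le_pow_left₀ (abs_nonneg _) (haA z i) 2

/-- The conditional variance of the residual term is a variance form of the matching weights. -/
theorem residualVariance_ae_eq (hR : NoiseModel R v C) (hM : 1 ≤ M)
    (hμ : Measurable fun z : Covariate p × Bool => μ z.1 z.2)
    (hπ : Measurable π) (hZ : Measurable (designSample Xs Ws n)) (hY : ∀ i, Measurable (Ys i))
    (hlaw : P.map (fun ω => (designSample Xs Ws n ω, fun i : Fin n => Ys i ω)) =
      (noiseLaw Q n).map
        fun c => (c.1, fun i => μ (c.1 i).1 (c.1 i).2 + R (c.1 i) (c.2 i))) :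
    residualVariance P M π μ Xs Ws Ys n =ᵐ[P] fun ω =>
      matchVar M (formNorm (sampleCov fun i => (designSample Xs Ws n ω i).1))
        (fun q => sgn (π q.1)) v (designSample Xs Ws n ω) := by
  have hG0 : Measurable fun c : (Fin n → Covariate p × Bool) × (Fin n → unitInterval) =>
      noiseSum R (residualCoef M π c.1) c.1 c.2 :=
    hR.measurable_noiseSum fun i => measurable_residualCoef M hπ i
  have hG := hG0.const_mul (n : ℝ)⁻¹
  have hres0 := measurable_weightedResidual hμ hZ hY fun i => measurable_residualCoef M hπ i
  have hresm : Measurable (residual M π μ Xs Ws Ys n) := hres0.const_mul (n : ℝ)⁻¹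
  have hlaw1 : P.map (fun ω => (designSample Xs Ws n ω, residual M π μ Xs Ws Ys n ω)) =
      (noiseLaw Q n).map
        fun c => (c.1, (n : ℝ)⁻¹ * noiseSum R (residualCoef M π c.1) c.1 c.2) :=
    map_prodMk_comp_eq hZ hres0 hG0 (map_weightedResidual_eq hR hμ hZ hY hlaw
      fun i => measurable_residualCoef M hπ i) (ψ := fun q => (n : ℝ)⁻¹ * q.2)
      (measurable_snd.const_mul _)
  have hlaw2 := map_prodMk_comp_eq hZ hresm hG hlaw1 (ψ := fun q => q.2 ^ 2)
    (measurable_snd.pow_const 2)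
  -- The crude bound `1 + n` of the coefficients suffices for square integrability at fixed `n`.
  have hi2 : Integrable (fun ω => residual M π μ Xs Ws Ys n ω ^ 2) P :=
    (integrable_of_map_prodMk_eq hZ (hresm.pow_const 2) (hG.pow_const 2) hlaw2).1
      (hR.integrable_noiseSum_sq (fun i => measurable_residualCoef M hπ i)
        (fun z i => abs_residualCoef_le_card hM π z i) (n : ℝ)⁻¹)
  have hL2 : MemLp (residual M π μ Xs Ws Ys n) 2 P :=
    (memLp_two_iff_integrable_sq hresm.aestronglyMeasurable).2 hi2
  have h1 := integral_ae_eq_condExp_of_map_prodMk_eq hZ hresm (hL2.integrable (by norm_num))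
    (G := fun z u => (n : ℝ)⁻¹ * noiseSum R (residualCoef M π z) z u) hG hlaw1
  have h2 := integral_ae_eq_condExp_of_map_prodMk_eq hZ (hresm.pow_const 2) hi2
    (G := fun z u => ((n : ℝ)⁻¹ * noiseSum R (residualCoef M π z) z u) ^ 2)
    (hG.pow_const 2) hlaw2
  filter_upwards [h1, h2, condVar_ae_eq_condExp_sq_sub_sq_condExp hZ.comap_le hL2] with ω a b c
  -- Given the design, the noise sum has mean zero, and independence across units makes its second
  -- moment the sum of the squared coefficients times the variances.
  have c' : (Var[residual M π μ Xs Ws Ys n; P | sigmaOf (designSample Xs Ws n)]) ω =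
      ∑ i, residualCoef M π (designSample Xs Ws n ω) i ^ 2 * v (designSample Xs Ws n ω i) *
        ((n : ℝ)⁻¹ ^ 2) := by
    rw [c]
    simp only [Pi.sub_apply, Pi.pow_apply]
    rw [← a]
    change (P[fun ω => residual M π μ Xs Ws Ys n ω ^ 2 | sigmaOf (designSample Xs Ws n)]) ω - _ = _
    rw [← b, integral_const_mul, hR.integral_noiseSum]
    simp_rw [mul_pow]
    rw [integral_const_mul, hR.integral_noiseSum_sq, ← Finset.sum_mul]
    ring
  change (n : ℝ) * (Var[residual M π μ Xs Ws Ys n; P | sigmaOf (designSample Xs Ws n)]) ω = _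
  rw [c', ← sum_residualCoef_sq, ← Finset.sum_mul]
  rcases Nat.eq_zero_or_pos n with h0 | h0
  · simp [h0]
  · have : (n : ℝ) ≠ 0 := by positivity
    field_simp

end Decomposition

/-! ### Estimates for characteristic functions -/

section CharFun

open Complex (I)

/-- Taylor's remainder for `|y| ≤ 1`; for larger `|y|` every term is dominated by `|y|³`. -/
lemma norm_cexp_sub_le (y : ℝ) :
    ‖Complex.exp (y * I) - (1 + y * I - y ^ 2 / 2)‖ ≤ 4 * |y| ^ 3 := by
  have hn : ‖(y : ℂ) * I‖ = |y| := by simp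
  have h0 := abs_nonneg y
  rcases le_total |y| 1 with h | h
  · have h1 := Complex.exp_bound (x := y * I) (by rw [hn]; exact h) (n := 3) (by norm_num)
    have e : ∑ m ∈ Finset.range 3, ((y : ℂ) * I) ^ m / (m.factorial : ℂ) =
        1 + y * I - y ^ 2 / 2 := by
      simp [Finset.sum_range_succ, Nat.factorial, mul_pow]
      ring
    rw [e, hn] at h1
    refine h1.trans ?_
    rw [mul_comm]
    refine mul_le_mul_of_nonneg_right ?_ (by positivity)
    norm_num [Nat.factorial]
  · have h1 : ‖Complex.exp (y * I)‖ = 1 := Complex.norm_exp_ofReal_mul_I y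
    have h2 : ‖(1 : ℂ) + y * I - y ^ 2 / 2‖ ≤ 1 + |y| + |y| ^ 2 / 2 := by
      refine (norm_sub_le _ _).trans (add_le_add ((norm_add_le _ _).trans ?_) ?_)
      · simp
      · simp
    refine (norm_sub_le _ _).trans ?_
    rw [h1]
    nlinarith [pow_le_pow_right₀ h (show 2 ≤ 3 by norm_num), pow_le_pow_right₀ h (show 1 ≤
        3 by norm_num),
      pow_le_pow_right₀ h (show 0 ≤ 3 by norm_num)]

lemma abs_exp_neg_sub_le {a : ℝ} (ha : 0 ≤ a) : |Real.exp (-a) - (1 - a)| ≤ a ^ 2 := by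
  have h1 := Real.add_one_le_exp (-a)
  rw [abs_of_nonneg (by linarith)]
  rcases le_total a 1 with h | h
  · have := Real.abs_exp_sub_one_sub_id_le (x := -a) (by rwa [abs_neg, abs_of_nonneg ha])
    have := le_abs_self (Real.exp (-a) - 1 - -a)
    nlinarith
  · have := Real.exp_le_one_iff.2 (neg_nonpos.2 ha)
    nlinarith

lemma abs_exp_neg_sub_exp_neg_le {a b : ℝ} (ha : 0 ≤ a) (hb : 0 ≤ b) :
    |Real.exp (-a) - Real.exp (-b)| ≤ |a - b| := by
  wlog hab : a ≤ b generalizing a b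
  · rw [abs_sub_comm, abs_sub_comm a]
    exact this hb ha (le_of_not_ge hab)
  have h1 : Real.exp (-b) = Real.exp (-a) * Real.exp (-(b - a)) := by
    rw [← Real.exp_add]; congr 1; ring
  have h2 := Real.add_one_le_exp (-(b - a))
  have h3 := Real.exp_le_one_iff.2 (neg_nonpos.2 ha)
  have h4 := Real.exp_pos (-a)
  have h5 : Real.exp (-(b - a)) ≤ 1 := Real.exp_le_one_iff.2 (by linarith)
  rw [abs_of_nonneg (by nlinarith), abs_of_nonpos (by linarith), h1]
  nlinarith

/-- The characteristic function of a centred random variable is close to that of a Gaussian random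
variable of the same variance. -/
lemma norm_integral_cexp_sub_le {α : Type*} [MeasurableSpace α] {ν : Measure α}
    [IsProbabilityMeasure ν] {f : α → ℝ} (hf : MemLp f 2 ν) (h0 : ∫ u, f u ∂ν = 0)
    {s C C₃ : ℝ} (h2 : ∫ u, f u ^ 2 ∂ν = s) (hs : s ≤ C) (hi3 : Integrable (fun u => |f u| ^ 3) ν)
    (h3 : ∫ u, |f u| ^ 3 ∂ν ≤ C₃) (x : ℝ) :
    ‖∫ u, Complex.exp ((x * f u : ℝ) * I) ∂ν - (Real.exp (-(x ^ 2 * s / 2)) : ℂ)‖ ≤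
      (4 * C₃ + C ^ 2 + 2) * |x| ^ 3 := by
  have hs0 : 0 ≤ s := by rw [← h2]; exact integral_nonneg fun u => sq_nonneg _
  have hC₃ : 0 ≤ C₃ := (integral_nonneg fun u => by positivity).trans h3
  have hx0 := abs_nonneg x
  -- For `|x| ≤ 1` both sides are compared with `1 - x² s / 2`: the left one through the third
  -- moment, the right one with an error of `x⁴ s² / 4 ≤ C² |x|³`. For `|x| ≥ 1` two numbers of
  -- modulus at most one differ by at most `2 ≤ 2 |x|³`.
  rcases le_total |x| 1 with hx | hx
  · have hm : AEStronglyMeasurable (fun u => Complex.exp ((x * f u : ℝ) * I)) ν := by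
      have : Continuous fun y : ℝ => Complex.exp ((x * y : ℝ) * I) := by fun_prop
      exact this.comp_aestronglyMeasurable hf.aestronglyMeasurable
    have hei : Integrable (fun u => Complex.exp ((x * f u : ℝ) * I)) ν :=
      Integrable.of_bound hm 1 (ae_of_all _ fun u => (Complex.norm_exp_ofReal_mul_I _).le)
    have hfi : Integrable f ν := hf.integrable (by norm_num)
    have hi1 : Integrable (fun u => ((x * f u : ℝ) : ℂ) * I) ν :=
      ((hfi.const_mul x).ofReal).mul_const I
    have hi2 : Integrable (fun u => ((x * f u : ℝ) : ℂ) ^ 2 / 2) ν := by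
      have h : Integrable (fun u => ((x ^ 2 * f u ^ 2 : ℝ) : ℂ)) ν :=
        (hf.integrable_sq.const_mul (x ^ 2)).ofReal
      refine (h.div_const 2).congr (ae_of_all _ fun u => ?_)
      push_cast
      ring
    have hi12 : Integrable (fun u => 1 + ((x * f u : ℝ) : ℂ) * I) ν := (integrable_const _).add hi1
    have hi3' : Integrable (fun u => 1 + ((x * f u : ℝ) : ℂ) * I - ((x * f u : ℝ) : ℂ) ^ 2 / 2) ν :=
      hi12.sub hi2
    have hq : ∫ u, (1 + ((x * f u : ℝ) : ℂ) * I - ((x * f u : ℝ) : ℂ) ^ 2 / 2) ∂ν =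
        ((1 - x ^ 2 * s / 2 : ℝ) : ℂ) := by
      rw [integral_sub hi12 hi2, integral_add (integrable_const _) hi1, integral_mul_const,
        integral_div, integral_complex_ofReal, integral_const_mul, h0]
      have e : ∀ u, ((x * f u : ℝ) : ℂ) ^ 2 = ((x ^ 2 * f u ^ 2 : ℝ) : ℂ) := fun u => by
        push_cast; ring
      simp_rw [e]
      rw [integral_complex_ofReal, integral_const_mul, h2]
      simp
    have h4 : ‖∫ u, Complex.exp ((x * f u : ℝ) * I) ∂ν - ((1 - x ^ 2 * s / 2 : ℝ) : ℂ)‖ ≤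
        4 * (|x| ^ 3 * C₃) := by
      rw [← hq, ← integral_sub hei hi3']
      refine (norm_integral_le_integral_norm _).trans ?_
      have hle : ∀ u, ‖Complex.exp ((x * f u : ℝ) * I) -
          (1 + ((x * f u : ℝ) : ℂ) * I - ((x * f u : ℝ) : ℂ) ^ 2 / 2)‖ ≤
          4 * (|x| ^ 3 * |f u| ^ 3) := fun u => by
        refine (norm_cexp_sub_le (x * f u)).trans (le_of_eq ?_)
        rw [abs_mul, mul_pow]
      refine (integral_mono (hei.sub hi3').norm ((hi3.const_mul _).const_mul 4)
        hle).trans ?_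
      rw [integral_const_mul, integral_const_mul]
      gcongr
    have h5 : ‖((1 - x ^ 2 * s / 2 : ℝ) : ℂ) - (Real.exp (-(x ^ 2 * s / 2)) : ℂ)‖ ≤
        (x ^ 2 * s / 2) ^ 2 := by
      rw [← Complex.ofReal_sub, Complex.norm_real, Real.norm_eq_abs, abs_sub_comm]
      exact abs_exp_neg_sub_le (by positivity)
    have h6 : (x ^ 2 * s / 2) ^ 2 ≤ C ^ 2 * |x| ^ 3 := by
      have e : (x ^ 2 * s / 2) ^ 2 = s ^ 2 * (|x| ^ 3 * |x|) / 4 := by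
        have : |x| ^ 3 * |x| = x ^ 4 := by rw [← pow_succ, Even.pow_abs (by decide)]
        rw [this]; ring
      rw [e]
      have h7 : s ^ 2 ≤ C ^ 2 := pow_le_pow_left₀ hs0 hs 2
      have h8 : |x| ^ 3 * |x| ≤ |x| ^ 3 := mul_le_of_le_one_right (by positivity) hx
      have h9 : s ^ 2 * (|x| ^ 3 * |x|) ≤ C ^ 2 * |x| ^ 3 :=
        mul_le_mul h7 h8 (by positivity) (by positivity)
      have : 0 ≤ C ^ 2 * |x| ^ 3 := by positivity
      linarith
    have h10 := norm_sub_le_norm_sub_add_norm_sub (∫ u, Complex.exp ((x * f u : ℝ) * I) ∂ν)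
      ((1 - x ^ 2 * s / 2 : ℝ) : ℂ) (Real.exp (-(x ^ 2 * s / 2)) : ℂ)
    have : 0 ≤ |x| ^ 3 := by positivity
    nlinarith
  · have h4 : ‖∫ u, Complex.exp ((x * f u : ℝ) * I) ∂ν‖ ≤ 1 := by
      refine (norm_integral_le_integral_norm _).trans ?_
      simp only [Complex.norm_exp_ofReal_mul_I]
      simp
    have h5 : ‖(Real.exp (-(x ^ 2 * s / 2)) : ℂ)‖ ≤ 1 := by
      rw [Complex.norm_real, Real.norm_of_nonneg (Real.exp_pos _).le]
      exact Real.exp_le_one_iff.2 (by rw [neg_nonpos]; positivity)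
    have h6 : 1 ≤ |x| ^ 3 := one_le_pow₀ hx
    have h7 : 0 ≤ (4 * C₃ + C ^ 2) * |x| ^ 3 := by positivity
    have := norm_sub_le (∫ u, Complex.exp ((x * f u : ℝ) * I) ∂ν) (Real.exp (-(x ^ 2 * s / 2)) : ℂ)
    linarith

/-- Telescoping: the factors are exchanged one at a time, and the others have norm at most one. -/
lemma norm_prod_sub_prod_le {ι : Type*} (t : Finset ι) {f g : ι → ℂ} (hf : ∀ i, ‖f i‖ ≤ 1)
    (hg : ∀ i, ‖g i‖ ≤ 1) : ‖∏ i ∈ t, f i - ∏ i ∈ t, g i‖ ≤ ∑ i ∈ t, ‖f i - g i‖ := by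
  classical
  induction t using Finset.induction_on with
  | empty => simp
  | insert a t ha ih =>
    rw [Finset.prod_insert ha, Finset.prod_insert ha, Finset.sum_insert ha]
    have e : f a * ∏ i ∈ t, f i - g a * ∏ i ∈ t, g i =
        (f a - g a) * ∏ i ∈ t, f i + g a * (∏ i ∈ t, f i - ∏ i ∈ t, g i) := by ring
    rw [e]
    refine (norm_add_le _ _).trans (add_le_add ?_ ?_)
    · rw [norm_mul]
      refine mul_le_of_le_one_right (norm_nonneg _) ?_
      rw [norm_prod]
      exact Finset.prod_le_one (fun i _ => norm_nonneg _) fun i _ => hf i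
    · rw [norm_mul]
      exact (mul_le_of_le_one_left (norm_nonneg _) (hg a)).trans ih

end CharFun

/-! ### The central limit theorem for the design and the noise -/

section CLT

open Complex (I)
open Function

variable {p : ℕ} {Q : Measure (Covariate p × Bool)} [IsProbabilityMeasure Q]
  {R : Covariate p × Bool → unitInterval → ℝ} {v : Covariate p × Bool → ℝ} {C C₃ : ℝ}

/-- For a frozen design the terms are independent, so both characteristic functions are products
over the units and are compared factor by factor. -/
lemma NoiseModel.norm_charFun_sub_le {n : ℕ} (hR : NoiseModel R v C)
    (hR3 : ∀ z, Integrable (fun u => |R z u| ^ 3) ∧ ∫ u, |R z u| ^ 3 ≤ C₃)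
    (a : Fin n → ℝ) (z : Fin n → Covariate p × Bool) (θ : ℝ) :
    ‖∫ u, Complex.exp ((θ * noiseSum R a z u : ℝ) * I) ∂(Measure.pi fun _ => volume) -
      (Real.exp (-(θ ^ 2 * (∑ i, a i ^ 2 * v (z i)) / 2)) : ℂ)‖ ≤
        ∑ i, (4 * C₃ + C ^ 2 + 2) * |θ * a i| ^ 3 := by
  have h1 : ∀ u : Fin n → unitInterval, Complex.exp ((θ * noiseSum R a z u : ℝ) * I) =
      ∏ i, Complex.exp (((θ * a i) * R (z i) (u i) : ℝ) * I) := by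
    intro u
    rw [← Complex.exp_sum, noiseSum]
    congr 1
    push_cast
    rw [Finset.mul_sum, Finset.sum_mul]
    exact Finset.sum_congr rfl fun i _ => by ring
  have h2 : (Real.exp (-(θ ^ 2 * (∑ i, a i ^ 2 * v (z i)) / 2)) : ℂ) =
      ∏ i, (Real.exp (-((θ * a i) ^ 2 * v (z i) / 2)) : ℂ) := by
    rw [← Complex.ofReal_prod, ← Real.exp_sum, Finset.sum_neg_distrib, ← Finset.sum_div,
      Finset.mul_sum]
    congr 5
    exact funext fun i => by ring
  simp_rw [h1]
  rw [integral_fintype_prod_eq_prod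
    (f := fun i u => Complex.exp (((θ * a i) * R (z i) u : ℝ) * I)), h2]
  refine (norm_prod_sub_prod_le _ (fun i => ?_) fun i => ?_).trans (Finset.sum_le_sum fun i _ => ?_)
  · refine (norm_integral_le_integral_norm _).trans ?_
    simp only [Complex.norm_exp_ofReal_mul_I]
    simp
  · rw [Complex.norm_real, Real.norm_of_nonneg (Real.exp_pos _).le]
    refine Real.exp_le_one_iff.2 ?_
    have := hR.variance_nonneg (z i)
    rw [neg_nonpos]
    positivity
  · exact norm_integral_cexp_sub_le (hR.memLp (z i)) (hR.integral_eq_zero _) (hR.integral_sq _)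
      (hR.variance_le _) (hR3 _).1 (hR3 _).2 _

lemma norm_charFun_sum_sub_le {n : ℕ} {g : Covariate p × Bool → ℝ} (hg : Measurable g) {B : ℝ}
    (hgB : ∀ z, |g z| ≤ B) (hg0 : ∫ z, g z ∂Q = 0) (θ : ℝ) :
    ‖∫ z : Fin n → Covariate p × Bool, Complex.exp ((θ * ∑ i, g (z i) : ℝ) * I) ∂sampleLaw Q n -
      (Real.exp (-(n * (θ ^ 2 * (∫ z, g z ^ 2 ∂Q) / 2))) : ℂ)‖ ≤
        n * ((4 * B ^ 3 + (B ^ 2) ^ 2 + 2) * |θ| ^ 3) := by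
  have hL2 : MemLp g 2 Q := MemLp.of_bound hg.aestronglyMeasurable B (ae_of_all _ hgB)
  have hb2 : ∀ k, Integrable (fun z => |g z| ^ k) Q := fun k =>
    Integrable.of_bound (hg.abs.pow_const k).aestronglyMeasurable (B ^ k) (ae_of_all _ fun z => by
      rw [norm_pow, Real.norm_eq_abs, abs_abs]
      exact pow_le_pow_left₀ (abs_nonneg _) (hgB z) k)
  have hbk : ∀ k, ∫ z, |g z| ^ k ∂Q ≤ B ^ k := fun k => by
    refine (integral_mono (hb2 k) (integrable_const _) fun z =>
      pow_le_pow_left₀ (abs_nonneg _) (hgB z) k).trans ?_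
    simp
  have hs : ∫ z, g z ^ 2 ∂Q ≤ B ^ 2 := by simpa using hbk 2
  have h1 : ∀ z : Fin n → Covariate p × Bool, Complex.exp ((θ * ∑ i, g (z i) : ℝ) * I) =
      ∏ i, Complex.exp ((θ * g (z i) : ℝ) * I) := by
    intro z
    rw [← Complex.exp_sum]
    congr 1
    push_cast
    rw [Finset.mul_sum, Finset.sum_mul]
  have h2 : (Real.exp (-(n * (θ ^ 2 * (∫ z, g z ^ 2 ∂Q) / 2))) : ℂ) =
      ∏ _i : Fin n, (Real.exp (-(θ ^ 2 * (∫ z, g z ^ 2 ∂Q) / 2)) : ℂ) := by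
    rw [← Complex.ofReal_prod, ← Real.exp_sum]
    congr 2
    simp
  simp_rw [h1]
  rw [sampleLaw, integral_fintype_prod_eq_prod
    (f := fun (_ : Fin n) z => Complex.exp ((θ * g z : ℝ) * I)), h2]
  refine (norm_prod_sub_prod_le _ (fun i => ?_) fun i => ?_).trans ?_
  · refine (norm_integral_le_integral_norm _).trans ?_
    simp only [Complex.norm_exp_ofReal_mul_I]
    simp
  · rw [Complex.norm_real, Real.norm_of_nonneg (Real.exp_pos _).le]
    refine Real.exp_le_one_iff.2 ?_
    have : 0 ≤ ∫ z, g z ^ 2 ∂Q := integral_nonneg fun z => sq_nonneg _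
    rw [neg_nonpos]
    positivity
  · rw [Finset.sum_const, Finset.card_univ, Fintype.card_fin, nsmul_eq_mul]
    exact mul_le_mul_of_nonneg_left (norm_integral_cexp_sub_le hL2 hg0 rfl hs (hb2 3) (hbk 3) θ)
      (Nat.cast_nonneg n)

/-- A bound for the characteristic function of the normalised sum. -/
lemma NoiseModel.norm_charFun_sum_add_sub_le {n : ℕ} (hn : 1 ≤ n) (hR : NoiseModel R v C)
    (hR3 : ∀ z, Integrable (fun u => |R z u| ^ 3) ∧ ∫ u, |R z u| ^ 3 ≤ C₃)
    {g : Covariate p × Bool → ℝ} (hg : Measurable g) {B : ℝ}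
    (hgB : ∀ z, |g z| ≤ B) (hg0 : ∫ z, g z ∂Q = 0)
    {a : (Fin n → Covariate p × Bool) → Fin n → ℝ} (ham : ∀ i, Measurable fun z => a z i) {A : ℝ}
    (haA : ∀ z i, |a z i| ≤ A) {c : ℝ} (hc : 0 ≤ c) {δ : ℝ} (hδ : 0 ≤ δ) (θ : ℝ) :
    ‖∫ q, Complex.exp ((θ * (∑ i, g (q.1 i) + noiseSum R (a q.1) q.1 q.2) : ℝ) * I)
        ∂noiseLaw Q n - (Real.exp (-(n * θ ^ 2 * (∫ z, g z ^ 2 ∂Q + c) / 2)) : ℂ)‖ ≤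
      (n * ((4 * C₃ + C ^ 2 + 2) * (|θ| * A) ^ 3) + n * θ ^ 2 / 2 * δ +
        (sampleLaw Q n).real {z | δ ≤ |(n : ℝ)⁻¹ * ∑ i, a z i ^ 2 * v (z i) - c|}) +
        n * ((4 * B ^ 3 + (B ^ 2) ^ 2 + 2) * |θ| ^ 3) := by
  have hC₃ : 0 ≤ C₃ := (integral_nonneg fun u => by positivity).trans (hR3 (0, true)).2
  set V : (Fin n → Covariate p × Bool) → ℝ := fun z => (n : ℝ)⁻¹ * ∑ i, a z i ^ 2 * v (z i) with hV
  have hVm : Measurable V := (Finset.measurable_sum _ fun i _ => ((ham i).pow_const 2).mul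
    (hR.measurable_variance.comp (measurable_pi_apply i))).const_mul _
  have hV0 : ∀ z, 0 ≤ V z := fun z => mul_nonneg (by positivity)
    (Finset.sum_nonneg fun i _ => mul_nonneg (sq_nonneg _) (hR.variance_nonneg _))
  have hn0 : (n : ℝ) ≠ 0 := by positivity
  set E : (Fin n → Covariate p × Bool) → ℂ :=
    fun z => Complex.exp ((θ * ∑ i, g (z i) : ℝ) * I) with hE
  set Ψ : (Fin n → Covariate p × Bool) → ℂ := fun z =>
    ∫ u, Complex.exp ((θ * noiseSum R (a z) z u : ℝ) * I) ∂(Measure.pi fun _ => volume) with hΨ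
  -- A constant to replace the conditional characteristic function `Ψ z`. After this replacement the
  -- integral of `E z * Ψ z` decouples into `κ` times the characteristic function of the i.i.d. sum.
  set κ : ℂ := (Real.exp (-(n * θ ^ 2 * c / 2)) : ℂ) with hκ
  have hsum : Measurable fun z : Fin n → Covariate p × Bool => ∑ i, g (z i) :=
    Finset.measurable_sum _ fun i _ => hg.comp (measurable_pi_apply i)
  have hNm := hR.measurable_noiseSum ham
  have hcexp : Continuous fun y : ℝ => Complex.exp ((θ * y : ℝ) * I) := by fun_prop
  have hEm : Measurable E := hcexp.measurable.comp hsum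
  have hΨm : StronglyMeasurable Ψ :=
    StronglyMeasurable.integral_prod_right
      (f := fun z u => Complex.exp ((θ * noiseSum R (a z) z u : ℝ) * I))
      (hcexp.measurable.comp hNm).stronglyMeasurable
  have hEn : ∀ z, ‖E z‖ = 1 := fun z => Complex.norm_exp_ofReal_mul_I _
  have hΨn : ∀ z, ‖Ψ z‖ ≤ 1 := fun z => by
    refine (norm_integral_le_integral_norm _).trans ?_
    simp only [Complex.norm_exp_ofReal_mul_I]
    simp
  have hκn : ‖κ‖ ≤ 1 := by
    rw [hκ, Complex.norm_real, Real.norm_of_nonneg (Real.exp_pos _).le]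
    refine Real.exp_le_one_iff.2 ?_
    rw [neg_nonpos]
    positivity
  -- integrate the noise
  have hfub : ∫ q, Complex.exp ((θ * (∑ i, g (q.1 i) + noiseSum R (a q.1) q.1 q.2) : ℝ) * I)
      ∂noiseLaw Q n = ∫ z, E z * Ψ z ∂sampleLaw Q n := by
    rw [noiseLaw, integral_prod]
    · refine integral_congr_ae (ae_of_all _ fun z => ?_)
      simp only [hE, hΨ]
      rw [← integral_const_mul]
      refine integral_congr_ae (ae_of_all _ fun u => ?_)
      simp only
      rw [← Complex.exp_add]
      congr 1
      push_cast
      ring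
    · refine Integrable.of_bound (hcexp.measurable.comp
        ((hsum.comp measurable_fst).add hNm)).aestronglyMeasurable 1 (ae_of_all _ fun q => ?_)
      exact (Complex.norm_exp_ofReal_mul_I _).le
  -- the conditional characteristic function
  have hΨκ : ∀ z, ‖Ψ z - κ‖ ≤ n * ((4 * C₃ + C ^ 2 + 2) * (|θ| * A) ^ 3) + n * θ ^ 2 / 2 * δ +
      {z | δ ≤ |V z - c|}.indicator (fun _ => (1 : ℝ)) z := by
    intro z
    have h1 := hR.norm_charFun_sub_le hR3 (a z) z θ
    have h2 : θ ^ 2 * (∑ i, a z i ^ 2 * v (z i)) / 2 = n * θ ^ 2 * V z / 2 := by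
      simp only [hV]; field_simp
    rw [h2] at h1
    have h3 : ∑ i, (4 * C₃ + C ^ 2 + 2) * |θ * a z i| ^ 3 ≤
        n * ((4 * C₃ + C ^ 2 + 2) * (|θ| * A) ^ 3) := by
      refine (Finset.sum_le_sum fun i _ => ?_).trans_eq (b := ∑ _i : Fin n,
        (4 * C₃ + C ^ 2 + 2) * (|θ| * A) ^ 3) (by simp)
      rw [abs_mul]
      have := haA z i
      gcongr
    have h4 : ‖(Real.exp (-(n * θ ^ 2 * V z / 2)) : ℂ) - κ‖ ≤
        n * θ ^ 2 / 2 * δ + {z | δ ≤ |V z - c|}.indicator (fun _ => (1 : ℝ)) z := by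
      have hVz := hV0 z
      rw [hκ, ← Complex.ofReal_sub, Complex.norm_real, Real.norm_eq_abs]
      -- If the conditional variance is far from `c`, two numbers in `[0, 1]` differ by at most one,
      -- which is charged to the probability of that event; otherwise `exp (-·)` is Lipschitz on the
      -- nonnegative reals.
      by_cases hz : δ ≤ |V z - c|
      · rw [Set.indicator_of_mem (show z ∈ {z | δ ≤ |V z - c|} from hz)]
        have e1 := Real.exp_pos (-(n * θ ^ 2 * V z / 2))
        have e2 := Real.exp_pos (-(n * θ ^ 2 * c / 2))
        have e3 : Real.exp (-(n * θ ^ 2 * V z / 2)) ≤ 1 :=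
          Real.exp_le_one_iff.2 (by rw [neg_nonpos]; positivity)
        have e4 : Real.exp (-(n * θ ^ 2 * c / 2)) ≤ 1 :=
          Real.exp_le_one_iff.2 (by rw [neg_nonpos]; positivity)
        have e5 : 0 ≤ n * θ ^ 2 / 2 * δ := by positivity
        rw [abs_le]
        constructor <;> linarith
      · rw [Set.indicator_of_notMem (show z ∉ {z | δ ≤ |V z - c|} from hz), add_zero]
        refine (abs_exp_neg_sub_exp_neg_le (by positivity) (by positivity)).trans ?_
        have e : n * θ ^ 2 * V z / 2 - n * θ ^ 2 * c / 2 = n * θ ^ 2 / 2 * (V z - c) := by ring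
        rw [e, abs_mul, abs_of_nonneg (by positivity : 0 ≤ n * θ ^ 2 / 2)]
        exact mul_le_mul_of_nonneg_left (not_le.1 hz).le (by positivity)
    have h5 := norm_sub_le_norm_sub_add_norm_sub (Ψ z) (Real.exp (-(n * θ ^ 2 * V z / 2)) : ℂ) κ
    linarith
  have hset : MeasurableSet {z : Fin n → Covariate p × Bool | δ ≤ |V z - c|} :=
    measurableSet_le measurable_const (hVm.sub_const c).abs
  have hEi : Integrable E (sampleLaw Q n) :=
    Integrable.of_bound hEm.aestronglyMeasurable 1 (ae_of_all _ fun z => (hEn z).le)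
  have hEΨ : Integrable (fun z => E z * Ψ z) (sampleLaw Q n) :=
    Integrable.of_bound (hEm.mul hΨm.measurable).aestronglyMeasurable 1 (ae_of_all _ fun z => by
      rw [norm_mul, hEn, one_mul]; exact hΨn z)
  have hmain : ‖∫ z, E z * Ψ z ∂sampleLaw Q n - κ * ∫ z, E z ∂sampleLaw Q n‖ ≤
      n * ((4 * C₃ + C ^ 2 + 2) * (|θ| * A) ^ 3) + n * θ ^ 2 / 2 * δ +
        (sampleLaw Q n).real {z | δ ≤ |V z - c|} := by
    rw [← integral_const_mul, ← integral_sub hEΨ (hEi.const_mul κ)]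
    have hi1 : Integrable ({z | δ ≤ |V z - c|}.indicator (fun _ => (1 : ℝ))) (sampleLaw Q n) :=
      (integrable_const _).indicator hset
    refine (norm_integral_le_of_norm_le ((integrable_const (n * ((4 * C₃ + C ^ 2 + 2) *
      (|θ| * A) ^ 3) + n * θ ^ 2 / 2 * δ)).add hi1) (ae_of_all _ fun z => ?_)).trans_eq ?_
    · have e : E z * Ψ z - κ * E z = E z * (Ψ z - κ) := by ring
      rw [e, norm_mul, hEn, one_mul]
      exact hΨκ z
    · rw [integral_add' (integrable_const _) hi1, integral_indicator hset]
      simp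
  have hE2 := norm_charFun_sum_sub_le (n := n) hg hgB hg0 θ
  have hκ2 : (Real.exp (-(n * θ ^ 2 * (∫ z, g z ^ 2 ∂Q + c) / 2)) : ℂ) =
      κ * (Real.exp (-(n * (θ ^ 2 * (∫ z, g z ^ 2 ∂Q) / 2))) : ℂ) := by
    rw [hκ, ← Complex.ofReal_mul, ← Real.exp_add]
    congr 2
    ring
  rw [hfub, hκ2]
  refine (norm_sub_le_norm_sub_add_norm_sub _ (κ * ∫ z, E z ∂sampleLaw Q n) _).trans
    (add_le_add hmain ?_)
  rw [← mul_sub, norm_mul]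
  exact (mul_le_of_le_one_left (norm_nonneg _) hκn).trans hE2

/-- The characteristic functions of the normalised sums tend to that of a standard Gaussian random
variable. -/
theorem NoiseModel.tendsto_charFun (hR : NoiseModel R v C)
    (hR3 : ∀ z, Integrable (fun u => |R z u| ^ 3) ∧ ∫ u, |R z u| ^ 3 ≤ C₃)
    {g : Covariate p × Bool → ℝ} (hg : Measurable g) {B : ℝ}
    (hgB : ∀ z, |g z| ≤ B) (hg0 : ∫ z, g z ∂Q = 0)
    {a : ∀ n, (Fin n → Covariate p × Bool) → Fin n → ℝ} (ham : ∀ n i, Measurable fun z => a n z i)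
    (haA : ∀ n z i, |a n z i| ≤ 2 * rate n ^ 2) {c : ℕ → ℝ} {c₀ : ℝ} (hc₀ : 0 < c₀)
    (hc : ∀ n, c₀ ≤ c n)
    (hV : ∀ ε : ℝ, 0 < ε → Tendsto (fun n : ℕ => (sampleLaw Q n).real
      {z | ε ≤ |(n : ℝ)⁻¹ * ∑ i, a n z i ^ 2 * v (z i) - c n|}) atTop (𝓝 0)) (t : ℝ) :
    Tendsto (fun n : ℕ => ∫ q, Complex.exp ((t * ((√(∫ z, g z ^ 2 ∂Q + c n))⁻¹ * ((√(n : ℝ))⁻¹ *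
      (∑ i, g (q.1 i) + noiseSum R (a n q.1) q.1 q.2))) : ℝ) * I) ∂noiseLaw Q n) atTop
      (𝓝 (Real.exp (-(t ^ 2 / 2)) : ℂ)) := by
  have hB : 0 ≤ B := (abs_nonneg _).trans (hgB (0, true))
  have hC₃ : 0 ≤ C₃ := (integral_nonneg fun u => by positivity).trans (hR3 (0, true)).2
  have hτ : 0 ≤ ∫ z, g z ^ 2 ∂Q := integral_nonneg fun z => sq_nonneg _
  set T := |t| * (√c₀)⁻¹ with hT
  have hT0 : 0 ≤ T := by positivity
  rw [Metric.tendsto_nhds]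
  intro ε hε
  -- Chosen so that the variance error `n θ² δ / 2 ≤ T² δ / 2` stays below `ε / 2`.
  set δ := ε / (T ^ 2 + 1) with hδ
  have hδ0 : 0 < δ := by positivity
  have hlim : Tendsto (fun n : ℕ => (4 * C₃ + C ^ 2 + 2) * (T * 2) ^ 3 * (rate n ^ 26)⁻¹ +
      (sampleLaw Q n).real {z | δ ≤ |(n : ℝ)⁻¹ * ∑ i, a n z i ^ 2 * v (z i) - c n|} +
      (4 * B ^ 3 + (B ^ 2) ^ 2 + 2) * T ^ 3 * (rate n ^ 32)⁻¹) atTop (𝓝 0) := by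
    have := ((tendsto_const_mul_inv_rate_pow ((4 * C₃ + C ^ 2 + 2) * (T * 2) ^ 3) (k := 26)
      (by norm_num)).add (hV δ hδ0)).add (tendsto_const_mul_inv_rate_pow
        ((4 * B ^ 3 + (B ^ 2) ^ 2 + 2) * T ^ 3) (k := 32) (by norm_num))
    simpa using this
  filter_upwards [eventually_ge_atTop 1, hlim.eventually_lt_const (half_pos hε)] with n hn hsmall
  have hu1 := one_le_rate hn
  have hu0 : 0 < rate n := by linarith
  have hD0 : 0 < ∫ z, g z ^ 2 ∂Q + c n := by linarith [hc n]
  have hsq : √(n : ℝ) = rate n ^ 32 := by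
    rw [← rate_pow n, show rate n ^ 64 = (rate n ^ 32) ^ 2 by ring, Real.sqrt_sq (by positivity)]
  -- The argument absorbs both normalisations, so the total Gaussian exponent is exactly `t² / 2`
  -- for every `n`, although `c n` need not converge.
  set θ := t * ((√(∫ z, g z ^ 2 ∂Q + c n))⁻¹ * (√(n : ℝ))⁻¹) with hθ
  have hθT : |θ| ≤ T * (rate n ^ 32)⁻¹ := by
    rw [hθ, hsq, abs_mul, abs_of_nonneg (by positivity : 0 ≤ (√(∫ z, g z ^ 2 ∂Q + c n))⁻¹ *
      (rate n ^ 32)⁻¹), ← mul_assoc, hT]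
    have : √c₀ ≤ √(∫ z, g z ^ 2 ∂Q + c n) := Real.sqrt_le_sqrt (by linarith [hc n])
    have h0 : 0 < √c₀ := Real.sqrt_pos.2 hc₀
    gcongr
  have hnθ : n * θ ^ 2 * (∫ z, g z ^ 2 ∂Q + c n) / 2 = t ^ 2 / 2 := by
    rw [hθ, mul_pow, mul_pow, inv_pow, inv_pow, Real.sq_sqrt hD0.le,
      Real.sq_sqrt (Nat.cast_nonneg n)]
    have : (n : ℝ) ≠ 0 := by positivity
    field_simp
  have hθ2 : n * θ ^ 2 ≤ T ^ 2 := by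
    rw [← sq_abs, ← rate_pow n]
    calc rate n ^ 64 * |θ| ^ 2 ≤ rate n ^ 64 * (T * (rate n ^ 32)⁻¹) ^ 2 := by gcongr
      _ = T ^ 2 := by field_simp
  have hθ3 : n * |θ| ^ 3 ≤ T ^ 3 * (rate n ^ 32)⁻¹ := by
    rw [← rate_pow n]
    calc rate n ^ 64 * |θ| ^ 3 ≤ rate n ^ 64 * (T * (rate n ^ 32)⁻¹) ^ 3 := by gcongr
      _ = _ := by field_simp
  have hb := hR.norm_charFun_sum_add_sub_le hn hR3 hg hgB hg0 (ham n) (haA n)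
    (hc₀.le.trans (hc n)) hδ0.le θ
  rw [hnθ] at hb
  -- The coefficient bound `2 u²` enters cubed against `n |θ|³`, of order `u⁻³²`, leaving `u⁻²⁶`.
  have h1 : n * ((4 * C₃ + C ^ 2 + 2) * (|θ| * (2 * rate n ^ 2)) ^ 3) ≤
      (4 * C₃ + C ^ 2 + 2) * (T * 2) ^ 3 * (rate n ^ 26)⁻¹ := by
    calc n * ((4 * C₃ + C ^ 2 + 2) * (|θ| * (2 * rate n ^ 2)) ^ 3)
        = (4 * C₃ + C ^ 2 + 2) * (2 * rate n ^ 2) ^ 3 * (n * |θ| ^ 3) := by ring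
      _ ≤ (4 * C₃ + C ^ 2 + 2) * (2 * rate n ^ 2) ^ 3 * (T ^ 3 * (rate n ^ 32)⁻¹) :=
          mul_le_mul_of_nonneg_left hθ3 (by positivity)
      _ = _ := by field_simp
  have h2 : n * θ ^ 2 / 2 * δ ≤ ε / 2 := by
    calc n * θ ^ 2 / 2 * δ ≤ T ^ 2 / 2 * δ := by gcongr
      _ = ε / 2 * (T ^ 2 / (T ^ 2 + 1)) := by rw [hδ]; ring
      _ ≤ ε / 2 := mul_le_of_le_one_right (by positivity)
          ((div_le_one (by positivity)).2 (by linarith))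
  have h3 : n * ((4 * B ^ 3 + (B ^ 2) ^ 2 + 2) * |θ| ^ 3) ≤
      (4 * B ^ 3 + (B ^ 2) ^ 2 + 2) * T ^ 3 * (rate n ^ 32)⁻¹ := by
    calc n * ((4 * B ^ 3 + (B ^ 2) ^ 2 + 2) * |θ| ^ 3)
        = (4 * B ^ 3 + (B ^ 2) ^ 2 + 2) * (n * |θ| ^ 3) := by ring
      _ ≤ (4 * B ^ 3 + (B ^ 2) ^ 2 + 2) * (T ^ 3 * (rate n ^ 32)⁻¹) :=
          mul_le_mul_of_nonneg_left hθ3 (by positivity)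
      _ = _ := by ring
  rw [dist_eq_norm]
  have e : ∀ y : ℝ, t * ((√(∫ z, g z ^ 2 ∂Q + c n))⁻¹ * ((√(n : ℝ))⁻¹ * y)) = θ * y := fun y => by
    rw [hθ]; ring
  simp_rw [e]
  linarith

end CLT

/-! ### The advantage in terms of the regression function -/

section Advantage

variable {Ω : Type*} [MeasurableSpace Ω] {P : Measure Ω} [IsProbabilityMeasure P] {p : ℕ}
  {X : Ω → Covariate p} {W : Ω → Bool} {Ypot : Bool → Ω → ℝ} {Y : Ω → ℝ}
  {S : Set (Covariate p)} {μ : Covariate p → Bool → ℝ} {π : Covariate p → Bool}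

open scoped Classical in
/-- The signed treatment effect `(2 π(x) - 1) (μ(x, 1) - μ(x, 0))`, set to zero outside of `S`. -/
def effectOn (S : Set (Covariate p)) (π : Covariate p → Bool) (μ : Covariate p → Bool → ℝ)
    (z : Covariate p × Bool) : ℝ :=
  if z.1 ∈ S then sgn (π z.1) * (μ z.1 true - μ z.1 false) else 0

lemma measurable_effectOn (hS : MeasurableSet S) (hπ : Measurable π)
    (hμ : ∀ w, Measurable fun x => μ x w) : Measurable (effectOn S π μ) := by
  refine Measurable.ite (measurable_fst hS) ?_ measurable_const
  exact (measurable_sgn_comp (hπ.comp measurable_fst)).mul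
    (((hμ true).comp measurable_fst).sub ((hμ false).comp measurable_fst))

lemma abs_effectOn_le {B : ℝ} (hB0 : 0 ≤ B) (hB : ∀ x ∈ S, ∀ w, |μ x w| ≤ B)
    (z : Covariate p × Bool) : |effectOn S π μ z| ≤ 2 * B := by
  unfold effectOn
  split_ifs with hz
  · rw [abs_mul, abs_sgn, one_mul]
    have h1 := hB _ hz true
    have h2 := hB _ hz false
    have := abs_sub (μ z.1 true) (μ z.1 false)
    linarith
  · simpa using hB0

lemma CausalModel.cate_ae_eq (h : CausalModel P X W Ypot Y) (hS : RegularSupport P X S)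
    (hμ : IsRegressionFunction P X W Y μ) (hμL : LipschitzInCovariate μ S) :
    cate P X Ypot =ᵐ[P] fun ω => μ (X ω) true - μ (X ω) false := by
  obtain ⟨B, hB0, hB⟩ := hμL.exists_abs_le hS.compact
  have hμi : ∀ w, Integrable (fun ω => μ (X ω) w) P := fun w =>
    Integrable.of_bound ((hμ.measurable w).comp h.measurable_covariate).aestronglyMeasurable B
      ((hS.ae_mem h.measurable_covariate).mono fun ω hω => hB _ hω w)
  have h1 := condExp_sub (m := sigmaOf X) (h.integrable_potential hμ.integrable true)
    (h.integrable_potential hμ.integrable false)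
  filter_upwards [h1, h.condExp_potential hμ true (hμi true),
    h.condExp_potential hμ false (hμi false)] with ω a b c
  have e : cate P X Ypot ω = (P[Ypot true - Ypot false | sigmaOf X]) ω := rfl
  rw [e, a, Pi.sub_apply, b, c]

lemma CausalModel.sgn_mul_cate_ae_eq (h : CausalModel P X W Ypot Y) (hS : RegularSupport P X S)
    (hμ : IsRegressionFunction P X W Y μ) (hμL : LipschitzInCovariate μ S) :
    (fun ω => sgn (π (X ω)) * cate P X Ypot ω) =ᵐ[P] fun ω => effectOn S π μ (X ω, W ω) := by
  filter_upwards [h.cate_ae_eq hS hμ hμL, hS.ae_mem h.measurable_covariate] with ω a b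
  rw [a, effectOn, if_pos b]

lemma CausalModel.advantage_eq (h : CausalModel P X W Ypot Y) (hS : RegularSupport P X S)
    (hμ : IsRegressionFunction P X W Y μ) (hμL : LipschitzInCovariate μ S) (hπ : Measurable π) :
    advantage P X Ypot π = ∫ z, effectOn S π μ z ∂P.map fun ω => (X ω, W ω) := by
  rw [advantage, integral_congr_ae (h.sgn_mul_cate_ae_eq hS hμ hμL), integral_map
    (h.measurable_covariate.prodMk h.measurable_treatment).aemeasurable
    (measurable_effectOn hS.compact.measurableSet hπ hμ.measurable).aestronglyMeasurable]

lemma CausalModel.cateVariance_eq (h : CausalModel P X W Ypot Y) (hS : RegularSupport P X S)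
    (hμ : IsRegressionFunction P X W Y μ) (hμL : LipschitzInCovariate μ S) (hπ : Measurable π) :
    cateVariance P X Ypot π =
      ∫ z, (effectOn S π μ z - advantage P X Ypot π) ^ 2 ∂P.map fun ω => (X ω, W ω) := by
  rw [integral_map
    (h.measurable_covariate.prodMk h.measurable_treatment).aemeasurable
    (((measurable_effectOn hS.compact.measurableSet hπ hμ.measurable).sub_const
      _).pow_const 2).aestronglyMeasurable, cateVariance]
  refine integral_congr_ae ?_
  filter_upwards [h.sgn_mul_cate_ae_eq (π := π) hS hμ hμL] with ω a
  have a' : sgn (π (X ω)) * cate P X Ypot ω = effectOn S π μ (X ω, W ω) := a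
  rw [a']

end Advantage

/-! ### The sample -/

section SampleModel

open Function

variable {Ω : Type*} [MeasurableSpace Ω] {p : ℕ}

/-- A sample of independent observations from a regular design `Q`, with regression function `μ`
and noise `R`. -/
structure SampleModel (P : Measure Ω) (Q : Measure (Covariate p × Bool)) (S : Set (Covariate p))
    (R : Covariate p × Bool → unitInterval → ℝ) (v : Covariate p × Bool → ℝ) (C : ℝ)
    (μ : Covariate p → Bool → ℝ) (Xs : ℕ → Ω → Covariate p) (Ws : ℕ → Ω → Bool)
    (Ys : ℕ → Ω → ℝ) : Prop where
  design : RegularDesign Q S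
  noise : NoiseModel R v C
  measurable_regression : ∀ w, Measurable fun x => μ x w
  measurable_design : ∀ n, Measurable (designSample Xs Ws n)
  measurable_outcome : ∀ i, Measurable (Ys i)
  map_eq : ∀ n, P.map (fun ω => (designSample Xs Ws n ω, fun i : Fin n => Ys i ω)) =
    (noiseLaw Q n).map fun c => (c.1, fun i => μ (c.1 i).1 (c.1 i).2 + R (c.1 i) (c.2 i))

variable {P : Measure Ω} [IsProbabilityMeasure P] {Q : Measure (Covariate p × Bool)}
  [IsProbabilityMeasure Q] {S : Set (Covariate p)}
  {R : Covariate p × Bool → unitInterval → ℝ} {v : Covariate p × Bool → ℝ} {C : ℝ}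
  {μ : Covariate p → Bool → ℝ} {π : Covariate p → Bool}
  {Xs : ℕ → Ω → Covariate p} {Ws : ℕ → Ω → Bool} {Ys : ℕ → Ω → ℝ} {M n : ℕ}

omit [IsProbabilityMeasure P] [IsProbabilityMeasure Q] in
lemma SampleModel.measurable_regression_prod (h : SampleModel P Q S R v C μ Xs Ws Ys) :
    Measurable fun z : Covariate p × Bool => μ z.1 z.2 :=
  measurable_of_forall_treatment h.measurable_regression

omit [IsProbabilityMeasure P] [IsProbabilityMeasure Q] in
lemma SampleModel.map_designSample (h : SampleModel P Q S R v C μ Xs Ws Ys) (n : ℕ) :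
    P.map (designSample Xs Ws n) = sampleLaw Q n := by
  -- Zero weights reduce the joint law of the design and a residual sum to that of the design.
  have h1 := map_weightedResidual_eq (n := n) h.noise h.measurable_regression_prod
    (h.measurable_design n) h.measurable_outcome (h.map_eq n) (a := fun _ _ => 0)
    fun _ => measurable_const
  refine map_eq_of_map_prodMk_eq (η := Measure.pi fun _ : Fin n => (volume : Measure unitInterval))
    (h.measurable_design n) (measurable_weightedResidual h.measurable_regression_prod
    (h.measurable_design n) h.measurable_outcome (a := fun _ _ => 0) fun _ => measurable_const)
    (G := fun z u => noiseSum R (fun _ => 0) z u) ?_ h1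
  exact h.noise.measurable_noiseSum (a := fun _ _ => 0) fun _ => measurable_const

omit [IsProbabilityMeasure Q] in
-- An inequality instead of an equality, so that `B` need not be measurable.
lemma SampleModel.measureReal_design_le (h : SampleModel P Q S R v C μ Xs Ws Ys)
    (B : Set (Fin n → Covariate p × Bool)) :
    P.real {ω | designSample Xs Ws n ω ∈ B} ≤ (sampleLaw Q n).real B := by
  rw [← h.map_designSample]
  have := Measure.isProbabilityMeasure_map (μ := P) (h.measurable_design n).aemeasurable
  exact ENNReal.toReal_mono (measure_ne_top _ _)
    (Measure.le_map_apply (h.measurable_design n).aemeasurable B)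

omit [IsProbabilityMeasure P] in
lemma SampleModel.ae_mem (h : SampleModel P Q S R v C μ Xs Ws Ys) (n : ℕ) :
    ∀ᵐ ω ∂P, ∀ i : Fin n, Xs i ω ∈ S := by
  have h1 := ae_sampleLaw_of_ae (n := n) Q h.design.ae_mem
  rw [← h.map_designSample] at h1
  exact ae_of_ae_map (h.measurable_design n).aemeasurable h1

omit [IsProbabilityMeasure P] [IsProbabilityMeasure Q] in
/-- Expectations of functions of the design and a weighted sum of residuals. -/
lemma SampleModel.integral_eq (h : SampleModel P Q S R v C μ Xs Ws Ys)
    {a : (Fin n → Covariate p × Bool) → Fin n → ℝ} (ha : ∀ i, Measurable fun z => a z i)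
    {E : Type*} [NormedAddCommGroup E] [NormedSpace ℝ E]
    {F : (Fin n → Covariate p × Bool) × ℝ → E} (hF : StronglyMeasurable F) :
    ∫ ω, F (designSample Xs Ws n ω, ∑ i : Fin n, a (designSample Xs Ws n ω) i *
      (Ys i ω - μ (Xs i ω) (Ws i ω))) ∂P = ∫ q, F (q.1, noiseSum R (a q.1) q.1 q.2) ∂noiseLaw Q n
          := by
  have h1 := map_weightedResidual_eq (n := n) h.noise h.measurable_regression_prod
    (h.measurable_design n) h.measurable_outcome (h.map_eq n) ha
  have h2 := measurable_weightedResidual (n := n) h.measurable_regression_prod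
    (h.measurable_design n) h.measurable_outcome ha
  have h3 : Measurable fun c : (Fin n → Covariate p × Bool) × (Fin n → unitInterval) =>
      (c.1, noiseSum R (a c.1) c.1 c.2) :=
    measurable_fst.prodMk (h.noise.measurable_noiseSum ha)
  rw [← integral_map (((h.measurable_design n).prodMk h2).aemeasurable) hF.aestronglyMeasurable, h1,
    integral_map h3.aemeasurable hF.aestronglyMeasurable]

/-- Weighted means of residuals with small coefficients are small. -/
lemma SampleModel.measureReal_le_weightedResidual (h : SampleModel P Q S R v C μ Xs Ws Ys)
    {a : (Fin n → Covariate p × Bool) → Fin n → ℝ} (ha : ∀ i, Measurable fun z => a z i) {A : ℝ}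
    (haA : ∀ z i, |a z i| ≤ A) {ε : ℝ} (hε : 0 < ε) :
    P.real {ω | ε ≤ |(n : ℝ)⁻¹ * ∑ i : Fin n, a (designSample Xs Ws n ω) i *
      (Ys i ω - μ (Xs i ω) (Ws i ω))|} ≤ A ^ 2 * C / n / ε ^ 2 := by
  have hm := measurable_weightedResidual (n := n) h.measurable_regression_prod
    (h.measurable_design n) h.measurable_outcome ha
  have h1 := map_weightedResidual_eq (n := n) h.noise h.measurable_regression_prod
    (h.measurable_design n) h.measurable_outcome (h.map_eq n) ha
  have hsq : Measurable fun q : (Fin n → Covariate p × Bool) × ℝ => ((n : ℝ)⁻¹ * q.2) ^ 2 :=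
    (measurable_snd.const_mul _).pow_const 2
  have hlaw2 := map_prodMk_comp_eq (h.measurable_design n) hm (h.noise.measurable_noiseSum ha) h1
      hsq
  have hG : Measurable (uncurry fun (z : Fin n → Covariate p × Bool) u =>
      ((n : ℝ)⁻¹ * noiseSum R (a z) z u) ^ 2) :=
    ((h.noise.measurable_noiseSum ha).const_mul _).pow_const 2
  have hi := (integrable_of_map_prodMk_eq (h.measurable_design n) ((hm.const_mul _).pow_const 2) hG
    hlaw2).1 (h.noise.integrable_noiseSum_sq ha haA _)
  have hle : ∫ ω, ((n : ℝ)⁻¹ * ∑ i : Fin n, a (designSample Xs Ws n ω) i *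
      (Ys i ω - μ (Xs i ω) (Ws i ω))) ^ 2 ∂P ≤ (n : ℝ)⁻¹ ^ 2 * (n * (A ^ 2 * C)) :=
    (h.integral_eq ha (F := fun q => ((n : ℝ)⁻¹ * q.2) ^ 2) hsq.stronglyMeasurable).trans_le
      (h.noise.integral_noiseLaw_sq_le ha haA _)
  have h2 := measureReal_le_abs_sub_le (ν := P) (m := 0) (by simpa using hi) hε
    (V := A ^ 2 * C / n) (by
      simp only [sub_zero]
      refine hle.trans_eq ?_
      rcases Nat.eq_zero_or_pos n with h0 | h0
      · simp [h0]
      · have : (n : ℝ) ≠ 0 := by positivity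
        field_simp)
  simpa only [sub_zero] using h2

open scoped Classical in
/-- The coefficients of the residuals, truncated at a slowly increasing level. -/
def truncatedCoef (M : ℕ) (π : Covariate p → Bool) (z : Fin n → Covariate p × Bool) (i : Fin n) :
    ℝ :=
  if |residualCoef M π z i| ≤ 2 * rate n ^ 2 then residualCoef M π z i else 0

lemma abs_truncatedCoef_le (M : ℕ) (π : Covariate p → Bool) (z : Fin n → Covariate p × Bool)
    (i : Fin n) : |truncatedCoef M π z i| ≤ 2 * rate n ^ 2 := by
  unfold truncatedCoef
  split_ifs with h
  · exact h
  · rw [abs_zero]; positivity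

lemma measurable_truncatedCoef (M : ℕ) (hπ : Measurable π) (i : Fin n) :
    Measurable fun z : Fin n → Covariate p × Bool => truncatedCoef M π z i :=
  Measurable.ite (measurableSet_le (measurable_residualCoef M hπ i).abs measurable_const)
    (measurable_residualCoef M hπ i) measurable_const

/-- All matched sets have `M` elements, all matches are within the distance `r`, and no unit has a
large weight. -/
def MatchingEvent (M : ℕ) (r : ℝ) (z : Fin n → Covariate p × Bool) : Prop :=
  (∀ i, (nbrSet M (formNorm (sampleCov fun i => (z i).1)) z i).card = M) ∧
    (∀ i, ∀ j ∈ nbrSet M (formNorm (sampleCov fun i => (z i).1)) z i,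
      dist (z j).1 (z i).1 ≤ r) ∧
    ∀ s : Fin n → ℝ, (∀ j, |s j| ≤ 1) → ∀ i,
      |weight (nbrSet M (formNorm (sampleCov fun i => (z i).1)) z) s i| ≤ rate n ^ 2

/-- On the event the coefficients are at most `1 + u² ≤ 2 u²` in absolute value, so the truncation
is inactive. It exists to supply the bound valid for every design that the moment and characteristic
function estimates require. -/
lemma MatchingEvent.truncatedCoef_eq (hM : 1 ≤ M) {r : ℝ} {z : Fin n → Covariate p × Bool}
    (h : MatchingEvent M r z) (i : Fin n) : truncatedCoef M π z i = residualCoef M π z i := by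
  have hn : 1 ≤ n := Fin.pos i
  have h1 := abs_residualCoef_le hM π (h.2.2 (fun j => sgn (π (z j).1)) (fun j => (abs_sgn _).le) i)
  have h2 : 1 ≤ rate n ^ 2 := one_le_pow₀ (one_le_rate hn)
  exact if_pos (by linarith)

omit [MeasurableSpace Ω] in
/-- On the matching event, the matching estimator minus its bias is a sum of independent treatment
effects and weighted residuals. -/
lemma MatchingEvent.estimator_sub_bias_eq (hM : 1 ≤ M) {r A : ℝ} {ω : Ω} (hn : 1 ≤ n)
    (h : MatchingEvent M r (designSample Xs Ws n ω)) (hS : ∀ i : Fin n, Xs i ω ∈ S) :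
    estimator M π Xs Ws Ys n ω - bias M π μ Xs Ws n ω - A =
      (n : ℝ)⁻¹ * (∑ i, (effectOn S π μ (designSample Xs Ws n ω i) - A) +
        ∑ i : Fin n, truncatedCoef M π (designSample Xs Ws n ω) i *
          (Ys i ω - μ (Xs i ω) (Ws i ω))) := by
  have hcard : ∀ i, (matchSet M (fun i : Fin n => Xs i ω) (fun i : Fin n => Ws i ω) i).card =
      M := by
    have := matchSet_eq_nbrSet M (designSample Xs Ws n ω)
    simp only [designSample] at this
    rw [this]
    exact h.1
  have h1 := matchEstimator_eq hM π μ (fun i : Fin n => Ys i ω) hcard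
  have h2 : ∀ i : Fin n, effectOn S π μ (designSample Xs Ws n ω i) =
      sgn (π (Xs i ω)) * (μ (Xs i ω) true - μ (Xs i ω) false) := fun i => if_pos (hS i)
  have hn0 : (n : ℝ) ≠ 0 := by positivity
  simp only [h2, h.truncatedCoef_eq hM]
  rw [estimator, bias, h1, Finset.sum_sub_distrib]
  simp only [Finset.sum_const, Finset.card_univ, Fintype.card_fin, nsmul_eq_mul]
  rw [mul_add, mul_sub, inv_mul_cancel_left₀ hn0]
  simp only [matchResidual, residualCoef, designSample]
  ring

omit [MeasurableSpace Ω] in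
/-- On the matching event, the bias is small. -/
lemma MatchingEvent.abs_bias_le {r L : ℝ} (hL : 0 ≤ L) {ω : Ω}
    (hM : 1 ≤ M) (hn : 1 ≤ n) (h : MatchingEvent M r (designSample Xs Ws n ω)) (hS : ∀ i : Fin n,
        Xs i ω ∈ S)
    (hμ : ∀ x ∈ S, ∀ y ∈ S, ∀ w, |μ x w - μ y w| ≤ L * dist x y) :
    |bias M π μ Xs Ws n ω| ≤ L * r := by
  have hset := matchSet_eq_nbrSet M (designSample Xs Ws n ω)
  have hM0 : (M : ℝ) ≠ 0 := by positivity
  simp only [designSample] at hset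
  have hterm : ∀ i : Fin n, |sgn (Ws i ω) * sgn (π (Xs i ω)) * ((M : ℝ)⁻¹ *
      ∑ j ∈ matchSet M (fun i : Fin n => Xs i ω) (fun i : Fin n => Ws i ω) i,
        (μ (Xs i ω) (!Ws i ω) - μ (Xs j ω) (!Ws i ω)))| ≤ L * r := by
    intro i
    rw [abs_mul, abs_mul, abs_sgn, abs_sgn, one_mul, one_mul, abs_mul, abs_inv, Nat.abs_cast]
    have h1 : |∑ j ∈ matchSet M (fun i : Fin n => Xs i ω) (fun i : Fin n => Ws i ω) i,
        (μ (Xs i ω) (!Ws i ω) - μ (Xs j ω) (!Ws i ω))| ≤ M * (L * r) := by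
      refine (Finset.abs_sum_le_sum_abs _ _).trans ?_
      rw [hset]
      refine (Finset.sum_le_card_nsmul _ _ (L * r) fun j hj => ?_).trans_eq ?_
      · refine (hμ _ (hS i) _ (hS j) _).trans ?_
        rw [dist_comm]
        exact mul_le_mul_of_nonneg_left (h.2.1 i j hj) hL
      · have hc := h.1 i
        simp only [designSample] at hc
        rw [hc, nsmul_eq_mul]
    calc (M : ℝ)⁻¹ * _ ≤ (M : ℝ)⁻¹ * (M * (L * r)) :=
          mul_le_mul_of_nonneg_left h1 (by positivity)
      _ = L * r := inv_mul_cancel_left₀ hM0 _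
  rw [bias, matchBias, abs_mul, abs_inv, Nat.abs_cast]
  have hn0 : (n : ℝ) ≠ 0 := by positivity
  calc (n : ℝ)⁻¹ * _ ≤ (n : ℝ)⁻¹ * (n * (L * r)) := by
        refine mul_le_mul_of_nonneg_left ((Finset.abs_sum_le_sum_abs _ _).trans
          ((Finset.sum_le_sum fun i _ => hterm i).trans_eq ?_)) (by positivity)
        simp
    _ = L * r := inv_mul_cancel_left₀ hn0 _

end SampleModel

/-! ### Consistency -/

section Consistency

variable {Ω : Type*} [MeasurableSpace Ω] {p : ℕ} {P : Measure Ω} [IsProbabilityMeasure P]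
  {Q : Measure (Covariate p × Bool)}
  [IsProbabilityMeasure Q] {S : Set (Covariate p)}
  {R : Covariate p × Bool → unitInterval → ℝ} {v : Covariate p × Bool → ℝ} {C : ℝ}
  {μ : Covariate p → Bool → ℝ} {π : Covariate p → Bool}
  {Xs : ℕ → Ω → Covariate p} {Ws : ℕ → Ω → Bool} {Ys : ℕ → Ω → ℝ} {M : ℕ}

lemma LipschitzInCovariate.exists_abs_sub_le (hμL : LipschitzInCovariate μ S) :
    ∃ L : ℝ, 0 ≤ L ∧ ∀ x ∈ S, ∀ y ∈ S, ∀ w, |μ x w - μ y w| ≤ L * dist x y := by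
  choose L hL using hμL
  refine ⟨max (L true) (L false), by positivity, fun x hx y hy w => ?_⟩
  have h1 := (hL w).dist_le_mul x hx y hy
  rw [Real.dist_eq] at h1
  refine h1.trans (mul_le_mul_of_nonneg_right ?_ dist_nonneg)
  cases w <;> simp

omit [IsProbabilityMeasure P] in
/-- Matching fails to be accurate with probability tending to zero. -/
lemma SampleModel.exists_tendsto_matchingEvent (h : SampleModel P Q S R v C μ Xs Ws Ys)
    (hp : 1 ≤ p) (M : ℕ) :
    ∃ ρ : ℕ → ℝ, Tendsto ρ atTop (𝓝 0) ∧ Tendsto (fun n : ℕ =>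
      (sampleLaw Q n).real {z | ¬ MatchingEvent M (ρ n) z}) atTop (𝓝 0) :=
  h.design.exists_tendsto_matching hp M

/-- The matching estimator is consistent. -/
theorem SampleModel.tendstoInMeasure_estimator (h : SampleModel P Q S R v C μ Xs Ws Ys)
    (hp : 1 ≤ p) (hM : 1 ≤ M) (hπ : Measurable π) (hμL : LipschitzInCovariate μ S) :
    TendstoInMeasure P (fun n ω => estimator M π Xs Ws Ys n ω - ∫ z, effectOn S π μ z ∂Q) atTop
      fun _ => 0 := by
  obtain ⟨ρ, hρ, hE⟩ := h.exists_tendsto_matchingEvent hp M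
  obtain ⟨L, hL0, hL⟩ := hμL.exists_abs_sub_le
  obtain ⟨B, hB0, hB⟩ := hμL.exists_abs_le h.design.compact
  have hgm := measurable_effectOn h.design.compact.measurableSet hπ h.measurable_regression
  have hgB := abs_effectOn_le (π := π) hB0 hB
  rw [tendstoInMeasure_iff_measureReal_norm]
  intro ε hε
  have hε3 : 0 < ε / 3 := by positivity
  -- The three terms are the probabilities of failed matching, of a deviating mean effect, and of a
  -- large residual term, the last with second moment at most `4 u⁴ C / n`.
  have hlim : Tendsto (fun n : ℕ => (sampleLaw Q n).real {z | ¬ MatchingEvent M (ρ n) z} +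
      4 * (2 * B) ^ 2 / (ε / 3) ^ 2 * (rate n ^ 64)⁻¹ + 4 * C / (ε / 3) ^ 2 * (rate n ^ 60)⁻¹)
      atTop (𝓝 0) := by
    have := (hE.add (tendsto_const_mul_inv_rate_pow (4 * (2 * B) ^ 2 / (ε / 3) ^ 2) (k := 64)
      (by norm_num))).add (tendsto_const_mul_inv_rate_pow (4 * C / (ε / 3) ^ 2) (k := 60)
        (by norm_num))
    simpa using this
  have hLρ : Tendsto (fun n => L * ρ n) atTop (𝓝 0) := by simpa using hρ.const_mul L
  refine squeeze_zero' (Eventually.of_forall fun n => measureReal_nonneg) ?_ hlim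
  filter_upwards [eventually_ge_atTop 1, hLρ.eventually_lt_const hε3] with n hn hsmall
  have hu1 := one_le_rate hn
  have hu0 : 0 < rate n := by linarith
  have h1 := h.measureReal_design_le (n := n) {z | ¬ MatchingEvent M (ρ n) z}
  have h2 := (h.measureReal_design_le (n := n)
    {z | ε / 3 ≤ |average (effectOn S π μ) z - ∫ z, effectOn S π μ z ∂Q|}).trans
    (sampleLaw_le_abs_average_sub_le Q hgm hgB hn hε3)
  have h3 := h.measureReal_le_weightedResidual (n := n) (a := truncatedCoef M π)
    (fun i => measurable_truncatedCoef M hπ i) (fun z i => abs_truncatedCoef_le M π z i) hε3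
  have e2 : 4 * (2 * B) ^ 2 / n / (ε / 3) ^ 2 =
      4 * (2 * B) ^ 2 / (ε / 3) ^ 2 * (rate n ^ 64)⁻¹ := by
    rw [rate_pow n, div_right_comm, div_eq_mul_inv _ (n : ℝ)]
  have e3 : (2 * rate n ^ 2) ^ 2 * C / n / (ε / 3) ^ 2 =
      4 * C / (ε / 3) ^ 2 * (rate n ^ 60)⁻¹ := by
    rw [← rate_pow n]
    field_simp
    ring
  rw [e2] at h2
  rw [e3] at h3
  refine le_trans ?_ (add_le_add (add_le_add h1 h2) h3)
  refine le_trans ?_ ((measureReal_union_le _ _).trans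
    (add_le_add (measureReal_union_le _ _) le_rfl))
  refine ENNReal.toReal_mono (measure_ne_top _ _) (measure_mono_ae ?_)
  filter_upwards [h.ae_mem n] with ω hωS hω
  have hω' : ε ≤ ‖estimator M π Xs Ws Ys n ω - ∫ z, effectOn S π μ z ∂Q - 0‖ := hω
  rw [sub_zero, Real.norm_eq_abs] at hω'
  by_contra hcon
  have c1 : MatchingEvent M (ρ n) (designSample Xs Ws n ω) := by
    by_contra hn; exact hcon (Or.inl (Or.inl hn))
  have c2 : |average (effectOn S π μ) (designSample Xs Ws n ω) - ∫ z, effectOn S π μ z ∂Q| <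
      ε / 3 := by
    by_contra hn; exact hcon (Or.inl (Or.inr (not_lt.1 hn)))
  have c3 : |(n : ℝ)⁻¹ * ∑ i : Fin n, truncatedCoef M π (designSample Xs Ws n ω) i *
      (Ys i ω - μ (Xs i ω) (Ws i ω))| < ε / 3 := by
    by_contra hn; exact hcon (Or.inr (not_lt.1 hn))
  have c4 := c1.estimator_sub_bias_eq (π := π) (μ := μ) (Ys := Ys) (S := S)
    (A := ∫ z, effectOn S π μ z ∂Q) hM hn hωS
  have c5 := c1.abs_bias_le (π := π) hL0 hM hn hωS hL
  have c6 : (n : ℝ)⁻¹ * ∑ i, (effectOn S π μ (designSample Xs Ws n ω i) -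
      ∫ z, effectOn S π μ z ∂Q) =
      average (effectOn S π μ) (designSample Xs Ws n ω) - ∫ z, effectOn S π μ z ∂Q := by
    have hn0 : (n : ℝ) ≠ 0 := by positivity
    rw [average, Finset.sum_sub_distrib]
    simp only [Finset.sum_const, Finset.card_univ, Fintype.card_fin, nsmul_eq_mul]
    rw [mul_sub, inv_mul_cancel_left₀ hn0]
  rw [mul_add, c6] at c4
  rw [abs_lt] at c2 c3
  rw [abs_le] at c5
  have : |estimator M π Xs Ws Ys n ω - ∫ z, effectOn S π μ z ∂Q| < ε := by
    rw [abs_lt]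
    constructor <;> linarith [c2.1, c2.2, c3.1, c3.2, c5.1, c5.2]
  linarith

end Consistency

/-! ### Asymptotic normality -/

section Normality

/-- From `|√x - 1| ≤ |x - 1|` at `x = D / E`, where `E` is at least `c / 2`. -/
lemma abs_sqrt_div_sqrt_sub_one_le {D E c : ℝ} (hc : 0 < c) (hD : c ≤ D) (hE : |E - D| ≤ c / 2) :
    |√D / √E - 1| ≤ |E - D| / (c / 2) := by
  rw [abs_le] at hE
  have hE0 : c / 2 ≤ E := by linarith [hE.1]
  have hE1 : 0 < E := by linarith
  have h1 : ∀ x : ℝ, 0 ≤ x → |√x - 1| ≤ |x - 1| := fun x hx => by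
    have e : x - 1 = (√x - 1) * (√x + 1) := by
      have := Real.mul_self_sqrt hx
      linarith
    rw [e, abs_mul]
    refine le_mul_of_one_le_right (abs_nonneg _) ?_
    rw [abs_of_nonneg (by positivity)]
    linarith [Real.sqrt_nonneg x]
  rw [← Real.sqrt_div' _ hE1.le]
  refine (h1 _ (by apply div_nonneg <;> linarith)).trans ?_
  have e : D / E - 1 = -(E - D) / E := by field_simp; ring
  rw [e, abs_div, abs_neg, abs_of_pos hE1]
  exact div_le_div_of_nonneg_left (abs_nonneg _) (by positivity) hE0

variable {Ω : Type*} [MeasurableSpace Ω] {p : ℕ} {P : Measure Ω} [IsProbabilityMeasure P]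
  {Q : Measure (Covariate p × Bool)}
  [IsProbabilityMeasure Q] {S : Set (Covariate p)}
  {R : Covariate p × Bool → unitInterval → ℝ} {v : Covariate p × Bool → ℝ} {C C₃ : ℝ}
  {μ : Covariate p → Bool → ℝ} {π : Covariate p → Bool}
  {Xs : ℕ → Ω → Covariate p} {Ws : ℕ → Ω → Bool} {Ys : ℕ → Ω → ℝ} {M : ℕ}

lemma SampleModel.residualVariance_ae_eq (h : SampleModel P Q S R v C μ Xs Ws Ys) (hM : 1 ≤ M)
    (hπ : Measurable π) (n : ℕ) :
    residualVariance P M π μ Xs Ws Ys n =ᵐ[P] fun ω =>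
      matchVar M (formNorm (sampleCov fun i => (designSample Xs Ws n ω i).1))
        (fun q => sgn (π q.1)) v (designSample Xs Ws n ω) :=
  MatchingPolicy.residualVariance_ae_eq h.noise hM h.measurable_regression_prod hπ
    (h.measurable_design n) h.measurable_outcome (h.map_eq n)

lemma SampleModel.measureReal_residualVariance_le (h : SampleModel P Q S R v C μ Xs Ws Ys)
    (hM : 1 ≤ M) (hπ : Measurable π) (n : ℕ) (ε c : ℝ) :
    P.real {ω | ε ≤ |residualVariance P M π μ Xs Ws Ys n ω - c|} ≤ (sampleLaw Q n).real
      {z | ε ≤ |matchVar M (formNorm (sampleCov fun i => (z i).1)) (fun q => sgn (π q.1)) v z -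
          c|} := by
  refine le_trans ?_ (h.measureReal_design_le (n := n) _)
  refine ENNReal.toReal_mono (measure_ne_top _ _) (measure_mono_ae ?_)
  filter_upwards [h.residualVariance_ae_eq hM hπ n] with ω hω hle
  have hle' : ε ≤ |residualVariance P M π μ Xs Ws Ys n ω - c| := hle
  rw [hω] at hle'
  exact hle'

/-- The residual variances are close to deterministic numbers, bounded away from zero. -/
lemma SampleModel.exists_variance_centre (h : SampleModel P Q S R v C μ Xs Ws Ys) (hp : 1 ≤ p)
    (hM : 1 ≤ M) (hπ : Measurable π)
    (hnd : ResidualVarianceNondegenerate P M π μ Xs Ws Ys) :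
    ∃ (c : ℕ → ℝ) (c₀ : ℝ), 0 < c₀ ∧ (∀ n, c₀ ≤ c n) ∧ ∀ ε : ℝ, 0 < ε →
      Tendsto (fun n : ℕ => (sampleLaw Q n).real {z | ε ≤ |matchVar M
        (formNorm (sampleCov fun i => (z i).1)) (fun q => sgn (π q.1)) v z - c n|}) atTop (𝓝 0)
            := by
  obtain ⟨c, hc⟩ := h.design.exists_matchVar_concentration hp hM (s := fun q => sgn (π q.1))
    (fun _ => (abs_sgn _).le) (v := v) (C := C)
    (fun z => by rw [abs_of_nonneg (h.noise.variance_nonneg z)]; exact h.noise.variance_le z)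
    (measurable_sgn_comp (hπ.comp measurable_fst)) h.noise.measurable_variance
  obtain ⟨b, hb, hnd⟩ := hnd
  have hnd' : Tendsto (fun n => P.real {ω | residualVariance P M π μ Xs Ws Ys n ω < b}) atTop
      (𝓝 0) := by
    have := (ENNReal.tendsto_toReal ENNReal.zero_ne_top).comp hnd
    rw [ENNReal.toReal_zero] at this
    exact this
  -- If the centre were below `b / 2`, then V^E being at least `b` would force a deviation of at
  -- least `b / 2`; two events of small total probability would cover the whole space.
  have hev : ∀ᶠ n in atTop, b / 2 ≤ c n := by
    filter_upwards [(hnd'.add (hc (b / 2) (by positivity))).eventually_lt_const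
      (show (0 : ℝ) + 0 < 1 by norm_num)] with n hn
    by_contra! hlt
    have hle := h.measureReal_residualVariance_le hM hπ n (b / 2) (c n)
    have huniv : (Set.univ : Set Ω) ⊆ {ω | residualVariance P M π μ Xs Ws Ys n ω < b} ∪
        {ω | b / 2 ≤ |residualVariance P M π μ Xs Ws Ys n ω - c n|} := by
      intro ω _
      by_cases hω : residualVariance P M π μ Xs Ws Ys n ω < b
      · exact Or.inl hω
      · have hle' : b / 2 ≤ |residualVariance P M π μ Xs Ws Ys n ω - c n| :=
          le_trans (by linarith [not_lt.1 hω]) (le_abs_self _)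
        exact Or.inr hle'
    have h1 := (measureReal_mono huniv).trans (measureReal_union_le (μ := P) _ _)
    rw [probReal_univ] at h1
    linarith
  -- The maximum alters only finitely many centres and makes the lower bound hold for every `n`.
  refine ⟨fun n => max (c n) (b / 2), b / 2, by positivity, fun n => le_max_right _ _,
    fun ε hε => (hc ε hε).congr' ?_⟩
  filter_upwards [hev] with n hn
  rw [max_eq_left hn]

/-- The sum of treatment effects and weighted residuals, with a deterministic normalisation. -/
def normalisedSum (M : ℕ) (π : Covariate p → Bool) (μ : Covariate p → Bool → ℝ)
    (g : Covariate p × Bool → ℝ) (D : ℕ → ℝ) (Xs : ℕ → Ω → Covariate p) (Ws : ℕ → Ω → Bool)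
    (Ys : ℕ → Ω → ℝ) (n : ℕ) (ω : Ω) : ℝ :=
  (√(D n))⁻¹ * ((√(n : ℝ))⁻¹ * (∑ i, g (designSample Xs Ws n ω i) +
    ∑ i : Fin n, truncatedCoef M π (designSample Xs Ws n ω) i * (Ys i ω - μ (Xs i ω) (Ws i ω))))

omit [IsProbabilityMeasure P] [IsProbabilityMeasure Q] in
lemma SampleModel.measurable_normalisedSum (h : SampleModel P Q S R v C μ Xs Ws Ys)
    (hπ : Measurable π) {g : Covariate p × Bool → ℝ} (hg : Measurable g) (D : ℕ → ℝ) (n : ℕ) :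
    Measurable (normalisedSum M π μ g D Xs Ws Ys n) := by
  have h1 := measurable_weightedResidual (n := n) h.measurable_regression_prod
    (h.measurable_design n) h.measurable_outcome fun i => measurable_truncatedCoef M hπ i
  exact (((Finset.measurable_sum _ fun i _ => hg.comp ((measurable_pi_apply i).comp
    (h.measurable_design n))).add h1).const_mul _).const_mul _

/-- Asymptotic normality with a deterministic normalisation. -/
lemma SampleModel.tendstoInDistribution_normalisedSum (h : SampleModel P Q S R v C μ Xs Ws Ys)
    (hp : 1 ≤ p) (hM : 1 ≤ M) (hπ : Measurable π)
    (hR3 : ∀ z, Integrable (fun u => |R z u| ^ 3) ∧ ∫ u, |R z u| ^ 3 ≤ C₃)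
    {g : Covariate p × Bool → ℝ} (hg : Measurable g) {B : ℝ} (hgB : ∀ z, |g z| ≤ B)
    (hg0 : ∫ z, g z ∂Q = 0) {c : ℕ → ℝ} {c₀ : ℝ} (hc₀ : 0 < c₀) (hc : ∀ n, c₀ ≤ c n)
    (hV : ∀ ε : ℝ, 0 < ε → Tendsto (fun n : ℕ => (sampleLaw Q n).real {z | ε ≤ |matchVar M
      (formNorm (sampleCov fun i => (z i).1)) (fun q => sgn (π q.1)) v z - c n|}) atTop (𝓝 0)) :
    TendstoInDistribution (normalisedSum M π μ g (fun n => ∫ z, g z ^ 2 ∂Q + c n) Xs Ws Ys) atTop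
      (id : ℝ → ℝ) (fun _ => P) (gaussianReal 0 1) := by
  obtain ⟨ρ, -, hE⟩ := h.exists_tendsto_matchingEvent hp M
  -- Concentration of V^E passes to the truncated coefficients, which agree with the original ones
  -- on the matching event.
  have hV' : ∀ ε : ℝ, 0 < ε → Tendsto (fun n : ℕ => (sampleLaw Q n).real
      {z | ε ≤ |(n : ℝ)⁻¹ * ∑ i, truncatedCoef M π z i ^ 2 * v (z i) - c n|}) atTop (𝓝 0) := by
    intro ε hε
    have hsum := (hV ε hε).add hE
    rw [add_zero] at hsum
    refine squeeze_zero (fun n => measureReal_nonneg) (fun n => ?_) hsum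
    refine (measureReal_mono fun z hz => ?_).trans (measureReal_union_le _ _)
    by_cases hz2 : MatchingEvent M (ρ n) z
    · refine Or.inl ?_
      have hz' : ε ≤ |(n : ℝ)⁻¹ * ∑ i, truncatedCoef M π z i ^ 2 * v (z i) - c n| := hz
      simp only [hz2.truncatedCoef_eq hM, sum_residualCoef_sq] at hz'
      exact hz'
    · exact Or.inr hz2
  refine ⟨fun n => (h.measurable_normalisedSum hπ hg _ n).aemeasurable, aemeasurable_id, ?_⟩
  -- Lévy's continuity theorem reduces the claim to pointwise convergence of characteristic
  -- functions.
  refine ProbabilityMeasure.tendsto_iff_tendsto_charFun.2 fun t => ?_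
  change Tendsto (fun n => charFun (P.map (normalisedSum M π μ g
    (fun n => ∫ z, g z ^ 2 ∂Q + c n) Xs Ws Ys n)) t) atTop
    (𝓝 (charFun ((gaussianReal 0 1).map id) t))
  have hlim := h.noise.tendsto_charFun (Q := Q) hR3 hg hgB hg0
    (fun n i => measurable_truncatedCoef M hπ i) (fun n z i => abs_truncatedCoef_le M π z i) hc₀ hc
    hV' t
  have hgauss : charFun ((gaussianReal 0 1).map id) t = (Real.exp (-(t ^ 2 / 2)) : ℂ) := by
    rw [Measure.map_id, charFun_gaussianReal]
    push_cast
    congr 1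
    simp
  rw [hgauss]
  refine hlim.congr fun n => ?_
  rw [charFun_apply_real, integral_map (h.measurable_normalisedSum hπ hg _ n).aemeasurable
    (by fun_prop : Continuous fun x : ℝ => Complex.exp (t * x * Complex.I)).aestronglyMeasurable]
  have hF : StronglyMeasurable fun q : (Fin n → Covariate p × Bool) × ℝ =>
      Complex.exp ((t * ((√(∫ z, g z ^ 2 ∂Q + c n))⁻¹ * ((√(n : ℝ))⁻¹ *
        (∑ i, g (q.1 i) + q.2))) : ℝ) * Complex.I) := by
    have h1 : Continuous fun y : ℝ => Complex.exp ((t * ((√(∫ z, g z ^ 2 ∂Q + c n))⁻¹ *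
      ((√(n : ℝ))⁻¹ * y)) : ℝ) * Complex.I) := by fun_prop
    have h2 : Measurable fun q : (Fin n → Covariate p × Bool) × ℝ => ∑ i, g (q.1 i) + q.2 :=
      (Finset.measurable_sum _ fun i _ => hg.comp ((measurable_pi_apply i).comp
        measurable_fst)).add measurable_snd
    exact (h1.measurable.comp h2).stronglyMeasurable
  rw [← h.integral_eq (fun i => measurable_truncatedCoef M hπ i) hF]
  refine integral_congr_ae (ae_of_all _ fun ω => ?_)
  simp only [normalisedSum]
  push_cast
  rfl

/-- Slutsky's theorem for products, with equality off events of small probability. -/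
lemma tendstoInDistribution_of_eq_mul {T U r : ℕ → Ω → ℝ} {ν : Measure ℝ}
    [IsProbabilityMeasure ν] (hU : TendstoInDistribution U atTop (id : ℝ → ℝ) (fun _ => P) ν)
    (hr : TendstoInMeasure P r atTop fun _ => (1 : ℝ)) (hrm : ∀ n, Measurable (r n))
    (hT : ∀ n, Measurable (T n)) {δ : ℕ → ℝ} (hδ : Tendsto δ atTop (𝓝 0))
    (hle : ∀ᶠ n in atTop, P.real {ω | T n ω ≠ U n ω * r n ω} ≤ δ n) :
    TendstoInDistribution T atTop (id : ℝ → ℝ) (fun _ => P) ν := by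
  have hprod := hU.continuous_comp_prodMk_of_tendstoInMeasure_const
    (g := fun q : ℝ × ℝ => q.1 * q.2) (by fun_prop) hr (fun n => (hrm n).aemeasurable)
  have hid : (fun x : ℝ => (fun q : ℝ × ℝ => q.1 * q.2) (id x, 1)) = id := by
    funext x
    simp
  rw [hid] at hprod
  refine tendstoInDistribution_of_tendstoInMeasure_sub T id hprod ?_
    fun n => (hT n).aemeasurable
  rw [tendstoInMeasure_iff_measureReal_norm]
  intro ε hε
  refine squeeze_zero' (Eventually.of_forall fun n => measureReal_nonneg) ?_ hδ
  filter_upwards [hle] with n hn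
  refine (measureReal_mono fun ω hω => ?_).trans hn
  have hω' : ε ≤ ‖T n ω - U n ω * r n ω - 0‖ := hω
  intro heq
  have heq' : T n ω = U n ω * r n ω := heq
  rw [heq'] at hω'
  simp at hω'
  linarith

end Normality

/-! ### Asymptotic normality of the studentised estimator -/

section EstimatorNormality

lemma measurable_matchBias {p n : ℕ} (M : ℕ) {π : Covariate p → Bool} (hπ : Measurable π)
    {μ : Covariate p → Bool → ℝ} (hμ : Measurable fun z : Covariate p × Bool => μ z.1 z.2) :
    Measurable fun z : Fin n → Covariate p × Bool =>
      matchBias M π μ (fun i => (z i).1) (fun i => (z i).2) := by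
  classical
  unfold matchBias
  simp only [matchSet_eq_nbrSet]
  have hz : ∀ i, Measurable fun z : Fin n → Covariate p × Bool => z i := measurable_pi_apply
  have hm : ∀ i j, Measurable fun z : Fin n → Covariate p × Bool => μ (z j).1 (!(z i).2) :=
    fun i j => hμ.comp ((measurable_fst.comp (hz j)).prodMk
      ((measurable_of_finite Bool.not).comp (measurable_snd.comp (hz i))))
  refine Measurable.const_mul (Finset.measurable_sum _ fun i _ => ?_) _
  refine ((measurable_sgn_comp (measurable_snd.comp (hz i))).mul
    (measurable_sgn_comp (hπ.comp (measurable_fst.comp (hz i))))).mul (Measurable.const_mul ?_ _)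
  have e : ∀ z : Fin n → Covariate p × Bool,
      ∑ j ∈ nbrSet M (formNorm (sampleCov fun i => (z i).1)) z i,
        (μ (z i).1 (!(z i).2) - μ (z j).1 (!(z i).2)) =
      ∑ j, if j ∈ nbrSet M (formNorm (sampleCov fun i => (z i).1)) z i then
        μ (z i).1 (!(z i).2) - μ (z j).1 (!(z i).2) else 0 := by
    intro z
    rw [← Finset.sum_filter, Finset.filter_mem_eq_inter, Finset.univ_inter]
  simp only [e]
  refine Finset.measurable_sum _ fun j _ => Measurable.ite ?_ ((hm i i).sub (hm i j))
    measurable_const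
  exact measurableSet_mem_nbrSet M
    (D := fun z : Fin n → Covariate p × Bool => formNorm (sampleCov fun i => (z i).1))
    (fun i => measurable_pi_apply i) (fun i j => measurable_formNorm_sampleCov i j) i j

variable {Ω : Type*} [MeasurableSpace Ω] {p : ℕ} {P : Measure Ω} [IsProbabilityMeasure P]
  {Q : Measure (Covariate p × Bool)}
  [IsProbabilityMeasure Q] {S : Set (Covariate p)}
  {R : Covariate p × Bool → unitInterval → ℝ} {v : Covariate p × Bool → ℝ} {C C₃ : ℝ}
  {μ : Covariate p → Bool → ℝ} {π : Covariate p → Bool}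
  {Xs : ℕ → Ω → Covariate p} {Ws : ℕ → Ω → Bool} {Ys : ℕ → Ω → ℝ} {M : ℕ}

omit [IsProbabilityMeasure P] [IsProbabilityMeasure Q] in
lemma SampleModel.measurable_residualVariance (h : SampleModel P Q S R v C μ Xs Ws Ys) (n : ℕ) :
    Measurable (residualVariance P M π μ Xs Ws Ys n) :=
  ((stronglyMeasurable_condVar.mono (h.measurable_design n).comap_le).measurable).const_mul _

omit [IsProbabilityMeasure P] [IsProbabilityMeasure Q] in
lemma SampleModel.measurable_estimator (h : SampleModel P Q S R v C μ Xs Ws Ys)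
    (hπ : Measurable π) (n : ℕ) : Measurable (estimator M π Xs Ws Ys n) := by
  have hd : Measurable fun ω => (designSample Xs Ws n ω, fun i : Fin n => Ys i ω) :=
    (h.measurable_design n).prodMk (measurable_pi_lambda _ fun i : Fin n => h.measurable_outcome i)
  have h1 := (measurable_matchEstimator (n := n) M hπ).comp hd
  simp only [Function.comp_def, designSample] at h1
  exact h1

omit [IsProbabilityMeasure P] [IsProbabilityMeasure Q] in
lemma SampleModel.measurable_bias (h : SampleModel P Q S R v C μ Xs Ws Ys)
    (hπ : Measurable π) (n : ℕ) : Measurable (bias M π μ Xs Ws n) := by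
  have h1 := (measurable_matchBias (n := n) M hπ h.measurable_regression_prod).comp
    (h.measurable_design n)
  simp only [Function.comp_def, designSample] at h1
  exact h1

omit [IsProbabilityMeasure P] [IsProbabilityMeasure Q] in
lemma SampleModel.measurable_studentised (h : SampleModel P Q S R v C μ Xs Ws Ys)
    (hπ : Measurable π) (V A : ℝ) (n : ℕ) :
    Measurable fun ω => (√(V + residualVariance P M π μ Xs Ws Ys n ω))⁻¹ *
      (√(n : ℝ) * (estimator M π Xs Ws Ys n ω - bias M π μ Xs Ws n ω - A)) := by
  have h1 : Measurable (estimator M π Xs Ws Ys n) := h.measurable_estimator hπ n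
  have h2 : Measurable (bias M π μ Xs Ws n) := h.measurable_bias hπ n
  have h3 : Measurable (residualVariance P M π μ Xs Ws Ys n) := h.measurable_residualVariance n
  generalize estimator M π Xs Ws Ys n = f1 at *
  generalize bias M π μ Xs Ws n = f2 at *
  generalize residualVariance P M π μ Xs Ws Ys n = f3 at *
  fun_prop

/-- The ratio of the deterministic and the random normalisation tends to one. -/
lemma SampleModel.tendstoInMeasure_sqrt_ratio (h : SampleModel P Q S R v C μ Xs Ws Ys)
    (hM : 1 ≤ M) (hπ : Measurable π) {V : ℝ} (hV0 : 0 ≤ V) {c : ℕ → ℝ} {c₀ : ℝ} (hc₀ : 0 < c₀)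
    (hc : ∀ n, c₀ ≤ c n)
    (hV : ∀ ε : ℝ, 0 < ε → Tendsto (fun n : ℕ => (sampleLaw Q n).real {z | ε ≤ |matchVar M
      (formNorm (sampleCov fun i => (z i).1)) (fun q => sgn (π q.1)) v z - c n|}) atTop (𝓝 0)) :
    TendstoInMeasure P (fun n ω => √(V + c n) /
      √(V + residualVariance P M π μ Xs Ws Ys n ω)) atTop fun _ => (1 : ℝ) := by
  rw [tendstoInMeasure_iff_measureReal_norm]
  intro ε hε
  -- The first bound keeps the random variance at least `c₀ / 2`; the second makes the error of the
  -- ratio at most `ε / 2`.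
  set η := min (c₀ / 2) (ε * (c₀ / 2) / 2) with hη
  have hη0 : 0 < η := by positivity
  refine squeeze_zero (fun n => measureReal_nonneg) (fun n => ?_) (hV η hη0)
  refine le_trans (measureReal_mono fun ω hω => ?_)
    (h.measureReal_residualVariance_le hM hπ n η (c n))
  by_contra hcon
  have hcon' : |residualVariance P M π μ Xs Ws Ys n ω - c n| < η := not_le.1 hcon
  have e : V + residualVariance P M π μ Xs Ws Ys n ω - (V + c n) =
      residualVariance P M π μ Xs Ws Ys n ω - c n := by ring
  have h1 := abs_sqrt_div_sqrt_sub_one_le (D := V + c n)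
    (E := V + residualVariance P M π μ Xs Ws Ys n ω) hc₀ (by linarith [hc n])
    (by rw [e]; exact hcon'.le.trans (min_le_left _ _))
  rw [e] at h1
  have h2 : |residualVariance P M π μ Xs Ws Ys n ω - c n| / (c₀ / 2) ≤ ε / 2 := by
    rw [div_le_iff₀ (by positivity)]
    refine (hcon'.le.trans (min_le_right _ _)).trans_eq ?_
    ring
  have hω' : ε ≤ ‖√(V + c n) / √(V + residualVariance P M π μ Xs Ws Ys n ω) - 1‖ := hω
  rw [Real.norm_eq_abs] at hω'
  linarith

omit [MeasurableSpace Ω] [IsProbabilityMeasure P] [IsProbabilityMeasure Q] in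
/-- On the matching event, the studentised estimator is a renormalised sum. -/
lemma MatchingEvent.studentised_eq (hM : 1 ≤ M) {r A V e : ℝ} {ω : Ω} {n : ℕ} (hn : 1 ≤ n)
    (h : MatchingEvent M r (designSample Xs Ws n ω)) (hS : ∀ i : Fin n, Xs i ω ∈ S)
    {D : ℕ → ℝ} (hD : 0 < D n) :
    (√(V + e))⁻¹ * (√(n : ℝ) * (estimator M π Xs Ws Ys n ω - bias M π μ Xs Ws n ω - A)) =
      normalisedSum M π μ (fun z => effectOn S π μ z - A) D Xs Ws Ys n ω *
        (√(D n) / √(V + e)) := by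
  have hn0 : (0 : ℝ) < n := by positivity
  have hD0 : √(D n) ≠ 0 := (Real.sqrt_pos.2 hD).ne'
  have hsq : √(n : ℝ) * (n : ℝ)⁻¹ = (√(n : ℝ))⁻¹ := by
    rw [← div_eq_mul_inv, Real.sqrt_div_self', one_div]
  rw [h.estimator_sub_bias_eq (π := π) (μ := μ) (Ys := Ys) (A := A) hM hn hS,
    ← mul_assoc (√(n : ℝ)), hsq, normalisedSum]
  have hcancel : ∀ a b d : ℝ, d ≠ 0 → a⁻¹ * b = d⁻¹ * b * (d / a) := fun a b d hd => by
    rw [div_eq_mul_inv]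
    field_simp
  exact hcancel _ _ _ hD0

/-- Asymptotic normality of the matching estimator. -/
theorem SampleModel.tendstoInDistribution_estimator (h : SampleModel P Q S R v C μ Xs Ws Ys)
    (hp : 1 ≤ p) (hM : 1 ≤ M) (hπ : Measurable π) (hμL : LipschitzInCovariate μ S)
    (hR3 : ∀ z, Integrable (fun u => |R z u| ^ 3) ∧ ∫ u, |R z u| ^ 3 ≤ C₃)
    (hnd : ResidualVarianceNondegenerate P M π μ Xs Ws Ys) {A : ℝ}
    (hA : A = ∫ z, effectOn S π μ z ∂Q) :
    TendstoInDistribution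
      (fun (n : ℕ) ω => (√(∫ z, (effectOn S π μ z - A) ^ 2 ∂Q +
        residualVariance P M π μ Xs Ws Ys n ω))⁻¹ *
        (√(n : ℝ) * (estimator M π Xs Ws Ys n ω - bias M π μ Xs Ws n ω - A)))
      atTop (id : ℝ → ℝ) (fun _ => P) (gaussianReal 0 1) := by
  obtain ⟨c, c₀, hc₀, hc, hV⟩ := h.exists_variance_centre hp hM hπ hnd
  obtain ⟨ρ, -, hE⟩ := h.exists_tendsto_matchingEvent hp M
  obtain ⟨B, hB0, hB⟩ := hμL.exists_abs_le h.design.compact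
  have hem := measurable_effectOn h.design.compact.measurableSet hπ h.measurable_regression
  have heB := abs_effectOn_le (π := π) hB0 hB
  have hgm : Measurable fun z => effectOn S π μ z - A := hem.sub_const A
  have hgB : ∀ z, |effectOn S π μ z - A| ≤ 2 * B + |A| := fun z =>
    (abs_sub _ _).trans (by linarith [heB z])
  have hg0 : ∫ z, (effectOn S π μ z - A) ∂Q = 0 := by
    rw [integral_sub (Integrable.of_bound hem.aestronglyMeasurable (2 * B) (ae_of_all _ heB))
      (integrable_const _), hA]
    simp
  have hV0 : 0 ≤ ∫ z, (effectOn S π μ z - A) ^ 2 ∂Q := integral_nonneg fun z => sq_nonneg _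
  have hlim := h.tendstoInDistribution_normalisedSum hp hM hπ hR3 hgm hgB hg0 hc₀ hc hV
  have hratio := h.tendstoInMeasure_sqrt_ratio hM hπ hV0 hc₀ hc hV
  -- The exact identity `MatchingEvent.studentised_eq` may fail only off the matching event, up to a
  -- null set, so the exceptional probabilities are those in `hE`.
  refine tendstoInDistribution_of_eq_mul hlim hratio
    (fun n => measurable_const.div (((h.measurable_residualVariance n).const_add _).sqrt))
    (fun n => h.measurable_studentised hπ _ A n) hE ?_
  filter_upwards [eventually_ge_atTop 1] with n hn
  refine le_trans ?_ (h.measureReal_design_le (n := n) _)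
  refine ENNReal.toReal_mono (measure_ne_top _ _) (measure_mono_ae ?_)
  filter_upwards [h.ae_mem n] with ω hωS hω
  intro hcon
  have hcon' : MatchingEvent M (ρ n) (designSample Xs Ws n ω) := hcon
  exact hω (hcon'.studentised_eq hM hn hωS (by linarith [hc n]))

end EstimatorNormality

end MatchingPolicy

end

/-! ### Assembly of consistency and asymptotic normality -/

theorem theorem1 {Ω : Type*} [MeasurableSpace Ω] (P : Measure Ω) [IsProbabilityMeasure P]
    {p : ℕ} (hp : 1 ≤ p) (M : ℕ) (hM : 1 ≤ M)
    (X : Ω → MatchingPolicy.Covariate p) (W : Ω → Bool) (Ypot : Bool → Ω → ℝ) (Y : Ω → ℝ)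
    (hmodel : MatchingPolicy.CausalModel P X W Ypot Y)
    (Xs : ℕ → Ω → MatchingPolicy.Covariate p) (Ws : ℕ → Ω → Bool) (Ys : ℕ → Ω → ℝ)
    (hsample : MatchingPolicy.IsIIDCopies P (fun ω => (X ω, W ω, Y ω))
      (fun i ω => (Xs i ω, Ws i ω, Ys i ω)))
    (S : Set (MatchingPolicy.Covariate p)) (hS : MatchingPolicy.RegularSupport P X S)
    (μ v : MatchingPolicy.Covariate p → Bool → ℝ)
    (hμ : MatchingPolicy.IsRegressionFunction P X W Y μ)
    (hv : MatchingPolicy.IsCondVarianceFunction P X W Y v)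
    (hμLip : MatchingPolicy.LipschitzInCovariate μ S)
    (hvLip : MatchingPolicy.LipschitzInCovariate v S)
    (π : MatchingPolicy.Covariate p → Bool) (hπ : Measurable π) :
    TendstoInMeasure P
      (fun n ω => MatchingPolicy.estimator M π Xs Ws Ys n ω -
        MatchingPolicy.advantage P X Ypot π) atTop (fun _ => 0) ∧
    (MatchingPolicy.BoundedFourthMoment P X W Y →
      MatchingPolicy.ResidualVarianceNondegenerate P M π μ Xs Ws Ys →
      TendstoInDistribution
        (fun (n : ℕ) ω =>
          (√(MatchingPolicy.cateVariance P X Ypot π +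
            MatchingPolicy.residualVariance P M π μ Xs Ws Ys n ω))⁻¹ *
          (√(n : ℝ) * (MatchingPolicy.estimator M π Xs Ws Ys n ω -
            MatchingPolicy.bias M π μ Xs Ws n ω - MatchingPolicy.advantage P X Ypot π)))
        atTop (id : ℝ → ℝ) (fun _ => P) (gaussianReal 0 1)) := by
  have hX := hmodel.measurable_covariate
  have hW := hmodel.measurable_treatment
  have hY := hmodel.measurable_outcome
  obtain ⟨R, r, C, hR, hR3, hlaw⟩ := MatchingPolicy.exists_noiseModel hX hW hY
    (hS.ae_mem hX) hS.compact hμ hv hμLip hvLip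
  have hQ : IsProbabilityMeasure (P.map fun ω => (X ω, W ω)) :=
    Measure.isProbabilityMeasure_map (hX.prodMk hW).aemeasurable
  have hf : Measurable (Function.uncurry fun (z : MatchingPolicy.Covariate p × Bool)
      (u : unitInterval) => μ z.1 z.2 + R z u) :=
    ((MatchingPolicy.measurable_of_forall_treatment hμ.measurable).comp measurable_fst).add
      hR.measurable
  have hsm : MatchingPolicy.SampleModel P (P.map fun ω => (X ω, W ω)) S R r C μ Xs Ws Ys :=
    { design := hmodel.regularDesign hS
      noise := hR
      measurable_regression := hμ.measurable
      measurable_design := hsample.measurable_designSample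
      measurable_outcome := hsample.measurable_outcome
      map_eq := hsample.map_sample_eq hX hW hY hf hlaw }
  have hA := hmodel.advantage_eq hS hμ hμLip hπ
  refine ⟨?_, fun h4 hnd => ?_⟩
  · rw [hA]
    exact hsm.tendstoInMeasure_estimator hp hM hπ hμLip
  -- Fourth moments enter only here, through the uniform third moment bound of the noise that the
  -- comparison of characteristic functions requires.
  · obtain ⟨C₃, hC₃⟩ := hR3 h4
    rw [hmodel.cateVariance_eq hS hμ hμLip hπ]
    exact hsm.tendstoInDistribution_estimator hp hM hπ hμLip hC₃ hnd hA
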